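/- Conventions. A ternary lattice $K$ is a finitely generated $\mathbb Z$-submodule spanning a $3$-dimensional positive definite quadratic space $(V,B)$ over $\mathbb Q$, $Q(x)=B(x,x)$; $K$ is primitive if the ideal generated by $B(K,K)$ is $\mathbb Z$. $O(K)$ is the group of isometries $\sigma$ of $V$ with $\sigma(K)=K$. A symmetry of $K$ is a $\sigma\in O(K)$ of the form $\tau_x(y)=y-\frac{2B(x,y)}{Q(x)}x$ with $x\neq 0$; taking $x$ to be a primitive vector of $K$, put $Q_K(\sigma)=Q(x)$. If $\sigma_1,\dots,\sigma_t$ are all the symmetries of $K$, ordered so that $Q_K(\sigma_1)\le\dots\le Q_K(\sigma_t)$, the label of $K$ is $\langle\!\langle |O(K)|;Q_K(\sigma_1),\dots,Q_K(\sigma_t)\rangle\!\rangle$. For a prime $p$ let $\Lambda_p(K)=\{x\in K: Q(x+y)\equiv Q(y) \bmod p \text{ for all } y\in K\}$. The genus $\mathrm{gen}(L)$ is the set of lattices $M$ on the space of $L$ with $M_q\cong L_q$ for all primes $q$, where $L_q=\mathbb Z_q\otimes L$. For a lattice $N$ let $\Gamma_p^L(N)=\{M\in\mathrm{gen}(L):\Lambda_p(M)=N\}$;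 its label is the multiset of the labels of the isometry classes of lattices in $\Gamma_p^L(N)$, one label for each class. Theorem. Let $p$ be an odd prime, let $L$ be a primitive ternary lattice with $p^2\mid dL$ (the discriminant of $L$), and let $N=\Lambda_p(L)$. Then the set of isometry classes in $\Gamma_p^L(N)$ is finite, and the label of $\Gamma_p^L(N)$ can be computed effectively from $p$, the label of $N$, and a Jordan decomposition of $L_p$. Precisely: there is one computable function $F$, independent of $p$, $V$, $B$, $L$ and $N$, such that for all such $p$, $L$, $N$ the lattice $N$ has a label $\ell$ with entries in $\mathbb N$, and whenever $L_p\cong\langle \varepsilon_1,\,p^{\alpha}\varepsilon_2,\,p^{\beta}\varepsilon_3\rangle$ with $\varepsilon_i\in\mathbb Z_p^\times$ and $0\le\alpha\le\beta$ (so that $\alpha+\beta=\mathrm{ord}_p(dL)\ge 2$), the value $F\bigl(p,\ell,\alpha,\beta,\varepsilon_1\bmod p,\varepsilon_2\bmod p,\varepsilon_3\bmod p\bigr)$ is a list of the labels of all the isometry classes in $\Gamma_p^L(N)$, with multiplicity. -/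

import Mathlib

namespace TernaryLattice

open scoped TensorProduct

variable {V : Type*} [AddCommGroup V] [Module ℚ V]

/-- `(V, B)` is a positive definite quadratic space over `ℚ`; its quadratic map is `Q x = B x x`. -/
structure IsPosDefSpace (B : LinearMap.BilinForm ℚ V) : Prop where
  symm : ∀ x y, B x y = B y x
  pos : ∀ x, x ≠ 0 → 0 < B x x

/-- The scale ideal of a lattice: the `ℤ`-module generated by all the values `B x y`. -/
def scale (B : LinearMap.BilinForm ℚ V) (L : Submodule ℤ V) : Submodule ℤ ℚ :=
  Submodule.span ℤ {q | ∃ x ∈ L, ∃ y ∈ L, q = B x y}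

/-- A lattice is primitive if its scale ideal is `ℤ` (here `1` is `ℤ` as a submodule of `ℚ`). -/
def IsPrimitive (B : LinearMap.BilinForm ℚ V) (L : Submodule ℤ V) : Prop :=
  scale B L = 1

/-- `Λ_m(L) = {x ∈ L : Q (x + y) ≡ Q y mod m for all y ∈ L}`. -/
def watson (B : LinearMap.BilinForm ℚ V) (m : ℕ) (L : Submodule ℤ V) : Submodule ℤ V :=
  AddSubgroup.toIntSubmodule
    { carrier := {x | x ∈ L ∧ ∀ y ∈ L, ∃ k : ℤ, B (x + y) (x + y) - B y y = (m : ℚ) * k}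
      zero_mem' := ⟨L.zero_mem, fun y _ => ⟨0, by simp⟩⟩
      add_mem' := by
        rintro a b ⟨ha, ha'⟩ ⟨hb, hb'⟩
        refine ⟨L.add_mem ha hb, fun y hy => ?_⟩
        obtain ⟨k, hk⟩ := ha' (b + y) (L.add_mem hb hy)
        obtain ⟨l, hl⟩ := hb' y hy
        refine ⟨k + l, ?_⟩
        rw [add_assoc]
        push_cast
        linear_combination hk + hl
      neg_mem' := by
        rintro a ⟨ha, ha'⟩
        refine ⟨L.neg_mem ha, fun y hy => ?_⟩
        obtain ⟨k, hk⟩ := ha' (-a + y) (L.add_mem (L.neg_mem ha) hy)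
        refine ⟨-k, ?_⟩
        rw [add_neg_cancel_left] at hk
        push_cast
        linear_combination -hk }

/-- The completion `L_q`, the `ℤ_q`-span of `L` inside `V_q = ℚ_q ⊗ V`. -/
noncomputable def completion (q : ℕ) [Fact q.Prime] (L : Submodule ℤ V) : Submodule ℤ_[q] (ℚ_[q] ⊗[ℚ] V) :=
  Submodule.span ℤ_[q] ((fun x : V => (1 : ℚ_[q]) ⊗ₜ[ℚ] x) '' (L : Set V))

/-- `L_q ≅ M_q`: an isometry of the quadratic space `V_q` carries `L_q` onto `M_q`. -/
def LocallyIsometric (B : LinearMap.BilinForm ℚ V) (q : ℕ) [Fact q.Prime]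
    (L M : Submodule ℤ V) : Prop :=
  ∃ σ : (ℚ_[q] ⊗[ℚ] V) ≃ₗ[ℚ_[q]] (ℚ_[q] ⊗[ℚ] V),
    (∀ x y, B.baseChange ℚ_[q] (σ x) (σ y) = B.baseChange ℚ_[q] x y) ∧
    σ '' (completion q L : Set (ℚ_[q] ⊗[ℚ] V)) = (completion q M : Set (ℚ_[q] ⊗[ℚ] V))

/-- The genus of `L`: the lattices on the space of `L` that are isometric to `L` at every prime. -/
def genus (B : LinearMap.BilinForm ℚ V) (L : Submodule ℤ V) : Set (Submodule ℤ V) :=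
  {M | Submodule.IsLattice ℚ M ∧ ∀ (q : ℕ) [Fact q.Prime], LocallyIsometric B q L M}

/-- `L_p ≅ ⟨ε₁, p ^ α ε₂, p ^ β ε₃⟩` with units `ε_i` and `α ≤ β`: a Jordan decomposition of `L_p`,
for `p` odd and `L` a primitive ternary lattice. -/
def HasJordan (B : LinearMap.BilinForm ℚ V) (p : ℕ) [Fact p.Prime] (L : Submodule ℤ V)
    (α β : ℕ) (ε₁ ε₂ ε₃ : ℤ_[p]ˣ) : Prop :=
  α ≤ β ∧ ∃ b : Module.Basis (Fin 3) ℤ_[p] (completion p L), ∀ i j,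
    B.baseChange ℚ_[p] (b i : ℚ_[p] ⊗[ℚ] V) (b j : ℚ_[p] ⊗[ℚ] V) =
      Matrix.diagonal ![((ε₁ : ℤ_[p]) : ℚ_[p]), (p : ℚ_[p]) ^ α * ((ε₂ : ℤ_[p]) : ℚ_[p]),
        (p : ℚ_[p]) ^ β * ((ε₃ : ℤ_[p]) : ℚ_[p])] i j

/-- The set `O(V)` of isometries of `V`. -/
def isometries (B : LinearMap.BilinForm ℚ V) : Set (V ≃ₗ[ℚ] V) :=
  {σ | ∀ x y, B (σ x) (σ y) = B x y}

/-- The set `O(K)` of isometries of the lattice `K`. Since `K` spans `V`, they are the isometries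
of `V` that map `K` onto itself. -/
def latticeIsometries (B : LinearMap.BilinForm ℚ V) (K : Submodule ℤ V) : Set (V ≃ₗ[ℚ] V) :=
  {σ | σ ∈ isometries B ∧ σ '' (K : Set V) = (K : Set V)}

/-- `σ` is the symmetry `τ_x : y ↦ y - (2 B(x, y) / Q(x)) x`. It is used only for `x ≠ 0`. -/
def IsSymmetryAlong (B : LinearMap.BilinForm ℚ V) (σ : V ≃ₗ[ℚ] V) (x : V) : Prop :=
  ∀ y, σ y = y - (2 * B x y / B x x) • x

/-- The set `S(K)` of symmetries of `K`. -/
def symmetries (B : LinearMap.BilinForm ℚ V) (K : Submodule ℤ V) : Set (V ≃ₗ[ℚ] V) :=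
  {σ | σ ∈ latticeIsometries B K ∧ ∃ x, x ≠ 0 ∧ IsSymmetryAlong B σ x}

/-- `x` is a primitive vector of `K`: it is in `K`, and not a proper multiple of a vector of `K`
(in particular it is not zero). -/
def IsPrimitiveVector (K : Submodule ℤ V) (x : V) : Prop :=
  x ∈ K ∧ ∀ (n : ℤ), ∀ y ∈ K, x = n • y → IsUnit n

/-- `Q_K(σ) = c`, that is, `σ = τ_x` for a primitive vector `x` of `K` with `Q x = c`. -/
def HasNorm (B : LinearMap.BilinForm ℚ V) (K : Submodule ℤ V) (σ : V ≃ₗ[ℚ] V) (c : ℚ) : Prop :=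
  ∃ x, IsPrimitiveVector K x ∧ IsSymmetryAlong B σ x ∧ B x x = c

/-- Labels `⟨g; c₁, …, c_t⟩` of integral lattices. -/
abbrev Label : Type := ℕ × List ℕ

/-- `ℓ` is the label `⟨|O(K)|; Q_K(σ₁), …, Q_K(σ_t)⟩` of `K`, where `σ₁, …, σ_t` are all the
symmetries of `K`, each listed once, arranged so that `Q_K(σ₁) ≤ … ≤ Q_K(σ_t)`. -/
def HasLabel (B : LinearMap.BilinForm ℚ V) (K : Submodule ℤ V) (ℓ : Label) : Prop :=
  (latticeIsometries B K).Finite ∧ (latticeIsometries B K).ncard = ℓ.1 ∧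
  ℓ.2.Pairwise (· ≤ ·) ∧
  ∃ σ : Fin ℓ.2.length ≃ symmetries B K,
    ∀ i, HasNorm B K (σ i : V ≃ₗ[ℚ] V) ((ℓ.2.get i : ℕ) : ℚ)

/-- `Γ_p^L(N)`: the lattices `M` in the genus of `L` such that `Λ_p(M) = N`. -/
def Gam (B : LinearMap.BilinForm ℚ V) (p : ℕ) (L N : Submodule ℤ V) : Set (Submodule ℤ V) :=
  {M | M ∈ genus B L ∧ watson B p M = N}

/-- Isometry of lattices on `V`, as an equivalence relation on a set of lattices. -/
def isometrySetoid (B : LinearMap.BilinForm ℚ V) (X : Set (Submodule ℤ V)) : Setoid X where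
  r M M' := ∃ σ ∈ isometries B, σ '' (M.1 : Set V) = (M'.1 : Set V)
  iseqv :=
    { refl := fun M => ⟨LinearEquiv.refl ℚ V, fun _ _ => rfl, Set.image_id _⟩
      symm := by
        rintro M M' ⟨σ, hσ, h⟩
        refine ⟨σ.symm, fun x y => ?_, ?_⟩
        · have := hσ (σ.symm x) (σ.symm y)
          simpa using this.symm
        · rw [← h, ← Set.image_comp]
          ext x
          simp
      trans := by
        rintro M M' M'' ⟨σ, hσ, h⟩ ⟨τ, hτ, h'⟩
        refine ⟨σ.trans τ, fun x y => ?_, ?_⟩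
        · simpa using (hτ (σ x) (σ y)).trans (hσ x y)
        · rw [← h', ← h, ← Set.image_comp]
          rfl }

/-- `X / ~`, the set of isometry classes of the lattices in `X`. -/
abbrev Classes (B : LinearMap.BilinForm ℚ V) (X : Set (Submodule ℤ V)) : Type _ :=
  Quotient (isometrySetoid B X)

/-- `s` is the label of `X`: the set of classes of the lattices in `X` is finite, all the lattices
in a class `c` have one and the same label `lab c`, and `s` is the multiset of the labels of all the
classes, each label occurring as often as there are classes with that label. -/
def HasLabelMultiset (B : LinearMap.BilinForm ℚ V) (X : Set (Submodule ℤ V))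
    (s : Multiset Label) : Prop :=
  ∃ (_ : Fintype (Classes B X)) (lab : Classes B X → Label),
    (∀ M : X, HasLabel B M.1 (lab (Quotient.mk (isometrySetoid B X) M))) ∧
    (Finset.univ : Finset (Classes B X)).val.map lab = s

/-- The finite data `(α, β; ε₁ mod p, ε₂ mod p, ε₃ mod p)` that an algorithm reads off a Jordan
decomposition `⟨ε₁, p ^ α ε₂, p ^ β ε₃⟩`; the residues are given by their representatives in
`{0, …, p - 1}`. -/
abbrev JordanData : Type := (ℕ × ℕ) × (ℕ × ℕ × ℕ)

/-- The data read off `⟨ε₁, p ^ α ε₂, p ^ β ε₃⟩`. -/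
noncomputable def jordanData (p : ℕ) [Fact p.Prime] (α β : ℕ) (ε₁ ε₂ ε₃ : ℤ_[p]ˣ) : JordanData :=
  ((α, β), ((PadicInt.toZMod (ε₁ : ℤ_[p])).val, (PadicInt.toZMod (ε₂ : ℤ_[p])).val,
    (PadicInt.toZMod (ε₃ : ℤ_[p])).val))

end TernaryLattice

namespace TernaryLattice

open scoped TensorProduct Matrix

open LinearMap (BilinForm mem_ker proj)
open Module (Basis finrank)
open Submodule (IsLattice coe_smul coe_sum smul_mem span span_induction span_le
  subset_span)
open LinearEquiv (apply_symm_apply coe_one neg)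
open Function (Bijective Injective Surjective)
open Int (cast_mul cast_natCast cast_smul_eq_zsmul)
open Finset (card_eq_zero card_filter card_pair coe_filter dvd_sum filter_eq_empty_iff mem_insert
  mem_range mem_singleton mem_univ mul_sum smul_sum sum_add_distrib sum_congr sum_const sum_filter
  sum_mul univ)
open Fin (sum_univ_three)
open Matrix (det_mul)
open List (Perm filter_cons flatMap_cons map_congr_left map_cons map_map mem_cons mem_cons_of_mem
  mem_cons_self mem_filter mem_map not_mem_nil pairwise_cons replicate sum_cons sum_nil)
open MulAction (orbit)
open Set (mem_insert_iff mem_ofPred_eq mem_singleton_iff ncard_pair)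
open TensorProduct (induction_on tmul_smul)
open Algebra (linearMap smul_def)
open PadicInt (ker_toZMod pow_p_dvd_int_iff toZMod)
open ZMod (natCast_eq_zero_iff natCast_zmod_val val_lt)
open LinearMap.BilinForm (add_left neg_left smul_left sub_left)

variable {V : Type*} [AddCommGroup V] [Module ℚ V] {B B' : LinearMap.BilinForm ℚ V}
  {K K' K'' L M M' N : Submodule ℤ V} {x y z n : V} {g σ : V ≃ₗ[ℚ] V} {xs ys : List V} {f : V → ℕ}
  {ℓ ℓ' : Label} {j m b : ℕ} {k e : ℤ} {s : ℚ} {p : ℕ} [Fact p.Prime] {a a' : Fin 3 → ℕ}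
  {D D' : Fin 3 → ℤ_[p]} {ε : Fin 3 → ℤ_[p]ˣ} {c c' : V →ₗ[ℚ] (Fin 3 → ℚ_[p])} {u v w : Fin 3 → ZMod p}
  {red : V → Fin 3 → ZMod p}

/-! Suppose first that α ≥ 1. Then N_p ≅ ⟨p²ε₁, p^α ε₂, p^β ε₃⟩, and the lattices in Γ_p^L(N) are
the lattices M = N + ℤ p⁻¹n with n in N, B(n, N) ⊆ p²ℤ and Q(n) ≡ p²ε₁ mod p³ (`mem_fiber_iff`).
Away from p nothing changes, so the genus imposes no condition beyond the Jordan decomposition at p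
(`gam_eq_fiber`). M depends only on the class of n in N/pN up to sign, and the classes that occur
form a quadric `quadX` in the space of dimension three over ℤ/p.

Because O(M) ⊆ O(N), two such lattices are isometric if and only if O(N) carries one to the other,
and the class of M contains |O(N)|/|O(M)| of them. Hence the number of classes with a given label is
the number of points of the quadric with that label, times the group order in the label, divided by
2|O(N)| (`ncard_class_mul`, `hasLabelMultiset_of_weight`). It remains to count the points with each
label.

A symmetry τ_x of N survives in the lattice of a point v exactly if v lies on the axis of x, the
line spanned by the reduction of x, or on its mirror, the kernel of y ↦ 2B(x, y)/Q(x) mod p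
(`Frame.tau_mem_over_iff`). In the first case the norm of the symmetry is divided by p², in the
second it stays. The number of points on an axis or a mirror depends only on Q(x) and the local data
(`Frame.card_axis`, `Frame.card_mirror`). A point on the mirrors of two orthogonal roots is on the
axis of the third, so a point off all axes has no mirror, one mirror, or the three mirrors of a
system A₂ (`Gluing.mirrors`). Points with three mirrors are fixed points of a rotation of order
three and are counted by `Frame.card_a2_mirrors`. Inclusion and exclusion then gives all the numbers
(`Gluing.regular_weight`).

The count needs the norms and angles of the roots of N, not only its label. They follow from a
classification of the root systems of ternary lattices (`IntLattice.rootType`): ∅, A₁, A₁³, A₂, B₂ ×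
A₁, G₂ × A₁, and B₃ or C₃, with groups of order 2, 4, 8, 12, 16, 24 and 48. The order and the norms
determine the configuration (`Gluing.describes`). For p = 3 and G₂ × A₁ different roots can have
proportional reductions; there x, y, z form a basis of N/3N and the 27 vectors are enumerated
(`Gluing.g2_weight`).

If α = 0, then β ≥ 2, and a scaled partial dual turns ⟨ε₁, ε₂, p^β ε₃⟩ into ⟨ε₃, p^β ε₁, p^β ε₂⟩. It
commutes with isometries and is compatible with Λ_p, and changes labels in a known way, which
reduces this case to the first one (`hasLabelMultiset_fiber_dual`). All the functions involved are
primitive recursive. -/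

/-! ### Roots, reflections and finiteness -/

/-- An integral lattice on a positive definite ternary space. -/
structure IntLattice (B : BilinForm ℚ V) (K : Submodule ℤ V) : Prop where
  pd : IsPosDefSpace B
  rank : finrank ℚ V = 3
  lat : IsLattice ℚ K
  int : ∀ x ∈ K, ∀ y ∈ K, ∃ k : ℤ, B x y = k

/-- The reflection along `x`, and the identity if `x` is isotropic. -/
noncomputable def tau (B : BilinForm ℚ V) (x : V) : V ≃ₗ[ℚ] V :=
  open scoped Classical in
  if h : B x x = 0 then LinearEquiv.refl ℚ V
  else Module.reflection (x := x) (f := (2 / B x x) • B x) (by simp [h])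

/-- A primitive vector of `K` whose reflection preserves `K`. -/
def IsRoot (B : BilinForm ℚ V) (K : Submodule ℤ V) (x : V) : Prop :=
  IsPrimitiveVector K x ∧ ∀ k ∈ K, ∃ n : ℤ, 2 * B x k = n * B x x

/-- The orthogonal group of `K` as a group. -/
def orthGroup (B : BilinForm ℚ V) (K : Submodule ℤ V) : Subgroup (V ≃ₗ[ℚ] V) where
  carrier := latticeIsometries B K
  mul_mem' := by
    rintro a b ⟨ha, ha'⟩ ⟨hb, hb'⟩
    refine ⟨fun x y => ?_, ?_⟩
    · rw [LinearEquiv.mul_apply, LinearEquiv.mul_apply, ha, hb]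
    · have : (⇑(a * b) : V → V) = a ∘ b := rfl
      rw [this, Set.image_comp, hb', ha']
  one_mem' := ⟨fun _ _ => rfl, by simp⟩
  inv_mem' := by
    rintro a ⟨ha, ha'⟩
    refine ⟨fun x y => ?_, ?_⟩
    · have := ha (a⁻¹ x) (a⁻¹ y)
      simp_all
    · conv_lhs => rw [← ha']
      rw [← Set.image_comp]
      simp

theorem IsPosDefSpace.ne_zero (h : IsPosDefSpace B) (hx : x ≠ 0) : B x x ≠ 0 :=
  (h.pos x hx).ne'

theorem IsPosDefSpace.nonneg (h : IsPosDefSpace B) (x : V) : 0 ≤ B x x := by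
  by_cases hx : x = 0
  · simp [hx]
  · exact (h.pos x hx).le

theorem IsPosDefSpace.eq_zero (h : IsPosDefSpace B) (hx : B x x = 0) : x = 0 := by
  by_contra h0
  exact h.ne_zero h0 hx

theorem IsPosDefSpace.eq_of_forall (h : IsPosDefSpace B) (hx : ∀ z, B x z = B y z) : x = y := by
  rw [← sub_eq_zero]
  apply h.eq_zero
  simp_all

theorem IsPosDefSpace.cauchy (h : IsPosDefSpace B) (x y : V) :
    B x y ^ 2 ≤ B x x * B y y := by
  by_cases hy : y = 0
  · simp [hy]
  have h1 := h.nonneg (B y y • x - B x y • y)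
  have h2 := h.pos y hy
  simp only [map_sub, map_smul, LinearMap.sub_apply, LinearMap.smul_apply, smul_eq_mul,
    h.symm y x] at h1
  have h3 : 0 ≤ B y y * (B x x * B y y - B x y ^ 2) := by nlinarith
  simp_all

theorem tau_apply (h : B x x ≠ 0) (y : V) : tau B x y = y - (2 * B x y / B x x) • x := by
  classical
  rw [tau, dif_neg h, Module.reflection_apply]
  simp only [LinearMap.smul_apply, smul_eq_mul]
  grind

theorem mem_orthGroup : g ∈ orthGroup B K ↔ (∀ x y, B (g x) (g y) = B x y) ∧ ∀ x, g x ∈ K ↔ x ∈ K := by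
  change (_ ∧ _) ↔ _
  refine and_congr Iff.rfl ⟨fun h x => ?_, fun h => ?_⟩
  · constructor
    · intro hx
      have : g x ∈ g '' (K : Set V) := by rw [h]; exact hx
      obtain ⟨y, hy, hxy⟩ := this
      simp_all
    · intro hx
      have : g x ∈ g '' (K : Set V) := ⟨x, hx, rfl⟩
      simp_all
  · ext x
    constructor
    · rintro ⟨y, hy, rfl⟩
      simp_all
    · intro hx
      refine ⟨g.symm x, ?_, by simp⟩
      have := h (g.symm x)
      simp_all

theorem mem_orthGroup_iff : g ∈ orthGroup B K ↔ g ∈ latticeIsometries B K := Iff.rfl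

theorem neg_mem_orthGroup : neg ℚ (M := V) ∈ orthGroup B K := by
  rw [mem_orthGroup]
  simp

theorem IntLattice.fg (h : IntLattice B K) : K.FG := h.lat.fg

theorem IntLattice.finiteDimensional (h : IntLattice B K) : FiniteDimensional ℚ V :=
  Module.finite_of_finrank_pos (by rw [h.rank]; norm_num)

theorem IntLattice.exists_basis (h : IntLattice B K) :
    ∃ e : Basis (Fin 3) ℚ V, ∀ i, e i ∈ K := by
  have := h.finiteDimensional
  obtain ⟨b, hb1, hb2, hb3⟩ := exists_linearIndependent ℚ (K : Set V)
  have hs : span ℚ (K : Set V) = ⊤ := h.lat.span_eq_top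
  rw [hs] at hb2
  let e := Basis.mk hb3 (by rw [Subtype.range_coe, hb2])
  have hf : Fintype b := FiniteDimensional.fintypeBasisIndex e
  have hc : Fintype.card b = 3 := by rw [← h.rank, Module.finrank_eq_card_basis e]
  refine ⟨e.reindex (Fintype.equivFinOfCardEq hc), fun i => hb1 ?_⟩
  simp [e]

theorem IntLattice.norm_nat (h : IntLattice B K) (hx : x ∈ K) : ∃ k : ℕ, B x x = k := by
  obtain ⟨k, hk⟩ := h.int x hx x hx
  have h0 := h.pd.nonneg x
  rw [hk] at h0
  have : 0 ≤ k := by exact_mod_cast h0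
  lift k to ℕ using this
  simp_all

/-- A vector is determined by its inner products with a basis of V chosen in K. For vectors of K
these are integers, and the Cauchy–Schwarz inequality bounds them. -/
theorem IntLattice.finite_le (h : IntLattice B K) (c : ℚ) : {x | x ∈ K ∧ B x x ≤ c}.Finite := by
  obtain ⟨e, he⟩ := h.exists_basis
  have hK : ∀ x : K, ∀ i, ∃ k : ℤ, B x (e i) = k := fun x i => h.int x x.2 _ (he i)
  choose f hf using hK
  have hinj : Injective f := by
    intro x y hxy
    apply Subtype.ext
    apply h.pd.eq_of_forall
    intro z
    have : B (x : V) = B (y : V) := e.ext fun i => by rw [hf, hf, hxy]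
    rw [this]
  -- The inequality bounds the square of an integer, and the absolute value of an integer is at most
  -- its square, so no square root is needed.
  let bd : Fin 3 → ℤ := fun i => ⌈c * B (e i) (e i)⌉ + 1
  have hfin : (f ⁻¹' (Set.Icc (-bd) bd)).Finite := (Set.finite_Icc _ _).preimage hinj.injOn
  refine (hfin.image Subtype.val).subset ?_
  rintro x ⟨hx, hc⟩
  refine ⟨⟨x, hx⟩, ?_, rfl⟩
  have key : ∀ i, |f ⟨x, hx⟩ i| ≤ bd i := by
    intro i
    have h1 := h.pd.cauchy x (e i)
    rw [hf ⟨x, hx⟩ i] at h1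
    have h2 : B x x * B (e i) (e i) ≤ c * B (e i) (e i) :=
      mul_le_mul_of_nonneg_right hc (h.pd.nonneg _)
    have h3 : ((f ⟨x, hx⟩ i ^ 2 : ℤ) : ℚ) ≤ (⌈c * B (e i) (e i)⌉ : ℤ) := by
      push_cast
      exact (h1.trans h2).trans (Int.le_ceil _)
    have h4 : f ⟨x, hx⟩ i ^ 2 ≤ ⌈c * B (e i) (e i)⌉ := by exact_mod_cast h3
    have h5 : |f ⟨x, hx⟩ i| ≤ f ⟨x, hx⟩ i ^ 2 := by
      rw [← sq_abs]
      rcases eq_or_lt_of_le (abs_nonneg (f ⟨x, hx⟩ i)) with h0 | h0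
      · grind
      · nlinarith
    linarith
  exact ⟨fun i => (abs_le.1 (key i)).1, fun i => (abs_le.1 (key i)).2⟩

/-- An isometry is determined by the images of a basis in K, and each image is one of finitely many
vectors of bounded norm. -/
theorem IntLattice.finite_orthGroup (h : IntLattice B K) : (latticeIsometries B K).Finite := by
  obtain ⟨e, he⟩ := h.exists_basis
  let S : Set V := ⋃ i, {x | x ∈ K ∧ B x x ≤ B (e i) (e i)}
  have hS : S.Finite := Set.finite_iUnion fun i => h.finite_le _
  have hP : (Set.pi Set.univ fun _ : Fin 3 => S).Finite := Set.Finite.pi fun _ => hS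
  refine Set.Finite.of_finite_image (f := fun g : V ≃ₗ[ℚ] V => fun i => g (e i)) (hP.subset ?_) ?_
  · rintro _ ⟨g, hg, rfl⟩ i -
    rw [← mem_orthGroup_iff, mem_orthGroup] at hg
    exact Set.mem_iUnion.2 ⟨i, (hg.2 _).2 (he i), (hg.1 _ _).le⟩
  · intro g _ g' _ hgg
    exact LinearEquiv.toLinearMap_injective (e.ext fun i => congrFun hgg i)

theorem IsPrimitiveVector.ne_zero (h : IsPrimitiveVector K x) : x ≠ 0 := by
  rintro rfl
  have := h.2 0 0 K.zero_mem (by simp)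
  simp at this

theorem IsPrimitiveVector.neg (h : IsPrimitiveVector K x) : IsPrimitiveVector K (-x) := by
  refine ⟨K.neg_mem h.1, fun n y hy hxy => h.2 n (-y) (K.neg_mem hy) ?_⟩
  rw [smul_neg, ← hxy, neg_neg]

/-- Write r = a/d in lowest terms and ua + vd = 1. Then u(rx) + vx = x/d lies in K, so d is a unit
by primitivity. -/
theorem IsPrimitiveVector.int_of_smul (h : IsPrimitiveVector K x) {r : ℚ} (hr : r • x ∈ K) : ∃ n :
    ℤ, r = n := by
  have hc : IsCoprime r.num r.den := by
    rw [Int.isCoprime_iff_gcd_eq_one]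
    exact_mod_cast r.reduced
  obtain ⟨u, v, huv⟩ := hc
  have hd : (r.den : ℚ) ≠ 0 := by exact_mod_cast r.den_ne_zero
  have hr' : r = r.num / r.den := (Rat.num_div_den r).symm
  have h1 : u • (r • x) + v • x ∈ K := K.add_mem (K.smul_mem _ hr) (K.smul_mem _ h.1)
  have h2 : x = (r.den : ℤ) • (u • (r • x) + v • x) := by
    have huv' : (u : ℚ) * r.num + v * r.den = 1 := by exact_mod_cast huv
    have hn : (r.den : ℚ) * r = r.num := by rw [mul_comm]; exact Rat.mul_den_eq_num r
    simp only [← cast_smul_eq_zsmul ℚ, ← add_smul, smul_smul]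
    conv_lhs => rw [← one_smul ℚ x]
    congr 1
    push_cast
    grind
  have h3 := h.2 _ _ h1 h2
  rw [Int.isUnit_iff] at h3
  have h4 : r.den = 1 := by have := r.den_pos; omega
  exact ⟨r.num, by rw [hr', h4]; simp⟩

theorem IsPrimitiveVector.eq_or_eq_neg (hx : IsPrimitiveVector K x) (hy : IsPrimitiveVector K y) {r
    : ℚ} (h : y = r • x) : y = x ∨ y = -x := by
  obtain ⟨n, rfl⟩ := hx.int_of_smul (h ▸ hy.1)
  rw [cast_smul_eq_zsmul] at h
  rcases Int.isUnit_iff.1 (hy.2 n x hx.1 h) with rfl | rfl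
  · simp_all
  · simp_all

/-- Descent on the norm, a positive integer: if x = n • y with n not a unit, then y is shorter than
x. -/
theorem IntLattice.exists_primitive (h : IntLattice B K) (hx : x ∈ K) (h0 : x ≠ 0) : ∃ y,
    IsPrimitiveVector K y ∧ ∃ n : ℤ, x = n • y := by
  obtain ⟨k, hk⟩ := h.norm_nat hx
  induction k using Nat.strong_induction_on generalizing x with
  | _ k ih =>
    by_cases hp : IsPrimitiveVector K x
    · exact ⟨x, hp, 1, by simp⟩
    · have : ∃ (n : ℤ), ∃ y ∈ K, x = n • y ∧ ¬ IsUnit n := by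
        by_contra hcon
        push Not at hcon
        exact hp ⟨hx, fun n y hy hxy => by by_contra hu; exact hu (hcon n y hy hxy)⟩
      obtain ⟨n, y, hy, rfl, hn⟩ := this
      obtain ⟨l, hl⟩ := h.norm_nat hy
      have hn0 : n ≠ 0 := by rintro rfl; simp at h0
      have hy0 : y ≠ 0 := by rintro rfl; simp at h0
      have hl0 : 0 < l := by
        have := h.pd.pos y hy0
        simp_all
      have hkl : (k : ℤ) = n ^ 2 * l := by
        have : (k : ℚ) = n ^ 2 * l := by
          rw [← hk, ← hl]
          simp
          ring
        exact_mod_cast this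
      have hn2 : 1 < n ^ 2 := by
        have : n ^ 2 ≠ 1 := by
          intro hh
          exact hn (IsUnit.of_pow_eq_one hh two_ne_zero)
        have : 0 < n ^ 2 := by positivity
        omega
      have hlk : l < k := by
        have : (l : ℤ) < k := by rw [hkl]; nlinarith
        omega
      obtain ⟨z, hz, m, hm⟩ := ih l hlk hy hy0 hl
      exact ⟨z, hz, n * m, by rw [hm, smul_smul]⟩

theorem IntLattice.exists_primitive_line (h : IntLattice B K) (h0 : x ≠ 0) : ∃ y, IsPrimitiveVector
    K y ∧ ∃ r : ℚ, r ≠ 0 ∧ x = r • y := by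
  obtain ⟨e, he⟩ := h.exists_basis
  let d : ℤ := ∏ i, ((e.repr x i).den : ℤ)
  have hd0 : d ≠ 0 := Finset.prod_ne_zero_iff.2 fun i _ => by exact_mod_cast (e.repr x i).den_ne_zero
  have hd : (d : ℚ) • x ∈ K := by
    rw [← e.sum_repr x, smul_sum]
    refine K.sum_mem fun i _ => ?_
    have : ∃ m : ℤ, (d : ℚ) * e.repr x i = m := by
      refine ⟨(∏ j ∈ univ.erase i, ((e.repr x j).den : ℤ)) * (e.repr x i).num, ?_⟩
      have h1 : d = (∏ j ∈ univ.erase i, ((e.repr x j).den : ℤ)) * (e.repr x i).den := by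
        rw [Finset.prod_erase_mul _ _ (mem_univ i)]
      rw [h1]
      push_cast
      rw [mul_assoc, mul_comm ((e.repr x i).den : ℚ), Rat.mul_den_eq_num]
    obtain ⟨m, hm⟩ := this
    rw [smul_smul, hm, cast_smul_eq_zsmul]
    exact K.smul_mem _ (he i)
  have hdq : (d : ℚ) ≠ 0 := by exact_mod_cast hd0
  obtain ⟨y, hy, n, hn⟩ := h.exists_primitive hd (smul_ne_zero hdq h0)
  have hx : x = ((d : ℚ)⁻¹ * n) • y := by
    rw [mul_smul, cast_smul_eq_zsmul, ← hn, inv_smul_smul₀ hdq]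
  refine ⟨y, hy, _, ?_, hx⟩
  simp_all

theorem tau_smul {r : ℚ} (hr : r ≠ 0) : tau B (r • x) = tau B x := by
  by_cases h : B x x = 0
  · have h' : B (r • x) (r • x) = 0 := by simp [h]
    rw [tau, tau, dif_pos h, dif_pos h']
  · have h' : B (r • x) (r • x) ≠ 0 := by simp [h, hr]
    ext y
    rw [tau_apply h, tau_apply h', smul_smul]
    congr 2
    simp
    field_simp

theorem tau_neg (x : V) : tau B (-x) = tau B x := by
  have := tau_smul (B := B) (x := x) (r := -1) (by norm_num)
  simp_all

theorem isSymmetryAlong_iff (h : B x x ≠ 0) : IsSymmetryAlong B σ x ↔ σ = tau B x := by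
  constructor
  · intro hs
    ext y
    rw [hs y, tau_apply h]
  · rintro rfl y
    exact tau_apply h y

theorem tau_isometry (hB : IsPosDefSpace B) (hx : x ≠ 0) (y z : V) : B (tau B x y) (tau B x z) = B
    y z := by
  have h := hB.ne_zero hx
  rw [tau_apply h, tau_apply h]
  simp [map_sub, hB.symm y x]
  grind

theorem tau_tau (y : V) : tau B x (tau B x y) = y := by
  by_cases h : B x x = 0
  · rw [tau, dif_pos h]; rfl
  · rw [tau_apply h, tau_apply h]
    simp
    rw [sub_sub, ← add_smul]
    have : 2 * B x y / B x x + 2 * (B x y - 2 * B x y / B x x * B x x) / B x x = 0 := by grind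
    simp_all

theorem tau_self (h : B x x ≠ 0) : tau B x x = -x := by
  rw [tau_apply h, mul_div_assoc, div_self h]
  module

theorem tau_of_orth (h : B x x ≠ 0) (hxy : B x y = 0) : tau B x y = y := by
  rw [tau_apply h, hxy]
  simp

theorem IsRoot.ne_zero (h : IsRoot B K x) : x ≠ 0 := h.1.ne_zero

theorem IsRoot.mem (h : IsRoot B K x) : x ∈ K := h.1.1

theorem IsRoot.neg (h : IsRoot B K x) : IsRoot B K (-x) := by
  refine ⟨h.1.neg, fun k hk => ?_⟩
  obtain ⟨n, hn⟩ := h.2 k hk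
  exact ⟨-n, by simp; linarith⟩

theorem tau_mem_of_int (hB : IsPosDefSpace B) (hx : x ∈ K) (h0 : x ≠ 0) (h : ∀ k ∈ K, ∃ n : ℤ, 2 *
    B x k = n * B x x) : tau B x ∈ orthGroup B K := by
  have hne := hB.ne_zero h0
  have key : ∀ y ∈ K, tau B x y ∈ K := by
    intro y hy
    obtain ⟨n, hn⟩ := h y hy
    rw [tau_apply hne, hn, mul_div_assoc, div_self hne, mul_one, cast_smul_eq_zsmul]
    exact K.sub_mem hy (K.smul_mem _ hx)
  refine mem_orthGroup.2 ⟨tau_isometry hB h0, fun y => ⟨fun hy => ?_, key y⟩⟩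
  have := key _ hy
  rwa [tau_tau] at this

theorem IsRoot.tau_mem (hB : IsPosDefSpace B) (h : IsRoot B K x) : tau B x ∈ orthGroup B K := tau_mem_of_int hB h.mem h.ne_zero h.2

theorem IsRoot.tau_mem_symmetries (hB : IsPosDefSpace B) (h : IsRoot B K x) : tau B x ∈ symmetries
    B K :=
  ⟨h.tau_mem hB, x, h.ne_zero, (isSymmetryAlong_iff (hB.ne_zero h.ne_zero)).2 rfl⟩

/-- The vector k - τ_x(k) = (2B(x, k)/Q(x)) • x lies in K, and since x is primitive its coefficient
is an integer. -/
theorem isRoot_of_tau_mem (hB : IsPosDefSpace B) (hx : IsPrimitiveVector K x) (h : tau B x ∈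
    orthGroup B K) : IsRoot B K x := by
  refine ⟨hx, fun k hk => ?_⟩
  have hne := hB.ne_zero hx.ne_zero
  have h1 := ((mem_orthGroup.1 h).2 k).2 hk
  rw [tau_apply hne] at h1
  have h2 : (2 * B x k / B x x) • x ∈ K := by
    have := K.sub_mem hk h1
    simp_all
  obtain ⟨n, hn⟩ := hx.int_of_smul h2
  grind

theorem IntLattice.exists_root_of_tau (h : IntLattice B K) (h0 : x ≠ 0) (ht : tau B x ∈ orthGroup B
    K) : ∃ y, IsRoot B K y ∧ ∃ r : ℚ, r ≠ 0 ∧ x = r • y := by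
  obtain ⟨y, hy, r, hr, rfl⟩ := h.exists_primitive_line h0
  rw [tau_smul hr] at ht
  exact ⟨y, isRoot_of_tau_mem h.pd hy ht, r, hr, rfl⟩

/-- Symmetries correspond to roots up to sign, so that labels can be studied through roots. -/
theorem IntLattice.mem_symmetries_iff (h : IntLattice B K) : σ ∈ symmetries B K ↔ ∃ x, IsRoot B K x
    ∧ σ = tau B x := by
  constructor
  · rintro ⟨h1, x, hx, hs⟩
    rw [isSymmetryAlong_iff (h.pd.ne_zero hx)] at hs
    subst hs
    obtain ⟨y, hy, r, hr, rfl⟩ := h.exists_root_of_tau hx h1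
    exact ⟨y, hy, tau_smul hr⟩
  · rintro ⟨x, hx, rfl⟩
    exact hx.tau_mem_symmetries h.pd

theorem parallel_of_tau_eq (hB : IsPosDefSpace B) (hx : x ≠ 0) (hy : y ≠ 0) (h : tau B x = tau B y)
    : ∃ r : ℚ, y = r • x := by
  have h1 := tau_self (hB.ne_zero hy)
  rw [← h, tau_apply (hB.ne_zero hx)] at h1
  refine ⟨B x y / B x x, ?_⟩
  have h2 : (2 : ℚ) • y = (2 : ℚ) • ((B x y / B x x) • x) := by
    rw [smul_smul, ← mul_div_assoc, two_smul]
    grind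
  exact smul_right_injective V (two_ne_zero) h2

theorem IsRoot.tau_eq_iff (hB : IsPosDefSpace B) (hx : IsRoot B K x) (hy : IsRoot B K y) : tau B x
    = tau B y ↔ y = x ∨ y = -x := by
  constructor
  · intro h
    obtain ⟨r, hr⟩ := parallel_of_tau_eq hB hx.ne_zero hy.ne_zero h
    exact hx.1.eq_or_eq_neg hy.1 hr
  · rintro (rfl | rfl)
    · rfl
    · rw [tau_neg]

theorem IsRoot.hasNorm_iff (hB : IsPosDefSpace B) (hx : IsRoot B K x) {c : ℚ} : HasNorm B K (tau B
    x) c ↔ B x x = c := by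
  constructor
  · rintro ⟨y, hy, hs, rfl⟩
    rw [isSymmetryAlong_iff (hB.ne_zero hy.ne_zero)] at hs
    obtain ⟨r, hr⟩ := parallel_of_tau_eq hB hx.ne_zero hy.ne_zero hs
    rcases hx.1.eq_or_eq_neg hy hr with rfl | rfl <;> simp
  · rintro rfl
    exact ⟨x, hx.1, (isSymmetryAlong_iff (hB.ne_zero hx.ne_zero)).2 rfl, rfl⟩

theorem orthGroup_map_root (hg : g ∈ orthGroup B K) (hx : IsRoot B K x) : IsRoot B K (g x) := by
  have hg' := mem_orthGroup.1 hg
  refine ⟨⟨(hg'.2 x).2 hx.mem, fun n y hy hxy => ?_⟩, fun k hk => ?_⟩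
  · have h1 : g.symm y ∈ K := by
      rw [← hg'.2]; simpa using hy
    refine hx.1.2 n _ h1 ?_
    apply g.injective
    simp_all
  · have h1 : g.symm k ∈ K := by
      rw [← hg'.2]; simpa using hk
    obtain ⟨n, hn⟩ := hx.2 _ h1
    refine ⟨n, ?_⟩
    rw [hg'.1, ← hn, ← hg'.1 x (g.symm k)]
    simp

/-! ### Orthogonal frames and isometries of a ternary space -/

/-- An orthogonal triple of nonzero vectors. -/
structure OrthTriple (B : BilinForm ℚ V) (x y z : V) : Prop where
  hx : x ≠ 0
  hy : y ≠ 0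
  hz : z ≠ 0
  xy : B x y = 0
  xz : B x z = 0
  yz : B y z = 0

theorem exists_orth (hr : finrank ℚ V = 3) (B : BilinForm ℚ V) (x y : V) :
    ∃ u, u ≠ 0 ∧ B x u = 0 ∧ B y u = 0 := by
  have : FiniteDimensional ℚ V := Module.finite_of_finrank_pos (by rw [hr]; norm_num)
  let f : V →ₗ[ℚ] (Fin 2 → ℚ) := LinearMap.pi ![B x, B y]
  have h : LinearMap.ker f ≠ ⊥ := LinearMap.ker_ne_bot_of_finrank_lt (by simp [hr])
  obtain ⟨u, hu, hu0⟩ := Submodule.exists_mem_ne_zero_of_ne_bot h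
  have h1 := congrFun (mem_ker.1 hu) 0
  have h2 := congrFun (mem_ker.1 hu) 1
  exact ⟨u, hu0, by simpa [f] using h1, by simpa [f] using h2⟩

theorem OrthTriple.exists_basis (hB : IsPosDefSpace B) (hr : finrank ℚ V = 3) (h :
    OrthTriple B x y z) : ∃ e : Basis (Fin 3) ℚ V, e 0 = x ∧ e 1 = y ∧ e 2 = z := by
  have hli : LinearIndependent ℚ ![x, y, z] := by
    rw [Fintype.linearIndependent_iff]
    intro g hg
    simp [sum_univ_three] at hg
    have h1 := congrArg (B x) hg
    have h2 := congrArg (B y) hg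
    have h3 := congrArg (B z) hg
    simp [h.xy, h.xz, h.yz, hB.symm y x, hB.symm z x, hB.symm z y, hB.ne_zero h.hx, hB.ne_zero h.hy,
      hB.ne_zero h.hz] at h1 h2 h3
    intro i
    fin_cases i
    exacts [h1, h2, h3]
  refine ⟨basisOfLinearIndependentOfCardEqFinrank hli (by simp [hr]), ?_, ?_, ?_⟩ <;> simp

theorem OrthTriple.ext (hB : IsPosDefSpace B) (hr : finrank ℚ V = 3) (h : OrthTriple B x y
    z) {f g : V →ₗ[ℚ] V} (hx : f x = g x) (hy : f y = g y) (hz : f z = g z) : f = g := by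
  obtain ⟨e, rfl, rfl, rfl⟩ := h.exists_basis hB hr
  refine e.ext fun i => ?_
  fin_cases i
  exacts [hx, hy, hz]

theorem OrthTriple.ext_equiv (hB : IsPosDefSpace B) (hr : finrank ℚ V = 3) (h : OrthTriple B
    x y z) {f : V ≃ₗ[ℚ] V} (hx : f x = g x) (hy : f y = g y) (hz : f z = g z) : f = g :=
  LinearEquiv.toLinearMap_injective (h.ext hB hr hx hy hz)

theorem OrthTriple.expand (hB : IsPosDefSpace B) (hr : finrank ℚ V = 3) (h : OrthTriple B x
    y z) (v : V) : v = (B x v / B x x) • x + (B y v / B y y) • y + (B z v / B z z) • z := by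
  have h1 := hB.ne_zero h.hx
  have h2 := hB.ne_zero h.hy
  have h3 := hB.ne_zero h.hz
  let f : V →ₗ[ℚ] V := ((B x x)⁻¹ • (B x)).smulRight x + ((B y y)⁻¹ • (B y)).smulRight y +
    ((B z z)⁻¹ • (B z)).smulRight z
  have hf : LinearMap.id = f := by
    apply h.ext hB hr <;>
    simp [f, h.xy, h.xz, h.yz, hB.symm y x, hB.symm z x, hB.symm z y, h1, h2, h3]
  have := congrArg (fun F : V →ₗ[ℚ] V => F v) hf
  simp at this
  conv_lhs => rw [this]
  simp [f, div_eq_inv_mul]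

theorem OrthTriple.parseval (hB : IsPosDefSpace B) (hr : finrank ℚ V = 3) (h : OrthTriple B
    x y z) (v w : V) : B v w = B x v * B x w / B x x + B y v * B y w / B y y + B z v * B z w / B z
    z := by
  conv_lhs => rw [h.expand hB hr v]
  simp
  ring

theorem OrthTriple.perp (hB : IsPosDefSpace B) (hr : finrank ℚ V = 3) (h : OrthTriple B x y
    z) {v : V} (h1 : B x v = 0) (h2 : B y v = 0) : v = (B z v / B z z) • z := by
  conv_lhs => rw [h.expand hB hr v, h1, h2]
  simp

theorem OrthTriple.rotate (hB : IsPosDefSpace B) (h : OrthTriple B x y z) : OrthTriple B y z x :=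
  ⟨h.hy, h.hz, h.hx, h.yz, by rw [hB.symm, h.xy], by rw [hB.symm, h.xz]⟩

theorem OrthTriple.swap (hB : IsPosDefSpace B) (h : OrthTriple B x y z) : OrthTriple B y x z :=
  ⟨h.hy, h.hx, h.hz, by rw [hB.symm, h.xy], h.yz, h.xz⟩

theorem exists_orthTriple (hB : IsPosDefSpace B) (hr : finrank ℚ V = 3) (hx : x ≠ 0) (hy : y
    ≠ 0) (hxy : B x y = 0) : ∃ z, OrthTriple B x y z := by
  obtain ⟨u, hu, h1, h2⟩ := exists_orth hr B x y
  exact ⟨u, hx, hy, hu, hxy, h1, h2⟩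

/-- In odd dimension the determinant d = ±1 of an isometry is an eigenvalue. With A the matrix of g
and G the Gram matrix, (A - d)ᵀGA = -dG(A - d), and taking determinants gives det(A - d) = -det(A -
d). -/
theorem exists_axis (hB : IsPosDefSpace B) (hr : finrank ℚ V = 3) (g : V ≃ₗ[ℚ] V)
    (hg : ∀ x y, B (g x) (g y) = B x y) : ∃ z, z ≠ 0 ∧ (g z = z ∨ g z = -z) := by
  have : FiniteDimensional ℚ V := Module.finite_of_finrank_pos (by rw [hr]; norm_num)
  let e := Module.finBasisOfFinrankEq ℚ V hr
  set A := LinearMap.toMatrix e e g.toLinearMap with hA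
  set G := LinearMap.BilinForm.toMatrix e B with hG
  have hGA : A.transpose * G * A = G := by
    have := LinearMap.BilinForm.toMatrix_comp (b := e) (c := e) B g.toLinearMap g.toLinearMap
    rw [← hA, ← hG] at this
    rw [← this, hG]
    congr 1
    ext x y
    exact hg x y
  have hG0 : G.det ≠ 0 := by
    have hn : B.Nondegenerate := by
      exact ⟨fun x hx => hB.eq_zero (hx x), fun x hx => hB.eq_zero (hx x)⟩
    exact (LinearMap.BilinForm.nondegenerate_iff_det_ne_zero e).1 hn
  have hd : A.det ^ 2 = 1 := by
    have := congrArg Matrix.det hGA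
    rw [det_mul, det_mul, Matrix.det_transpose] at this
    grind
  set d := A.det with hdd
  have hd' : d = 1 ∨ d = -1 := sq_eq_one_iff.1 hd
  have key : (A - d • (1 : Matrix (Fin 3) (Fin 3) ℚ)).det = 0 := by
    have h1 : (A - d • (1 : Matrix (Fin 3) (Fin 3) ℚ)).transpose * G * A =
        (-d) • (G * (A - d • (1 : Matrix (Fin 3) (Fin 3) ℚ))) := by
      rw [Matrix.transpose_sub, Matrix.sub_mul, Matrix.sub_mul, hGA]
      simp only [Matrix.transpose_smul, Matrix.transpose_one, Matrix.smul_mul, Matrix.one_mul,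
        Matrix.mul_sub, Matrix.mul_smul, Matrix.mul_one, smul_sub, smul_smul, neg_mul, ← pow_two,
        hd, neg_smul, one_smul]
      abel
    have h2 := congrArg Matrix.det h1
    rw [det_mul, det_mul, Matrix.det_transpose, Matrix.det_smul, det_mul,
      ← hdd, Fintype.card_fin] at h2
    grind
  obtain ⟨v, hv0, hv⟩ := Matrix.exists_mulVec_eq_zero_iff.2 key
  refine ⟨e.equivFun.symm v, by rwa [Ne, LinearEquiv.map_eq_zero_iff], ?_⟩
  have h1 : A.mulVec v = d • v := by
    rw [Matrix.sub_mulVec, Matrix.smul_mulVec, Matrix.one_mulVec, sub_eq_zero] at hv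
    exact hv
  have h2 : g (e.equivFun.symm v) = d • e.equivFun.symm v := by
    apply e.equivFun.injective
    rw [map_smul]
    simp only [apply_symm_apply]
    rw [← h1, hA]
    have := LinearMap.toMatrix_mulVec_repr e e g.toLinearMap (e.equivFun.symm v)
    ext i
    have h3 := congrFun this i
    simp only [Basis.equivFun_apply]
    rw [LinearEquiv.coe_coe] at h3
    rw [← h3]
    congr 2
    ext j
    exact congrFun (e.equivFun.apply_symm_apply v) j
  rcases hd' with h | h
  · left; rw [h2, h, one_smul]
  · right; rw [h2, h, neg_smul, one_smul]

theorem smul_eq_or_of_norm (hB : IsPosDefSpace B) {u v : V} (hu : u ≠ 0) {r : ℚ} (h : v = r • u)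
    (hn : B v v = B u u) : v = u ∨ v = -u := by
  rw [h] at hn
  simp at hn
  have h0 := hB.ne_zero hu
  have : r ^ 2 = 1 := by grind
  rcases sq_eq_one_iff.1 this with rfl | rfl
  · simp_all
  · simp_all

theorem OrthTriple.map_third (hB : IsPosDefSpace B) (hr : finrank ℚ V = 3) (h : OrthTriple B
    x y z) (hg : ∀ x y, B (g x) (g y) = B x y) (hx : g x = x ∨ g x = -x) (hy : g y = y ∨ g y = -y)
    : g z = z ∨ g z = -z := by
  have h1 : B x (g z) = 0 := by
    have := hg x z
    rw [h.xz] at this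
    rcases hx with hx | hx <;> rw [hx] at this <;> simpa using this
  have h2 : B y (g z) = 0 := by
    have := hg y z
    rw [h.yz] at this
    rcases hy with hy | hy <;> rw [hy] at this <;> simpa using this
  exact smul_eq_or_of_norm hB h.hz (h.perp hB hr h1 h2) (hg z z)

/-- This is the Cayley–Hamilton relation of a rotation of the plane orthogonal to z. Writing g²y =
ay + b(gy) and comparing inner products gives a² = 1, and a = 1 would force g² = 1. -/
theorem rotation_apply (hB : IsPosDefSpace B) (hr : finrank ℚ V = 3) (hg : ∀ x y, B (g x) (g
    y) = B x y) (hz : z ≠ 0) (hgz : g z = z) (hg2 : g * g ≠ 1) (hy : y ≠ 0) (hzy : B z y = 0) : g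
    (g y) = (2 * B y (g y) / B y y) • g y - y ∧ g y ≠ y ∧ g y ≠ -y := by
  obtain ⟨w, hw⟩ := exists_orthTriple hB hr hz hy hzy
  have hne : ¬ (g y = y ∨ g y = -y) := by
    intro hcon
    apply hg2
    have h3 := hw.map_third hB hr hg (Or.inl hgz) hcon
    apply hw.ext_equiv hB hr
    · simp [hgz]
    · rcases hcon with h | h <;> simp [h]
    · rcases h3 with h | h <;> simp [h]
  push Not at hne
  refine ⟨?_, hne⟩
  have hzg : ∀ v, B z (g v) = B z v := fun v => by grind
  set q := B y y with hq
  have hq0 : q ≠ 0 := hB.ne_zero hy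
  set s := B y (g y) with hs
  have hzgy : B z (g y) = 0 := by rw [hzg, hzy]
  have hu0 : g y - (s / q) • y ≠ 0 := by
    intro h0
    rw [sub_eq_zero] at h0
    rcases smul_eq_or_of_norm hB hy h0 (hg y y) with h | h
    · grind
    · grind
  have ht : OrthTriple B z y (g y - (s / q) • y) := by
    refine ⟨hz, hy, hu0, hzy, ?_, ?_⟩
    · simp_all
    · simp_all
  have hex := ht.expand hB hr (g (g y))
  rw [hzg, hzgy, zero_div, zero_smul, zero_add, ← hq] at hex
  obtain ⟨a, b, hab⟩ : ∃ a b : ℚ, g (g y) = a • y + b • g y := by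
    rw [smul_sub, smul_smul, add_sub, add_sub_right_comm, ← sub_smul] at hex
    grind
  have e1 : a * s + b * q = s := by
    have := hg y (g y)
    rw [hab] at this
    simp [hg, hB.symm (g y) y, ← hs, ← hq] at this
    exact this
  have e2 : a ^ 2 * q + 2 * a * b * s + b ^ 2 * q = q := by
    have := (hg (g y) (g y)).trans (hg y y)
    rw [hab] at this
    simp [hg, hB.symm (g y) y, ← hs, ← hq] at this
    linarith
  have e3 : q ^ 2 - s ^ 2 ≠ 0 := by
    have := hB.ne_zero hu0
    simp only [map_sub, map_smul, smul_eq_mul, LinearMap.sub_apply, LinearMap.smul_apply, hg,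
      hB.symm (g y) y, ← hs, ← hq] at this
    grind
  have e4 : (a ^ 2 - 1) * (q ^ 2 - s ^ 2) = 0 := by grind
  have e5 : a ^ 2 = 1 := by grind
  rcases sq_eq_one_iff.1 e5 with rfl | rfl
  · exfalso
    have hb : b = 0 := by simp_all
    rw [hb] at hab
    simp at hab
    apply hg2
    apply ht.ext_equiv hB hr
    · simp [hgz]
    · simpa using hab
    · simp [hab]
  · rw [hab]
    have hb : b = 2 * s / q := by grind
    rw [hb]
    module

/-- Up to the sign of g there is a fixed vector z. For y orthogonal to z either y is reversed or y +
gy is fixed, which gives a second axis; the third axis of the frame is then preserved up to sign. -/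
theorem involution_cases (hB : IsPosDefSpace B) (hr : finrank ℚ V = 3) (hg : ∀ x y, B (g x)
    (g y) = B x y) (hg2 : g * g = 1) : (g = 1 ∨ g = neg ℚ) ∨ ∃ u, u ≠ 0 ∧ (g = tau B u
    ∨ g = neg ℚ * tau B u) := by
  have fixed : ∀ g : V ≃ₗ[ℚ] V, (∀ x y, B (g x) (g y) = B x y) → g * g = 1 →
      (∃ z, z ≠ 0 ∧ g z = z) → g = 1 ∨
        ∃ u, u ≠ 0 ∧ (g = tau B u ∨ g = neg ℚ * tau B u) := by
    rintro g hg hg2 ⟨z, hz, hgz⟩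
    obtain ⟨y, hy, hzy, -⟩ := exists_orth hr B z z
    have hggy : g (g y) = y := by
      have := congrArg (fun f : V ≃ₗ[ℚ] V => f y) hg2
      simpa using this
    by_cases hs : g y = -y
    · obtain ⟨u, hu⟩ := exists_orthTriple hB hr hz hy hzy
      have hyz : B y z = 0 := by rw [hB.symm, hzy]
      rcases hu.map_third hB hr hg (Or.inl hgz) (Or.inr hs) with h | h
      · right
        refine ⟨y, hy, Or.inl (hu.ext_equiv hB hr ?_ ?_ ?_)⟩
        · rw [hgz, tau_of_orth (hB.ne_zero hy) hyz]
        · rw [hs, tau_self (hB.ne_zero hy)]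
        · rw [h, tau_of_orth (hB.ne_zero hy) hu.yz]
      · right
        refine ⟨z, hz, Or.inr (hu.ext_equiv hB hr ?_ ?_ ?_)⟩
        · simp [hgz, tau_self (hB.ne_zero hz)]
        · simp [hs, tau_of_orth (hB.ne_zero hz) hzy]
        · simp [h, tau_of_orth (hB.ne_zero hz) hu.xz]
    · have he : y + g y ≠ 0 := fun h => hs (by rw [← sub_eq_zero, sub_neg_eq_add, add_comm, h])
      have hge : g (y + g y) = y + g y := by rw [map_add, hggy, add_comm]
      have hze : B z (y + g y) = 0 := by grind
      obtain ⟨u, hu⟩ := exists_orthTriple hB hr hz he hze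
      rcases hu.map_third hB hr hg (Or.inl hgz) (Or.inl hge) with h | h
      · left
        exact hu.ext_equiv hB hr (by simpa using hgz) (by simpa using hge) (by simpa using h)
      · right
        have hu' := (hu.rotate hB).rotate hB
        refine ⟨u, hu.hz, Or.inl (hu.ext_equiv hB hr ?_ ?_ ?_)⟩
        · rw [hgz, tau_of_orth (hB.ne_zero hu.hz) hu'.xy]
        · rw [hge, tau_of_orth (hB.ne_zero hu.hz) hu'.xz]
        · rw [h, tau_self (hB.ne_zero hu.hz)]
  obtain ⟨z, hz, h | h⟩ := exists_axis hB hr g hg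
  · rcases fixed g hg hg2 ⟨z, hz, h⟩ with h1 | h1
    · simp_all
    · exact Or.inr h1
  · have hnn : neg ℚ * neg ℚ = (1 : V ≃ₗ[ℚ] V) := by ext; simp
    have hgn : neg ℚ * (neg ℚ * g) = g := by rw [← mul_assoc, hnn, one_mul]
    rcases fixed (neg ℚ * g) (fun x y => by simp [hg]) (by
        ext v
        have := congrArg (fun f : V ≃ₗ[ℚ] V => f v) hg2
        simpa using this) ⟨z, hz, by simp [h]⟩ with h1 | ⟨u, hu, h1 | h1⟩
    · simp_all
    · grind
    · grind

/-- If g is a rotation about z with g² ≠ 1, the shortest vector y of K orthogonal to z is a root.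
Indeed each k - gk with k in K turns out to be an integral combination of y and gy, and comparing
inner products gives 2B(y, k) = (a - b)Q(y) for its coefficients a and b. -/
theorem IntLattice.exists_roots_of_rotation (hK : IntLattice B K) (hg : g ∈ orthGroup B K) (hz : z
    ≠ 0) (hgz : g z = z) (hg2 : g * g ≠ 1) : ∃ x y, IsRoot B K x ∧ IsRoot B K y ∧ B z x = 0 ∧ B z y
    = 0 ∧ B x y ≠ 0 ∧ y ≠ x ∧ y ≠ -x := by
  classical
  have hB := hK.pd
  have hr := hK.rank
  have hg' := mem_orthGroup.1 hg
  have hex : ∃ n : ℕ, ∃ y ∈ K, y ≠ 0 ∧ B z y = 0 ∧ B y y = n := by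
    obtain ⟨u, hu, h1, -⟩ := exists_orth hr B z z
    obtain ⟨y, hy, r, hr0, rfl⟩ := hK.exists_primitive_line hu
    obtain ⟨k, hk⟩ := hK.norm_nat hy.1
    refine ⟨k, y, hy.1, hy.ne_zero, ?_, hk⟩
    simp_all
  obtain ⟨y, hy, hy0, hzy, hyn⟩ := Nat.find_spec hex
  have hmin : ∀ w ∈ K, w ≠ 0 → B z w = 0 → B y y ≤ B w w := by
    intro w hw hw0 hzw
    obtain ⟨k, hk⟩ := hK.norm_nat hw
    rw [hyn, hk]
    exact_mod_cast Nat.find_min' hex ⟨w, hw, hw0, hzw, hk⟩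
  obtain ⟨hrot, hne1, hne2⟩ := rotation_apply hB hr hg'.1 hz hgz hg2 hy0 hzy
  have hzg : ∀ v, B z (g v) = B z v := fun v => by grind
  have hprim : IsPrimitiveVector K y := by
    refine ⟨hy, fun n w hw hyw => ?_⟩
    have hn0 : n ≠ 0 := by rintro rfl; exact hy0 (by simpa using hyw)
    have hw0 : w ≠ 0 := by rintro rfl; exact hy0 (by simpa using hyw)
    have hq : B y y = n ^ 2 * B w w := by
      rw [hyw]
      simp
      ring
    have hzw : B z w = 0 := by
      rw [hyw] at hzy
      simpa [← cast_smul_eq_zsmul ℚ, hn0] using hzy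
    have h1 := hmin w hw hw0 hzw
    have h2 := hB.pos w hw0
    rw [hq] at h1
    have h3 : (n : ℚ) ^ 2 ≤ 1 := by
      by_contra hc
      push Not at hc
      nlinarith
    have h4 : n ^ 2 ≤ 1 := by exact_mod_cast h3
    rw [Int.isUnit_iff]
    have h5 : -1 ≤ n := by nlinarith
    have h6 : n ≤ 1 := by nlinarith
    omega
  have hgprim : IsPrimitiveVector K (g y) := by
    refine ⟨(hg'.2 y).2 hy, fun n w hw hyw => ?_⟩
    refine hprim.2 n (g.symm w) (by rw [← hg'.2]; simpa using hw) (g.injective ?_)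
    simp_all
  have hgy : g y ∈ K := hgprim.1
  set q := B y y with hq
  have hq0 : 0 < q := hB.pos y hy0
  -- By `rotation_apply`, t • gy = g²y + y lies in K, and gy is primitive.
  obtain ⟨t, ht⟩ : ∃ t : ℤ, 2 * B y (g y) / q = t := by
    apply hgprim.int_of_smul
    have : (2 * B y (g y) / q) • g y = g (g y) + y := by rw [hrot]; abel
    rw [this]
    exact K.add_mem ((hg'.2 _).2 hgy) hy
  have hs : B y (g y) = t * q / 2 := by rw [← ht]; field_simp
  have hs' : B (g y) y = t * q / 2 := by rw [hB.symm, hs]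
  rw [ht] at hrot
  have hqq : B (g y) (g y) = q := hg'.1 y y
  have hzgy : B z (g y) = 0 := by rw [hzg, hzy]
  -- The vectors y - gy and y + gy are nonzero and orthogonal to z, so they are not shorter than y.
  -- This bounds t from both sides.
  have ht1 : t ≤ 1 := by
    have h1 := hmin (y - g y) (K.sub_mem hy hgy) (sub_ne_zero.2 (Ne.symm hne1)) (by simp [hzy,
      hzgy])
    simp [hs, hs', ← hq, hqq] at h1
    have : (t : ℚ) ≤ 1 := by nlinarith
    exact_mod_cast this
  have ht2 : -1 ≤ t := by
    have h1 := hmin (y + g y) (K.add_mem hy hgy)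
      (fun h => hne2 (by rw [eq_neg_iff_add_eq_zero, add_comm, h])) (by simp [hzy, hzgy])
    simp [hs, hs', ← hq, hqq] at h1
    have : (-1 : ℚ) ≤ t := by nlinarith
    exact_mod_cast this
  have htq1 : (t : ℚ) ≤ 1 := by exact_mod_cast ht1
  have htq2 : (-1 : ℚ) ≤ t := by exact_mod_cast ht2
  have hu0 : g y - ((t : ℚ) / 2) • y ≠ 0 := by
    intro h0
    rw [sub_eq_zero] at h0
    rcases smul_eq_or_of_norm hB hy0 h0 hqq with h | h
    · exact hne1 h
    · exact hne2 h
  have htr : OrthTriple B z y (g y - ((t : ℚ) / 2) • y) := by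
    refine ⟨hz, hy0, hu0, hzy, by simp [hzy, hzgy], ?_⟩
    simp [hs, ← hq]
    ring
  have hyroot : IsRoot B K y := by
    refine ⟨hprim, fun k hk => ?_⟩
    have hzk : B z (k - g k) = 0 := by simp [hzg]
    have hkK : k - g k ∈ K := K.sub_mem hk ((hg'.2 k).2 hk)
    have hex := htr.expand hB hr (k - g k)
    rw [hzk, zero_div, zero_smul, zero_add] at hex
    obtain ⟨a, b, hab⟩ : ∃ a b : ℚ, k - g k = a • y + b • g y := by
      rw [smul_sub, smul_smul, add_sub, add_sub_right_comm, ← sub_smul] at hex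
      grind
    -- The distance to the nearest integral combination of y and gy is a vector of K orthogonal to
    -- z. It is shorter than y, because a'² + b'² + ta'b' < 1 if |a'|, |b'| ≤ 1/2 and |t| ≤ 1; hence
    -- it vanishes.
    have hw : (a - round a) • y + (b - round b) • g y = 0 := by
      by_contra hw0
      have hwK : (a - round a) • y + (b - round b) • g y ∈ K := by
        have : (a - round a) • y + (b - round b) • g y =
            (k - g k) - (round a • y + round b • g y) := by
          rw [hab]
          simp [← cast_smul_eq_zsmul ℚ]
          module
        rw [this]
        exact K.sub_mem hkK (K.add_mem (K.smul_mem _ hy) (K.smul_mem _ hgy))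
      have h1 := hmin _ hwK hw0 (by simp [hzy, hzgy])
      simp [hs, hs', ← hq, hqq] at h1
      have ha := abs_sub_round a
      have hb := abs_sub_round b
      generalize a - round a = a' at *
      generalize b - round b = b' at *
      rw [abs_le] at ha hb
      have h2 : a' ^ 2 + b' ^ 2 + t * a' * b' < 1 := by
        have ha2 : a' ^ 2 ≤ 1 / 4 := by nlinarith
        have hb2 : b' ^ 2 ≤ 1 / 4 := by nlinarith
        nlinarith [sq_nonneg (a' + b'), sq_nonneg (a' - b'),
          mul_nonneg (sub_nonneg.2 htq1) (sq_nonneg (a' - b')),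
          mul_nonneg (sub_nonneg.2 htq1) (sq_nonneg (a' + b')),
          mul_nonneg (by linarith : 0 ≤ 1 + (t : ℚ)) (sq_nonneg (a' + b')),
          mul_nonneg (by linarith : 0 ≤ 1 + (t : ℚ)) (sq_nonneg (a' - b'))]
      nlinarith
    have hb0 : b - round b = 0 := by
      have h1 := congrArg (B (g y - ((t : ℚ) / 2) • y)) hw
      have h2 := (htr.rotate hB).xy
      have h3 := hB.symm y (g y - ((t : ℚ) / 2) • y)
      rw [htr.yz] at h3
      have h4 : B (g y - ((t : ℚ) / 2) • y) (g y) ≠ 0 := by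
        have := hB.ne_zero hu0
        rw [map_sub (B (g y - ((t : ℚ) / 2) • y)), map_smul, ← h3] at this
        simpa using this
      rw [map_add, map_smul, map_smul, ← h3, map_zero, smul_zero, zero_add, smul_eq_mul,
        mul_eq_zero] at h1
      grind
    have ha0 : a - round a = 0 := by
      rw [hb0, zero_smul, add_zero, smul_eq_zero] at hw
      grind
    refine ⟨round a - round b, ?_⟩
    have haq : (round a : ℚ) = a := by linarith
    have hbq : (round b : ℚ) = b := by linarith
    push_cast
    rw [haq, hbq, ← hq]
    have e1 : B (g k) y = t * B k y - B k (g y) := by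
      have h1 : g ((t : ℚ) • y - g y) = y := by
        rw [map_sub, map_smul, hrot]
        abel
      conv_lhs => rw [← h1]
      rw [hg'.1]
      simp
    have e2 : B (k - g k) y = a * q + b * (t * q / 2) := by
      rw [hab]
      simp [hs', ← hq]
    have e3 : B (k - g k) (g y) = a * (t * q / 2) + b * q := by
      rw [hab]
      simp [hs, hqq]
    rw [map_sub, LinearMap.sub_apply] at e2 e3
    rw [e1] at e2
    rw [hg'.1] at e3
    rw [hB.symm y k]
    grind
  have hgyroot := orthGroup_map_root hg hyroot
  -- For t = 0 the roots y and gy are orthogonal, and the root at 45 degrees to y comes from the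
  -- reflection along y + gy, which equals g τ_y. For t ≠ 0 the pair y, gy is itself skew.
  by_cases ht0 : t = 0
  · rw [ht0] at hs hs' hrot
    simp at hs hs' hrot
    have hy1 : y + g y ≠ 0 := fun h => hne2 (by rw [eq_neg_iff_add_eq_zero, add_comm, h])
    have hy2 : y - g y ≠ 0 := sub_ne_zero.2 (Ne.symm hne1)
    have htt : OrthTriple B z (y + g y) (y - g y) := by
      refine ⟨hz, hy1, hy2, by simp [hzy, hzgy], by simp [hzy, hzgy], ?_⟩
      simp [hs, hs', ← hq, hqq]
    have hyz : B y z = 0 := by rw [hB.symm, hzy]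
    have htau : tau B (y + g y) = g * tau B y := by
      have hyq := hB.ne_zero hy0
      apply htt.ext_equiv hB hr
      · rw [LinearEquiv.mul_apply, tau_of_orth hyq hyz, hgz,
          tau_of_orth (hB.ne_zero hy1) (by rw [hB.symm]; exact htt.xy)]
      · rw [LinearEquiv.mul_apply, tau_self (hB.ne_zero hy1), map_add, tau_self hyq,
          tau_of_orth hyq hs, map_add, map_neg, hrot]
        abel
      · rw [LinearEquiv.mul_apply, tau_of_orth (hB.ne_zero hy1) htt.yz, map_sub, tau_self hyq,
          tau_of_orth hyq hs, map_sub, map_neg, hrot]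
        abel
    obtain ⟨w, hw, r, hr0, hwr⟩ := hK.exists_root_of_tau hy1
      (htau ▸ (orthGroup B K).mul_mem hg (hyroot.tau_mem hB))
    have hzw : B z w = 0 := by
      have := htt.xy
      rw [hwr] at this
      simpa [hr0] using this
    have hyw : B y w * r = q := by
      have : B y (y + g y) = q := by simp [hs, ← hq]
      rw [hwr] at this
      simpa [mul_comm] using this
    have hgw : B (g y) w * r = q := by
      have : B (g y) (y + g y) = q := by simp [hs', hqq]
      rw [hwr] at this
      simpa [mul_comm] using this
    refine ⟨y, w, hyroot, hw, hzy, hzw, ?_, ?_, ?_⟩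
    · grind
    · grind
    · grind
  · refine ⟨y, g y, hyroot, hgyroot, hzy, hzgy, ?_, hne1, hne2⟩
    rw [hs]
    have : (t : ℚ) ≠ 0 := by exact_mod_cast ht0
    grind

/-! ### The possible root systems -/

/-- Distinct roots of `K` up to sign that are not orthogonal. -/
def HasSkewRoots (B : BilinForm ℚ V) (K : Submodule ℤ V) : Prop :=
  ∃ x y, IsRoot B K x ∧ IsRoot B K y ∧ B x y ≠ 0 ∧ y ≠ x ∧ y ≠ -x

/-- An element with g² ≠ 1 is, up to sign, a rotation and produces skew roots. So only involutions
remain, and these are ±1 and ±τ_u. -/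
theorem IntLattice.orthGroup_of_no_skew (hK : IntLattice B K) (h : ¬ HasSkewRoots B K) (hg : g ∈
    orthGroup B K) : (g = 1 ∨ g = neg ℚ) ∨ ∃ x, IsRoot B K x ∧ (g = tau B x ∨ g =
    neg ℚ * tau B x) := by
  have hg' := mem_orthGroup.1 hg
  have hg2 : g * g = 1 := by
    by_contra hg2
    obtain ⟨z, hz, h1 | h1⟩ := exists_axis hK.pd hK.rank g hg'.1
    · obtain ⟨x, y, hx, hy, -, -, hxy⟩ := hK.exists_roots_of_rotation hg hz h1 hg2
      exact h ⟨x, y, hx, hy, hxy⟩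
    · have h2 : (neg ℚ * g) * (neg ℚ * g) = g * g := by ext; simp
      obtain ⟨x, y, hx, hy, -, -, hxy⟩ := hK.exists_roots_of_rotation
        ((orthGroup B K).mul_mem neg_mem_orthGroup hg) hz (by simp [h1]) (by rwa [h2])
      exact h ⟨x, y, hx, hy, hxy⟩
  rcases involution_cases hK.pd hK.rank hg'.1 hg2 with h1 | ⟨u, hu, h1⟩
  · exact Or.inl h1
  · right
    have ht : tau B u ∈ orthGroup B K := by
      rcases h1 with rfl | rfl
      · exact hg
      · have := (orthGroup B K).mul_mem neg_mem_orthGroup hg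
        convert this using 1
        ext
        simp
    obtain ⟨x, hx, r, hr, rfl⟩ := hK.exists_root_of_tau hu ht
    rw [tau_smul hr] at h1
    grind

/-- `xs` lists the roots of `K`, one from each pair `±x`. -/
structure IsRootList (B : BilinForm ℚ V) (K : Submodule ℤ V) (xs : List V) : Prop where
  root : ∀ x ∈ xs, IsRoot B K x
  pairwise : xs.Pairwise fun x y => y ≠ x ∧ y ≠ -x
  complete : ∀ w, IsRoot B K w → ∃ x ∈ xs, w = x ∨ w = -x

/-- Two roots spanning a root system of type `A₂`. -/
structure IsA2Pair (B : BilinForm ℚ V) (x y : V) : Prop where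
  pos : 0 < B x x
  norm : B y y = B x x
  inner : 2 * B x y = -B x x

/-- The representatives of the roots of type `G₂ × A₁`. -/
def listG2 (z x y : V) : List V := [z, x, y, x + y, x - y, (2 : ℚ) • x + y, x + (2 : ℚ) • y]

/-- The representatives of the roots of types `B₃` and `C₃`. -/
def listCubic (s : ℚ) (a b c : V) : List V :=
  [a, b, c, s • (a + b), s • (a - b), s • (a + c), s • (a - c), s • (b + c), s • (b - c)]

/-- The possible systems of roots of a ternary lattice. -/
inductive RootType (B : BilinForm ℚ V) (K : Submodule ℤ V) : Prop
  | none : IsRootList B K [] → RootType B K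
  | one (x : V) : IsRootList B K [x] → RootType B K
  | three (x y z : V) : OrthTriple B x y z → IsRootList B K [x, y, z] → RootType B K
  | a2 (x y : V) : IsA2Pair B x y → IsRootList B K [x, y, x + y] → RootType B K
  | b2 (z x y : V) : OrthTriple B z x y → B y y = B x x →
      IsRootList B K [z, x, y, x + y, x - y] → RootType B K
  | g2 (z x y : V) : z ≠ 0 → B z x = 0 → B z y = 0 → IsA2Pair B x y →
      IsRootList B K (listG2 z x y) → RootType B K
  | cubic (s : ℚ) (a b c : V) : s = 1 ∨ s = 1 / 2 → OrthTriple B a b c → B b b = B a a →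
      B c c = B a a → IsRootList B K (listCubic s a b c) → RootType B K

theorem nonparallel_of (hB : IsPosDefSpace B) (h : B x y ^ 2 ≠ B x x * B y y) : y ≠ x ∧ y ≠ -x := by
  constructor
  · grind
  · rintro rfl; exact h (by simp; ring)

theorem IsRoot.tau_root (hB : IsPosDefSpace B) (hx : IsRoot B K x) (hy : IsRoot B K y) {n : ℚ} (h :
    2 * B x y = n * B x x) : IsRoot B K (y - n • x) := by
  have h1 := orthGroup_map_root (hx.tau_mem hB) hy
  rw [tau_apply (hB.ne_zero hx.ne_zero), h, mul_div_assoc, div_self (hB.ne_zero hx.ne_zero),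
    mul_one] at h1
  exact h1

/-- The crystallographic restriction: c is the product of the integers 2B(x, y)/Q(x) and 2B(x,
y)/Q(y). It is four times the squared cosine of the angle; recording angles in this form eliminates
signs from the classification. -/
theorem IsRoot.angle (hB : IsPosDefSpace B) (hx : IsRoot B K x) (hy : IsRoot B K y) : ∃ c : ℕ, 4 *
    B x y ^ 2 = c * (B x x * B y y) ∧ c ≤ 4 ∧ (c = 4 → y = x ∨ y = -x) := by
  obtain ⟨n, hn⟩ := hx.2 y hy.mem
  obtain ⟨m, hm⟩ := hy.2 x hx.mem
  rw [hB.symm y x] at hm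
  have hx0 := hB.pos x hx.ne_zero
  have hy0 := hB.pos y hy.ne_zero
  have h1 : 4 * B x y ^ 2 = ((n * m : ℤ) : ℚ) * (B x x * B y y) := by grind
  have hxy := mul_pos hx0 hy0
  have h2 : 0 ≤ n * m := by
    have : (0 : ℚ) ≤ ((n * m : ℤ) : ℚ) := by
      by_contra hc
      push Not at hc
      nlinarith [sq_nonneg (B x y)]
    exact_mod_cast this
  have h3 : n * m ≤ 4 := by
    have : ((n * m : ℤ) : ℚ) ≤ 4 := by
      by_contra hc
      push Not at hc
      nlinarith [hB.cauchy x y]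
    exact_mod_cast this
  obtain ⟨c, hc⟩ := Int.eq_ofNat_of_zero_le h2
  refine ⟨c, ?_, by omega, ?_⟩
  · simp_all
  · intro h4
    have h5 : B x y ^ 2 = B x x * B y y := by simp_all
    have h6 : y = (B x y / B x x) • x := by
      rw [← sub_eq_zero]
      apply hB.eq_zero
      simp [hB.symm y x]
      grind
    exact hx.1.eq_or_eq_neg hy.1 h6

/-- In an orthogonal frame τ_z = -τ_x τ_y, so two orthogonal symmetries force a third one. -/
theorem IntLattice.third_root (hK : IntLattice B K) (hx : IsRoot B K x) (hy : IsRoot B K y) (hxy :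
    B x y = 0) : ∃ z, IsRoot B K z ∧ OrthTriple B x y z := by
  have hB := hK.pd
  obtain ⟨w, hw⟩ := exists_orthTriple hB hK.rank hx.ne_zero hy.ne_zero hxy
  have hx0 := hB.ne_zero hw.hx
  have hy0 := hB.ne_zero hw.hy
  have hz0 := hB.ne_zero hw.hz
  have hyx : B y x = 0 := by rw [hB.symm, hxy]
  have hzx : B w x = 0 := by rw [hB.symm, hw.xz]
  have hzy : B w y = 0 := by rw [hB.symm, hw.yz]
  have ht : tau B w = neg ℚ * (tau B x * tau B y) := by
    apply hw.ext_equiv hB hK.rank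
    · simp [tau_of_orth hz0 hzx, tau_of_orth hy0 hyx, tau_self hx0]
    · simp [tau_of_orth hz0 hzy, tau_self hy0, tau_of_orth hx0 hxy]
    · simp [tau_self hz0, tau_of_orth hy0 hw.yz, tau_of_orth hx0 hw.xz]
  obtain ⟨z, hz, r, hr, rfl⟩ := hK.exists_root_of_tau hw.hz (by
    rw [ht]
    exact (orthGroup B K).mul_mem neg_mem_orthGroup
      ((orthGroup B K).mul_mem (hx.tau_mem hB) (hy.tau_mem hB)))
  have h1 := hw.xz
  have h2 := hw.yz
  simp [hr] at h1 h2
  exact ⟨z, hz, hw.hx, hw.hy, hz.ne_zero, hxy, h1, h2⟩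

/-- Expanding B(x + y, w)² determines the product B(x, w)B(y, w), whose square is P1 P2 up to a
factor. The relation that results does not see the signs of the inner products. -/
theorem IsA2Pair.angles {w : V} (h : IsA2Pair B x y) (hw : 0 < B w w) {P1 P2 P3 : ℕ} (h1 : 4 * B x
    w ^ 2 = P1 * (B x x * B w w)) (h2 : 4 * B y w ^ 2 = P2 * (B y y * B w w)) (h3 : 4 * B (x + y) w
    ^ 2 = P3 * (B x x * B w w)) : 4 * (P1 : ℤ) * P2 = (P3 - P1 - P2) ^ 2 := by
  rw [h.norm] at h2
  rw [map_add, LinearMap.add_apply] at h3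
  have hq : 0 < B x x * B w w := mul_pos h.pos hw
  have e : 8 * (B x w * B y w) = ((P3 : ℚ) - P1 - P2) * (B x x * B w w) := by linarith
  have e2 : (4 * (P1 : ℚ) * P2 - (P3 - P1 - P2) ^ 2) * (B x x * B w w) ^ 2 = 0 := by grind
  have e3 : 4 * (P1 : ℚ) * P2 - (P3 - P1 - P2) ^ 2 = 0 := by grind
  have : 4 * (P1 : ℚ) * P2 = (P3 - P1 - P2) ^ 2 := by linarith
  exact_mod_cast this

/-- The same elimination of signs, for the two axes x, y of a square and its two diagonals. -/
theorem square_angles (hB : IsPosDefSpace B) {w : V} (hx : x ≠ 0) (hxy : B x y = 0) (hn : B y y = B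
    x x) (hw : 0 < B w w) (hs : s ≠ 0) {P1 P2 F G : ℕ} (h1 : 4 * B x w ^ 2 = P1 * (B x x * B w w))
    (h2 : 4 * B y w ^ 2 = P2 * (B y y * B w w)) (h3 : 4 * B (s • (x + y)) w ^ 2 = F * (B (s • (x +
    y)) (s • (x + y)) * B w w)) (h4 : 4 * B (s • (x - y)) w ^ 2 = G * (B (s • (x - y)) (s • (x -
    y)) * B w w)) : F + G = P1 + P2 ∧ 4 * (P1 : ℤ) * P2 = (F - G) ^ 2 := by
  have hyx : B y x = 0 := by rw [hB.symm, hxy]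
  simp only [map_add, map_sub, map_smul, LinearMap.add_apply, LinearMap.sub_apply,
    LinearMap.smul_apply, smul_eq_mul, hxy, hyx] at h3 h4
  rw [hn] at h2 h3 h4
  set q := B x x * B w w with hq
  have hq0 : 0 < q := mul_pos (hB.pos x hx) hw
  have h3' : 4 * (B x w + B y w) ^ 2 = F * (2 * q) := by grind
  have h4' : 4 * (B x w - B y w) ^ 2 = G * (2 * q) := by grind
  constructor
  · have : ((F : ℚ) + G - (P1 + P2)) * q = 0 := by linarith
    rcases mul_eq_zero.1 this with h | h
    · have : (F : ℚ) + G = P1 + P2 := by linarith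
      exact_mod_cast this
    · linarith
  · have e : 8 * (B x w * B y w) = ((F : ℚ) - G) * q := by linear_combination (h3' - h4') / 2
    have e2 : (4 * (P1 : ℚ) * P2 - (F - G) ^ 2) * q ^ 2 = 0 := by grind
    have e3 : 4 * (P1 : ℚ) * P2 - (F - G) ^ 2 = 0 := by grind
    have : 4 * (P1 : ℚ) * P2 = (F - G) ^ 2 := by linarith
    exact_mod_cast this

/-- Parseval: the squared cosines of w with respect to an orthogonal frame add up to 1. -/
theorem OrthTriple.angles (hK : IntLattice B K) {w : V} (h : OrthTriple B x y z) (hw : w ≠ 0) {a c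
    : ℕ} (h1 : 4 * B x w ^ 2 = a * (B x x * B w w)) (h2 : 4 * B y w ^ 2 = b * (B y y * B w w)) (h3
    : 4 * B z w ^ 2 = c * (B z z * B w w)) : a + b + c = 4 := by
  have hB := hK.pd
  have h4 := h.parseval hB hK.rank w w
  have hx := hB.ne_zero h.hx
  have hy := hB.ne_zero h.hy
  have hz := hB.ne_zero h.hz
  have hw0 := hB.ne_zero hw
  have e1 : B x w * B x w / B x x = a / 4 * B w w := by field_simp; linear_combination h1
  have e2 : B y w * B y w / B y y = b / 4 * B w w := by field_simp; linear_combination h2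
  have e3 : B z w * B z w / B z z = c / 4 * B w w := by field_simp; linear_combination h3
  rw [e1, e2, e3] at h4
  have : ((a : ℚ) + b + c - 4) * B w w = 0 := by linear_combination -4 * h4
  rcases mul_eq_zero.1 this with h5 | h5
  · have : (a : ℚ) + b + c = 4 := by linarith
    exact_mod_cast this
  · grind

/-- There are roots at an angle of 30 degrees. -/
def HasG2 (B : BilinForm ℚ V) (K : Submodule ℤ V) : Prop :=
  ∃ x y, IsRoot B K x ∧ IsRoot B K y ∧ 4 * B x y ^ 2 = 3 * (B x x * B y y)

/-- There are roots at an angle of 45 degrees. -/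
def HasB2 (B : BilinForm ℚ V) (K : Submodule ℤ V) : Prop :=
  ∃ x y, IsRoot B K x ∧ IsRoot B K y ∧ 4 * B x y ^ 2 = 2 * (B x x * B y y)

/-- Let u be the shorter of the two roots. Since c ≤ 3, the integer that 2B(u, v)/Q(v) gives for the
longer one is ±1, and the sign of v is chosen to make the angle obtuse. -/
theorem skew_pair (hB : IsPosDefSpace B) (hx : IsRoot B K x) (hy : IsRoot B K y) {c : ℕ} (h : 4 * B
    x y ^ 2 = c * (B x x * B y y)) (hc0 : 0 < c) (hc3 : c ≤ 3) : ∃ u v, IsRoot B K u ∧ IsRoot B K v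
    ∧ B v v = c * B u u ∧ 2 * B u v = -(c * B u u) := by
  have aux : ∀ x y, IsRoot B K x → IsRoot B K y → 4 * B x y ^ 2 = c * (B x x * B y y) →
      B x x ≤ B y y →
      ∃ u v, IsRoot B K u ∧ IsRoot B K v ∧ B v v = c * B u u ∧ 2 * B u v = -(c * B u u) := by
    intro x y hx hy h hle
    obtain ⟨m, hm⟩ := hy.2 x hx.mem
    rw [hB.symm y x] at hm
    have hx0 := hB.pos x hx.ne_zero
    have hy0 := hB.pos y hy.ne_zero
    have h1 : (m : ℚ) ^ 2 * B y y = c * B x x := by grind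
    have hm1 : m ^ 2 ≤ 3 := by
      have : (m : ℚ) ^ 2 ≤ 3 := by
        by_contra hcon
        push Not at hcon
        have : (c : ℚ) ≤ 3 := by exact_mod_cast hc3
        nlinarith
      exact_mod_cast this
    have hm0 : m ≠ 0 := by
      rintro rfl
      have : (c : ℚ) * B x x = 0 := by rw [← h1]; simp
      have hc : (c : ℚ) ≠ 0 := by exact_mod_cast hc0.ne'
      grind
    have hm2 : m = 1 ∨ m = -1 := by
      have : -1 ≤ m := by nlinarith
      have : m ≤ 1 := by nlinarith
      omega
    rcases hm2 with rfl | rfl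
    · refine ⟨x, -y, hx, hy.neg, ?_, ?_⟩
      · simp_all
      · grind
    · grind
  rcases le_total (B x x) (B y y) with hle | hle
  · grind
  · exact aux y x hy hx (by rw [hB.symm y x, h]; ring) hle

/-- Reflections in two roots at 30 degrees produce the roots of G₂, and the third root of a frame in
this plane produces A₁. For a further root w all the numbers 4cos² would be at most 3; the Parseval
relations of three frames together with the relation for the short A₂ have no such solution. -/
theorem exists_g2 (hK : IntLattice B K) (h : HasG2 B K) : ∃ z x y, z ≠ 0 ∧ B z x = 0 ∧ B z y = 0 ∧
    IsA2Pair B x y ∧ IsRootList B K (listG2 z x y) := by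
  have hB := hK.pd
  obtain ⟨x', y', hx', hy', hxy'⟩ := h
  obtain ⟨x, v, hx, hv, hvn, hxv⟩ := skew_pair hB hx' hy' (c := 3) (by exact_mod_cast hxy')
    (by norm_num) le_rfl
  push_cast at hvn hxv
  have hvx : 2 * B v x = -(3 * B x x) := by rw [hB.symm, hxv]
  have hx0 := hB.pos x hx.ne_zero
  obtain ⟨y, rfl⟩ : ∃ y, v = y - x := ⟨v + x, by abel⟩
  have hyx : B y x = B x y := hB.symm _ _
  simp [hyx] at hvn hxv hvx
  have hxy : 2 * B x y = -B x x := by linarith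
  have hyy : B y y = B x x := by linarith
  have hA : IsA2Pair B x y := ⟨hx0, hyy, hxy⟩
  have hy : IsRoot B K y := by
    have := hv.tau_root hB hx (n := -1) (by simp [hyx]; linarith)
    simp_all
  have hxy3 : IsRoot B K (x + y) := by
    have := hx.tau_root hB hy (n := -1) (by linarith)
    convert this using 1
    module
  have hv' : IsRoot B K (x - y) := by have := hv.neg; rwa [neg_sub] at this
  have hl2 : IsRoot B K ((2 : ℚ) • x + y) := by
    have := hx.tau_root hB hv' (n := 3) (by simp; linarith)
    have := this.neg
    convert this using 1
    module
  have hl1 : IsRoot B K (x + (2 : ℚ) • y) := by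
    have := hy.tau_root hB hv' (n := -3) (by simp [hyx]; linarith)
    convert this using 1
    module
  obtain ⟨z, hz, ht1⟩ := hK.third_root hx hl1 (by simp; linarith)
  have hxz : B x z = 0 := ht1.xz
  have hyz : B y z = 0 := by
    have := ht1.yz
    simp_all
  have hzx : B z x = 0 := by rw [hB.symm, hxz]
  have hzy : B z y = 0 := by rw [hB.symm, hyz]
  have hz0 := hB.pos z hz.ne_zero
  have ht2 : OrthTriple B y ((2 : ℚ) • x + y) z :=
    ⟨hy.ne_zero, hl2.ne_zero, hz.ne_zero, by simp [hyx]; linarith, hyz, by simp [hxz, hyz]⟩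
  have ht3 : OrthTriple B (x + y) (x - y) z :=
    ⟨hxy3.ne_zero, hv'.ne_zero, hz.ne_zero, by simp [hyx]; linarith, by simp [hxz, hyz],
      by simp [hxz, hyz]⟩
  refine ⟨z, x, y, hz.ne_zero, hzx, hzy, hA, ?_, ?_, ?_⟩
  · simp only [listG2, mem_cons, not_mem_nil, or_false]
    grind
  · have hB1 : B x y = -(B x x / 2) := by linarith
    have hq2 : 0 < B x x * B x x := mul_pos hx0 hx0
    have hq3 : 0 < B z z * B x x := mul_pos hz0 hx0
    simp only [listG2, pairwise_cons, mem_cons, not_mem_nil, forall_eq_or_imp, false_imp_iff,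
      implies_true, List.Pairwise.nil, and_true]
    refine ⟨⟨?_, ?_, ?_, ?_, ?_, ?_⟩, ⟨?_, ?_, ?_, ?_, ?_⟩, ⟨?_, ?_, ?_, ?_⟩, ⟨?_, ?_, ?_⟩,
      ⟨?_, ?_⟩, ?_⟩ <;>
    · apply nonparallel_of hB
      simp only [map_add, map_sub, map_smul, LinearMap.add_apply, LinearMap.sub_apply,
        LinearMap.smul_apply, smul_eq_mul, hyx, hzx, hzy, hyy, hB1]
      intro h
      linarith
  · intro w hw
    have hw0 := hB.pos w hw.ne_zero
    obtain ⟨P1, a1, a2, a3⟩ := hx.angle hB hw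
    obtain ⟨P2, b1, b2, b3⟩ := hy.angle hB hw
    obtain ⟨P3, c1, c2, c3⟩ := hxy3.angle hB hw
    obtain ⟨L1, d1, d2, d3⟩ := hl1.angle hB hw
    obtain ⟨L2, e1, e2, e3⟩ := hl2.angle hB hw
    obtain ⟨L3, f1, f2, f3⟩ := hv'.angle hB hw
    obtain ⟨R, g1, g2, g3⟩ := hz.angle hB hw
    have s1 := ht1.angles hK hw.ne_zero a1 d1 g1
    have s2 := ht2.angles hK hw.ne_zero b1 e1 g1
    have s3 := ht3.angles hK hw.ne_zero c1 f1 g1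
    have hn3 : B (x + y) (x + y) = B x x := by simp [hyx]; linarith
    rw [hn3] at c1
    have s4 := hA.angles hw0 a1 b1 c1
    -- The parallelogram law for B(x + y, w) ± B(y, w).
    have s5 : 3 * L1 + P1 = 2 * P3 + 2 * P2 := by
      have hq : B x x * B w w ≠ 0 := (mul_pos hx0 hw0).ne'
      have hn : B (x + (2 : ℚ) • y) (x + (2 : ℚ) • y) = 3 * B x x := by simp [hyx]; linarith
      rw [hn] at d1
      rw [hyy] at b1
      simp at d1 c1
      have : (3 * (L1 : ℚ) + P1 - (2 * P3 + 2 * P2)) * (B x x * B w w) = 0 := by linarith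
      rcases mul_eq_zero.1 this with h | h
      · have : 3 * (L1 : ℚ) + P1 = 2 * P3 + 2 * P2 := by linarith
        exact_mod_cast this
      · grind
    simp only [listG2, mem_cons, not_mem_nil, or_false, exists_eq_or_imp, exists_eq_left]
    by_cases h1 : P1 = 4
    · grind
    by_cases h2 : P2 = 4
    · grind
    by_cases h3 : P3 = 4
    · grind
    by_cases h4 : L3 = 4
    · grind
    by_cases h5 : L2 = 4
    · grind
    by_cases h6 : L1 = 4
    · grind
    by_cases h7 : R = 4
    · grind
    exfalso
    have i1 : P1 ≤ 3 := by omega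
    have i2 : P2 ≤ 3 := by omega
    have i3 : P3 ≤ 3 := by omega
    clear a1 b1 c1 d1 e1 f1 g1 a3 b3 c3 d3 e3 f3 g3
    interval_cases P1 <;> interval_cases P2 <;> interval_cases P3 <;>
      first | omega | (norm_num at s4)

/-- For P = Q = 2 the relations make F or G equal to 4; in the other cases 4PQ is 8 or 12, which is
not a square. -/
theorem pair_arith {P Q F G : ℕ} (h1 : F + G = P + Q) (h2 : 4 * (P : ℤ) * Q = (F - G) ^ 2)
    (hF : F ≠ 4) (hG : G ≠ 4) : ¬ ((P = 2 ∧ Q = 2) ∨ (P = 1 ∧ Q = 2) ∨ (P = 2 ∧ Q = 1) ∨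
      (P = 1 ∧ Q = 3) ∨ (P = 3 ∧ Q = 1)) := by
  have hG' : (G : ℤ) = P + Q - F := by omega
  rw [hG'] at h2
  rintro (⟨rfl, rfl⟩ | ⟨rfl, rfl⟩ | ⟨rfl, rfl⟩ | ⟨rfl, rfl⟩ | ⟨rfl, rfl⟩) <;>
  · have : F ≤ 4 := by omega
    interval_cases F <;> first | omega | norm_num at h2

theorem sum_four_cases : ∀ a < 4, ∀ b < 4, ∀ c < 4, a + b + c = 4 →
    ((a = 2 ∧ b = 2) ∨ (a = 1 ∧ b = 2) ∨ (a = 2 ∧ b = 1) ∨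
      (a = 1 ∧ b = 3) ∨ (a = 3 ∧ b = 1)) ∨
    ((a = 2 ∧ c = 2) ∨ (a = 1 ∧ c = 2) ∨ (a = 2 ∧ c = 1) ∨
      (a = 1 ∧ c = 3) ∨ (a = 3 ∧ c = 1)) ∨
    ((b = 2 ∧ c = 2) ∨ (b = 1 ∧ c = 2) ∨ (b = 2 ∧ c = 1) ∨
      (b = 1 ∧ c = 3) ∨ (b = 3 ∧ c = 1)) := by
  intro a ha b hb c hc h
  grind

/-- Given are the axes and diagonals of a square in the plane of a and b, and a root w orthogonal to
b at 45 degrees to c. The reflection in w exchanges c and ±a, so it moves the square to the plane of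
b and c; the reflection in a diagonal moves it on to the plane of a and c. By `sum_four_cases` and
`pair_arith` there is no further root. The scale is s = 1 if the axes are the short roots (B₃) and s
= 1/2 if they are the long ones (C₃). -/
theorem rootType_cubic (hK : IntLattice B K) {a b c w : V} (hs : s = 1 ∨ s = 1 / 2) (ha : IsRoot B
    K a) (hb : IsRoot B K b) (hc : IsRoot B K c) (ht : OrthTriple B a b c) (hab : B b b = B a a)
    (hf : IsRoot B K (s • (a + b))) (hg : IsRoot B K (s • (a - b))) (hw : IsRoot B K w) (hwb : B b
    w = 0) (hwc : 4 * B c w ^ 2 = 2 * (B c c * B w w)) : RootType B K := by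
  have hB := hK.pd
  have hw0 := hB.ne_zero hw.ne_zero
  have hc0 := hB.ne_zero hc.ne_zero
  have hs0 : s ≠ 0 := by rcases hs with rfl | rfl <;> norm_num
  have hba : B b a = 0 := by rw [hB.symm, ht.xy]
  have hca : B c a = 0 := by rw [hB.symm, ht.xz]
  have hcb : B c b = 0 := by rw [hB.symm, ht.yz]
  have hwb' : B w b = 0 := by rw [hB.symm, hwb]
  have hT := tau_isometry hB hw.ne_zero
  -- The image of c is orthogonal to b, and orthogonal to c because w is at 45 degrees to c. So it
  -- is a primitive vector on the line of a.
  have hTc : tau B w c = a ∨ tau B w c = -a := by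
    have h1 : B c (tau B w c) = 0 := by
      rw [tau_apply hw0]
      simp [hB.symm w c]
      grind
    have h2 : B b (tau B w c) = 0 := by
      rw [tau_apply hw0]
      simp [hwb, ht.yz]
    have h3 := (((ht.rotate hB).perp hB hK.rank) h2 h1)
    exact ha.1.eq_or_eq_neg (orthGroup_map_root (hw.tau_mem hB) hc).1 h3
  have hcc : B c c = B a a := by
    rw [← hT c c]
    rcases hTc with h | h <;> simp [h]
  obtain ⟨ε, hε, hTc⟩ : ∃ ε : ℚ, (ε = 1 ∨ ε = -1) ∧ tau B w c = ε • a := by simp_all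
  have hεε : ε * ε = 1 := by rcases hε with rfl | rfl <;> norm_num
  have hTa : tau B w a = ε • c := by
    have h1 := tau_tau (B := B) (x := w) c
    rw [hTc, map_smul] at h1
    rw [← h1, smul_smul, hεε, one_smul]
  have hTb : tau B w b = b := tau_of_orth hw0 hwb'
  have key : IsRoot B K (s • (b + c)) ∧ IsRoot B K (s • (b - c)) := by
    have h1 := orthGroup_map_root (hw.tau_mem hB) hf
    have h2 := orthGroup_map_root (hw.tau_mem hB) hg
    rw [map_smul, map_add, hTa, hTb] at h1
    rw [map_smul, map_sub, hTa, hTb] at h2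
    have h3 := h2.neg
    rcases hε with rfl | rfl
    · exact ⟨by convert h1 using 1; module, by convert h3 using 1; module⟩
    · exact ⟨by convert h3 using 1; module, by convert h1 using 1; module⟩
  have hg0 := hB.ne_zero hg.ne_zero
  have hga : tau B (s • (a - b)) b = a := by
    rw [tau_smul hs0, tau_apply (by simp_all)]
    have h1 := hB.ne_zero ha.ne_zero
    have : 2 * B (a - b) b / B (a - b) (a - b) = -1 := by
      simp only [map_sub, LinearMap.sub_apply, ht.xy, hba, hab]
      grind
    simp_all
  have hgc : tau B (s • (a - b)) c = c := tau_of_orth hg0 (by simp [ht.xz, ht.yz])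
  have key2 : IsRoot B K (s • (a + c)) ∧ IsRoot B K (s • (a - c)) := by
    have h1 := orthGroup_map_root (hg.tau_mem hB) key.1
    have h2 := orthGroup_map_root (hg.tau_mem hB) key.2
    rw [map_smul, map_add, hga, hgc] at h1
    simp_all
  refine RootType.cubic s a b c hs ht hab hcc ⟨?_, ?_, ?_⟩
  · simp only [listCubic, mem_cons, not_mem_nil, or_false]
    rintro w (rfl | rfl | rfl | rfl | rfl | rfl | rfl | rfl | rfl)
    exacts [ha, hb, hc, hf, hg, key2.1, key2.2, key.1, key.2]
  · have hq := hB.pos a ha.ne_zero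
    have hq2 : 0 < B a a * B a a := mul_pos hq hq
    simp only [listCubic, pairwise_cons, mem_cons, not_mem_nil, forall_eq_or_imp, false_imp_iff,
      implies_true, List.Pairwise.nil, and_true]
    refine ⟨⟨?_, ?_, ?_, ?_, ?_, ?_, ?_, ?_⟩, ⟨?_, ?_, ?_, ?_, ?_, ?_, ?_⟩,
      ⟨?_, ?_, ?_, ?_, ?_, ?_⟩, ⟨?_, ?_, ?_, ?_, ?_⟩, ⟨?_, ?_, ?_, ?_⟩, ⟨?_, ?_, ?_⟩,
      ⟨?_, ?_⟩, ?_⟩ <;>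
    · apply nonparallel_of hB
      simp only [map_add, map_sub, map_smul, LinearMap.add_apply, LinearMap.sub_apply,
        LinearMap.smul_apply, smul_eq_mul, ht.xy, ht.xz, ht.yz, hba, hca, hcb, hab, hcc]
      rcases hs with rfl | rfl <;> (intro h; linarith)
  · intro w hw
    have hw0 := hB.pos w hw.ne_zero
    obtain ⟨P1, a1, a2, a3⟩ := ha.angle hB hw
    obtain ⟨P2, b1, b2, b3⟩ := hb.angle hB hw
    obtain ⟨P3, c1, c2, c3⟩ := hc.angle hB hw
    obtain ⟨F1, d1, d2, d3⟩ := hf.angle hB hw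
    obtain ⟨G1, e1, e2, e3⟩ := hg.angle hB hw
    obtain ⟨F2, f1, f2, f3⟩ := key2.1.angle hB hw
    obtain ⟨G2, g1, g2, g3⟩ := key2.2.angle hB hw
    obtain ⟨F3, i1, i2, i3⟩ := key.1.angle hB hw
    obtain ⟨G3, j1, j2, j3⟩ := key.2.angle hB hw
    have s1 := ht.angles hK hw.ne_zero a1 b1 c1
    have s2 := square_angles hB ht.hx ht.xy hab hw0 hs0 a1 b1 d1 e1
    have s3 := square_angles hB ht.hx ht.xz hcc hw0 hs0 a1 c1 f1 g1
    have s4 := square_angles hB ht.hy ht.yz (hcc.trans hab.symm) hw0 hs0 b1 c1 i1 j1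
    simp only [listCubic, mem_cons, not_mem_nil, or_false, exists_eq_or_imp,
      exists_eq_left]
    by_cases h1 : P1 = 4
    · grind
    by_cases h2 : P2 = 4
    · grind
    by_cases h3 : P3 = 4
    · grind
    by_cases h4 : F1 = 4
    · grind
    by_cases h5 : G1 = 4
    · grind
    by_cases h6 : F2 = 4
    · grind
    by_cases h7 : G2 = 4
    · grind
    by_cases h8 : F3 = 4
    · grind
    by_cases h9 : G3 = 4
    · grind
    exfalso
    clear a1 b1 c1 d1 e1 f1 g1 i1 j1 a3 b3 c3 d3 e3 f3 g3 i3 j3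
    obtain ⟨s2, t2⟩ := s2
    obtain ⟨s3, t3⟩ := s3
    obtain ⟨s4, t4⟩ := s4
    have k1 := pair_arith s2 t2 h4 h5
    have k2 := pair_arith s3 t3 h6 h7
    have k3 := pair_arith s4 t4 h8 h9
    rcases sum_four_cases P1 (Nat.lt_of_le_of_ne a2 h1) P2 (Nat.lt_of_le_of_ne b2 h2) P3
      (Nat.lt_of_le_of_ne c2 h3) s1 with h | h | h
    exacts [k1 h, k2 h, k3 h]

/-- Without angles of 30 degrees, a root w outside B₂ × A₁ must be at 45 degrees to z and orthogonal
to an axis or a diagonal of the square. According to these four cases the axes or the diagonals, in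
one of the two orders, become part of a cubic frame. -/
theorem rootType_b2 (hK : IntLattice B K) (hG : ¬ HasG2 B K) (h : HasB2 B K) : RootType B K := by
  have hB := hK.pd
  obtain ⟨x', y', hx', hy', hxy'⟩ := h
  obtain ⟨x, v, hx, hv, hvn, hxv⟩ := skew_pair hB hx' hy' (c := 2) (by exact_mod_cast hxy')
    (by norm_num) (by norm_num)
  push_cast at hvn hxv
  have hvx : 2 * B v x = -(2 * B x x) := by rw [hB.symm, hxv]
  have hx0 := hB.pos x hx.ne_zero
  obtain ⟨y, rfl⟩ : ∃ y, v = y - x := ⟨v + x, by abel⟩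
  have hyx' : B y x = B x y := hB.symm _ _
  simp [hyx'] at hvn hxv hvx
  have hxy : B x y = 0 := by linarith
  have hyx : B y x = 0 := by rw [hyx', hxy]
  have hyy : B y y = B x x := by linarith
  have hy : IsRoot B K y := by
    have := hv.tau_root hB hx (n := -1) (by simp [hyx, hxy, hyy]; try linarith)
    simp_all
  have hm : IsRoot B K (x - y) := by have := hv.neg; rwa [neg_sub] at this
  have hp : IsRoot B K (x + y) := by
    have := hy.tau_root hB hm (n := -2) (by simp [hyx])
    convert this using 1
    module
  obtain ⟨z, hz, ht'⟩ := hK.third_root hx hy hxy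
  have ht := (ht'.rotate hB).rotate hB
  have hxz := ht'.xz
  have hyz := ht'.yz
  have hzx := ht.xy
  have hzy := ht.xz
  have hz0 := hB.pos z hz.ne_zero
  by_cases hcomp : ∀ w, IsRoot B K w → ∃ u ∈ [z, x, y, x + y, x - y], w = u ∨ w = -u
  · refine RootType.b2 z x y ht hyy ⟨?_, ?_, hcomp⟩
    · grind
    · have hq2 : 0 < B x x * B x x := mul_pos hx0 hx0
      have hq3 : 0 < B z z * B x x := mul_pos hz0 hx0
      simp only [pairwise_cons, mem_cons, not_mem_nil, forall_eq_or_imp, false_imp_iff,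
        implies_true, List.Pairwise.nil, and_true]
      refine ⟨⟨?_, ?_, ?_, ?_⟩, ⟨?_, ?_, ?_⟩, ⟨?_, ?_⟩, ?_⟩ <;>
      · apply nonparallel_of hB
        simp only [map_add, map_sub, LinearMap.add_apply, LinearMap.sub_apply, hyx, hzx, hzy, hyy,
          hxy]
        linarith
  · push Not at hcomp
    obtain ⟨w, hw, hne⟩ := hcomp
    simp only [mem_cons, not_mem_nil, or_false, forall_eq_or_imp, forall_eq] at hne
    obtain ⟨n1, n2, n3, n4, n5⟩ := hne
    have hw0 := hB.pos w hw.ne_zero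
    obtain ⟨R, g1, g2, g3⟩ := hz.angle hB hw
    obtain ⟨P1, a1, a2, a3⟩ := hx.angle hB hw
    obtain ⟨P2, b1, b2, b3⟩ := hy.angle hB hw
    obtain ⟨F, d1, d2, d3⟩ := hp.angle hB hw
    obtain ⟨G, e1, e2, e3⟩ := hm.angle hB hw
    have i0 : R ≠ 4 := fun h => by rcases g3 h with h | h; exacts [n1.1 h, n1.2 h]
    have i1 : P1 ≠ 4 := fun h => by rcases a3 h with h | h; exacts [n2.1 h, n2.2 h]
    have i2 : P2 ≠ 4 := fun h => by rcases b3 h with h | h; exacts [n3.1 h, n3.2 h]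
    have i3 : F ≠ 4 := fun h => by rcases d3 h with h | h; exacts [n4.1 h, n4.2 h]
    have i4 : G ≠ 4 := fun h => by rcases e3 h with h | h; exacts [n5.1 h, n5.2 h]
    have j0 : R ≠ 3 := fun h => hG ⟨z, w, hz, hw, by rw [g1, h]; norm_num⟩
    have j1 : P1 ≠ 3 := fun h => hG ⟨x, w, hx, hw, by rw [a1, h]; norm_num⟩
    have j2 : P2 ≠ 3 := fun h => hG ⟨y, w, hy, hw, by rw [b1, h]; norm_num⟩
    have j3 : F ≠ 3 := fun h => hG ⟨x + y, w, hp, hw, by rw [d1, h]; norm_num⟩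
    have j4 : G ≠ 3 := fun h => hG ⟨x - y, w, hm, hw, by rw [e1, h]; norm_num⟩
    have s1 := ht.angles hK hw.ne_zero g1 a1 b1
    have s2 := square_angles hB ht'.hx hxy hyy hw0 one_ne_zero a1 b1 (by rwa [one_smul])
      (by rwa [one_smul])
    obtain ⟨s2, s3⟩ := s2
    have hcase : R = 2 ∧ ((P1 = 0 ∨ P2 = 0) ∨ (F = 0 ∨ G = 0)) := by
      clear a1 b1 d1 e1 g1 a3 b3 d3 e3 g3
      have k1 : P1 ≤ 2 := by omega
      have k2 : P2 ≤ 2 := by omega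
      have k3 : F ≤ 2 := by omega
      have k4 : G ≤ 2 := by omega
      interval_cases P1 <;> interval_cases P2 <;> interval_cases F <;> interval_cases G <;>
        first | omega | norm_num at s3
    have zero_of : ∀ {u : V} {n : ℕ}, 4 * B u w ^ 2 = n * (B u u * B w w) → n = 0 → B u w = 0 := by
      intro u n h hn
      simp_all
    obtain ⟨hR, hcase⟩ := hcase
    have hzw : 4 * B z w ^ 2 = 2 * (B z z * B w w) := by rw [g1, hR]; norm_num
    have hnp : B (x - y) (x - y) = B (x + y) (x + y) := by simp [hxy, hyx]
    have h2 : x = (1 / 2 : ℚ) • ((x + y) + (x - y)) := by module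
    have h2' : y = (1 / 2 : ℚ) • ((x + y) - (x - y)) := by module
    have tpm : OrthTriple B (x + y) (x - y) z :=
      ⟨hp.ne_zero, hm.ne_zero, hz.ne_zero, by simp [hxy, hyx, hyy], by simp [hxz, hyz],
        by simp [hxz, hyz]⟩
    rcases hcase with (h | h) | (h | h)
    · refine rootType_cubic hK (Or.inl rfl) hy hx hz (ht'.swap hB) hyy.symm (by rwa [one_smul,
        add_comm]) ?_ hw
        (zero_of a1 h) hzw
      rw [one_smul, ← neg_sub]
      exact hm.neg
    · exact rootType_cubic hK (Or.inl rfl) hx hy hz ht' hyy (by rwa [one_smul])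
        (by rwa [one_smul]) hw (zero_of b1 h) hzw
    · refine rootType_cubic hK (Or.inr rfl) hm hp hz (tpm.swap hB) hnp.symm ?_ ?_ hw
        (zero_of d1 h) hzw
      · grind
      · rw [← neg_sub, smul_neg, ← h2']
        exact hy.neg
    · exact rootType_cubic hK (Or.inr rfl) hp hm hz tpm hnp (by rwa [← h2]) (by rwa [← h2']) hw
        (zero_of e1 h) hzw

/-- Only angles of 60 and 90 degrees are left. If a further root w is orthogonal to x and y, the
third root of the frame of x and w is at 30 degrees to y. Otherwise w is orthogonal to just one line
of the A₂, and a third root is at 45 degrees to another root of it. -/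
theorem rootType_a2 (hK : IntLattice B K) (hG : ¬ HasG2 B K) (hB2 : ¬ HasB2 B K)
    (h : HasSkewRoots B K) : RootType B K := by
  have hB := hK.pd
  obtain ⟨x', y', hx', hy', hxy', hn1, hn2⟩ := h
  obtain ⟨c, c1, c2, c3⟩ := hx'.angle hB hy'
  have hc0 : c ≠ 0 := by
    rintro rfl
    grind
  have hc4 : c ≠ 4 := fun h => by rcases c3 h with h | h; exacts [hn1 h, hn2 h]
  have hc3 : c ≠ 3 := fun h => hG ⟨x', y', hx', hy', by rw [c1, h]; norm_num⟩
  have hc2 : c ≠ 2 := fun h => hB2 ⟨x', y', hx', hy', by rw [c1, h]; norm_num⟩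
  obtain rfl : c = 1 := by omega
  obtain ⟨x, y, hx, hy, hyy, hxy⟩ := skew_pair hB hx' hy' c1 (by norm_num) (by norm_num)
  simp at hyy hxy
  have hx0 := hB.pos x hx.ne_zero
  have hA : IsA2Pair B x y := ⟨hx0, hyy, hxy⟩
  have hyx : B y x = B x y := hB.symm _ _
  have hs : IsRoot B K (x + y) := by
    have := hx.tau_root hB hy (n := -1) (by linarith)
    convert this using 1
    module
  have hss : B (x + y) (x + y) = B x x := by simp [hyx]; linarith
  refine RootType.a2 x y hA ⟨?_, ?_, ?_⟩
  · grind
  · have hB1 : B x y = -(B x x / 2) := by linarith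
    have hq2 : 0 < B x x * B x x := mul_pos hx0 hx0
    simp only [pairwise_cons, mem_cons, not_mem_nil, forall_eq_or_imp, false_imp_iff, implies_true,
      List.Pairwise.nil, and_true]
    refine ⟨⟨?_, ?_⟩, ?_⟩ <;>
    · apply nonparallel_of hB
      simp only [map_add, LinearMap.add_apply, hyx, hyy, hB1]
      linarith
  · intro w hw
    have hw0 := hB.pos w hw.ne_zero
    obtain ⟨P1, a1, a2, a3⟩ := hx.angle hB hw
    obtain ⟨P2, b1, b2, b3⟩ := hy.angle hB hw
    obtain ⟨P3, d1, d2, d3⟩ := hs.angle hB hw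
    simp only [mem_cons, not_mem_nil, or_false, exists_eq_or_imp, exists_eq_left]
    by_cases h1 : P1 = 4
    · grind
    by_cases h2 : P2 = 4
    · grind
    by_cases h3 : P3 = 4
    · grind
    exfalso
    have s := hA.angles hw0 a1 b1 (by rw [← hss]; exact d1)
    have j1 : P1 ≠ 3 := fun h => hG ⟨x, w, hx, hw, by rw [a1, h]; norm_num⟩
    have j2 : P2 ≠ 3 := fun h => hG ⟨y, w, hy, hw, by rw [b1, h]; norm_num⟩
    have j3 : P3 ≠ 3 := fun h => hG ⟨x + y, w, hs, hw, by rw [d1, h]; norm_num⟩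
    have k1 : P1 ≠ 2 := fun h => hB2 ⟨x, w, hx, hw, by rw [a1, h]; norm_num⟩
    have k2 : P2 ≠ 2 := fun h => hB2 ⟨y, w, hy, hw, by rw [b1, h]; norm_num⟩
    have k3 : P3 ≠ 2 := fun h => hB2 ⟨x + y, w, hs, hw, by rw [d1, h]; norm_num⟩
    have zero_of : ∀ {u : V} {n : ℕ}, 4 * B u w ^ 2 = n * (B u u * B w w) → n = 0 → B u w = 0 := by
      intro u n h hn
      simp_all
    -- a root orthogonal to `u` and not to `v` gives a root at 45 degrees with `v`
    have aux : ∀ {u v : V}, IsRoot B K u → IsRoot B K v → B u w = 0 →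
        4 * B u v ^ 2 = 1 * (B u u * B v v) → 4 * B v w ^ 2 = 1 * (B v v * B w w) → False := by
      intro u v hu hv huw huv hvw
      obtain ⟨t, ht, htt⟩ := hK.third_root hu hw huw
      obtain ⟨m, m1, m2, m3⟩ := ht.angle hB hv
      have := htt.angles hK hv.ne_zero (a := 1) (b := 1) (c := m) (by exact_mod_cast huv)
        (by rw [hB.symm w v, hvw]; push_cast; ring) m1
      obtain rfl : m = 2 := by omega
      exact hB2 ⟨t, v, ht, hv, by exact_mod_cast m1⟩
    have hxy2 : 4 * B x y ^ 2 = 1 * (B x x * B y y) := by grind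
    have hcase : (P1 = 0 ∧ P2 = 0) ∨ (P1 = 0 ∧ P2 = 1) ∨ (P1 = 1 ∧ P2 = 0) ∨ (P3 = 0 ∧ P1 = 1) := by
      grind
    rcases hcase with ⟨h1, h2⟩ | ⟨h1, h2⟩ | ⟨h1, h2⟩ | ⟨h1, h2⟩
    · have hxw := zero_of a1 h1
      have hyw := zero_of b1 h2
      obtain ⟨t, ht, htt⟩ := hK.third_root hx hw hxw
      obtain ⟨m, m1, m2, m3⟩ := ht.angle hB hy
      have := htt.angles hK hy.ne_zero (a := 1) (b := 0) (c := m) (by exact_mod_cast hxy2)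
        (by rw [hB.symm w y, hyw]; push_cast; ring) m1
      obtain rfl : m = 3 := by omega
      exact hG ⟨t, y, ht, hy, by exact_mod_cast m1⟩
    · exact aux hx hy (zero_of a1 h1) hxy2 (by rw [b1, h2]; norm_num)
    · exact aux hy hx (zero_of b1 h2) (by rw [hyx, hxy2]; ring)
        (by rw [a1, h1]; norm_num)
    · refine aux hs hx (zero_of d1 h1) ?_ (by rw [a1, h2]; norm_num)
      rw [hss, map_add, LinearMap.add_apply, hyx]
      grind

/-- Among pairwise orthogonal roots two produce a third, so there are none, one or three. -/
theorem rootType_of_no_skew (hK : IntLattice B K) (h : ¬ HasSkewRoots B K) : RootType B K := by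
  have hB := hK.pd
  have orth : ∀ x y, IsRoot B K x → IsRoot B K y → ¬ (y = x ∨ y = -x) → B x y = 0 := by
    intro x y hx hy hne
    by_contra h0
    push Not at hne
    exact h ⟨x, y, hx, hy, h0, hne⟩
  by_cases h0 : ∃ x, IsRoot B K x
  · obtain ⟨x, hx⟩ := h0
    by_cases h1 : ∃ y, IsRoot B K y ∧ ¬ (y = x ∨ y = -x)
    · obtain ⟨y, hy, hne⟩ := h1
      obtain ⟨z, hz, ht⟩ := hK.third_root hx hy (orth x y hx hy hne)
      refine RootType.three x y z ht ⟨?_, ?_, ?_⟩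
      · grind
      · have h1 := (mul_pos (hB.pos x ht.hx) (hB.pos y ht.hy)).ne
        have h2 := (mul_pos (hB.pos x ht.hx) (hB.pos z ht.hz)).ne
        have h3 := (mul_pos (hB.pos y ht.hy) (hB.pos z ht.hz)).ne
        simp only [pairwise_cons, mem_cons, not_mem_nil, forall_eq_or_imp, false_imp_iff,
          implies_true, List.Pairwise.nil, and_true]
        refine ⟨⟨?_, ?_⟩, ?_⟩ <;> apply nonparallel_of hB
        · grind
        · rw [ht.xz]; simpa using h2
        · rw [ht.yz]; simpa using h3
      · intro w hw
        by_contra hcon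
        simp at hcon
        have e1 := orth x w hx hw (by tauto)
        have e2 := orth y w hy hw (by tauto)
        have e3 := orth z w hz hw (by tauto)
        have e4 := ht.expand hB hK.rank w
        rw [e1, e2, e3] at e4
        simp at e4
        exact hw.ne_zero e4
    · push Not at h1
      refine RootType.one x ⟨by simpa using hx, by simp, fun w hw => ⟨x, by simp, h1 w hw⟩⟩
  · push Not at h0
    exact RootType.none ⟨by simp, by simp, fun w hw => absurd hw (h0 w)⟩

theorem IntLattice.rootType (hK : IntLattice B K) : RootType B K := by
  by_cases hG : HasG2 B K
  · obtain ⟨z, x, y, h1, h2, h3, h4, h5⟩ := exists_g2 hK hG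
    exact RootType.g2 z x y h1 h2 h3 h4 h5
  by_cases hB : HasB2 B K
  · exact rootType_b2 hK hG hB
  by_cases hs : HasSkewRoots B K
  · exact rootType_a2 hK hG hB hs
  · exact rootType_of_no_skew hK hs

/-! ### Orders of the orthogonal groups -/

/-- The stabilizer of a vector in a group of linear maps. -/
def fixer (H : Subgroup (V ≃ₗ[ℚ] V)) (v : V) : Subgroup (V ≃ₗ[ℚ] V) where
  carrier := {g | g ∈ H ∧ g v = v}
  mul_mem' := by
    rintro a b ⟨ha, ha'⟩ ⟨hb, hb'⟩
    exact ⟨H.mul_mem ha hb, by rw [LinearEquiv.mul_apply, hb', ha']⟩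
  one_mem' := ⟨H.one_mem, rfl⟩
  inv_mem' := by
    rintro a ⟨ha, ha'⟩
    refine ⟨H.inv_mem ha, ?_⟩
    conv_lhs => rw [← ha']
    simp

theorem mem_fixer {H : Subgroup (V ≃ₗ[ℚ] V)} {v : V} : g ∈ fixer H v ↔ g ∈ H ∧ g v = v := Iff.rfl

theorem card_eq_orbit_mul_fixer (H : Subgroup (V ≃ₗ[ℚ] V)) (v : V) :
    Nat.card H = {w | ∃ g ∈ H, g v = w}.ncard * Nat.card (fixer H v) := by
  have h1 : orbit H v = {w | ∃ g ∈ H, g v = w} := by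
    ext w
    constructor
    · rintro ⟨⟨g, hg⟩, rfl⟩
      exact ⟨g, hg, rfl⟩
    · rintro ⟨g, hg, rfl⟩
      exact ⟨⟨g, hg⟩, rfl⟩
  have h2 : Nat.card (MulAction.stabilizer H v) = Nat.card (fixer H v) := by
    refine Nat.card_congr ⟨fun g => ⟨g.1.1, g.1.2, g.2⟩, fun g => ⟨⟨g.1, g.2.1⟩, g.2.2⟩,
      fun _ => rfl, fun _ => rfl⟩
  rw [← h1, ← h2, ← MulAction.index_stabilizer, mul_comm, Subgroup.card_mul_index]

theorem self_ne_neg_of_ne_zero (hx : x ≠ 0) : x ≠ -x := by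
  intro h
  have h1 : (2 : ℚ) • x = 0 := by
    rw [two_smul]
    grind
  exact hx ((smul_eq_zero.1 h1).resolve_left two_ne_zero)

theorem neg_ne_one (hx : x ≠ 0) : neg ℚ ≠ (1 : V ≃ₗ[ℚ] V) := by
  intro h
  have h1 := congrArg (fun f : V ≃ₗ[ℚ] V => f x) h
  simp at h1
  exact self_ne_neg_of_ne_zero hx h1.symm

/-- An isometry that fixes x and y sends z to z or -z, and both occur because z is a root. -/
theorem card_fixer_pair (hK : IntLattice B K) (ht : OrthTriple B x y z) (hz : IsRoot B K z) :
    Nat.card (fixer (fixer (orthGroup B K) x) y) = 2 := by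
  have hB := hK.pd
  have hz0 := hB.ne_zero ht.hz
  have hzx : B z x = 0 := by rw [hB.symm, ht.xz]
  have hzy : B z y = 0 := by rw [hB.symm, ht.yz]
  have : (fixer (fixer (orthGroup B K) x) y : Set (V ≃ₗ[ℚ] V)) = {1, tau B z} := by
    ext g
    simp [mem_fixer]
    constructor
    · rintro ⟨⟨hg, hx⟩, hy⟩
      rcases ht.map_third hB hK.rank (mem_orthGroup.1 hg).1 (Or.inl hx) (Or.inl hy) with h | h
      · left
        exact ht.ext_equiv hB hK.rank hx hy h
      · right
        exact ht.ext_equiv hB hK.rank (by rw [hx, tau_of_orth hz0 hzx])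
          (by rw [hy, tau_of_orth hz0 hzy]) (by rw [h, tau_self hz0])
    · rintro (rfl | rfl)
      · simp
      · exact ⟨⟨hz.tau_mem hB, tau_of_orth hz0 hzx⟩, tau_of_orth hz0 hzy⟩
  change (fixer (fixer (orthGroup B K) x) y : Set (V ≃ₗ[ℚ] V)).ncard = 2
  rw [this, ncard_pair]
  intro h
  have h1 := congrArg (fun f : V ≃ₗ[ℚ] V => f z) h
  simp [tau_self hz0] at h1
  grind

/-- An involution τ_u that fixes x has u orthogonal to x, and a rotation about x with nontrivial
square yields roots orthogonal to x. Both are excluded, so only 1 and the half turn -τ_x remain. -/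
theorem card_fixer_isolated (hK : IntLattice B K) (hx : IsRoot B K x) (h : ∀ y, IsRoot B K y → B x
    y ≠ 0) : Nat.card (fixer (orthGroup B K) x) = 2 := by
  have hB := hK.pd
  have hx0 := hB.ne_zero hx.ne_zero
  have : (fixer (orthGroup B K) x : Set (V ≃ₗ[ℚ] V)) = {1, neg ℚ * tau B x} := by
    ext g
    simp [mem_fixer]
    constructor
    · rintro ⟨hg, hgx⟩
      have hg' := mem_orthGroup.1 hg
      by_cases hg2 : g * g = 1
      · rcases involution_cases hB hK.rank hg'.1 hg2 with (h1 | h1) | ⟨u, hu, h1 | h1⟩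
        · exact Or.inl h1
        · rw [h1] at hgx
          exact absurd hgx.symm (self_ne_neg_of_ne_zero hx.ne_zero)
        · exfalso
          rw [h1] at hg
          obtain ⟨y, hy, r, hr, rfl⟩ := hK.exists_root_of_tau hu hg
          rw [tau_smul hr] at h1
          have hy0 := hB.ne_zero hy.ne_zero
          rw [h1, tau_apply hy0, sub_eq_self, smul_eq_zero] at hgx
          have h3 := hgx.resolve_right hy.ne_zero
          apply h y hy
          rw [hB.symm]
          simp_all
        · right
          have hu0 := hB.ne_zero hu
          have h2 : tau B u x = -x := by
            rw [h1] at hgx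
            simp [LinearEquiv.neg_apply] at hgx
            grind
          rw [h1]
          congr 1
          rw [tau_apply hu0] at h2
          have h3 : x = (B u x / B u u) • u := by
            have : (2 : ℚ) • x = (2 : ℚ) • ((B u x / B u u) • u) := by
              rw [smul_smul, ← mul_div_assoc, two_smul]
              grind
            exact smul_right_injective V (two_ne_zero) this
          have h4 : B u x / B u u ≠ 0 := by
            intro h4
            rw [h4, zero_smul] at h3
            simp_all
          conv_rhs => rw [h3]
          rw [tau_smul h4]
      · exfalso
        obtain ⟨y, -, hy, -, hxy, -⟩ := hK.exists_roots_of_rotation hg hx.ne_zero hgx hg2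
        simp_all
    · rintro (rfl | rfl)
      · simp
      · exact ⟨(orthGroup B K).mul_mem neg_mem_orthGroup (hx.tau_mem hB), by
          simp [tau_self hx0]⟩
  change (fixer (orthGroup B K) x : Set (V ≃ₗ[ℚ] V)).ncard = 2
  rw [this, ncard_pair]
  intro h1
  obtain ⟨u, hu, hxu, -⟩ := exists_orth hK.rank B x x
  have h2 := congrArg (fun f : V ≃ₗ[ℚ] V => f u) h1
  simp [tau_of_orth hx0 hxu] at h2
  exact self_ne_neg_of_ne_zero hu h2

theorem ncard_pm (hx : x ≠ 0) : ({x, -x} : Set V).ncard = 2 :=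
  ncard_pair (self_ne_neg_of_ne_zero hx)

theorem ncard_pm_two (hx : x ≠ 0) (hy : y ≠ 0) (h : y ≠ x ∧ y ≠ -x) : ({x, -x, y, -y} : Set
    V).ncard = 4 := by
  have h1 := self_ne_neg_of_ne_zero hx
  have h2 := self_ne_neg_of_ne_zero hy
  have h3 : -x ≠ -y := fun e => h.1 (neg_injective e).symm
  have h4 : x ≠ -y := fun e => h.2 (by rw [e, neg_neg])
  rw [Set.ncard_insert_of_notMem, Set.ncard_insert_of_notMem, ncard_pair h2]
  · grind
  · simp_all

theorem ncard_pm_three (hx : x ≠ 0) (hy : y ≠ 0) (hz : z ≠ 0) (hxy : y ≠ x ∧ y ≠ -x) (hxz : z ≠ x ∧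
    z ≠ -x) (hyz : z ≠ y ∧ z ≠ -y) : ({x, -x, y, -y, z, -z} : Set V).ncard = 6 := by
  have h1 := self_ne_neg_of_ne_zero hx
  have h4 : x ≠ -y := fun e => hxy.2 (by rw [e, neg_neg])
  have h5 : x ≠ -z := fun e => hxz.2 (by rw [e, neg_neg])
  rw [Set.ncard_insert_of_notMem, Set.ncard_insert_of_notMem, ncard_pm_two hy hz hyz]
  · grind
  · grind

theorem card_orthGroup_none (hK : IntLattice B K) (h : IsRootList B K []) :
    Nat.card (orthGroup B K) = 2 := by
  have hno : ∀ x, ¬ IsRoot B K x := fun x hx => by simpa using h.complete x hx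
  have : (orthGroup B K : Set (V ≃ₗ[ℚ] V)) = {1, neg ℚ} := by
    ext g
    simp
    constructor
    · intro hg
      rcases hK.orthGroup_of_no_skew (fun ⟨x, _, hx, _⟩ => hno x hx) hg with h1 | ⟨x, hx, -⟩
      · exact h1
      · simp_all
    · rintro (rfl | rfl)
      · simp
      · exact neg_mem_orthGroup
  obtain ⟨u, hu, -, -⟩ := exists_orth hK.rank B 0 0
  change (orthGroup B K : Set (V ≃ₗ[ℚ] V)).ncard = 2
  rw [this, ncard_pair (neg_ne_one hu).symm]

theorem card_orthGroup_one (hK : IntLattice B K) (h : IsRootList B K [x]) : Nat.card (orthGroup B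
    K) = 4 := by
  have hB := hK.pd
  have hx : IsRoot B K x := h.root x (by simp)
  have hall : ∀ y, IsRoot B K y → y = x ∨ y = -x := fun y hy => by simpa using h.complete y hy
  have hx0 := hB.ne_zero hx.ne_zero
  rw [card_eq_orbit_mul_fixer _ x, card_fixer_isolated hK hx fun y hy => by grind]
  have : {w | ∃ g ∈ orthGroup B K, g x = w} = {x, -x} := by
    ext w
    simp
    constructor
    · rintro ⟨g, hg, rfl⟩
      exact hall _ (orthGroup_map_root hg hx)
    · rintro (rfl | rfl)
      · exact ⟨1, one_mem _, rfl⟩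
      · exact ⟨_, neg_mem_orthGroup, rfl⟩
  rw [this, ncard_pm hx.ne_zero]

theorem card_orthGroup_three (hK : IntLattice B K) (ht : OrthTriple B x y z) (h : IsRootList B K
    [x, y, z]) : Nat.card (orthGroup B K) = 8 := by
  have hB := hK.pd
  have hz : IsRoot B K z := h.root z (by simp)
  have hy : IsRoot B K y := h.root y (by simp)
  have hyx : B y x = 0 := by rw [hB.symm, ht.xy]
  have hzx : B z x = 0 := by rw [hB.symm, ht.xz]
  have hzy : B z y = 0 := by rw [hB.symm, ht.yz]
  have hx0 := hB.ne_zero ht.hx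
  have hy0 := hB.ne_zero ht.hy
  have hz0 := hB.ne_zero ht.hz
  have hall : ∀ w, IsRoot B K w → w = x ∨ w = -x ∨ w = y ∨ w = -y ∨ w = z ∨ w = -z := by
    intro w hw
    have := h.complete w hw
    grind
  have hns : ¬ HasSkewRoots B K := by
    rintro ⟨u, v, hu, hv, huv, h1, h2⟩
    rcases hall u hu with rfl | rfl | rfl | rfl | rfl | rfl <;>
      rcases hall v hv with rfl | rfl | rfl | rfl | rfl | rfl <;>
      simp_all [ht.xy, ht.xz, ht.yz]
  have hdiag : ∀ g ∈ orthGroup B K, (g x = x ∨ g x = -x) ∧ (g y = y ∨ g y = -y) := by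
    intro g hg
    have ht' : ∀ w, IsRoot B K w →
        (tau B w x = x ∨ tau B w x = -x) ∧ (tau B w y = y ∨ tau B w y = -y) := by
      intro w hw
      rcases hall w hw with rfl | rfl | rfl | rfl | rfl | rfl <;>
        simp [tau_neg, tau_self, tau_of_orth, hx0, hy0, hz0, ht.xy, hyx, hzx, hzy]
    rcases hK.orthGroup_of_no_skew hns hg with (rfl | rfl) | ⟨w, hw, rfl | rfl⟩
    · simp
    · simp
    · exact ht' w hw
    · obtain ⟨h1, h2⟩ := ht' w hw
      refine ⟨?_, ?_⟩
      · rcases h1 with h1 | h1 <;> simp [h1]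
      · rcases h2 with h1 | h1 <;> simp [h1]
  have e1 : {w | ∃ g ∈ orthGroup B K, g x = w} = {x, -x} := by
    ext w
    simp
    constructor
    · grind
    · rintro (rfl | rfl)
      · exact ⟨1, one_mem _, rfl⟩
      · exact ⟨_, neg_mem_orthGroup, rfl⟩
  have e2 : {w | ∃ g ∈ fixer (orthGroup B K) x, g y = w} = {y, -y} := by
    ext w
    simp
    constructor
    · rintro ⟨g, hg, rfl⟩
      exact (hdiag g hg.1).2
    · rintro (rfl | rfl)
      · exact ⟨1, one_mem _, rfl⟩
      · exact ⟨tau B y, ⟨hy.tau_mem hB, tau_of_orth hy0 hyx⟩, tau_self hy0⟩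
  rw [card_eq_orbit_mul_fixer _ x, card_eq_orbit_mul_fixer _ y, card_fixer_pair hK ht hz, e1, e2,
    ncard_pm ht.hx, ncard_pm ht.hy]

theorem tau_sub_apply (hB : IsPosDefSpace B) (hn : B y y = B x x) (hxy : x ≠ y) : tau B (x - y) x =
    y := by
  have h0 := hB.ne_zero (sub_ne_zero.2 hxy)
  rw [tau_apply h0]
  have : 2 * B (x - y) x / B (x - y) (x - y) = 1 := by
    rw [div_eq_one_iff_eq h0]
    simp [hn, hB.symm y x]
    ring
  simp_all

theorem card_orthGroup_a2 (hK : IntLattice B K) (hA : IsA2Pair B x y) (h : IsRootList B K [x, y, x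
    + y]) : Nat.card (orthGroup B K) = 12 := by
  have hB := hK.pd
  have hx : IsRoot B K x := h.root x (by simp)
  have hy : IsRoot B K y := h.root y (by simp)
  have hs : IsRoot B K (x + y) := h.root _ (by simp)
  have hx0 := hB.ne_zero hx.ne_zero
  have hy0 := hB.ne_zero hy.ne_zero
  have hyx : B y x = B x y := hB.symm _ _
  have hxy : B x y = -(B x x / 2) := by linarith [hA.inner]
  have hall : ∀ w, IsRoot B K w →
      w = x ∨ w = -x ∨ w = y ∨ w = -y ∨ w = x + y ∨ w = -(x + y) := by
    intro w hw
    have := h.complete w hw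
    grind
  have hnot : ∀ w, IsRoot B K w → B x w ≠ 0 := by grind
  rw [card_eq_orbit_mul_fixer _ x, card_fixer_isolated hK hx hnot]
  have e : {w | ∃ g ∈ orthGroup B K, g x = w} = {x, -x, y, -y, x + y, -(x + y)} := by
    have hxs : tau B y x = x + y := by
      rw [tau_apply hy0, hyx, hA.inner, hA.norm, neg_div, div_self hx0]
      module
    have hxy' : tau B (x + y) x = -y := by
      rw [tau_apply (hB.ne_zero hs.ne_zero)]
      have : 2 * B (x + y) x / B (x + y) (x + y) = 1 := by
        rw [div_eq_one_iff_eq (hB.ne_zero hs.ne_zero)]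
        simp [hyx, hA.norm, hxy]
        ring
      simp_all
    ext w
    simp only [mem_ofPred_eq, mem_insert_iff, mem_singleton_iff]
    constructor
    · rintro ⟨g, hg, rfl⟩
      exact hall _ (orthGroup_map_root hg hx)
    · rintro (rfl | rfl | rfl | rfl | rfl | rfl)
      · exact ⟨1, one_mem _, rfl⟩
      · exact ⟨_, neg_mem_orthGroup, rfl⟩
      · exact ⟨_, mul_mem neg_mem_orthGroup (hs.tau_mem hB), by simp [hxy']⟩
      · exact ⟨_, hs.tau_mem hB, hxy'⟩
      · exact ⟨_, hy.tau_mem hB, hxs⟩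
      · exact ⟨_, mul_mem neg_mem_orthGroup (hy.tau_mem hB), by simp [hxs]⟩
  have hp := h.pairwise
  simp only [pairwise_cons, mem_cons, not_mem_nil, forall_eq_or_imp, false_imp_iff, implies_true,
    List.Pairwise.nil, and_true] at hp
  rw [e, ncard_pm_three hx.ne_zero hy.ne_zero hs.ne_zero hp.1.1 hp.1.2 hp.2]

/-- If gx were ±z, then gw would be parallel or orthogonal to gx, although x and w are skew. By
symmetry gx and gw are both orthogonal to z, so g preserves the plane they span and hence its normal
line. -/
theorem orbit_isolated (hK : IntLattice B K) {w u : V} (hiso : ∀ r, IsRoot B K r → (r = z ∨ r = -z)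
    ∨ B z r = 0) (hx : IsRoot B K x) (hw : IsRoot B K w) (hxw : B x w ≠ 0) (hne : w ≠ x ∧ w ≠ -x)
    (ht : OrthTriple B x u z) {a b : ℚ} (hu : u = a • x + b • w) : {v | ∃ g ∈ orthGroup B K, g z =
    v} = {z, -z} := by
  have hB := hK.pd
  ext v
  simp
  constructor
  · rintro ⟨g, hg, rfl⟩
    have hg' := (mem_orthGroup.1 hg).1
    have aux : ∀ x w, IsRoot B K x → IsRoot B K w → B x w ≠ 0 → w ≠ x ∧ w ≠ -x →
        B z (g x) = 0 := by
      intro x w hx hw hxw hne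
      rcases hiso _ (orthGroup_map_root hg hx) with h1 | h1
      · exfalso
        rcases hiso _ (orthGroup_map_root hg hw) with h2 | h2
        · have : g w = g x ∨ g w = -g x := by grind
          rcases this with h | h
          · simp_all
          · rw [← map_neg] at h
            exact hne.2 (g.injective h)
        · apply hxw
          rw [← hg']
          rcases h1 with h1 | h1 <;> simp [h1, h2]
      · exact h1
    have h1 := aux x w hx hw hxw hne
    have h2 := aux w x hw hx (by rwa [hB.symm])
      ⟨fun h => hne.1 h.symm, fun h => hne.2 (by rw [h, neg_neg])⟩
    have h3 : B z (g u) = 0 := by rw [hu]; simp [h1, h2]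
    have ht' : OrthTriple B (g x) (g u) (g z) :=
      ⟨by simpa using ht.hx, by simpa using ht.hy, by simpa using ht.hz, by rw [hg', ht.xy],
        by rw [hg', ht.xz], by rw [hg', ht.yz]⟩
    have h4 := ht'.perp hB hK.rank (v := z) (by rw [hB.symm, h1]) (by rw [hB.symm, h3])
    rcases smul_eq_or_of_norm hB ht'.hz h4 (hg' z z).symm with h | h
    · grind
    · grind
  · rintro (rfl | rfl)
    · exact ⟨1, one_mem _, rfl⟩
    · exact ⟨_, neg_mem_orthGroup, rfl⟩

/-- The order is the product of the orbit of z, the orbit of x under the fixer of z, and the fixer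
of both: 2 · 4 · 2. In the same way one gets 2 · 6 · 2 for G₂ × A₁ and 6 · 4 · 2 in the cubic case.
-/
theorem card_orthGroup_b2 (hK : IntLattice B K) (ht : OrthTriple B z x y) (hn : B y y = B x x) (h :
    IsRootList B K [z, x, y, x + y, x - y]) : Nat.card (orthGroup B K) = 16 := by
  have hB := hK.pd
  have hx : IsRoot B K x := h.root x (by simp)
  have hy : IsRoot B K y := h.root y (by simp)
  have hp : IsRoot B K (x + y) := h.root _ (by simp)
  have hm : IsRoot B K (x - y) := h.root _ (by simp)
  have hx0 := hB.ne_zero hx.ne_zero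
  have hy0 := hB.ne_zero hy.ne_zero
  have hyx : B y x = 0 := by rw [hB.symm, ht.yz]
  have hxz : B x z = 0 := by rw [hB.symm, ht.xy]
  have hyz : B y z = 0 := by rw [hB.symm, ht.xz]
  have hall : ∀ w, IsRoot B K w → (w = z ∨ w = -z) ∨ (w = x ∨ w = -x ∨ w = y ∨ w = -y) ∨
      (w = x + y ∨ w = -(x + y) ∨ w = x - y ∨ w = -(x - y)) := by
    intro w hw
    have := h.complete w hw
    grind
  have hpw := h.pairwise
  simp only [pairwise_cons, mem_cons, not_mem_nil, forall_eq_or_imp, false_imp_iff, implies_true,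
    List.Pairwise.nil, and_true] at hpw
  have e1 : {v | ∃ g ∈ orthGroup B K, g z = v} = {z, -z} := by
    refine orbit_isolated hK (fun r hr => ?_) hx hp (by simpa [ht.yz] using hx0) hpw.2.1.2.1
      (ht.rotate hB) (a := -1) (b := 1) (by module)
    rcases hall r hr with h | (rfl | rfl | rfl | rfl) | (rfl | rfl | rfl | rfl)
    · exact Or.inl h
    all_goals right; simp [ht.xy, ht.xz]
  have e2 : {w | ∃ g ∈ fixer (orthGroup B K) z, g x = w} = {x, -x, y, -y} := by
    ext w
    simp
    have hxy : tau B (x - y) x = y := tau_sub_apply hB hn (fun e => hpw.2.1.1.1 e.symm)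
    constructor
    · rintro ⟨g, ⟨hg, hgz⟩, rfl⟩
      have hg' := (mem_orthGroup.1 hg).1
      have h1 : B z (g x) = 0 := by rw [← ht.xy, ← hg' z x, hgz]
      have h2 := hg' x x
      have h3 := hB.ne_zero ht.hx
      rcases hall _ (orthGroup_map_root hg hx) with (h | h) | h | (h | h | h | h)
      · simp_all
      · simp_all
      · exact h
      all_goals
        exfalso
        rw [h] at h2
        simp [ht.yz, hyx, hn, hx0] at h2
    · have fz : ∀ v, IsRoot B K v → B v z = 0 → tau B v ∈ fixer (orthGroup B K) z := fun v hv hvz =>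
        ⟨hv.tau_mem hB, tau_of_orth (hB.ne_zero hv.ne_zero) hvz⟩
      rintro (rfl | rfl | rfl | rfl)
      · exact ⟨1, one_mem _, rfl⟩
      · exact ⟨_, fz x hx hxz, tau_self hx0⟩
      · exact ⟨_, fz _ hm (by simp [hxz, hyz]), hxy⟩
      · exact ⟨_, mul_mem (fz y hy hyz) (fz _ hm (by simp [hxz, hyz])), by
          rw [LinearEquiv.mul_apply, hxy, tau_self hy0]⟩
  rw [card_eq_orbit_mul_fixer _ z, card_eq_orbit_mul_fixer _ x, card_fixer_pair hK ht hy, e1, e2,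
    ncard_pm ht.hx, ncard_pm_two ht.hy ht.hz hpw.2.1.1]

theorem card_orthGroup_g2 (hK : IntLattice B K) (hzx : B z x = 0) (hzy : B z y = 0) (hA : IsA2Pair
    B x y) (h : IsRootList B K (listG2 z x y)) : Nat.card (orthGroup B K) = 24 := by
  have hB := hK.pd
  have hz : IsRoot B K z := h.root z (by simp [listG2])
  have hx : IsRoot B K x := h.root x (by simp [listG2])
  have hy : IsRoot B K y := h.root y (by simp [listG2])
  have hs : IsRoot B K (x + y) := h.root _ (by simp [listG2])
  have hm : IsRoot B K (x - y) := h.root _ (by simp [listG2])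
  have hl : IsRoot B K (x + (2 : ℚ) • y) := h.root _ (by simp [listG2])
  have hx0 := hB.ne_zero hx.ne_zero
  have hy0 := hB.ne_zero hy.ne_zero
  have hz0 := hB.ne_zero hz.ne_zero
  have hs0 := hB.ne_zero hs.ne_zero
  have hyx : B y x = B x y := hB.symm _ _
  have hxy : B x y = -(B x x / 2) := by linarith [hA.inner]
  have hxz : B x z = 0 := by rw [hB.symm, hzx]
  have hyz : B y z = 0 := by rw [hB.symm, hzy]
  have hall : ∀ w, IsRoot B K w → (w = z ∨ w = -z) ∨
      (w = x ∨ w = -x ∨ w = y ∨ w = -y ∨ w = x + y ∨ w = -(x + y)) ∨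
      (w = x - y ∨ w = -(x - y) ∨ w = (2 : ℚ) • x + y ∨ w = -((2 : ℚ) • x + y) ∨
        w = x + (2 : ℚ) • y ∨ w = -(x + (2 : ℚ) • y)) := by
    intro w hw
    have := h.complete w hw
    simp only [listG2, mem_cons, not_mem_nil, or_false, exists_eq_or_imp,
      exists_eq_left] at this
    tauto
  have ht : OrthTriple B z x (x + (2 : ℚ) • y) :=
    ⟨hz.ne_zero, hx.ne_zero, hl.ne_zero, hzx, by simp [hzx, hzy], by simp [hxy]; ring⟩
  have hpw := h.pairwise
  simp only [listG2, pairwise_cons, mem_cons, not_mem_nil, forall_eq_or_imp, false_imp_iff,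
    implies_true, List.Pairwise.nil, and_true] at hpw
  have e1 : {v | ∃ g ∈ orthGroup B K, g z = v} = {z, -z} := by
    refine orbit_isolated hK (fun r hr => ?_) hx hy (by rw [hxy]; simpa using hx0) hpw.2.1.1
      (ht.rotate hB) (a := 1) (b := 2) (by module)
    rcases hall r hr with h | (rfl | rfl | rfl | rfl | rfl | rfl) |
      (rfl | rfl | rfl | rfl | rfl | rfl)
    · exact Or.inl h
    all_goals right; simp [hzx, hzy]
  have e2 : {w | ∃ g ∈ fixer (orthGroup B K) z, g x = w} = {x, -x, y, -y, x + y, -(x + y)} := by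
    ext w
    simp only [mem_ofPred_eq, mem_insert_iff, mem_singleton_iff]
    have hxm : tau B (x - y) x = y := tau_sub_apply hB hA.norm (fun e => hpw.2.1.1.1 e.symm)
    have hxs : tau B y x = x + y := by
      rw [tau_apply hy0, hyx, hA.inner, hA.norm, neg_div, div_self hx0]
      module
    constructor
    · rintro ⟨g, ⟨hg, hgz⟩, rfl⟩
      have hg' := (mem_orthGroup.1 hg).1
      have h1 : B z (g x) = 0 := by rw [← hzx, ← hg' z x, hgz]
      have h2 := hg' x x
      rcases hall _ (orthGroup_map_root hg hx) with (h | h) | h | (h | h | h | h | h | h)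
      · simp_all
      · grind
      · exact h
      all_goals
        exfalso
        rw [h] at h2
        simp only [map_add, map_sub, map_neg, map_smul, LinearMap.add_apply, LinearMap.sub_apply,
          LinearMap.neg_apply, LinearMap.smul_apply, smul_eq_mul, hyx, hA.norm, hxy] at h2
        apply hx0
        linarith
    · have fz : ∀ v, IsRoot B K v → B v z = 0 → tau B v ∈ fixer (orthGroup B K) z := fun v hv hvz =>
        ⟨hv.tau_mem hB, tau_of_orth (hB.ne_zero hv.ne_zero) hvz⟩
      rintro (rfl | rfl | rfl | rfl | rfl | rfl)
      · exact ⟨1, one_mem _, rfl⟩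
      · exact ⟨_, fz x hx hxz, tau_self hx0⟩
      · exact ⟨_, fz _ hm (by simp [hxz, hyz]), hxm⟩
      · exact ⟨_, mul_mem (fz y hy hyz) (fz _ hm (by simp [hxz, hyz])), by
          rw [LinearEquiv.mul_apply, hxm, tau_self hy0]⟩
      · grind
      · exact ⟨_, mul_mem (fz _ hs (by simp [hxz, hyz])) (fz y hy hyz), by
          rw [LinearEquiv.mul_apply, hxs, tau_self hs0]⟩
  rw [card_eq_orbit_mul_fixer _ z, card_eq_orbit_mul_fixer _ x, card_fixer_pair hK ht hl, e1, e2,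
    ncard_pm ht.hx, ncard_pm_three hx.ne_zero hy.ne_zero hs.ne_zero hpw.2.1.1 hpw.2.1.2.1
      hpw.2.2.1.1]

theorem card_orthGroup_cubic (hK : IntLattice B K) {a b c : V} (hs : s = 1 ∨ s = 1 / 2) (ht :
    OrthTriple B a b c) (hab : B b b = B a a) (hac : B c c = B a a) (h : IsRootList B K (listCubic
    s a b c)) : Nat.card (orthGroup B K) = 48 := by
  have hB := hK.pd
  have ha : IsRoot B K a := h.root a (by simp [listCubic])
  have hb : IsRoot B K b := h.root b (by simp [listCubic])
  have hc : IsRoot B K c := h.root c (by simp [listCubic])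
  have h1 : IsRoot B K (s • (a - b)) := h.root _ (by simp [listCubic])
  have h2 : IsRoot B K (s • (a - c)) := h.root _ (by simp [listCubic])
  have h3 : IsRoot B K (s • (b - c)) := h.root _ (by simp [listCubic])
  have hs0 : s ≠ 0 := by rcases hs with rfl | rfl <;> norm_num
  have ha0 := hB.ne_zero ha.ne_zero
  have hb0 := hB.ne_zero hb.ne_zero
  have hc0 := hB.ne_zero hc.ne_zero
  have hba : B b a = 0 := by rw [hB.symm, ht.xy]
  have hca : B c a = 0 := by rw [hB.symm, ht.xz]
  have hcb : B c b = 0 := by rw [hB.symm, ht.yz]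
  have hall : ∀ w, IsRoot B K w → B w w = B a a →
      w = a ∨ w = -a ∨ w = b ∨ w = -b ∨ w = c ∨ w = -c := by
    intro w hw hn
    have := h.complete w hw
    simp only [listCubic, mem_cons, not_mem_nil, or_false, exists_eq_or_imp,
      exists_eq_left] at this
    have hpos := hB.pos a ha.ne_zero
    rcases this with h | h | h | (h | h) | (h | h) | (h | h) | (h | h) | (h | h) | (h | h)
    · tauto
    · tauto
    · tauto
    all_goals
      exfalso
      rw [h] at hn
      simp only [map_add, map_sub, map_neg, map_smul, LinearMap.add_apply, LinearMap.sub_apply,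
          LinearMap.neg_apply, LinearMap.smul_apply, smul_eq_mul, ht.xy, ht.xz, ht.yz, hba, hca,
          hcb, hab, hac] at hn
      rcases hs with rfl | rfl <;> linarith
  have nab := nonparallel_of hB (x := a) (y := b) (by rw [ht.xy]; simp [ha0, hb0])
  have nac := nonparallel_of hB (x := a) (y := c) (by rw [ht.xz]; simp [ha0, hc0])
  have nbc := nonparallel_of hB (x := b) (y := c) (by rw [ht.yz]; simp [hb0, hc0])
  have tab : tau B (s • (a - b)) a = b := by
    rw [tau_smul hs0]; exact tau_sub_apply hB hab nab.1.symm
  have tac : tau B (s • (a - c)) a = c := by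
    rw [tau_smul hs0]; exact tau_sub_apply hB hac nac.1.symm
  have tbc : tau B (s • (b - c)) b = c := by
    rw [tau_smul hs0]; exact tau_sub_apply hB (hac.trans hab.symm) nbc.1.symm
  have e1 : {w | ∃ g ∈ orthGroup B K, g a = w} = {a, -a, b, -b, c, -c} := by
    ext w
    simp
    constructor
    · rintro ⟨g, hg, rfl⟩
      exact hall _ (orthGroup_map_root hg ha) ((mem_orthGroup.1 hg).1 a a)
    · rintro (rfl | rfl | rfl | rfl | rfl | rfl)
      · exact ⟨1, one_mem _, rfl⟩
      · exact ⟨_, neg_mem_orthGroup, rfl⟩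
      · exact ⟨_, h1.tau_mem hB, tab⟩
      · exact ⟨_, mul_mem neg_mem_orthGroup (h1.tau_mem hB), by simp [tab]⟩
      · exact ⟨_, h2.tau_mem hB, tac⟩
      · exact ⟨_, mul_mem neg_mem_orthGroup (h2.tau_mem hB), by simp [tac]⟩
  have e2 : {w | ∃ g ∈ fixer (orthGroup B K) a, g b = w} = {b, -b, c, -c} := by
    ext w
    simp
    constructor
    · rintro ⟨g, ⟨hg, hga⟩, rfl⟩
      have hg' := (mem_orthGroup.1 hg).1
      have h1 : B a (g b) = 0 := by rw [← ht.xy, ← hg' a b, hga]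
      rcases hall _ (orthGroup_map_root hg hb) ((hg' b b).trans hab) with h | h | h
      · simp_all
      · simp_all
      · exact h
    · have fz : ∀ v, IsRoot B K v → B v a = 0 → tau B v ∈ fixer (orthGroup B K) a := fun v hv hva =>
        ⟨hv.tau_mem hB, tau_of_orth (hB.ne_zero hv.ne_zero) hva⟩
      rintro (rfl | rfl | rfl | rfl)
      · exact ⟨1, one_mem _, rfl⟩
      · exact ⟨_, fz b hb hba, tau_self hb0⟩
      · exact ⟨_, fz _ h3 (by simp [hba, hca]), tbc⟩
      · exact ⟨_, mul_mem (fz c hc hca) (fz _ h3 (by simp [hba, hca])), by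
          rw [LinearEquiv.mul_apply, tbc, tau_self hc0]⟩
  rw [card_eq_orbit_mul_fixer _ a, card_eq_orbit_mul_fixer _ b, card_fixer_pair hK ht hc, e1, e2,
    ncard_pm_three ht.hx ht.hy ht.hz nab nac nbc, ncard_pm_two ht.hy ht.hz nbc]

/-! ### Diagonal coordinates at p -/

/-- `c` gives coordinates at `p` that diagonalize the form, with diagonal `D`, and in which `K` is
locally the standard lattice. -/
structure Coord (p : ℕ) [Fact p.Prime] (B : BilinForm ℚ V) (K : Submodule ℤ V)
    (D : Fin 3 → ℤ_[p]) (c : V →ₗ[ℚ] (Fin 3 → ℚ_[p])) : Prop where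
  gram : ∀ x y, ((B x y : ℚ) : ℚ_[p]) = ∑ i, (D i : ℚ_[p]) * c x i * c y i
  int : ∀ x ∈ K, ∀ i, ∃ z : ℤ_[p], c x i = z
  dense : ∀ u : Fin 3 → ℤ_[p], ∃ x ∈ K, ∀ i, ∃ z : ℤ_[p], c x i = u i + p * z
  sat : ∀ y, (p : ℤ) • y ∈ K → (∀ i, ∃ z : ℤ_[p], c y i = z) → y ∈ K

theorem exists_smul_mem [hK : IsLattice ℚ K] (x : V) : ∃ d : ℤ, d ≠ 0 ∧ d • x ∈ K := by
  have hx : x ∈ span ℚ (K : Set V) := by rw [hK.span_eq_top]; trivial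
  induction hx using span_induction with
  | mem x hx => exact ⟨1, one_ne_zero, by simpa using hx⟩
  | zero => exact ⟨1, one_ne_zero, by simp⟩
  | add x y _ _ hx hy =>
    obtain ⟨d, hd, hd'⟩ := hx
    obtain ⟨e, he, he'⟩ := hy
    refine ⟨d * e, mul_ne_zero hd he, ?_⟩
    rw [smul_add]
    refine K.add_mem ?_ ?_
    · rw [mul_comm, mul_smul]; exact K.smul_mem _ hd'
    · rw [mul_smul]; exact K.smul_mem _ he'
  | smul a x _ hx =>
    obtain ⟨d, hd, hd'⟩ := hx
    refine ⟨d * a.den, mul_ne_zero hd (by exact_mod_cast a.den_ne_zero), ?_⟩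
    have : (d * (a.den : ℤ)) • a • x = a.num • d • x := by
      rw [← cast_smul_eq_zsmul ℚ, ← cast_smul_eq_zsmul ℚ, ← cast_smul_eq_zsmul ℚ,
        smul_smul, smul_smul]
      congr 1
      push_cast
      rw [mul_assoc, mul_comm (a.den : ℚ), Rat.mul_den_eq_num, mul_comm]
    rw [this]
    exact K.smul_mem _ hd'

theorem padicInt_eq_add_mul (z : ℤ_[p]) : ∃ (n : ℕ) (w : ℤ_[p]), z = n + p * w := by
  obtain ⟨w, hw⟩ := Ideal.mem_span_singleton.1 (PadicInt.appr_spec 1 z)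
  exact ⟨z.appr 1, w, by rw [pow_one] at hw; rw [← hw]; ring⟩

theorem tmul_mem_completion (hx : x ∈ K) : (1 : ℚ_[p]) ⊗ₜ[ℚ] x ∈ completion p K :=
  subset_span ⟨x, hx, rfl⟩

/-- Every p-adic integer is a natural number modulo p, so K fills K_p modulo pK_p. -/
theorem completion_approx {ξ : ℚ_[p] ⊗[ℚ] V} (hξ : ξ ∈ completion p K) :
    ∃ x ∈ K, ∃ η ∈ completion p K, ξ = (1 : ℚ_[p]) ⊗ₜ[ℚ] x + (p : ℤ_[p]) • η := by
  induction hξ using span_induction with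
  | mem ξ h =>
    obtain ⟨x, hx, rfl⟩ := h
    exact ⟨x, hx, 0, zero_mem _, by simp⟩
  | zero => exact ⟨0, K.zero_mem, 0, zero_mem _, by simp⟩
  | add ξ ξ' _ _ h h' =>
    obtain ⟨x, hx, η, hη, rfl⟩ := h
    obtain ⟨x', hx', η', hη', rfl⟩ := h'
    exact ⟨x + x', K.add_mem hx hx', η + η', add_mem hη hη', by
      rw [TensorProduct.tmul_add, smul_add]; abel⟩
  | smul z ξ hξ h =>
    obtain ⟨n, w, rfl⟩ := padicInt_eq_add_mul z
    obtain ⟨x, hx, η, hη, rfl⟩ := h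
    refine ⟨n • x, K.nsmul_mem hx n, (n : ℤ_[p]) • η + w • ((1 : ℚ_[p]) ⊗ₜ[ℚ] x + (p : ℤ_[p]) • η),
      add_mem (smul_mem _ _ hη) (smul_mem _ _ hξ), ?_⟩
    have e : (1 : ℚ_[p]) ⊗ₜ[ℚ] (n • x) = (n : ℤ_[p]) • ((1 : ℚ_[p]) ⊗ₜ[ℚ] x) := by
      rw [tmul_smul, Nat.cast_smul_eq_nsmul]
    rw [e]
    module

/-- In a ℤ-basis of K the coordinates of p • y are integers. The coordinates of y are p-adic
integers since y lies in K_p, so those integers are divisible by p. -/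
theorem mem_of_tmul_mem [hK : IsLattice ℚ K] (hy : (p : ℤ) • y ∈ K) (h : (1 : ℚ_[p])
    ⊗ₜ[ℚ] y ∈ completion p K) : y ∈ K := by
  have hfree := IsLattice.free ℚ K
  have hfin := IsLattice.finite ℚ K
  let f := Module.Free.chooseBasis ℤ K
  let F := f.extendOfIsLattice ℚ
  have hF : ∀ x : K, ∀ i, F.repr x i = f.repr x i := by
    intro x i
    have h1 : (x : V) = ∑ j, ((f.repr x j : ℤ) : ℚ) • F j := by
      conv_lhs => rw [← f.sum_repr x]
      simp only [coe_sum, coe_smul, F, Basis.extendOfIsLattice_apply,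
        cast_smul_eq_zsmul]
    rw [h1, map_sum]
    simp [Finsupp.single_apply]
  have hcomp : ∀ i, ∀ ξ ∈ completion p K, ∃ z : ℤ_[p],
      TensorProduct.lift ((LinearMap.mul ℚ ℚ_[p]).compr₂ LinearMap.id |>.compl₂
        ((linearMap ℚ ℚ_[p]) ∘ₗ F.coord i)) ξ = z := by
    intro i ξ hξ
    induction hξ using span_induction with
    | mem ξ h =>
      obtain ⟨x, hx, rfl⟩ := h
      refine ⟨(f.repr ⟨x, hx⟩ i : ℤ), ?_⟩
      simp [hF ⟨x, hx⟩ i]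
    | zero => exact ⟨0, by simp⟩
    | add a b _ _ ha hb =>
      obtain ⟨z, hz⟩ := ha
      obtain ⟨w, hw⟩ := hb
      exact ⟨z + w, by rw [map_add, hz, hw]; simp⟩
    | smul r a _ ha =>
      obtain ⟨z, hz⟩ := ha
      refine ⟨r * z, ?_⟩
      rw [PadicInt.coe_mul, ← hz]
      have hr : ∀ ξ : ℚ_[p] ⊗[ℚ] V, TensorProduct.lift ((LinearMap.mul ℚ ℚ_[p]).compr₂ LinearMap.id
          |>.compl₂ ((linearMap ℚ ℚ_[p]) ∘ₗ F.coord i)) (r • ξ) = (r : ℚ_[p]) *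
          TensorProduct.lift ((LinearMap.mul ℚ ℚ_[p]).compr₂ LinearMap.id
          |>.compl₂ ((linearMap ℚ ℚ_[p]) ∘ₗ F.coord i)) ξ := by
        intro ξ
        induction ξ using induction_on with
        | zero => simp
        | tmul a v =>
          rw [TensorProduct.smul_tmul']
          simp [smul_def, mul_assoc]
        | add a b ha hb => rw [smul_add, map_add, ha, hb, map_add, mul_add]
      exact hr a
  have hdiv : ∀ i, ∃ m : ℤ, f.repr ⟨_, hy⟩ i = p * m := by
    intro i
    obtain ⟨z, hz⟩ := hcomp i _ h
    have h1 : F.repr ((p : ℤ) • y) i = f.repr ⟨_, hy⟩ i := hF ⟨_, hy⟩ i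
    have h2 : F.repr ((p : ℤ) • y) i = p * F.repr y i := by simp
    simp at hz
    have h3 : (p : ℤ_[p]) ^ 1 ∣ ((f.repr ⟨_, hy⟩ i : ℤ) : ℤ_[p]) := by
      refine ⟨z, ?_⟩
      apply PadicInt.ext
      push_cast
      rw [pow_one, ← hz, ← Rat.cast_natCast, ← Rat.cast_mul, ← h2, h1]
      simp
    rw [pow_p_dvd_int_iff, pow_one] at h3
    exact h3
  choose m hm using hdiv
  have h4 : (p : ℤ) • y = (p : ℤ) • (∑ i, m i • (f i : V)) := by
    have h5 := congrArg (Subtype.val) (f.sum_repr ⟨_, hy⟩)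
    simp only [hm, coe_sum, coe_smul] at h5
    rw [← h5, smul_sum]
    simp [mul_smul]
  have h6 : y = ∑ i, m i • (f i : V) := by
    rw [← cast_smul_eq_zsmul ℚ, ← cast_smul_eq_zsmul ℚ] at h4
    have h7 : ((p : ℤ) : ℚ) ≠ 0 := by exact_mod_cast (Fact.out : p.Prime).ne_zero
    simp_all
  rw [h6]
  exact K.sum_mem fun i _ => K.smul_mem _ (f i).2

/-- The coordinates are x ↦ B(x, b_i)/D_i for the orthogonal basis b of K_p. The fields `dense` and
`sat` come from `completion_approx` and `mem_of_tmul_mem`. -/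
theorem exists_coord [IsLattice ℚ K] (hD : ∀ i, D i ≠ 0) (b : Basis (Fin 3) ℤ_[p]
    (completion p K)) (hb : ∀ i j, B.baseChange ℚ_[p] (b i : ℚ_[p] ⊗[ℚ] V) (b j : ℚ_[p] ⊗[ℚ] V) =
    Matrix.diagonal (fun i => (D i : ℚ_[p])) i j) : ∃ c, Coord p B K D c := by
  have hD' : ∀ i, (D i : ℚ_[p]) ≠ 0 := fun i h => hD i (PadicInt.ext (by simpa using h))
  let c : V →ₗ[ℚ] (Fin 3 → ℚ_[p]) := LinearMap.pi fun i =>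
    (((D i : ℚ_[p])⁻¹ • (B.baseChange ℚ_[p]).flip (b i : ℚ_[p] ⊗[ℚ] V)).restrictScalars ℚ) ∘ₗ
      TensorProduct.mk ℚ ℚ_[p] V 1
  have hc : ∀ x i, c x i = (D i : ℚ_[p])⁻¹ * B.baseChange ℚ_[p] (1 ⊗ₜ x) (b i) := fun x i => rfl
  have hcomp : ∀ ξ (hξ : ξ ∈ completion p K) i,
      (D i : ℚ_[p])⁻¹ * B.baseChange ℚ_[p] ξ (b i) = b.repr ⟨ξ, hξ⟩ i := by
    intro ξ hξ i
    have h1 : ξ = ∑ j, ((b.repr ⟨ξ, hξ⟩ j : ℤ_[p]) : ℚ_[p]) • (b j : ℚ_[p] ⊗[ℚ] V) := by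
      have := congrArg Subtype.val (b.sum_repr ⟨ξ, hξ⟩)
      simp only [coe_sum, coe_smul] at this
      exact this.symm
    conv_lhs => rw [h1]
    rw [map_sum, LinearMap.sum_apply]
    simp only [map_smul, LinearMap.smul_apply, hb, smul_eq_mul, Matrix.diagonal_apply]
    rw [Finset.sum_eq_single i]
    · grind
    · grind
    · simp
  have hexp : ∀ x : V, (1 : ℚ_[p]) ⊗ₜ[ℚ] x = ∑ i, c x i • (b i : ℚ_[p] ⊗[ℚ] V) := by
    have h1 : ∀ x ∈ K, (1 : ℚ_[p]) ⊗ₜ[ℚ] x = ∑ i, c x i • (b i : ℚ_[p] ⊗[ℚ] V) := by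
      intro x hx
      have := congrArg Subtype.val (b.sum_repr ⟨_, tmul_mem_completion (p := p) hx⟩)
      simp only [coe_sum, coe_smul] at this
      rw [← this]
      refine sum_congr rfl fun i _ => ?_
      rw [hc, hcomp _ (tmul_mem_completion hx)]
      rfl
    intro x
    obtain ⟨d, hd, hd'⟩ := exists_smul_mem (K := K) x
    have h2 := h1 _ hd'
    rw [← cast_smul_eq_zsmul ℚ] at h2
    simp at h2
    rw [← smul_sum] at h2
    have hd0 : (d : ℚ) ≠ 0 := by exact_mod_cast hd
    have := congrArg (fun v => (d : ℚ)⁻¹ • v) h2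
    simpa [smul_smul, inv_mul_cancel₀ hd0] using this
  refine ⟨c, ⟨?_, ?_, ?_, ?_⟩⟩
  · intro x y
    have h1 : B.baseChange ℚ_[p] (1 ⊗ₜ x) (1 ⊗ₜ y) = ((B x y : ℚ) : ℚ_[p]) := by simp
    rw [← h1]
    conv_lhs => rw [hexp y]
    rw [map_sum]
    refine sum_congr rfl fun i _ => ?_
    rw [map_smul, smul_eq_mul, hc x i, mul_inv_cancel_left₀ (hD' i), mul_comm]
  · intro x hx i
    exact ⟨_, (hc x i).trans (hcomp _ (tmul_mem_completion hx) i)⟩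
  · intro u
    have hu := (∑ i, u i • b i).2
    obtain ⟨x, hx, η, hη, h⟩ := completion_approx hu
    refine ⟨x, hx, fun i => ⟨-(b.repr ⟨η, hη⟩ i), ?_⟩⟩
    have h1 : (1 : ℚ_[p]) ⊗ₜ[ℚ] x = (∑ i, u i • b i : completion p K) - (p : ℤ_[p]) • η := by
      rw [h]; abel
    have h2 := hcomp _ hu i
    simp only [Subtype.coe_eta, map_sum, map_smul, Basis.repr_self] at h2
    have h3 : (p : ℤ_[p]) • η = (p : ℚ_[p]) • η := by
      rw [Nat.cast_smul_eq_nsmul, Nat.cast_smul_eq_nsmul]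
    rw [hc, h1, map_sub, LinearMap.sub_apply, mul_sub, h2, h3, map_smul, LinearMap.smul_apply,
      smul_eq_mul, mul_left_comm, hcomp η hη]
    simp [Finsupp.single_apply]
    ring
  · intro y hy h
    refine mem_of_tmul_mem hy ?_
    rw [hexp y]
    refine Submodule.sum_mem _ fun i _ => ?_
    obtain ⟨z, hz⟩ := h i
    rw [hz]
    exact smul_mem _ z (b i).2

/-- The way back from coordinates on V to the completion: K_p is the preimage of the standard
lattice, although `Coord` demands density modulo p only. -/
theorem Coord.exists_equiv (hr : finrank ℚ V = 3) (h : Coord p B K D c) : ∃ e : (ℚ_[p] ⊗[ℚ]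
    V) ≃ₗ[ℚ_[p]] (Fin 3 → ℚ_[p]), (∀ ξ η, B.baseChange ℚ_[p] ξ η = ∑ i, (D i : ℚ_[p]) * e ξ i * e η
    i) ∧ ∀ ξ, ξ ∈ completion p K ↔ ∀ i, ∃ z : ℤ_[p], e ξ i = z := by
  have hfd : FiniteDimensional ℚ V := Module.finite_of_finrank_pos (by rw [hr]; norm_num)
  let e₀ : (ℚ_[p] ⊗[ℚ] V) →ₗ[ℚ_[p]] (Fin 3 → ℚ_[p]) :=
    TensorProduct.AlgebraTensorModule.lift
      ((LinearMap.toSpanSingleton ℚ_[p] (V →ₗ[ℚ] (Fin 3 → ℚ_[p])) c))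
  have he₀ : ∀ (a : ℚ_[p]) (x : V), e₀ (a ⊗ₜ x) = a • c x := fun a x => rfl
  have hgram : ∀ ξ η, B.baseChange ℚ_[p] ξ η = ∑ i, (D i : ℚ_[p]) * e₀ ξ i * e₀ η i := by
    intro ξ η
    induction ξ using induction_on with
    | zero => simp
    | add a b ha hb =>
      rw [map_add, LinearMap.add_apply, ha, hb, map_add, ← sum_add_distrib]
      refine sum_congr rfl fun i _ => ?_
      rw [Pi.add_apply]; ring
    | tmul a x =>
      induction η using induction_on with
      | zero => simp
      | add u v hu hv =>
        rw [map_add, hu, hv, map_add, ← sum_add_distrib]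
        refine sum_congr rfl fun i _ => ?_
        rw [Pi.add_apply]; ring
      | tmul b y =>
        rw [LinearMap.BilinForm.baseChange_tmul, he₀, he₀, smul_def, eq_ratCast, h.gram,
          sum_mul]
        refine sum_congr rfl fun i _ => ?_
        simp
        ring
  choose x hx z hz using fun j : Fin 3 => h.dense (Pi.single j 1)
  -- The columns are the coordinates of vectors of K that approximate the unit vectors. As A ≡ 1 mod
  -- p, it is invertible over ℤ_p, so these vectors form a basis of the standard lattice.
  let A : Matrix (Fin 3) (Fin 3) ℤ_[p] := 1 + (p : ℤ_[p]) • Matrix.of fun i j => z j i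
  have hA : IsUnit A.det := by
    rw [← IsLocalRing.residue_ne_zero_iff_isUnit, RingHom.map_det]
    have : (IsLocalRing.residue ℤ_[p]).mapMatrix A = 1 := by
      ext i j
      have h0 : IsLocalRing.residue ℤ_[p] (p : ℤ_[p]) = 0 := by
        rw [IsLocalRing.residue_eq_zero_iff, PadicInt.maximalIdeal_eq_span_p]
        simp
      simp [A, map_add, h0]
    simp_all
  have hAc : ∀ i j, c (x j) i = (A i j : ℚ_[p]) := by
    intro i j
    rw [hz j i]
    simp [A, Matrix.one_apply, Pi.single_apply]
  have key : ∀ w : Fin 3 → ℤ_[p], ∃ v : Fin 3 → ℤ_[p],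
      e₀ (∑ j, v j • ((1 : ℚ_[p]) ⊗ₜ[ℚ] x j)) = fun i => (w i : ℚ_[p]) := by
    intro w
    refine ⟨A⁻¹ *ᵥ w, ?_⟩
    have h1 : A *ᵥ (A⁻¹ *ᵥ w) = w := by simp_all
    set v := A⁻¹ *ᵥ w
    ext i
    rw [← h1, map_sum, Finset.sum_apply]
    have : ∀ j, e₀ (v j • ((1 : ℚ_[p]) ⊗ₜ[ℚ] x j)) i = ((A i j * v j : ℤ_[p]) : ℚ_[p]) := by
      intro j
      have h2 : v j • ((1 : ℚ_[p]) ⊗ₜ[ℚ] x j) = (v j : ℚ_[p]) • ((1 : ℚ_[p]) ⊗ₜ[ℚ] x j) := rfl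
      rw [h2, map_smul, he₀]
      simp [hAc, mul_comm]
    simp only [this, Matrix.mulVec, dotProduct]
    simp
  have hsurj : Surjective e₀ := by
    intro w
    rw [← LinearMap.mem_range]
    have h1 : ∀ i, (Pi.single i (1 : ℚ_[p]) : Fin 3 → ℚ_[p]) ∈ LinearMap.range e₀ := by
      intro i
      obtain ⟨v, hv⟩ := key (Pi.single i 1)
      refine ⟨_, hv.trans ?_⟩
      ext j
      by_cases hj : j = i
      · subst hj; simp
      · simp [hj]
    rw [← Finset.univ_sum_single w]
    refine Submodule.sum_mem _ fun i _ => ?_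
    have : (Pi.single i (w i) : Fin 3 → ℚ_[p]) = w i • Pi.single i 1 := by
      rw [← Pi.single_smul]; simp
    rw [this]
    exact smul_mem _ _ (h1 i)
  have hdim : finrank ℚ_[p] (ℚ_[p] ⊗[ℚ] V) = finrank ℚ_[p] (Fin 3 → ℚ_[p]) := by simp_all
  have hinj : Injective e₀ :=
    (LinearMap.injective_iff_surjective_of_finrank_eq_finrank hdim).2 hsurj
  refine ⟨LinearEquiv.ofBijective e₀ ⟨hinj, hsurj⟩, hgram, fun ξ => ⟨fun hξ => ?_, fun hξ => ?_⟩⟩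
  · change ∀ i, ∃ z : ℤ_[p], e₀ ξ i = z
    induction hξ using span_induction with
    | mem ξ hξ =>
      obtain ⟨y, hy, rfl⟩ := hξ
      intro i
      obtain ⟨z, hz⟩ := h.int y hy i
      exact ⟨z, by rw [he₀, one_smul, hz]⟩
    | zero => exact fun i => ⟨0, by simp⟩
    | add a b _ _ ha hb =>
      intro i
      obtain ⟨z, hz⟩ := ha i
      obtain ⟨w, hw⟩ := hb i
      exact ⟨z + w, by rw [map_add, Pi.add_apply, hz, hw]; simp⟩
    | smul r a _ ha =>
      intro i
      obtain ⟨z, hz⟩ := ha i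
      have h2 : r • a = (r : ℚ_[p]) • a := rfl
      exact ⟨r * z, by rw [h2, map_smul, Pi.smul_apply, hz]; simp⟩
  · choose w hw using hξ
    obtain ⟨v, hv⟩ := key w
    have : ξ = ∑ j, v j • ((1 : ℚ_[p]) ⊗ₜ[ℚ] x j) := by
      apply hinj
      rw [hv]
      ext i
      exact hw i
    rw [this]
    exact Submodule.sum_mem _ fun j _ => smul_mem _ _ (tmul_mem_completion (hx j))

theorem Coord.locallyIsometric (hr : finrank ℚ V = 3) (h : Coord p B K D c) (h' : Coord p B
    M D c') : LocallyIsometric B p K M := by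
  obtain ⟨e, he, hK⟩ := h.exists_equiv hr
  obtain ⟨e', he', hM⟩ := h'.exists_equiv hr
  refine ⟨e.trans e'.symm, fun x y => ?_, ?_⟩
  · rw [he' (e.trans e'.symm x), he x y]
    simp
  · ext ξ
    simp only [Set.mem_image, SetLike.mem_coe]
    constructor
    · rintro ⟨η, hη, rfl⟩
      simp_all
    · intro hξ
      refine ⟨(e.trans e'.symm).symm ξ, ?_, by simp⟩
      simp_all

theorem LocallyIsometric.hasJordan (h : LocallyIsometric B p L M) {α β : ℕ} {ε₁ ε₂ ε₃ : ℤ_[p]ˣ} (hL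
    : HasJordan B p L α β ε₁ ε₂ ε₃) : HasJordan B p M α β ε₁ ε₂ ε₃ := by
  obtain ⟨σ, hσ, hσL⟩ := h
  obtain ⟨hαβ, b, hb⟩ := hL
  let s := σ.restrictScalars ℤ_[p]
  have hs : Submodule.map (s : (ℚ_[p] ⊗[ℚ] V) →ₗ[ℤ_[p]] _) (completion p L) = completion p M :=
    SetLike.coe_injective hσL
  refine ⟨hαβ, b.map (s.ofSubmodules _ _ hs), fun i j => ?_⟩
  rw [← hb i j, ← hσ (b i) (b j)]
  rfl

/-- For q ≠ p the number p is a unit in ℤ_q, so an index that is a power of p is invisible at q. -/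
theorem completion_eq_of_smul_mem {q : ℕ} [Fact q.Prime] (hq : q ≠ p) (h1 : N ≤ M) (h2 : ∀ x ∈ M,
    (p : ℤ) • x ∈ N) : completion q M = completion q N := by
  apply le_antisymm
  · refine span_le.2 ?_
    rintro _ ⟨x, hx, rfl⟩
    have hu : IsUnit (p : ℤ_[q]) := by
      rw [PadicInt.isUnit_iff]
      have := (PadicInt.norm_int_lt_one_iff_dvd (p := q) (p : ℤ)).not.2 (by
        intro h
        have h3 : q ∣ p := by exact_mod_cast h
        exact hq ((Nat.prime_dvd_prime_iff_eq Fact.out Fact.out).1 h3))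
      push_cast at this
      exact le_antisymm (PadicInt.norm_le_one _) (not_lt.1 this)
    obtain ⟨u, hu⟩ := hu
    have h3 := tmul_mem_completion (p := q) (h2 x hx)
    have h4 : (1 : ℚ_[q]) ⊗ₜ[ℚ] ((p : ℤ) • x) = (u : ℤ_[q]) • ((1 : ℚ_[q]) ⊗ₜ[ℚ] x) := by
      rw [hu, tmul_smul, natCast_zsmul, Nat.cast_smul_eq_nsmul]
    rw [h4] at h3
    have h5 := smul_mem _ (↑u⁻¹ : ℤ_[q]) h3
    rwa [smul_smul, Units.inv_mul, one_smul] at h5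
  · exact Submodule.span_mono (Set.image_mono h1)

/-! ### Divisibility of inner products and Λ_p -/

/-- `q` is an integer divisible by `p ^ j`. -/
def Dv (p j : ℕ) (q : ℚ) : Prop := ∃ k : ℤ, q = (p : ℚ) ^ j * k

theorem Dv.add {p j : ℕ} {q r : ℚ} (h : Dv p j q) (h' : Dv p j r) : Dv p j (q + r) := by
  obtain ⟨k, rfl⟩ := h
  obtain ⟨l, rfl⟩ := h'
  exact ⟨k + l, by push_cast; ring⟩

theorem Dv.int_mul {p j : ℕ} {q : ℚ} (h : Dv p j q) (n : ℤ) : Dv p j (n * q) := by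
  obtain ⟨k, rfl⟩ := h
  exact ⟨n * k, by push_cast; ring⟩

theorem Dv.mono {p j i : ℕ} {q : ℚ} (h : Dv p j q) (hi : i ≤ j) : Dv p i q := by
  obtain ⟨k, rfl⟩ := h
  refine ⟨p ^ (j - i) * k, ?_⟩
  push_cast
  rw [← mul_assoc, ← pow_add, Nat.add_sub_cancel' hi]

theorem dv_intCast_iff {p : ℕ} (hp : p ≠ 0) {j : ℕ} {k : ℤ} : Dv p j k ↔ (p : ℤ) ^ j ∣ k := by
  constructor
  · rintro ⟨m, hm⟩
    exact ⟨m, by exact_mod_cast hm⟩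
  · rintro ⟨m, rfl⟩
    exact ⟨m, by push_cast; ring⟩

theorem prime_ne_zero' (p : ℕ) [Fact p.Prime] : p ≠ 0 := (Fact.out : p.Prime).ne_zero

theorem dv_iff_padic : Dv p j k ↔ (p : ℤ_[p]) ^ j ∣ k := by
  rw [pow_p_dvd_int_iff, dv_intCast_iff (prime_ne_zero' p)]

theorem Coord.exists_int (h : Coord p B K D c) (hx : x ∈ K) : ∃ z : Fin 3 → ℤ_[p], ∀ i, c x i = z i
    :=
  ⟨fun i => (h.int x hx i).choose, fun i => (h.int x hx i).choose_spec⟩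

theorem Coord.gram_int (h : Coord p B K D c) {z w : Fin 3 → ℤ_[p]} (hz : ∀ i, c x i = z i) (hw : ∀
    i, c y i = w i) (hk : B x y = k) : (k : ℤ_[p]) = ∑ i, D i * z i * w i := by
  have h1 := h.gram x y
  apply PadicInt.ext
  simp_all

/-- Induction on j. A test vector that approximates the i-th unit vector is available only modulo p;
since the D_l z_l are already divisible by p^j, the error contributes a multiple of p^(j+1). -/
theorem Coord.dvd_iff (h : Coord p B K D c) (hK : IntLattice B K) (hx : x ∈ K) {z : Fin 3 → ℤ_[p]}
    (hz : ∀ i, c x i = z i) (j : ℕ) : (∀ y ∈ K, Dv p j (B x y)) ↔ ∀ i, (p : ℤ_[p]) ^ j ∣ D i * z i := by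
  constructor
  · intro hd
    induction j with
    | zero => simp
    | succ j ih =>
      have h1 := ih fun y hy => (hd y hy).mono (Nat.le_succ j)
      choose m hm using h1
      intro i
      obtain ⟨y, hy, hyi⟩ := h.dense (Pi.single i 1)
      choose t ht using hyi
      obtain ⟨k, hk⟩ := hK.int x hx y hy
      have h2 := hd y hy
      rw [hk, dv_iff_padic] at h2
      have h3 := h.gram_int hz (w := fun l => (Pi.single i 1 : Fin 3 → ℤ_[p]) l + p * t l) (fun l => by
        rw [ht l]; push_cast; rfl) hk
      have h4 : ∑ l, D l * z l * ((Pi.single i 1 : Fin 3 → ℤ_[p]) l + p * t l) =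
          D i * z i + (p : ℤ_[p]) ^ (j + 1) * ∑ l, m l * t l := by
        simp [mul_add, sum_add_distrib]
        congr 1
        · rw [Finset.sum_eq_single i]
          · simp
          · simp_all
          · simp
        · rw [mul_sum]
          grind
      rw [h3, h4] at h2
      exact (dvd_add_left (Dvd.intro _ rfl)).1 h2
  · intro hd y hy
    obtain ⟨w, hw⟩ := h.exists_int hy
    obtain ⟨k, hk⟩ := hK.int x hx y hy
    rw [hk, dv_iff_padic, h.gram_int hz hw hk]
    exact dvd_sum fun i _ => (hd i).mul_right _

/-- Taking y = 0 gives Q(x) ≡ 0, and then 2B(x, y) ≡ 0 for all y. For odd p this makes Λ_p(K) the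
radical of B modulo p. -/
theorem mem_watson_iff (hp : p ≠ 2) (hK : IntLattice B K) : x ∈ watson B p K ↔ x ∈ K ∧ ∀ y ∈ K, Dv
    p 1 (B x y) := by
  change (_ ∧ _) ↔ _
  have hpp : p.Prime := Fact.out
  have hB := hK.pd
  have hexp : ∀ x y, B (x + y) (x + y) - B y y = B x x + 2 * B x y := by
    intro x y
    simp [hB.symm y x]
    ring
  refine and_congr_right fun hx => ⟨fun h y hy => ?_, fun h y hy => ?_⟩
  · obtain ⟨k, hk⟩ := h 0 K.zero_mem
    obtain ⟨l, hl⟩ := h y hy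
    obtain ⟨m, hm⟩ := hK.int x hx y hy
    rw [hexp] at hl hk
    simp at hk
    have h2 : 2 * m = p * (l - k) := by
      have : (2 : ℚ) * m = p * (l - k) := by rw [← hm]; linarith
      exact_mod_cast this
    have h3 : (p : ℤ) ∣ 2 * m := ⟨_, h2⟩
    have h4 : (p : ℤ) ∣ m := by
      refine (Int.Prime.dvd_mul' hpp h3).resolve_left fun h5 => hp ?_
      exact (Nat.prime_dvd_prime_iff_eq hpp Nat.prime_two).1 (by exact_mod_cast h5)
    rw [hm, dv_intCast_iff hpp.ne_zero, pow_one]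
    exact h4
  · rw [hexp]
    obtain ⟨k, hk⟩ := h x hx
    obtain ⟨l, hl⟩ := h y hy
    exact ⟨k + 2 * l, by rw [hk, hl]; push_cast; ring⟩

theorem watson_le : watson B p K ≤ K := fun _ hx => hx.1

theorem smul_mem_watson (hK : IntLattice B K) (hx : x ∈ K) : (p : ℤ) • x ∈ watson B p K := by
  refine ⟨K.smul_mem _ hx, fun y hy => ?_⟩
  obtain ⟨k, hk⟩ := hK.int x hx x hx
  obtain ⟨l, hl⟩ := hK.int x hx y hy
  refine ⟨p * k + 2 * l, ?_⟩
  rw [← cast_smul_eq_zsmul ℚ]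
  simp only [map_add, map_smul, LinearMap.add_apply, LinearMap.smul_apply, smul_eq_mul,
    hK.pd.symm y x, hk, hl]
  push_cast
  ring

theorem IntLattice.of_smul_mem (hK : IntLattice B K) (h1 : N ≤ K) (h2 : ∀ x ∈ K, (p : ℤ) • x ∈ N) :
    IntLattice B N := by
  refine ⟨hK.pd, hK.rank, ⟨?_, ?_⟩, fun x hx y hy => hK.int x (h1 hx) y (h1 hy)⟩
  · have := hK.lat
    have hn : IsNoetherian ℤ K := isNoetherian_of_isNoetherianRing_of_finite ℤ K
    exact (isNoetherian_submodule.1 hn) N h1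
  · rw [eq_top_iff, ← hK.lat.span_eq_top]
    refine span_le.2 fun x hx => ?_
    have h3 := subset_span (R := ℚ) (h2 x hx)
    have hp0 : ((p : ℤ) : ℚ) ≠ 0 := by exact_mod_cast prime_ne_zero' p
    rw [← cast_smul_eq_zsmul ℚ] at h3
    simp_all

theorem watson_int (hK : IntLattice B K) : IntLattice B (watson B p K) :=
  hK.of_smul_mem watson_le fun _ => smul_mem_watson hK

/-! ### The lattices above N -/

/-- The diagonal form with exponents `a` and units `ε`. -/
noncomputable def diagForm (p : ℕ) [Fact p.Prime] (a : Fin 3 → ℕ) (ε : Fin 3 → ℤ_[p]ˣ) (i : Fin 3) : ℤ_[p] :=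
  (p : ℤ_[p]) ^ a i * ε i

/-- The integral lattices `M` with `Λ_p(M) = N` and a Jordan decomposition with diagonal `D`. -/
def fiber (p : ℕ) [Fact p.Prime] (B : BilinForm ℚ V) (N : Submodule ℤ V)
    (D : Fin 3 → ℤ_[p]) : Set (Submodule ℤ V) :=
  {M | IntLattice B M ∧ watson B p M = N ∧ ∃ c, Coord p B M D c}

theorem diagForm_ne_zero (a : Fin 3 → ℕ) (ε : Fin 3 → ℤ_[p]ˣ) (i : Fin 3) :
    diagForm p a ε i ≠ 0 :=
  mul_ne_zero (pow_ne_zero _ (by exact_mod_cast prime_ne_zero' p)) (ε i).ne_zero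

theorem HasJordan.exists_coord [IsLattice ℚ M] {α β : ℕ} {ε₁ ε₂ ε₃ : ℤ_[p]ˣ}
    (h : HasJordan B p M α β ε₁ ε₂ ε₃) :
    ∃ c, Coord p B M (diagForm p ![0, α, β] ![ε₁, ε₂, ε₃]) c := by
  obtain ⟨-, b, hb⟩ := h
  refine TernaryLattice.exists_coord (diagForm_ne_zero _ _) b fun i j => ?_
  rw [hb]
  congr 1
  congr 1
  ext i
  fin_cases i <;> simp [diagForm]

theorem rat_eq_int_of_padic {q : ℚ} (h : ∀ (r : ℕ) [Fact r.Prime], ‖(q : ℚ_[r])‖ ≤ 1) :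
    ∃ k : ℤ, q = k := by
  have h1 : q.den = 1 := by
    by_contra hd
    obtain ⟨r, hr, hrd⟩ := Nat.exists_prime_and_dvd hd
    have : Fact r.Prime := ⟨hr⟩
    have h2 := PadicInt.isUnit_den q (h r)
    rw [PadicInt.isUnit_iff] at h2
    have h3 := (PadicInt.norm_int_lt_one_iff_dvd (p := r) (q.den : ℤ)).2 (by exact_mod_cast hrd)
    push_cast at h3
    linarith
  exact ⟨q.num, (Rat.den_eq_one_iff q |>.1 h1).symm⟩

/-- The values of B on M are integral at every prime, by the local isometries with L, and such
rational numbers are integers. -/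
theorem mem_genus_int (hL : IntLattice B L) (hM : M ∈ genus B L) : IntLattice B M := by
  refine ⟨hL.pd, hL.rank, hM.1, fun x hx y hy => rat_eq_int_of_padic fun r _ => ?_⟩
  obtain ⟨σ, hσ, hLM⟩ := hM.2 r
  have key : ∀ ξ ∈ completion r L, ∀ η ∈ completion r L,
      ∃ z : ℤ_[r], B.baseChange ℚ_[r] ξ η = z := by
    intro ξ hξ η hη
    induction hξ using span_induction with
    | mem ξ h =>
      obtain ⟨x, hx, rfl⟩ := h
      induction hη using span_induction with
      | mem η h =>
        obtain ⟨y, hy, rfl⟩ := h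
        obtain ⟨k, hk⟩ := hL.int x hx y hy
        refine ⟨k, ?_⟩
        simp_all
      | zero => exact ⟨0, by simp⟩
      | add a b _ _ ha hb =>
        obtain ⟨z, hz⟩ := ha
        obtain ⟨w, hw⟩ := hb
        exact ⟨z + w, by rw [map_add, hz, hw]; simp⟩
      | smul t a _ ha =>
        obtain ⟨z, hz⟩ := ha
        have h2 : t • a = (t : ℚ_[r]) • a := rfl
        exact ⟨t * z, by rw [h2, map_smul, hz]; simp⟩
    | zero => exact ⟨0, by simp⟩
    | add a b _ _ ha hb =>
      obtain ⟨z, hz⟩ := ha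
      obtain ⟨w, hw⟩ := hb
      exact ⟨z + w, by rw [map_add, LinearMap.add_apply, hz, hw]; simp⟩
    | smul t a _ ha =>
      obtain ⟨z, hz⟩ := ha
      have h2 : t • a = (t : ℚ_[r]) • a := rfl
      exact ⟨t * z, by rw [h2, map_smul, LinearMap.smul_apply, hz]; simp⟩
  have hx' : (1 : ℚ_[r]) ⊗ₜ[ℚ] x ∈ σ '' (completion r L : Set _) := by
    rw [hLM]; exact tmul_mem_completion hx
  have hy' : (1 : ℚ_[r]) ⊗ₜ[ℚ] y ∈ σ '' (completion r L : Set _) := by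
    rw [hLM]; exact tmul_mem_completion hy
  obtain ⟨ξ, hξ, hξx⟩ := hx'
  obtain ⟨η, hη, hηy⟩ := hy'
  obtain ⟨z, hz⟩ := key ξ hξ η hη
  rw [← hσ, hξx, hηy, LinearMap.BilinForm.baseChange_tmul] at hz
  have h3 : ((B x y : ℚ) : ℚ_[r]) = z := by simp_all
  grind

/-- Both L and M lie between N and p⁻¹N, so their completions agree at all q ≠ p. The condition on
the genus reduces to a Jordan decomposition at p. -/
theorem gam_eq_fiber (hL : IntLattice B L) (hN : watson B p L = N) {α β : ℕ}
    {ε₁ ε₂ ε₃ : ℤ_[p]ˣ} (h : HasJordan B p L α β ε₁ ε₂ ε₃) :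
    Gam B p L N = fiber p B N (diagForm p ![0, α, β] ![ε₁, ε₂, ε₃]) := by
  ext M
  constructor
  · rintro ⟨hM, hw⟩
    have := hM.1
    exact ⟨mem_genus_int hL hM, hw, ((hM.2 p).hasJordan h).exists_coord⟩
  · rintro ⟨hM, hw, c, hc⟩
    have := hL.lat
    refine ⟨⟨hM.lat, fun q _ => ?_⟩, hw⟩
    by_cases hq : q = p
    · subst hq
      obtain ⟨c', hc'⟩ := h.exists_coord
      exact hc'.locallyIsometric hL.rank hc
    · have h1 : completion q L = completion q M := by
        rw [completion_eq_of_smul_mem hq (N := N) (hN ▸ watson_le)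
            fun x hx => hN ▸ smul_mem_watson hL hx,
          completion_eq_of_smul_mem hq (N := N) (hw ▸ watson_le)
            fun x hx => hw ▸ smul_mem_watson hM hx]
      exact ⟨LinearEquiv.refl _ _, fun _ _ => rfl, by rw [h1]; exact Set.image_id _⟩

/-- The lattice `N + ℤ p⁻¹ n`. -/
def overLat (p : ℕ) (N : Submodule ℤ V) (n : V) : Submodule ℤ V :=
  N ⊔ span ℤ {(p : ℚ)⁻¹ • n}

theorem mem_over : y ∈ overLat p N n ↔ ∃ m ∈ N, ∃ t : ℤ, y = m + t • (p : ℚ)⁻¹ • n := by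
  rw [overLat, Submodule.mem_sup]
  constructor
  · rintro ⟨m, hm, z, hz, rfl⟩
    obtain ⟨t, rfl⟩ := Submodule.mem_span_singleton.1 hz
    grind
  · rintro ⟨m, hm, t, rfl⟩
    exact ⟨m, hm, _, Submodule.mem_span_singleton.2 ⟨t, rfl⟩, rfl⟩

theorem le_over : N ≤ overLat p N n := le_sup_left

theorem inv_smul_mem_over : (p : ℚ)⁻¹ • n ∈ overLat p N n :=
  mem_over.2 ⟨0, N.zero_mem, 1, by simp⟩

theorem smul_smul_inv (n : V) : (p : ℤ) • (p : ℚ)⁻¹ • n = n := by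
  rw [← cast_smul_eq_zsmul ℚ, smul_smul, cast_natCast, mul_inv_cancel₀, one_smul]
  exact_mod_cast prime_ne_zero' p

theorem smul_mem_of_mem_over (hn : n ∈ N) (hy : y ∈ overLat p N n) : (p : ℤ) • y ∈ N := by
  obtain ⟨m, hm, t, rfl⟩ := mem_over.1 hy
  rw [smul_add, smul_comm, smul_smul_inv]
  exact N.add_mem (N.smul_mem _ hm) (N.smul_mem _ hn)

/-- `p⁻¹ n` may be adjoined to `N` so that `N` becomes the Watson transform, the diagonal entry
`u p ^ 2` being replaced by `u`. -/
structure Adjoinable (p : ℕ) (B : BilinForm ℚ V) (N : Submodule ℤ V) (u : ZMod p)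
    (n : V) : Prop where
  mem : n ∈ N
  dv : ∀ y ∈ N, Dv p 2 (B n y)
  norm : ∃ k : ℤ, B n n = (p : ℚ) ^ 2 * k ∧ (k : ZMod p) = u

theorem over_int (hN : IntLattice B N) {u : ZMod p} (hn : Adjoinable p B N u n) : IntLattice B
    (overLat p N n) := by
  have hp0 : (p : ℚ) ≠ 0 := by exact_mod_cast prime_ne_zero' p
  refine ⟨hN.pd, hN.rank, ?_, fun x hx y hy => ?_⟩
  · have := hN.lat
    refine IsLattice.of_le_of_isLattice_of_fg ℚ (M := N) le_over ?_
    exact hN.fg.sup (Submodule.fg_span_singleton _)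
  · obtain ⟨m, hm, t, rfl⟩ := mem_over.1 hx
    obtain ⟨m', hm', t', rfl⟩ := mem_over.1 hy
    obtain ⟨k, hk⟩ := hN.int m hm m' hm'
    obtain ⟨l, hl⟩ := hn.dv m hm
    obtain ⟨l', hl'⟩ := hn.dv m' hm'
    obtain ⟨q, hq, -⟩ := hn.norm
    refine ⟨k + t * p * l' + t' * p * l + t * t' * q, ?_⟩
    simp only [map_add, LinearMap.add_apply, ← cast_smul_eq_zsmul ℚ, map_smul,
      LinearMap.smul_apply, smul_eq_mul, hk, hl', hq, hN.pd.symm m n, hl]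
    push_cast
    grind

theorem zmod_intCast_eq_iff {z : ℤ_[p]} : (k : ZMod p) = toZMod z ↔ (p : ℤ_[p]) ∣ k - z := by
  rw [← sub_eq_zero, ← map_intCast (toZMod (p := p)), ← map_sub, ← RingHom.mem_ker,
    ker_toZMod, PadicInt.maximalIdeal_eq_span_p, Ideal.mem_span_singleton]

theorem toZMod_eq_zero_iff {z : ℤ_[p]} : toZMod z = 0 ↔ (p : ℤ_[p]) ∣ z := by
  rw [← RingHom.mem_ker, ker_toZMod, PadicInt.maximalIdeal_eq_span_p,
    Ideal.mem_span_singleton]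

theorem padicInt_eq_int_add (z : ℤ_[p]) : ∃ (t : ℤ) (w : ℤ_[p]), z = t + p * w := by
  obtain ⟨n, w, h⟩ := padicInt_eq_add_mul z
  exact ⟨n, w, by simpa using h⟩

theorem isUnit_of_toZMod_ne_zero {z : ℤ_[p]} (h : toZMod z ≠ 0) : IsUnit z := by
  by_contra hu
  apply h
  rw [← RingHom.mem_ker, ker_toZMod]
  exact hu

/-- The reflection along a p-adic vector z in coordinates. It is integral because the linear form
B(z, ·) is divisible by the full power p^j contained in Q(z), so composing with it gives new
coordinates for the same lattice. -/
theorem Coord.reflect (h : Coord p B N D c) {z g : Fin 3 → ℤ_[p]} {κ : ℤ_[p]ˣ} (hg : ∀ i, D i * z i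
    = (p : ℤ_[p]) ^ j * g i) (hκ : ∑ i, D i * z i * z i = (p : ℤ_[p]) ^ j * κ) : ∃ c', Coord p B N
    D c' ∧ ∀ x i, c' x i = c x i - 2 * (↑κ⁻¹ : ℤ_[p]) * (∑ l, (g l : ℚ_[p]) * c x l) * z i := by
  have hp0 : (p : ℚ_[p]) ≠ 0 := by exact_mod_cast prime_ne_zero' p
  let T : (Fin 3 → ℚ_[p]) →ₗ[ℚ_[p]] (Fin 3 → ℚ_[p]) := LinearMap.id -
    LinearMap.smulRight ((2 * ((↑κ⁻¹ : ℤ_[p]) : ℚ_[p])) • ∑ l, (g l : ℚ_[p]) • proj l)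
      (fun i => (z i : ℚ_[p]))
  have hT : ∀ v i, T v i = v i - 2 * ((↑κ⁻¹ : ℤ_[p]) : ℚ_[p]) * (∑ l, (g l : ℚ_[p]) * v l) * z i := by
    intro v i
    simp [T]
  have hκκ : ((κ : ℤ_[p]) : ℚ_[p]) * ((↑κ⁻¹ : ℤ_[p]) : ℚ_[p]) = 1 := by
    rw [← PadicInt.coe_mul, Units.mul_inv]; rfl
  have hg' : ∀ i, (D i : ℚ_[p]) * z i = (p : ℚ_[p]) ^ j * g i := by
    intro i
    have := congrArg (fun t : ℤ_[p] => (t : ℚ_[p])) (hg i)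
    simpa using this
  have hgz : ∑ l, (g l : ℚ_[p]) * z l = κ := by
    have h1 := congrArg (fun t : ℤ_[p] => (t : ℚ_[p])) hκ
    simp only [hg] at h1
    have h2 : (p : ℚ_[p]) ^ j * ∑ l, (g l : ℚ_[p]) * z l = (p : ℚ_[p]) ^ j * κ := by
      rw [mul_sum]
      push_cast at h1
      simpa [mul_assoc] using h1
    simp_all
  have hTT : ∀ v, T (T v) = v := by
    intro v
    ext i
    have h1 : ∑ l, (g l : ℚ_[p]) * T v l = -∑ l, (g l : ℚ_[p]) * v l := by
      have : ∀ l, (g l : ℚ_[p]) * T v l = g l * v l -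
          2 * ((↑κ⁻¹ : ℤ_[p]) : ℚ_[p]) * (∑ l, (g l : ℚ_[p]) * v l) * (g l * z l) := by
        intro l; rw [hT]; ring
      rw [sum_congr rfl fun l _ => this l, Finset.sum_sub_distrib, ← mul_sum, hgz]
      linear_combination (-2 * ∑ l, (g l : ℚ_[p]) * v l) * hκκ
    simp_all
  have hform : ∀ v w, ∑ i, (D i : ℚ_[p]) * T v i * T w i = ∑ i, (D i : ℚ_[p]) * v i * w i := by
    intro v w
    set sv := ∑ l, (g l : ℚ_[p]) * v l
    set sw := ∑ l, (g l : ℚ_[p]) * w l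
    set q := 2 * ((↑κ⁻¹ : ℤ_[p]) : ℚ_[p]) with hq
    have : ∀ i, (D i : ℚ_[p]) * T v i * T w i = D i * v i * w i
        - (p : ℚ_[p]) ^ j * q * sw * (g i * v i) - (p : ℚ_[p]) ^ j * q * sv * (g i * w i)
        + (p : ℚ_[p]) ^ j * q ^ 2 * sv * sw * (g i * z i) := by
      intro i
      rw [hT, hT]
      linear_combination (-q * sw * v i - q * sv * w i + q ^ 2 * sv * sw * z i) * hg' i
    rw [sum_congr rfl fun i _ => this i]
    simp [sum_add_distrib, ← mul_sum, hgz]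
    change _ - _ * sv - _ * sw + _ = _
    rw [hq]
    linear_combination (4 * (p : ℚ_[p]) ^ j * ((↑κ⁻¹ : ℤ_[p]) : ℚ_[p]) * sv * sw) * hκκ
  have hint : ∀ v : Fin 3 → ℚ_[p], (∀ i, ∃ t : ℤ_[p], v i = t) → ∀ i, ∃ t : ℤ_[p], T v i = t := by
    intro v hv i
    choose t ht using hv
    refine ⟨t i - 2 * (↑κ⁻¹ : ℤ_[p]) * (∑ l, g l * t l) * z i, ?_⟩
    rw [hT]
    simp only [ht]
    push_cast
    rfl
  refine ⟨T.restrictScalars ℚ ∘ₗ c, ⟨fun x y => ?_, fun x hx => ?_, fun u => ?_, fun y hy hi => ?_⟩,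
    fun x i => hT _ i⟩
  · rw [h.gram, ← hform]; rfl
  · exact hint _ (h.int x hx)
  · choose t ht using hint (fun i => (u i : ℚ_[p])) fun i => ⟨u i, rfl⟩
    obtain ⟨x, hx, hxi⟩ := h.dense t
    choose w hw using hxi
    refine ⟨x, hx, fun i => ?_⟩
    have h1 : c x = T (fun i => (u i : ℚ_[p])) + (p : ℚ_[p]) • fun i => (w i : ℚ_[p]) := by
      ext i
      simp_all
    obtain ⟨s, hs⟩ := hint (fun i => (w i : ℚ_[p])) (fun i => ⟨w i, rfl⟩) i
    refine ⟨s, ?_⟩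
    change T (c x) i = _
    rw [h1, map_add, map_smul, hTT, Pi.add_apply, Pi.smul_apply, hs, smul_eq_mul]
  · refine h.sat y hy fun i => ?_
    have := hint _ hi i
    change ∃ t : ℤ_[p], T (T (c y)) i = t at this
    rwa [hTT] at this

theorem pow_dvd_diag {a : ℕ} {ε : ℤ_[p]ˣ} {z : ℤ_[p]} : (p : ℤ_[p]) ^ j ∣ (p : ℤ_[p]) ^ a * ε * z ↔
    (p : ℤ_[p]) ^ (j - a) ∣ z := by
  have hp0 : (p : ℤ_[p]) ≠ 0 := by exact_mod_cast prime_ne_zero' p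
  rcases le_total j a with h | h
  · rw [Nat.sub_eq_zero_of_le h, pow_zero]
    simp
    exact ((pow_dvd_pow _ h).mul_right _).mul_right _
  · obtain ⟨i, rfl⟩ := Nat.exists_eq_add_of_le h
    rw [Nat.add_sub_cancel_left, pow_add, mul_assoc, mul_dvd_mul_iff_left (pow_ne_zero _ hp0),
      Units.dvd_mul_left]

/-- A local form of Witt's theorem: n and the first basis vector e₀ have the same norm modulo p³, so
the reflection along n - se₀ carries n to se₀ up to multiples of p. -/
theorem Adjoinable.straighten (hp : p ≠ 2) (hN : IntLattice B N) (ha : a 0 = 2) (h : Coord p B N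
    (diagForm p a ε) c) (hn : Adjoinable p B N (toZMod (ε 0 : ℤ_[p])) n) : ∃ c', Coord p B
    N (diagForm p a ε) c' ∧ ∃ (s : ℤ_[p]) (m : Fin 3 → ℤ_[p]), s * s = 1 ∧ ∀ i, c' n i = (Pi.single
    0 s : Fin 3 → ℤ_[p]) i + p * m i := by
  have hp0 : (p : ℤ_[p]) ≠ 0 := by exact_mod_cast prime_ne_zero' p
  have hp2 : ((p : ℤ_[p]) ^ 2) ≠ 0 := pow_ne_zero _ hp0
  obtain ⟨w, hw⟩ := h.exists_int hn.mem
  obtain ⟨k, hk, hku⟩ := hn.norm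
  have hdv := (h.dvd_iff hN hn.mem hw 2).1 hn.dv
  choose f hf using hdv
  have hD0 : diagForm p a ε 0 = (p : ℤ_[p]) ^ 2 * ε 0 := by rw [diagForm, ha]
  have hnorm : (p : ℤ_[p]) ^ 2 * k = ∑ i, diagForm p a ε i * w i * w i := by
    have := h.gram_int hw hw (k := p ^ 2 * k) (by rw [hk]; push_cast; rfl)
    simp_all
  obtain ⟨t, ht⟩ := zmod_intCast_eq_iff.1 hku
  have h2 : (2 : ZMod p) ≠ 0 := by
    intro h2
    have : p ∣ 2 := (natCast_eq_zero_iff 2 p).1 (by exact_mod_cast h2)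
    exact hp ((Nat.prime_dvd_prime_iff_eq Fact.out Nat.prime_two).1 this)
  obtain ⟨s, hs, hsw⟩ : ∃ s : ℤ_[p], s * s = 1 ∧ toZMod (1 - s * w 0) ≠ 0 := by
    by_cases h1 : toZMod (w 0) = 1
    · refine ⟨-1, by ring, ?_⟩
      grind
    · refine ⟨1, by ring, ?_⟩
      grind
  let e : Fin 3 → ℤ_[p] := Pi.single 0 s
  have he0 : e 0 = s := by simp [e]
  have he1 : e 1 = 0 := by simp [e]
  have he2 : e 2 = 0 := by simp [e]
  have hκu : IsUnit ((k : ℤ_[p]) - 2 * s * ε 0 * w 0 + ε 0) := by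
    apply isUnit_of_toZMod_ne_zero
    have h3 : ((k : ℤ_[p]) - 2 * s * ε 0 * w 0 + ε 0) = p * t + 2 * ε 0 * (1 - s * w 0) := by
      linear_combination ht
    have h4 : toZMod (ε 0 : ℤ_[p]) ≠ 0 :=
      ((ε 0).isUnit.map toZMod).ne_zero
    rw [h3]
    simp only [map_add, map_mul, map_natCast, CharP.cast_eq_zero, zero_mul, zero_add, map_ofNat]
    exact mul_ne_zero (mul_ne_zero h2 h4) hsw
  obtain ⟨κ, hκ⟩ := hκu
  have hs1 : ∀ F : Fin 3 → ℤ_[p], ∑ i, F i = F 0 + F 1 + F 2 := fun F => sum_univ_three F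
  rw [hs1] at hnorm
  obtain ⟨c', hc', hx⟩ := h.reflect (z := fun i => w i - e i) (g := fun i => f i - ε 0 * e i)
    (κ := κ) (j := 2) (fun i => by
      fin_cases i
      · grind
      · simp_all
      · simp only [Fin.reduceFinMk, he2]
        rw [mul_sub, hf]
        ring) (by
      rw [hκ, hs1, he0, he1, he2]
      grind)
  have hgw : 2 * ∑ l, (f l - ε 0 * e l) * w l = κ + p * t := by
    apply mul_left_cancel₀ hp2
    rw [hκ, hs1, he0, he1, he2]
    grind
  refine ⟨c', hc', s, fun i => -(↑κ⁻¹ : ℤ_[p]) * t * (w i - e i), hs, fun i => ?_⟩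
  have hκκ : (κ : ℤ_[p]) * (↑κ⁻¹ : ℤ_[p]) = 1 := Units.mul_inv κ
  rw [hx]
  simp only [hw]
  have h5 : w i - 2 * (↑κ⁻¹ : ℤ_[p]) * (∑ l, (f l - ε 0 * e l) * w l) * (w i - e i)
      = e i + p * (-(↑κ⁻¹ : ℤ_[p]) * t * (w i - e i)) := by grind
  have := congrArg (fun t : ℤ_[p] => (t : ℚ_[p])) h5
  push_cast at this ⊢
  exact this

/-- Once n is ±e₀ modulo p, adjoining p⁻¹n means allowing a denominator p in the coordinate 0.
Multiplying this coordinate by p gives coordinates of the new lattice and turns p²ε₀ into ε₀; N is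
recovered as the part where the new coordinate is divisible by p. -/
theorem Coord.over (hp : p ≠ 2) (hN : IntLattice B N) (ha : a 0 = 2) (ha' : a' 0 = 0) (h1 : a' 1 =
    a 1) (h2 : a' 2 = a 2) (h : Coord p B N (diagForm p a ε) c) (hn : Adjoinable p B N
    (toZMod (ε 0 : ℤ_[p])) n) : ∃ c', Coord p B (overLat p N n) (diagForm p a' ε) c' ∧ ∀ y
    ∈ overLat p N n, (∃ z : ℤ_[p], c' y 0 = p * z) → y ∈ N := by
  have hp0 : (p : ℚ_[p]) ≠ 0 := by exact_mod_cast prime_ne_zero' p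
  obtain ⟨c₁, hc₁, s, m, hs, hm⟩ := hn.straighten hp hN ha h
  let S : (Fin 3 → ℚ_[p]) →ₗ[ℚ_[p]] (Fin 3 → ℚ_[p]) :=
    LinearMap.pi ![(p : ℚ_[p]) • proj 0, proj 1, proj 2]
  let c' : V →ₗ[ℚ] (Fin 3 → ℚ_[p]) := S.restrictScalars ℚ ∘ₗ c₁
  have e0 : ∀ x, c' x 0 = p * c₁ x 0 := fun x => by simp [c', S]
  have e1 : ∀ x, c' x 1 = c₁ x 1 := fun x => by simp [c', S]
  have e2 : ∀ x, c' x 2 = c₁ x 2 := fun x => by simp [c', S]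
  have hinv : ∀ (t : ℤ) i, c₁ (t • (p : ℚ)⁻¹ • n) i = t * ((p : ℚ_[p])⁻¹ * c₁ n i) := by
    intro t i
    rw [← cast_smul_eq_zsmul ℚ, map_smul, map_smul, Pi.smul_apply, Pi.smul_apply]
    simp [smul_def]
  have m0 : c₁ n 0 = s + p * m 0 := by rw [hm]; simp
  have m1 : c₁ n 1 = p * m 1 := by rw [hm]; simp
  have m2 : c₁ n 2 = p * m 2 := by rw [hm]; simp
  have forall3 : ∀ P : Fin 3 → Prop, P 0 → P 1 → P 2 → ∀ i, P i := by
    intro P h0 h1 h2 i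
    fin_cases i <;> assumption
  have hback : ∀ y ∈ overLat p N n, (∃ z : ℤ_[p], c₁ y 0 = z) → y ∈ N := by
    intro y hy ⟨z0, hz0⟩
    obtain ⟨x, hx, t, rfl⟩ := mem_over.1 hy
    obtain ⟨z, hz⟩ := hc₁.exists_int hx
    refine hc₁.sat _ (smul_mem_of_mem_over hn.mem hy) (forall3 _ ⟨z0, hz0⟩
      ⟨z 1 + t * m 1, ?_⟩ ⟨z 2 + t * m 2, ?_⟩)
    · rw [map_add, Pi.add_apply, hinv, m1, hz]
      simp_all
    · rw [map_add, Pi.add_apply, hinv, m2, hz]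
      simp_all
  refine ⟨c', ⟨fun x y => ?_, fun y hy => ?_, fun u => ?_, fun y hy hi => ?_⟩, fun y hy hz => ?_⟩
  · rw [hc₁.gram, sum_univ_three, sum_univ_three, e0, e0, e1, e1, e2, e2]
    simp only [diagForm, ha, ha', h1, h2]
    push_cast
    ring
  · obtain ⟨x, hx, t, rfl⟩ := mem_over.1 hy
    obtain ⟨z, hz⟩ := hc₁.exists_int hx
    refine forall3 _ ⟨p * z 0 + t * (s + p * m 0), ?_⟩ ⟨z 1 + t * m 1, ?_⟩ ⟨z 2 + t * m 2, ?_⟩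
    · rw [e0, map_add, Pi.add_apply, hinv, m0, hz]
      push_cast
      field_simp
    · rw [e1, map_add, Pi.add_apply, hinv, m1, hz]
      simp_all
    · rw [e2, map_add, Pi.add_apply, hinv, m2, hz]
      simp_all
  · obtain ⟨t, r, ht⟩ := padicInt_eq_int_add (s * u 0)
    obtain ⟨x, hx, hxi⟩ := hc₁.dense ![0, u 1 - t * m 1, u 2 - t * m 2]
    choose z hz using hxi
    refine ⟨x + t • (p : ℚ)⁻¹ • n, mem_over.2 ⟨x, hx, t, rfl⟩,
      forall3 _ ⟨p * z 0 - s * r + t * m 0, ?_⟩ ⟨z 1, ?_⟩ ⟨z 2, ?_⟩⟩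
    · have h3 : (s : ℚ_[p]) * t = u 0 - p * s * r := by
        have h4 : s * t = u 0 - p * s * r := by linear_combination u 0 * hs - s * ht
        have := congrArg (fun t : ℤ_[p] => (t : ℚ_[p])) h4
        simpa using this
      rw [e0, map_add, Pi.add_apply, hinv, m0, hz]
      simp only [Matrix.cons_val_zero]
      push_cast
      field_simp
      linear_combination h3
    · rw [e1, map_add, Pi.add_apply, hinv, m1, hz]
      simp only [Matrix.cons_val_one, Matrix.cons_val_zero]
      push_cast
      field_simp
      ring
    · rw [e2, map_add, Pi.add_apply, hinv, m2, hz]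
      simp only [Matrix.cons_val]
      push_cast
      field_simp
      ring
  · obtain ⟨z0, hz0⟩ := hi 0
    obtain ⟨z1, hz1⟩ := hi 1
    obtain ⟨z2, hz2⟩ := hi 2
    rw [e0] at hz0
    rw [e1] at hz1
    rw [e2] at hz2
    obtain ⟨t, r, ht⟩ := padicInt_eq_int_add (s * z0)
    have h3 : (s : ℚ_[p]) * t = z0 - p * s * r := by
      have h4 : s * t = z0 - p * s * r := by linear_combination z0 * hs - s * ht
      have := congrArg (fun t : ℤ_[p] => (t : ℚ_[p])) h4
      simpa using this
    set x := y - t • (p : ℚ)⁻¹ • n with hxdef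
    have hx0 : c₁ x 0 = ((s * r - t * m 0 : ℤ_[p]) : ℚ_[p]) := by
      rw [hxdef, map_sub, Pi.sub_apply, hinv, m0]
      push_cast
      field_simp
      linear_combination hz0 - h3
    have hx : ∀ i, ∃ z : ℤ_[p], c₁ x i = z := by
      refine forall3 _ ⟨_, hx0⟩ ⟨z1 - t * m 1, ?_⟩ ⟨z2 - t * m 2, ?_⟩
      · rw [hxdef, map_sub, Pi.sub_apply, hinv, m1, hz1]
        simp_all
      · rw [hxdef, map_sub, Pi.sub_apply, hinv, m2, hz2]
        simp_all
    -- The field `sat` applies only once p • x is known to lie in N. This holds because p • x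
    -- belongs to the larger lattice and has integral coordinates.
    have hpx : (p : ℤ) • x ∈ overLat p N n := by
      rw [hxdef, smul_sub]
      refine Submodule.sub_mem _ hy (smul_mem _ _ (smul_mem _ _
        inv_smul_mem_over))
    have hpx' : (p : ℤ) • x ∈ N := by
      refine hback _ hpx ⟨p * (s * r - t * m 0), ?_⟩
      rw [map_zsmul, Pi.smul_apply, hx0]
      simp
    have hxN := hc₁.sat x hpx' hx
    exact mem_over.2 ⟨x, hxN, t, by rw [hxdef]; abel⟩
  · obtain ⟨z, hz⟩ := hz
    rw [e0] at hz
    exact hback y hy ⟨z, mul_left_cancel₀ hp0 hz⟩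

/-- In the new lattice only the coordinate 0 has a unit on the diagonal, so membership in Λ_p means
that this coordinate is divisible by p. -/
theorem watson_over (hp : p ≠ 2) (hN : IntLattice B N) (ha : a 0 = 2) (ha' : a' 0 = 0) (h1 : a' 1 =
    a 1) (h2 : a' 2 = a 2) (hpos : ∀ i, 1 ≤ a i) (h : Coord p B N (diagForm p a ε) c) (hn :
    Adjoinable p B N (toZMod (ε 0 : ℤ_[p])) n) : watson B p (overLat p N n) = N := by
  obtain ⟨c', hc', hback⟩ := h.over hp hN ha ha' h1 h2 hn
  have hM := over_int hN hn
  ext y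
  rw [mem_watson_iff hp hM]
  constructor
  · rintro ⟨hy, hd⟩
    obtain ⟨z, hz⟩ := hc'.exists_int hy
    have h3 := (hc'.dvd_iff hM hy hz 1).1 hd 0
    rw [diagForm, pow_dvd_diag, ha'] at h3
    obtain ⟨t, ht⟩ := h3
    exact hback y hy ⟨t, by rw [hz, ht]; simp⟩
  · intro hy
    refine ⟨le_over hy, fun x hx => ?_⟩
    obtain ⟨m, hm, t, rfl⟩ := mem_over.1 hx
    obtain ⟨z, hz⟩ := h.exists_int hy
    have h4 := (h.dvd_iff hN hy hz 1).2 (fun i => by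
      rw [diagForm, pow_dvd_diag, Nat.sub_eq_zero_of_le (hpos i)]
      simp) m hm
    obtain ⟨k, hk⟩ := hn.dv y hy
    rw [map_add, ← cast_smul_eq_zsmul ℚ, map_smul, map_smul, smul_eq_mul, smul_eq_mul,
      hN.pd.symm y n]
    refine h4.add (Dv.int_mul ⟨k, ?_⟩ t)
    grind

/-- For a given M take a vector of M that is e₀ modulo p; its multiple by p is the vector to adjoin,
since M = Λ_p(M) + ℤe₀ up to multiples of p. -/
theorem mem_fiber_iff (hp : p ≠ 2) (hN : IntLattice B N) (ha : a 0 = 2) (ha' : a' 0 = 0) (h1 : a' 1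
    = a 1) (h2 : a' 2 = a 2) (hpos : ∀ i, 1 ≤ a i) (h : Coord p B N (diagForm p a ε) c) : M ∈ fiber
    p B N (diagForm p a' ε) ↔ ∃ n, Adjoinable p B N (toZMod (ε 0 : ℤ_[p])) n ∧ M = overLat
    p N n := by
  have hp0 : (p : ℚ) ≠ 0 := by exact_mod_cast prime_ne_zero' p
  constructor
  · rintro ⟨hM, rfl, c', hc'⟩
    obtain ⟨n, hn, hni⟩ := hc'.dense (Pi.single 0 1)
    choose m hm using hni
    have hmem : ∀ {y}, y ∈ watson B p M ↔ y ∈ M ∧ ∀ x ∈ M, Dv p 1 (B y x) :=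
      mem_watson_iff hp hM
    have key : ∀ y ∈ M, ∀ z : ℤ_[p], c' y 0 = p * z → y ∈ watson B p M := by
      intro y hy z hz
      obtain ⟨w, hw⟩ := hc'.exists_int hy
      refine hmem.2 ⟨hy, (hc'.dvd_iff hM hy hw 1).2 fun i => ?_⟩
      rw [diagForm, pow_dvd_diag]
      fin_cases i
      · simp [ha']
        refine ⟨z, PadicInt.ext ?_⟩
        simp_all
      · simp_all
      · simp_all
    have hpn : (p : ℤ) • n ∈ watson B p M := smul_mem_watson hM hn
    have hinv : (p : ℚ)⁻¹ • (p : ℤ) • n = n := by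
      rw [← cast_smul_eq_zsmul ℚ, smul_smul, cast_natCast, inv_mul_cancel₀ hp0, one_smul]
    refine ⟨(p : ℤ) • n, ⟨hpn, fun y hy => ?_, ?_⟩, ?_⟩
    · obtain ⟨k, hk⟩ := (hmem.1 hy).2 n hn
      refine ⟨k, ?_⟩
      rw [← cast_smul_eq_zsmul ℚ, map_smul, LinearMap.smul_apply, smul_eq_mul, hM.pd.symm n y,
        hk]
      push_cast
      ring
    · obtain ⟨k, hk⟩ := hM.int n hn n hn
      refine ⟨k, ?_, ?_⟩
      · rw [← cast_smul_eq_zsmul ℚ]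
        simp only [map_smul, LinearMap.smul_apply, smul_eq_mul, hk]
        push_cast
        ring
      · rw [zmod_intCast_eq_iff]
        have h3 := hc'.gram_int (z := fun i => (Pi.single 0 1 : Fin 3 → ℤ_[p]) i + p * m i)
          (w := fun i => (Pi.single 0 1 : Fin 3 → ℤ_[p]) i + p * m i)
          (fun i => by rw [hm]; push_cast; rfl) (fun i => by rw [hm]; push_cast; rfl) hk
        rw [sum_univ_three] at h3
        simp [diagForm, ha'] at h3
        rw [h3]
        exact ⟨2 * ε 0 * m 0 + p * ε 0 * m 0 ^ 2 + p ^ a' 1 * ε 1 * p * m 1 ^ 2 +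
          p ^ a' 2 * ε 2 * p * m 2 ^ 2, by ring⟩
    · ext y
      rw [mem_over, hinv]
      constructor
      · intro hy
        obtain ⟨w, hw⟩ := hc'.exists_int hy
        obtain ⟨t, r, ht⟩ := padicInt_eq_int_add (w 0)
        refine ⟨y - t • n, key _ (M.sub_mem hy (M.smul_mem _ hn)) (r - t * m 0) ?_, t, by abel⟩
        rw [map_sub, map_zsmul, Pi.sub_apply, Pi.smul_apply, hw, hm, ht]
        simp
        ring
      · rintro ⟨m, hm, t, rfl⟩
        exact M.add_mem (watson_le hm) (M.smul_mem _ hn)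
  · rintro ⟨n, hn, rfl⟩
    obtain ⟨c', hc', -⟩ := h.over hp hN ha ha' h1 h2 hn
    exact ⟨over_int hN hn, watson_over hp hN ha ha' h1 h2 hpos h hn, c', hc'⟩

/-! ### The reduction modulo p -/

/-- The reduction of `K` modulo `p`, together with the forms on it. Here `a` are the exponents of
a Jordan decomposition and `u` the residues of its units. -/
structure Frame (p : ℕ) [Fact p.Prime] (B : BilinForm ℚ V) (K : Submodule ℤ V)
    (a : Fin 3 → ℕ) (u : Fin 3 → ZMod p) (red : V → Fin 3 → ZMod p) : Prop where
  add : ∀ x ∈ K, ∀ y ∈ K, red (x + y) = red x + red y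
  surj : ∀ v, ∃ x ∈ K, red x = v
  ker : ∀ x ∈ K, red x = 0 → ∃ y ∈ K, x = (p : ℤ) • y
  unit : ∀ i, u i ≠ 0
  zero : a 0 = 2
  pos : ∀ i, 1 ≤ a i
  scale : ∀ x ∈ K, ∀ y ∈ K, Dv p 1 (B x y)
  modular : ∀ x ∈ K, (∀ y ∈ K, Dv p 2 (B x y)) ↔ ∀ i, a i = 1 → red x i = 0
  form : ∀ x ∈ K, ∀ y ∈ K, (∀ i, a i = 1 → red x i = 0) → (∀ i, a i = 1 → red y i = 0) →
    ∀ k : ℤ, B x y = (p : ℚ) ^ 2 * k →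
    (k : ZMod p) = ∑ i, (if a i = 2 then u i else 0) * red x i * red y i
  rad : ∀ x ∈ K, (∀ y ∈ K, Dv p 3 (B x y)) → ∀ i, a i ≤ 2 → red x i = 0
  deep : 3 ≤ a 1 → a 1 < a 2 → ∀ j, 3 ≤ j → ∀ x ∈ K, ∀ y ∈ K, (∀ z ∈ K, Dv p j (B x z)) →
    (∀ z ∈ K, Dv p j (B y z)) → Dv p (2 * j + 1) (B x x * B y y - B x y ^ 2)

/-- The residues of the coordinates. -/
noncomputable def redCoord (c : V →ₗ[ℚ] (Fin 3 → ℚ_[p])) (x : V) (i : Fin 3) : ZMod p :=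
  open scoped Classical in
  if h : ∃ z : ℤ_[p], c x i = z then toZMod h.choose else 0

theorem redCoord_eq {i : Fin 3} {z : ℤ_[p]} (h : c x i = z) : redCoord c x i = toZMod z := by
  have h' : ∃ z : ℤ_[p], c x i = z := ⟨z, h⟩
  rw [redCoord, dif_pos h']
  congr 1
  exact PadicInt.ext (h'.choose_spec.symm.trans h)

theorem Coord.frame (hK : IntLattice B K) (ha : a 0 = 2) (hpos : ∀ i, 1 ≤ a i) (h : Coord p B K
    (diagForm p a ε) c) : Frame p B K a (fun i => toZMod (ε i : ℤ_[p])) (redCoord c) := by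
  have hp0 : (p : ℤ_[p]) ≠ 0 := by exact_mod_cast prime_ne_zero' p
  have hdiv : ∀ x ∈ K, ∀ z : Fin 3 → ℤ_[p], (∀ i, c x i = z i) → ∀ j,
      ((∀ y ∈ K, Dv p j (B x y)) ↔ ∀ i, (p : ℤ_[p]) ^ (j - a i) ∣ z i) := by
    intro x hx z hz j
    rw [h.dvd_iff hK hx hz]
    exact forall_congr' fun i => pow_dvd_diag
  have hred : ∀ {x} {z : Fin 3 → ℤ_[p]}, (∀ i, c x i = z i) → ∀ i,
      (redCoord c x i = 0 ↔ (p : ℤ_[p]) ∣ z i) := by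
    intro x z hz i
    rw [redCoord_eq (hz i), toZMod_eq_zero_iff]
  have hmod : ∀ x ∈ K, ∀ z : Fin 3 → ℤ_[p], (∀ i, c x i = z i) →
      ((∀ i, (p : ℤ_[p]) ^ (2 - a i) ∣ z i) ↔ ∀ i, a i = 1 → redCoord c x i = 0) := by
    intro x _ z hz
    refine forall_congr' fun i => ?_
    rw [hred hz]
    by_cases h1 : a i = 1
    · simp [h1]
    · have := hpos i
      rw [Nat.sub_eq_zero_of_le (by omega)]
      simp [h1]
  refine ⟨?_, ?_, ?_, ?_, ha, hpos, ?_, ?_, ?_, ?_, ?_⟩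
  · intro x hx y hy
    obtain ⟨z, hz⟩ := h.exists_int hx
    obtain ⟨w, hw⟩ := h.exists_int hy
    ext i
    rw [Pi.add_apply, redCoord_eq (hz i), redCoord_eq (hw i),
      redCoord_eq (z := z i + w i) (by rw [map_add, Pi.add_apply, hz, hw]; simp), map_add]
  · intro v
    obtain ⟨x, hx, hxi⟩ := h.dense fun i => ((v i).val : ℤ_[p])
    choose z hz using hxi
    refine ⟨x, hx, ?_⟩
    ext i
    rw [redCoord_eq (z := ((v i).val : ℤ_[p]) + (p : ℤ_[p]) * z i) (by rw [hz]; simp)]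
    simp
  · intro x hx h0
    obtain ⟨z, hz⟩ := h.exists_int hx
    have h1 : ∀ i, (p : ℤ_[p]) ∣ z i := fun i => (hred hz i).1 (congrFun h0 i)
    choose t ht using h1
    have hpx : (p : ℤ) • (p : ℚ)⁻¹ • x = x := smul_smul_inv x
    refine ⟨(p : ℚ)⁻¹ • x, h.sat _ (by rwa [hpx]) fun i => ⟨t i, ?_⟩, hpx.symm⟩
    have hp0' : (p : ℚ_[p]) ≠ 0 := by exact_mod_cast prime_ne_zero' p
    rw [map_smul, Pi.smul_apply, hz, ht]
    simp [smul_def, inv_mul_cancel_left₀ hp0']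
  · exact fun i => ((ε i).isUnit.map toZMod).ne_zero
  · intro x hx
    obtain ⟨z, hz⟩ := h.exists_int hx
    rw [hdiv x hx z hz]
    simp_all
  · intro x hx
    obtain ⟨z, hz⟩ := h.exists_int hx
    rw [hdiv x hx z hz, hmod x hx z hz]
  · intro x hx y hy h1 h2 k hk
    obtain ⟨z, hz⟩ := h.exists_int hx
    obtain ⟨w, hw⟩ := h.exists_int hy
    have h3 := h.gram_int hz hw (k := p ^ 2 * k) (by rw [hk]; push_cast; rfl)
    have h4 : ∀ i, ∃ r, diagForm p a ε i * z i * w i = (p : ℤ_[p]) ^ 2 * r ∧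
        toZMod r = (if a i = 2 then toZMod (ε i : ℤ_[p]) else 0) *
          toZMod (z i) * toZMod (w i) := by
      intro i
      rw [diagForm]
      have := hpos i
      by_cases h5 : a i = 2
      · exact ⟨ε i * z i * w i, by rw [h5]; ring, by simp [h5]⟩
      · rw [if_neg h5]
        by_cases h6 : a i = 1
        · obtain ⟨s, hs⟩ := (hred hz i).1 (h1 i h6)
          obtain ⟨t, ht⟩ := (hred hw i).1 (h2 i h6)
          exact ⟨p * (ε i * s * t), by rw [h6, hs, ht]; ring, by simp⟩
        · obtain ⟨d, hd⟩ := Nat.exists_eq_add_of_le (show 3 ≤ a i by omega)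
          exact ⟨p * (p ^ d * ε i * z i * w i), by rw [hd]; ring, by simp⟩
    choose r hr hr' using h4
    have h5 : (k : ℤ_[p]) = ∑ i, r i := by
      apply mul_left_cancel₀ (pow_ne_zero 2 hp0)
      rw [mul_sum, ← sum_congr rfl fun i _ => hr i, ← h3]
      simp
    rw [← map_intCast (toZMod (p := p)), h5, map_sum]
    refine sum_congr rfl fun i _ => ?_
    rw [hr', redCoord_eq (hz i), redCoord_eq (hw i)]
  · intro x hx hd i hi
    obtain ⟨z, hz⟩ := h.exists_int hx
    rw [hred hz]
    have := (hdiv x hx z hz 3).1 hd i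
    exact (dvd_pow_self _ (by omega)).trans this
  · intro h1 h12 j hj x hx y hy hxd hyd
    obtain ⟨z, hz⟩ := h.exists_int hx
    obtain ⟨w, hw⟩ := h.exists_int hy
    choose s hs using (hdiv x hx z hz j).1 hxd
    choose t ht using (hdiv y hy w hw j).1 hyd
    obtain ⟨k, hk⟩ := hK.int x hx x hx
    obtain ⟨l, hl⟩ := hK.int y hy y hy
    obtain ⟨m, hm⟩ := hK.int x hx y hy
    have e1 := h.gram_int hz hz hk
    have e2 := h.gram_int hw hw hl
    have e3 := h.gram_int hz hw hm
    rw [sum_univ_three] at e1 e2 e3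
    have h5 : B x x * B y y - B x y ^ 2 = ((k * l - m ^ 2 : ℤ) : ℚ) := by simp_all
    rw [h5, dv_iff_padic]
    push_cast
    -- Lagrange's identity for the Gram determinant of two vectors in diagonal coordinates.
    have h6 : (k : ℤ_[p]) * l - m ^ 2 =
        diagForm p a ε 0 * diagForm p a ε 1 * (z 0 * w 1 - z 1 * w 0) ^ 2 +
        diagForm p a ε 0 * diagForm p a ε 2 * (z 0 * w 2 - z 2 * w 0) ^ 2 +
        diagForm p a ε 1 * diagForm p a ε 2 * (z 1 * w 2 - z 2 * w 1) ^ 2 := by grind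
    rw [h6]
    -- An index of exponent a contributes a + 2(j - a) with truncated subtraction, which is at least
    -- j, with equality only for a = j. For two different exponents at least one factor p is gained.
    have h7 : ∀ i l, a i ≠ a l → (p : ℤ_[p]) ^ (2 * j + 1) ∣
        diagForm p a ε i * diagForm p a ε l * (z i * w l - z l * w i) ^ 2 := by
      intro i l hil
      have h8 : diagForm p a ε i * diagForm p a ε l * (z i * w l - z l * w i) ^ 2 =
          (p : ℤ_[p]) ^ (a i + a l + 2 * (j - a i) + 2 * (j - a l)) *
            (ε i * ε l * (s i * t l - s l * t i) ^ 2) := by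
        rw [hs i, hs l, ht i, ht l, diagForm, diagForm]
        ring
      rw [h8]
      exact (pow_dvd_pow _ (by omega)).mul_right _
    exact dvd_add (dvd_add (h7 0 1 (by omega)) (h7 0 2 (by omega))) (h7 1 2 (by omega))

/-! ### Labels in terms of lists of roots -/

theorem IsRootList.perm (h : IsRootList B K xs) (hp : ys.Perm xs) : IsRootList B K ys := by
  refine ⟨fun x hx => h.root x (hp.mem_iff.1 hx), ?_, fun w hw => ?_⟩
  · refine (Perm.pairwise_iff (fun {x y} h => ?_) hp).2 h.pairwise
    grind
  · obtain ⟨x, hx, hxw⟩ := h.complete w hw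
    grind

theorem IsRootList.nodup_tau (hB : IsPosDefSpace B) (h : IsRootList B K xs) : (xs.map (tau
    B)).Nodup := by
  rw [List.Nodup, List.pairwise_map]
  refine List.Pairwise.imp_of_mem (fun {x y} hx hy hxy e => ?_) h.pairwise
  rcases (IsRoot.tau_eq_iff hB (h.root x hx) (h.root y hy)).1 e with h1 | h1
  · exact hxy.1 h1
  · exact hxy.2 h1

/-- Both lists produce every symmetry exactly once, and the norm is a function of the symmetry
alone. -/
theorem IsRootList.norms_perm (hB : IsPosDefSpace B) (hx : IsRootList B K xs) (hy : IsRootList B K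
    ys) : (xs.map fun x => B x x).Perm (ys.map fun x => B x x) := by
  classical
  let f : (V ≃ₗ[ℚ] V) → ℚ := fun σ => if h : ∃ c, HasNorm B K σ c then h.choose else 0
  have hf : ∀ x, IsRoot B K x → f (tau B x) = B x x := by
    intro x hx
    have h1 : ∃ c, HasNorm B K (tau B x) c := ⟨_, (hx.hasNorm_iff hB).2 rfl⟩
    simp [f, dif_pos h1]
    exact ((hx.hasNorm_iff hB).1 h1.choose_spec).symm
  have h1 : ∀ zs : List V, IsRootList B K zs →
      (zs.map fun x => B x x) = (zs.map (tau B)).map f := by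
    intro zs hz
    rw [map_map]
    exact map_congr_left fun x hx => (hf x (hz.root x hx)).symm
  have h2 : ∀ zs ws : List V, IsRootList B K zs → IsRootList B K ws →
      ∀ σ ∈ zs.map (tau B), σ ∈ ws.map (tau B) := by
    intro zs ws hz hw σ hσ
    obtain ⟨z, hzz, rfl⟩ := mem_map.1 hσ
    obtain ⟨w, hww, h | h⟩ := hw.complete z (hz.root z hzz)
    · grind
    · exact mem_map.2 ⟨w, hww, by rw [h, tau_neg]⟩
  rw [h1 xs hx, h1 ys hy]
  refine Perm.map _ ?_
  rw [List.perm_ext_iff_of_nodup (hx.nodup_tau hB) (hy.nodup_tau hB)]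
  grind

/-- Choosing a root for every symmetry turns the enumeration in a label into a root list. Labels can
therefore be computed from any list of roots. -/
theorem IsRootList.hasLabel_iff (hK : IntLattice B K) (h : IsRootList B K xs) : HasLabel B K ℓ ↔
    ℓ.1 = Nat.card (orthGroup B K) ∧ ℓ.2.Pairwise (· ≤ ·) ∧ (ℓ.2.map fun n : ℕ => (n : ℚ)).Perm
    (xs.map fun x => B x x) := by
  have hB := hK.pd
  constructor
  · rintro ⟨-, hcard, hs, σ, hσ⟩
    refine ⟨hcard.symm, hs, ?_⟩
    have h1 : ∀ i, ∃ x, IsRoot B K x ∧ (σ i : V ≃ₗ[ℚ] V) = tau B x := fun i =>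
      hK.mem_symmetries_iff.1 (σ i).2
    choose x hx hxσ using h1
    have hr : IsRootList B K (List.ofFn x) := by
      refine ⟨fun y hy => ?_, ?_, fun w hw => ?_⟩
      · grind
      · rw [List.pairwise_ofFn]
        intro i j hij
        by_contra hc
        have h2 : tau B (x i) = tau B (x j) :=
          (IsRoot.tau_eq_iff hB (hx i) (hx j)).2 (by tauto)
        rw [← hxσ, ← hxσ] at h2
        exact hij.ne (σ.injective (Subtype.ext h2))
      · obtain ⟨i, hi⟩ := σ.surjective ⟨_, hw.tau_mem_symmetries hB⟩
        have h2 : tau B (x i) = tau B w := by rw [← hxσ, hi]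
        exact ⟨x i, (List.mem_ofFn' _ _).2 ⟨i, rfl⟩, (IsRoot.tau_eq_iff hB (hx i) hw).1 h2⟩
    refine Perm.trans (Perm.of_eq ?_) (hr.norms_perm hB h)
    apply List.ext_get
    · simp
    · intro n h1 h2
      simp
      have := hσ ⟨n, by simpa using h1⟩
      rw [hxσ, (hx _).hasNorm_iff hB] at this
      exact this.symm
  · rintro ⟨hcard, hs, hperm⟩
    refine ⟨hK.finite_orthGroup, hcard.symm, hs, ?_⟩
    have h1 : (Relation.Comp (fun (l : List ℚ) (k : List V) => l = k.map fun x => B x x)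
        (fun a b => Perm a b)) (ℓ.2.map fun n : ℕ => (n : ℚ)) xs := by
      rw [List.eq_map_comp_perm]
      exact hperm
    obtain ⟨ys, hys, hp⟩ := h1
    have hy := h.perm hp
    have hlen : ℓ.2.length = ys.length := by
      have := congrArg List.length hys
      grind
    have hnd := hy.nodup_tau hB
    let f : Fin ys.length → symmetries B K := fun i =>
      ⟨tau B (ys.get i), (hy.root _ (List.get_mem _ _)).tau_mem_symmetries hB⟩
    have hf : Bijective f := by
      constructor
      · intro i j hij
        have h2 : tau B (ys.get i) = tau B (ys.get j) := congrArg Subtype.val hij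
        have h3 := List.nodup_iff_injective_get.1 hnd
        have h4 : (⟨i, by simp⟩ : Fin (ys.map (tau B)).length) = ⟨j, by simp⟩ := by
          apply h3
          simpa using h2
        grind
      · rintro ⟨σ, hσ⟩
        obtain ⟨x, hx, rfl⟩ := hK.mem_symmetries_iff.1 hσ
        obtain ⟨y, hyy, hxy⟩ := hy.complete x hx
        obtain ⟨i, rfl⟩ := List.mem_iff_get.1 hyy
        exact ⟨i, Subtype.ext ((IsRoot.tau_eq_iff hB (hy.root _ (List.get_mem _ _)) hx).2 hxy)⟩
    refine ⟨(finCongr hlen).trans (Equiv.ofBijective f hf), fun i => ?_⟩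
    change HasNorm B K (tau B (ys.get (Fin.cast hlen i))) _
    rw [(hy.root _ (List.get_mem _ _)).hasNorm_iff hB]
    have h5 : (ℓ.2.map fun n : ℕ => (n : ℚ))[(i : ℕ)]'(by simp) =
        (ys.map fun x => B x x)[(i : ℕ)]'(by simp [← hlen]) := by
      congr 1
    grind

/-- Sorting a list of natural numbers. -/
def sortList (l : List ℕ) : List ℕ := l.insertionSort (· ≤ ·)

theorem sortList_perm (l : List ℕ) : (sortList l).Perm l := List.perm_insertionSort _ _

theorem sortList_pairwise (l : List ℕ) : (sortList l).Pairwise (· ≤ ·) :=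
  List.pairwise_insertionSort _ _

theorem sortList_eq_of_perm {l m : List ℕ} (h : l.Perm m) : sortList l = sortList m :=
  Perm.eq_of_pairwise' (sortList_pairwise l) (sortList_pairwise m)
    ((sortList_perm l).trans (h.trans (sortList_perm m).symm))

theorem IsRootList.hasLabel_iff_eq (hK : IntLattice B K) (h : IsRootList B K xs) {ns : List ℕ} (hn
    : (xs.map fun x => B x x) = ns.map fun n : ℕ => (n : ℚ)) : HasLabel B K ℓ ↔ ℓ = (Nat.card
    (orthGroup B K), sortList ns) := by
  rw [h.hasLabel_iff hK, hn, List.map_perm_map_iff Nat.cast_injective]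
  constructor
  · rintro ⟨h1, h2, h3⟩
    refine Prod.ext h1 ?_
    exact Perm.eq_of_pairwise' h2 (sortList_pairwise _) (h3.trans (sortList_perm _).symm)
  · rintro rfl
    exact ⟨rfl, sortList_pairwise _, sortList_perm _⟩

theorem RootType.exists_list (h : RootType B K) : ∃ xs, IsRootList B K xs := by
  cases h <;> exact ⟨_, by assumption⟩

theorem IsRootList.exists_norms (hK : IntLattice B K) (h : IsRootList B K xs) : ∃ ns : List ℕ,
    (xs.map fun x => B x x) = ns.map fun n : ℕ => (n : ℚ) := by
  have h1 : ∀ x ∈ xs, ∃ n : ℕ, B x x = n := fun x hx => hK.norm_nat (h.root x hx).mem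
  choose! f hf using h1
  refine ⟨xs.map f, ?_⟩
  simp_all

theorem IntLattice.exists_label (hK : IntLattice B K) : ∃ ℓ, HasLabel B K ℓ := by
  obtain ⟨xs, h⟩ := hK.rootType.exists_list
  obtain ⟨ns, hn⟩ := h.exists_norms hK
  exact ⟨_, (h.hasLabel_iff_eq hK hn).2 rfl⟩

/-- The order of the orthogonal group in terms of the number of symmetries, when two of them
commute. -/
def symmOrder (n : ℕ) : ℕ :=
  if n = 0 then 2 else if n = 1 then 4 else if n = 3 then 8 else if n = 5 then 16
  else if n = 7 then 24 else 48

/-- The seven types have 0, 1, 3, 3, 5, 7 and 9 roots up to sign. Only the number 3 is ambiguous,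
and an orthogonal pair excludes A₂. -/
theorem card_orthGroup_of_list (hK : IntLattice B K) (h : IsRootList B K xs) (ho : xs.length = 3 →
    ∃ x ∈ xs, ∃ y ∈ xs, B x y = 0) : Nat.card (orthGroup B K) = symmOrder xs.length := by
  have hB := hK.pd
  have hlen : ∀ ys, IsRootList B K ys → xs.length = ys.length := fun ys hy => by
    simpa using (h.norms_perm hB hy).length_eq
  rcases hK.rootType with h1 | ⟨x, h1⟩ | ⟨x, y, z, ht, h1⟩ | ⟨x, y, hA, h1⟩ | ⟨z, x, y, ht, hn,
    h1⟩ |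
    ⟨z, x, y, hz, hzx, hzy, hA, h1⟩ | ⟨s, a, b, c, hs, ht, hab, hac, h1⟩
  · rw [card_orthGroup_none hK h1, hlen _ h1]; rfl
  · rw [card_orthGroup_one hK h1, hlen _ h1]; rfl
  · rw [card_orthGroup_three hK ht h1, hlen _ h1]; rfl
  · exfalso
    obtain ⟨u, hu, v, hv, huv⟩ := ho (hlen _ h1)
    have hp := hA.pos
    have hxy : B x y = -(B x x / 2) := by linarith [hA.inner]
    have hyx : B y x = -(B x x / 2) := by rw [hB.symm, hxy]
    have key : ∀ w, IsRoot B K w → w = x ∨ w = -x ∨ w = y ∨ w = -y ∨ w = x + y ∨ w = -(x + y) := by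
      intro w hw
      have := h1.complete w hw
      grind
    rcases key u (h.root u hu) with rfl | rfl | rfl | rfl | rfl | rfl <;>
    rcases key v (h.root v hv) with rfl | rfl | rfl | rfl | rfl | rfl <;>
      (try simp only [map_neg, map_add, LinearMap.neg_apply, LinearMap.add_apply, hxy, hyx,
        hA.norm] at huv) <;> linarith
  · rw [card_orthGroup_b2 hK ht hn h1, hlen _ h1]; rfl
  · rw [card_orthGroup_g2 hK hzx hzy hA h1, hlen _ h1]; rfl
  · rw [card_orthGroup_cubic hK hs ht hab hac h1, hlen _ h1]; rfl

/-! ### The quadric of points in K/pK -/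

theorem Frame.red_zero (F : Frame p B K a u red) : red 0 = 0 := by
  have := F.add 0 K.zero_mem 0 K.zero_mem
  simp_all

/-- The reduction as a homomorphism. -/
def Frame.hom (F : Frame p B K a u red) : K →+ (Fin 3 → ZMod p) where
  toFun x := red x
  map_zero' := F.red_zero
  map_add' x y := F.add x x.2 y y.2

theorem Frame.red_zsmul (F : Frame p B K a u red) (n : ℤ) (hx : x ∈ K) : red (n • x) = (n : ZMod p)
    • red x := by
  have := map_zsmul F.hom n ⟨x, hx⟩
  rw [cast_smul_eq_zsmul]
  exact this

theorem Frame.red_smul_p (F : Frame p B K a u red) (hx : x ∈ K) : red ((p : ℤ) • x) = 0 := by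
  rw [F.red_zsmul _ hx]
  simp

theorem Frame.red_neg (F : Frame p B K a u red) (hx : x ∈ K) : red (-x) = -red x := by
  have := F.red_zsmul (-1) hx
  simp_all

theorem Frame.red_sub (F : Frame p B K a u red) (hx : x ∈ K) (hy : y ∈ K) : red (x - y) = red x -
    red y := by
  rw [sub_eq_add_neg, F.add x hx _ (K.neg_mem hy), F.red_neg hy, sub_eq_add_neg]

theorem Frame.red_eq_iff (F : Frame p B K a u red) (hx : x ∈ K) (hy : y ∈ K) : red x = red y ↔ ∃ z
    ∈ K, x = y + (p : ℤ) • z := by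
  constructor
  · intro h
    obtain ⟨z, hz, h1⟩ := F.ker (x - y) (K.sub_mem hx hy) (by rw [F.red_sub hx hy, h, sub_self])
    grind
  · rintro ⟨z, hz, rfl⟩
    rw [F.add y hy _ (K.smul_mem _ hz), F.red_smul_p hz, add_zero]

/-- If the reduction of y vanishes, then y = p • z and the integer 2B(x, y)/Q(x) is divisible by p.
So this integer modulo p depends only on the reduction of y. -/
theorem Frame.exists_functional (hB : IsPosDefSpace B) (F : Frame p B K a u red) (hx : IsRoot B K
    x) : ∃ l : (Fin 3 → ZMod p) →ₗ[ZMod p] ZMod p, ∀ y ∈ K, ∀ m : ℤ, 2 * B x y = m * B x x → l (red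
    y) = m := by
  have hx0 := hB.ne_zero hx.ne_zero
  choose! n hn using hx.2
  have huniq : ∀ y ∈ K, ∀ m : ℤ, 2 * B x y = m * B x x → m = n y := by simp_all
  let f : K →+ ZMod p := AddMonoidHom.mk' (fun y => ((n y : ℤ) : ZMod p)) (by
    intro y z
    rw [← Int.cast_add]
    congr 1
    refine (huniq _ (y + z).2 _ ?_).symm
    have h1 := hn y y.2
    have h2 := hn z z.2
    rw [Submodule.coe_add, map_add]
    grind)
  have hsurj : Surjective F.hom := fun v => by
    obtain ⟨y, hy, h⟩ := F.surj v
    exact ⟨⟨y, hy⟩, h⟩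
  have hker : F.hom.ker ≤ f.ker := by
    intro y hy
    obtain ⟨z, hz, h⟩ := F.ker y y.2 hy
    have h1 : n y = p * n z := by
      refine (huniq _ y.2 _ ?_).symm
      grind
    change ((n y : ℤ) : ZMod p) = 0
    simp_all
  let g := AddMonoidHom.liftOfSurjective F.hom hsurj ⟨f, hker⟩
  refine ⟨AddMonoidHom.toZModLinearMap p g, fun y hy m hm => ?_⟩
  have h1 : g (F.hom ⟨y, hy⟩) = f ⟨y, hy⟩ :=
    AddMonoidHom.liftOfRightInverse_comp_apply F.hom _ _ ⟨f, hker⟩ ⟨y, hy⟩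
  change g (F.hom ⟨y, hy⟩) = _
  rw [h1, huniq y hy m hm]
  rfl

/-- The functional `y ↦ 2 B(x, y) / Q(x)` modulo `p`. -/
noncomputable def rootFun (p : ℕ) [Fact p.Prime] (B : BilinForm ℚ V) (K : Submodule ℤ V)
    (red : V → Fin 3 → ZMod p) (x : V) : (Fin 3 → ZMod p) →ₗ[ZMod p] ZMod p :=
  open scoped Classical in
  if h : ∃ l : (Fin 3 → ZMod p) →ₗ[ZMod p] ZMod p,
      ∀ y ∈ K, ∀ m : ℤ, 2 * B x y = m * B x x → l (red y) = m then h.choose else 0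

theorem Frame.rootFun_red (hB : IsPosDefSpace B) (F : Frame p B K a u red) (hx : IsRoot B K x) (hy
    : y ∈ K) {m : ℤ} (hm : 2 * B x y = m * B x x) : rootFun p B K red x (red y) = m := by
  have h := F.exists_functional hB hx
  rw [rootFun, dif_pos h]
  grind

theorem Frame.rootFun_self (hB : IsPosDefSpace B) (F : Frame p B K a u red) (hx : IsRoot B K x) :
    rootFun p B K red x (red x) = 2 := by
  have := F.rootFun_red hB hx hx.mem (m := 2) (by push_cast; rfl)
  simp_all

theorem two_ne_zero_zmod (hp : p ≠ 2) : (2 : ZMod p) ≠ 0 := by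
  intro h2
  have : p ∣ 2 := (natCast_eq_zero_iff 2 p).1 (by exact_mod_cast h2)
  exact hp ((Nat.prime_dvd_prime_iff_eq Fact.out Nat.prime_two).1 this)

theorem Frame.red_root_ne_zero (hp : p ≠ 2) (hB : IsPosDefSpace B) (F : Frame p B K a u red) (hx : IsRoot B K x) : red x ≠ 0 := by
  intro h
  have := F.rootFun_self hB hx
  rw [h, map_zero] at this
  exact two_ne_zero_zmod hp this.symm

theorem Frame.red_tau (hB : IsPosDefSpace B) (F : Frame p B K a u red) (hx : IsRoot B K x) (hy : y
    ∈ K) : red (tau B x y) = red y - rootFun p B K red x (red y) • red x := by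
  obtain ⟨n, hn⟩ := hx.2 y hy
  have hx0 := hB.ne_zero hx.ne_zero
  rw [F.rootFun_red hB hx hy hn, tau_apply hx0, hn, mul_div_assoc, div_self hx0, mul_one,
    cast_smul_eq_zsmul, F.red_sub hy (K.smul_mem _ hx.mem), F.red_zsmul _ hx.mem]

/-- The coefficients of the reduced form. -/
def coefW (a : Fin 3 → ℕ) (u : Fin 3 → ZMod p) (i : Fin 3) : ZMod p := if a i = 2 then u i else 0

/-- The reduced form. -/
def formW (a : Fin 3 → ℕ) (u : Fin 3 → ZMod p) (v w : Fin 3 → ZMod p) : ZMod p :=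
  ∑ i, coefW a u i * v i * w i

/-- The subspace on which the reduced form lives. -/
def InU (a : Fin 3 → ℕ) (v : Fin 3 → ZMod p) : Prop := ∀ i, a i = 1 → v i = 0

instance (v : Fin 3 → ZMod p) : Decidable (InU a v) := inferInstanceAs (Decidable (∀ i, _))

/-- The reductions of the adjoinable vectors. -/
def quadX (a : Fin 3 → ℕ) (u : Fin 3 → ZMod p) : Finset (Fin 3 → ZMod p) :=
  univ.filter fun v => InU a v ∧ formW a u v v = u 0

theorem mem_quadX : v ∈ quadX a u ↔ InU a v ∧ formW a u v v = u 0 := by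
  simp [quadX]

theorem Frame.adjoinable_iff (hK : IntLattice B K) (F : Frame p B K a u red) : Adjoinable p B K (u
    0) n ↔ n ∈ K ∧ red n ∈ quadX a u := by
  rw [mem_quadX]
  constructor
  · rintro ⟨hn, hd, k, hk, hku⟩
    have hU := (F.modular n hn).1 hd
    exact ⟨hn, hU, (F.form n hn n hn hU hU k hk).symm.trans hku⟩
  · rintro ⟨hn, hU, hq⟩
    have hd := (F.modular n hn).2 hU
    obtain ⟨k, hk⟩ := hd n hn
    exact ⟨hn, hd, k, hk, (F.form n hn n hn hU hU k hk).trans hq⟩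

theorem formW_smul (s t : ZMod p) (v w : Fin 3 → ZMod p) :
    formW a u (s • v) (t • w) = s * t * formW a u v w := by
  simp [formW, mul_sum]
  grind

theorem formW_comm (v w : Fin 3 → ZMod p) : formW a u v w = formW a u w v := by
  simp [formW]
  grind

theorem formW_add_left (v v' w : Fin 3 → ZMod p) :
    formW a u (v + v') w = formW a u v w + formW a u v' w := by
  simp [formW, ← sum_add_distrib]
  grind

theorem formW_smul_left (s : ZMod p) (v w : Fin 3 → ZMod p) :
    formW a u (s • v) w = s * formW a u v w := by
  simpa using formW_smul (a := a) (u := u) s 1 v w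

theorem quadX_smul (hu : u 0 ≠ 0) (hv : v ∈ quadX a u) (hw : w ∈ quadX a u) {t : ZMod p} (h : w = t
    • v) : w = v ∨ w = -v := by
  rw [mem_quadX] at hv hw
  have h1 := hw.2
  rw [h, formW_smul, hv.2] at h1
  have h2 : t * t = 1 := mul_right_cancel₀ hu (h1.trans (one_mul _).symm)
  rcases mul_self_eq_one_iff.1 h2 with rfl | rfl
  · simp_all
  · simp_all

/-- Equal lattices have n ≡ tm modulo pK for some t, and since both points lie on the quadric, t =
±1. So the overlattices are the points of the quadric up to sign. -/
theorem Frame.over_eq_iff (hK : IntLattice B K) (F : Frame p B K a u red) {m : V} (hn : Adjoinable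
    p B K (u 0) n) (hm : Adjoinable p B K (u 0) m) : overLat p K n = overLat p K m ↔ red n = red m
    ∨ red n = -red m := by
  have hp0 : (p : ℚ) ≠ 0 := by exact_mod_cast prime_ne_zero' p
  constructor
  · intro h
    have h1 : (p : ℚ)⁻¹ • n ∈ overLat p K m := h ▸ inv_smul_mem_over
    obtain ⟨y, hy, t, hyt⟩ := mem_over.1 h1
    have h2 : n = (p : ℤ) • y + t • m := by
      have := congrArg (fun z => (p : ℤ) • z) hyt
      simp only [smul_add] at this
      rw [smul_smul_inv, smul_comm (p : ℤ) t, smul_smul_inv] at this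
      exact this
    have h3 : red n = (t : ZMod p) • red m := by
      rw [h2, F.add _ (K.smul_mem _ hy) _ (K.smul_mem _ hm.mem), F.red_smul_p hy, zero_add,
        F.red_zsmul _ hm.mem]
    exact quadX_smul (F.unit 0) ((F.adjoinable_iff hK).1 hm).2 ((F.adjoinable_iff hK).1 hn).2 h3
  · have key : ∀ n m : V, n ∈ K → m ∈ K → (red n = red m ∨ red n = -red m) →
        overLat p K n ≤ overLat p K m := by
      intro n m hn hm h
      have h1 : ∃ s : ℤ, red n = red (s • m) := by
        rcases h with h | h
        · exact ⟨1, by rw [h, one_smul]⟩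
        · exact ⟨-1, by rw [h, neg_smul, one_smul, F.red_neg hm]⟩
      obtain ⟨s, hs⟩ := h1
      obtain ⟨z, hz, hnz⟩ := (F.red_eq_iff hn (K.smul_mem _ hm)).1 hs
      intro y hy
      obtain ⟨x, hx, t, rfl⟩ := mem_over.1 hy
      refine mem_over.2 ⟨x + t • z, K.add_mem hx (K.smul_mem _ hz), t * s, ?_⟩
      rw [hnz]
      simp only [← cast_smul_eq_zsmul ℚ]
      simp only [smul_add, smul_smul, cast_natCast]
      grind
    intro h
    refine le_antisymm (key n m hn.mem hm.mem h) (key m n hm.mem hn.mem ?_)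
    grind

/-- Λ_p(M) is defined by M and the form alone, so every isometry of M preserves it. -/
theorem orthGroup_le_watson (hp : p ≠ 2) (hM : IntLattice B M) :
    orthGroup B M ≤ orthGroup B (watson B p M) := by
  intro g hg
  obtain ⟨h1, h2⟩ := mem_orthGroup.1 hg
  refine mem_orthGroup.2 ⟨h1, fun x => ?_⟩
  rw [mem_watson_iff hp hM, mem_watson_iff hp hM, h2]
  refine and_congr_right fun _ => ⟨fun h y hy => ?_, fun h y hy => ?_⟩
  · grind
  · have := h (g.symm y) (by rw [← h2]; simpa using hy)
    rw [← h1] at this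
    simp_all

theorem map_mem_over_iff (hg : g ∈ orthGroup B K) : g y ∈ overLat p K (g n) ↔ y ∈ overLat p K n := by
  have h2 := (mem_orthGroup.1 hg).2
  rw [mem_over, mem_over]
  constructor
  · rintro ⟨m, hm, t, h⟩
    refine ⟨g.symm m, by rw [← h2]; simpa using hm, t, g.injective ?_⟩
    simp_all
  · rintro ⟨m, hm, t, rfl⟩
    exact ⟨g m, (h2 m).2 hm, t, by rw [map_add, map_zsmul, map_smul]⟩

theorem mem_orthGroup_over_iff (hg : g ∈ orthGroup B K) : g ∈ orthGroup B (overLat p K n) ↔ overLat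
    p K (g n) = overLat p K n := by
  rw [mem_orthGroup]
  constructor
  · rintro ⟨-, h⟩
    ext y
    obtain ⟨x, rfl⟩ := g.surjective y
    rw [map_mem_over_iff hg, h]
  · intro h
    refine ⟨(mem_orthGroup.1 hg).1, fun x => ?_⟩
    rw [← h, map_mem_over_iff hg, h]

theorem Adjoinable.map (hg : g ∈ orthGroup B K) {r : ZMod p} (hn : Adjoinable p B K r n) :
    Adjoinable p B K r (g n) := by
  obtain ⟨h1, h2⟩ := mem_orthGroup.1 hg
  refine ⟨(h2 n).2 hn.mem, fun y hy => ?_, by rw [h1]; exact hn.norm⟩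
  have := hn.dv (g.symm y) (by rw [← h2]; simpa using hy)
  rw [← h1] at this
  simp_all

/-! ### Which roots survive: axes and mirrors -/

/-- The line of `v` is spanned by the reduction of `x`. -/
def IsAxis (red : V → Fin 3 → ZMod p) (x : V) (v : Fin 3 → ZMod p) : Prop :=
  ∃ t : ZMod p, v = t • red x

/-- `v` is fixed by the reflection along `x`. -/
def IsMirror (p : ℕ) [Fact p.Prime] (B : BilinForm ℚ V) (K : Submodule ℤ V)
    (red : V → Fin 3 → ZMod p) (x : V) (v : Fin 3 → ZMod p) : Prop :=
  rootFun p B K red x v = 0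

instance (x : V) (v : Fin 3 → ZMod p) : Decidable (IsAxis red x v) :=
  inferInstanceAs (Decidable (∃ t : ZMod p, v = t • red x))

noncomputable instance (x : V) (v : Fin 3 → ZMod p) : Decidable (IsMirror p B K red x v) :=
  inferInstanceAs (Decidable (rootFun p B K red x v = 0))

theorem ne_zero_of_mem_quadX (hu : u 0 ≠ 0) (hv : v ∈ quadX a u) : v ≠ 0 := by
  rintro rfl
  have := (mem_quadX.1 hv).2
  rw [formW] at this
  simp_all

theorem Frame.not_mirror_of_axis (hp : p ≠ 2) (hB : IsPosDefSpace B) (F : Frame p B K a u red) (hx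
    : IsRoot B K x) (hv : v ≠ 0) (h : IsAxis red x v) : ¬ IsMirror p B K red x v := by
  obtain ⟨t, rfl⟩ := h
  intro h
  rw [IsMirror, map_smul, F.rootFun_self hB hx, smul_eq_mul] at h
  have ht := (mul_eq_zero.1 h).resolve_right (two_ne_zero_zmod hp)
  simp_all

/-- The reflection sends the point v to v minus a multiple of the reduction of x. It must be ±v:
either the multiple is zero, or v is proportional to that reduction. -/
theorem Frame.tau_mem_over_iff (hp : p ≠ 2) (hK : IntLattice B K) (F : Frame p B K a u red) (hx :
    IsRoot B K x) (hn : Adjoinable p B K (u 0) n) : tau B x ∈ orthGroup B (overLat p K n) ↔ IsAxis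
    red x (red n) ∨ IsMirror p B K red x (red n) := by
  have hB := hK.pd
  have hw := F.red_root_ne_zero hp hB hx
  have h2 := two_ne_zero_zmod hp
  have hg := hx.tau_mem hB
  rw [mem_orthGroup_over_iff hg, F.over_eq_iff hK (hn.map hg) hn, F.red_tau hB hx hn.mem]
  constructor
  · rintro (h | h)
    · right
      rw [sub_eq_self, smul_eq_zero] at h
      exact h.resolve_right hw
    · left
      refine ⟨rootFun p B K red x (red n) / 2, ?_⟩
      rw [sub_eq_iff_eq_add, neg_add_eq_sub, eq_sub_iff_add_eq, ← two_smul (ZMod p)] at h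
      rw [div_eq_inv_mul, mul_smul, ← h, smul_smul, inv_mul_cancel₀ h2, one_smul]
  · rintro (⟨t, h⟩ | h)
    · right
      rw [h, map_smul, F.rootFun_self hB hx, smul_eq_mul]
      module
    · left
      rw [IsMirror] at h
      simp_all

/-- The generator of the line of `x` in the lattice belonging to `v`. -/
noncomputable def convRoot (p : ℕ) [Fact p.Prime] (red : V → Fin 3 → ZMod p)
    (v : Fin 3 → ZMod p) (x : V) : V :=
  if IsAxis red x v then (p : ℚ)⁻¹ • x else x

theorem convRoot_smul (v : Fin 3 → ZMod p) (x : V) : ∃ r : ℚ, r ≠ 0 ∧ convRoot p red v x = r • x := by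
  have hp0 : (p : ℚ) ≠ 0 := by exact_mod_cast prime_ne_zero' p
  rw [convRoot]
  split_ifs
  · grind
  · exact ⟨1, one_ne_zero, (one_smul _ _).symm⟩

theorem tau_convRoot (v : Fin 3 → ZMod p) (x : V) : tau B (convRoot p red v x) = tau B x := by
  obtain ⟨r, hr, h⟩ := convRoot_smul (p := p) (red := red) v x
  rw [h, tau_smul hr]

/-- On the axis, x is a multiple of n modulo pK, so x/p enters the new lattice. Off the axis, a
division of x in the new lattice could only be by p, and it would make the point proportional to the
reduction of x. -/
theorem Frame.primitive_convRoot (hp : p ≠ 2) (hK : IntLattice B K) (F : Frame p B K a u red) (hx :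
    IsRoot B K x) (hn : Adjoinable p B K (u 0) n) : IsPrimitiveVector (overLat p K n) (convRoot p
    red (red n) x) := by
  have hB := hK.pd
  have hp0 : (p : ℚ) ≠ 0 := by exact_mod_cast prime_ne_zero' p
  have hpz : (p : ℤ) ≠ 0 := by exact_mod_cast prime_ne_zero' p
  have hv := ne_zero_of_mem_quadX (F.unit 0) ((F.adjoinable_iff hK).1 hn).2
  rw [convRoot]
  split_ifs with h
  · obtain ⟨t, ht⟩ := h
    have ht0 : t ≠ 0 := by rintro rfl; exact hv (by rw [ht, zero_smul])
    have h1 : red x = red (((t⁻¹).val : ℤ) • n) := by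
      rw [F.red_zsmul _ hn.mem, ht, smul_smul]
      simp_all
    obtain ⟨z, hz, hxz⟩ := (F.red_eq_iff hx.mem (K.smul_mem _ hn.mem)).1 h1
    refine ⟨mem_over.2 ⟨z, hz, ((t⁻¹).val : ℤ), ?_⟩, fun k y hy hk => ?_⟩
    · rw [hxz]
      simp only [← cast_smul_eq_zsmul ℚ]
      simp only [smul_add, smul_smul, cast_natCast, inv_mul_cancel₀ hp0, one_smul]
      grind
    · refine hx.1.2 k _ (smul_mem_of_mem_over hn.mem hy) ?_
      rw [smul_comm, ← hk, smul_smul_inv]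
  · refine ⟨le_over hx.mem, fun k y hy hk => ?_⟩
    have h1 := smul_mem_of_mem_over hn.mem hy
    have hk0 : (k : ℚ) ≠ 0 := by
      rintro h0
      have : k = 0 := by exact_mod_cast h0
      rw [this, zero_smul] at hk
      exact hx.ne_zero hk
    have h2 : (p : ℤ) • y = ((p : ℚ) * (k : ℚ)⁻¹) • x := by
      rw [hk, ← cast_smul_eq_zsmul ℚ k, smul_smul, mul_assoc, inv_mul_cancel₀ hk0, mul_one,
        ← cast_smul_eq_zsmul ℚ, cast_natCast]
    rw [h2] at h1
    obtain ⟨j, hj⟩ := hx.1.int_of_smul h1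
    have h3 : (p : ℤ) = j * k := by
      have : (p : ℚ) = j * k := by rw [← hj, mul_assoc, inv_mul_cancel₀ hk0, mul_one]
      exact_mod_cast this
    have hpr : Prime (p : ℤ) := Nat.prime_iff_prime_int.1 Fact.out
    rcases hpr.irreducible.isUnit_or_isUnit h3 with hj' | hk'
    · exfalso
      obtain ⟨m, hm, t, hyt⟩ := mem_over.1 hy
      have h4 : j • x = (p : ℤ) • m + t • n := by
        rw [← cast_smul_eq_zsmul ℚ, ← hj, ← h2, hyt, smul_add, smul_comm (p : ℤ) t,
          smul_smul_inv]
      have h5 := congrArg red h4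
      rw [F.red_zsmul _ hx.mem, F.add _ (K.smul_mem _ hm) _ (K.smul_mem _ hn.mem),
        F.red_smul_p hm, zero_add, F.red_zsmul _ hn.mem] at h5
      have hw := F.red_root_ne_zero hp hB hx
      have hj0 : (j : ZMod p) ≠ 0 := by
        rcases Int.isUnit_iff.1 hj' with rfl | rfl <;> simp
      have ht0 : (t : ZMod p) ≠ 0 := by
        intro h0
        simp_all
      apply h
      refine ⟨(t : ZMod p)⁻¹ * j, ?_⟩
      rw [mul_smul, h5, smul_smul, inv_mul_cancel₀ ht0, one_smul]
    · exact hk'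

/-- No new symmetries appear, because isometries of the overlattice preserve its Λ_p, which is K.
Each old root either disappears or keeps its line. -/
theorem Frame.rootList_over (hp : p ≠ 2) (hK : IntLattice B K) (F : Frame p B K a u red) (hxs :
    IsRootList B K xs) (hn : Adjoinable p B K (u 0) n) (hw : watson B p (overLat p K n) = K) :
    IsRootList B (overLat p K n) ((xs.filter fun x => IsAxis red x (red n) ∨ IsMirror p B K red x
    (red n)).map (convRoot p red (red n))) := by
  have hB := hK.pd
  have hM := over_int hK hn
  refine ⟨fun y hy => ?_, ?_, fun y hy => ?_⟩
  · obtain ⟨x, hx, rfl⟩ := mem_map.1 hy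
    obtain ⟨hx1, hx2⟩ := mem_filter.1 hx
    have hxr := hxs.root x hx1
    refine isRoot_of_tau_mem hB (F.primitive_convRoot hp hK hxr hn) ?_
    rw [tau_convRoot, F.tau_mem_over_iff hp hK hxr hn]
    simpa using hx2
  · rw [List.pairwise_map]
    refine List.Pairwise.imp_of_mem (fun {x y} hx hy hxy => ?_) (hxs.pairwise.filter _)
    have hxr := hxs.root x (mem_filter.1 hx).1
    have hyr := hxs.root y (mem_filter.1 hy).1
    by_contra hc
    have h1 : tau B (convRoot p red (red n) y) = tau B (convRoot p red (red n) x) := by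
      by_cases h : convRoot p red (red n) y = convRoot p red (red n) x
      · rw [h]
      · have h2 : convRoot p red (red n) y = -convRoot p red (red n) x := by tauto
        rw [h2, tau_neg]
    rw [tau_convRoot, tau_convRoot] at h1
    rcases (IsRoot.tau_eq_iff hB hyr hxr).1 h1 with h | h
    · simp_all
    · simp_all
  · have h1 : tau B y ∈ orthGroup B K := by
      have := orthGroup_le_watson hp hM (hy.tau_mem hB)
      simp_all
    obtain ⟨x', hx', r, hr, rfl⟩ := hK.exists_root_of_tau hy.ne_zero h1
    obtain ⟨x, hx, hxx⟩ := hxs.complete x' hx'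
    have hxr := hxs.root x hx
    have h2 : tau B (r • x') = tau B x := by
      rw [tau_smul hr]
      exact (IsRoot.tau_eq_iff hB hxr hx').2 hxx |>.symm
    refine ⟨convRoot p red (red n) x, mem_map.2 ⟨x, mem_filter.2 ⟨hx, ?_⟩, rfl⟩, ?_⟩
    · have := hy.tau_mem hB
      rw [h2, F.tau_mem_over_iff hp hK hxr hn] at this
      simp_all
    · have h3 := F.primitive_convRoot hp hK hxr hn
      have h4 : tau B (convRoot p red (red n) x) = tau B (r • x') := by rw [tau_convRoot, h2]
      obtain ⟨s, hs⟩ := parallel_of_tau_eq hB h3.ne_zero hy.ne_zero h4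
      exact h3.eq_or_eq_neg hy.1 hs

/-! ### Counting the points on one axis or one mirror -/

theorem InU.add (hv : InU a v) (hw : InU a w) : InU a (v + w) :=
  fun i hi => by rw [Pi.add_apply, hv i hi, hw i hi, add_zero]

theorem InU.smul (hv : InU a v) (t : ZMod p) : InU a (t • v) :=
  fun i hi => by rw [Pi.smul_apply, hv i hi, smul_zero]

/-- The vectors of norm `r` in the reduction. -/
def quadS (a : Fin 3 → ℕ) (u : Fin 3 → ZMod p) (r : ZMod p) : Finset (Fin 3 → ZMod p) :=
  univ.filter fun v => InU a v ∧ formW a u v v = r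

theorem mem_quadS {r : ZMod p} : v ∈ quadS a u r ↔ InU a v ∧ formW a u v v = r := by
  simp [quadS]

theorem formW_reflect {z : Fin 3 → ZMod p} (hz : formW a u z z ≠ 0) : formW a u (v + (-(2 * formW a
    u z v / formW a u z z)) • z) (w + (-(2 * formW a u z w / formW a u z z)) • z) = formW a u v w := by
  have h1 : ∀ v w' w : Fin 3 → ZMod p, formW a u v (w + w') = formW a u v w + formW a u v w' := by
    intro v w' w
    rw [formW_comm, formW_add_left, formW_comm w, formW_comm w']
  have h2 : ∀ (s : ZMod p) (v w : Fin 3 → ZMod p), formW a u v (s • w) = s * formW a u v w := by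
    intro s v w
    rw [formW_comm, formW_smul_left, formW_comm]
  rw [formW_add_left, h1, h1, h2, h2, formW_smul_left, formW_smul_left, formW_comm v z]
  grind

/-- Vectors w and w' of the same norm r ≠ 0 are exchanged up to sign by a reflection along w ± w',
which also preserves the quadric. The form may be degenerate, so the reflection is used directly in
place of Witt's theorem. -/
theorem card_orth_eq (hp : p ≠ 2) {r : ZMod p} (hr : r ≠ 0) {w' : Fin 3 → ZMod p} (hw : w ∈ quadS a
    u r) (hw' : w' ∈ quadS a u r) : ((quadX a u).filter fun v => formW a u w v = 0).card = ((quadX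
    a u).filter fun v => formW a u w' v = 0).card := by
  have h2 := two_ne_zero_zmod hp
  rw [mem_quadS] at hw hw'
  have key : ∀ s : ZMod p, s * s = 1 → formW a u (w + (-s) • w') (w + (-s) • w') ≠ 0 →
      ((quadX a u).filter fun v => formW a u w v = 0).card =
      ((quadX a u).filter fun v => formW a u w' v = 0).card := by
    intro s hs hz
    set z := w + (-s) • w' with hzdef
    have hzU : InU a z := hw.1.add (hw'.1.smul _)
    let σ : (Fin 3 → ZMod p) → Fin 3 → ZMod p :=
      fun v => v + (-(2 * formW a u z v / formW a u z z)) • z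
    have hσσ : ∀ v, σ (σ v) = v := by
      intro v
      have h3 : formW a u z (σ v) = -formW a u z v := by
        simp only [σ]
        rw [formW_comm, formW_add_left, formW_smul_left, formW_comm v z]
        grind
      change σ v + (-(2 * formW a u z (σ v) / formW a u z z)) • z = v
      rw [h3]
      simp only [σ]
      module
    have hσX : ∀ v ∈ quadX a u, σ v ∈ quadX a u := by
      intro v hv
      rw [mem_quadX] at hv ⊢
      exact ⟨hv.1.add (hzU.smul _), (formW_reflect hz).trans hv.2⟩
    have hzw : 2 * formW a u z w = formW a u z z := by
      have h4 : formW a u z z = formW a u z w - s * formW a u z w' := by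
        conv_lhs => rw [formW_comm, hzdef, formW_add_left, formW_smul_left, ← hzdef]
        rw [formW_comm w, formW_comm w']
        ring
      have h5 : formW a u z w = r - s * formW a u w w' := by
        rw [hzdef, formW_add_left, formW_smul_left, hw.2, formW_comm w']
        ring
      have h6 : formW a u z w' = formW a u w w' - s * r := by
        rw [hzdef, formW_add_left, formW_smul_left, hw'.2]
        ring
      grind
    have hσw : σ w = s • w' := by
      simp only [σ]
      simp_all
    have hs0 : s ≠ 0 := by rintro rfl; simp at hs
    refine Finset.card_nbij' σ σ ?_ ?_ (fun v _ => hσσ v) (fun v _ => hσσ v)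
    · intro v hv
      simp at hv ⊢
      refine ⟨hσX v hv.1, ?_⟩
      have h3 := formW_reflect (v := w) (w := v) hz
      change formW a u (σ w) (σ v) = _ at h3
      rw [hσw, formW_smul_left, hv.2] at h3
      simp_all
    · intro v hv
      simp at hv ⊢
      refine ⟨hσX v hv.1, ?_⟩
      have h3 := formW_reflect (v := w) (w := σ v) hz
      change formW a u (σ w) (σ (σ v)) = _ at h3
      rw [← h3, hσw, hσσ, formW_smul_left, hv.2, mul_zero]
  -- The norms of w - w' and w + w' add up to 4r ≠ 0, so one of the two vectors is not isotropic.
  by_cases hz : formW a u (w + (-(1 : ZMod p)) • w') (w + (-(1 : ZMod p)) • w') = 0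
  · refine key (-1) (by ring) fun hz' => ?_
    have h4 : formW a u (w + (-(1 : ZMod p)) • w') (w + (-(1 : ZMod p)) • w') +
        formW a u (w + (-(-1 : ZMod p)) • w') (w + (-(-1 : ZMod p)) • w') = 2 * 2 * r := by
      have h1 : ∀ v w' w : Fin 3 → ZMod p,
          formW a u v (w + w') = formW a u v w + formW a u v w' := by
        intro v w' w
        rw [formW_comm, formW_add_left, formW_comm w, formW_comm w']
      have h2 : ∀ (s : ZMod p) (v w : Fin 3 → ZMod p),
          formW a u v (s • w) = s * formW a u v w := by
        intro s v w
        rw [formW_comm, formW_smul_left, formW_comm]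
      simp only [formW_add_left, h1, h2, formW_smul_left, hw.2, hw'.2]
      ring
    simp_all
  · grind

/-- This gives the number of points orthogonal to w as the number of orthogonal pairs divided by the
number of vectors of norm r, without reference to w itself. -/
theorem sum_card_orth (hp : p ≠ 2) {r : ZMod p} (hr : r ≠ 0) (hw : w ∈ quadS a u r) : ∑ w' ∈ quadS
    a u r, ((quadX a u).filter fun v => formW a u w' v = 0).card = (quadS a u r).card * ((quadX a
    u).filter fun v => formW a u w v = 0).card := by
  rw [sum_congr rfl fun w' hw' => card_orth_eq hp hr hw' hw, sum_const, smul_eq_mul]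

theorem dv_of_dvd_two_mul (hp : p ≠ 2) {m c : ℤ} (h : 2 * k = m * c) (hc : (p : ℤ) ^ j ∣ c) : (p :
    ℤ) ^ j ∣ k := by
  have hpr : Nat.Prime p := Fact.out
  have h1 : (p : ℤ) ^ j ∣ 2 * k := h ▸ hc.mul_left m
  refine IsCoprime.dvd_of_dvd_mul_left (IsCoprime.pow_left ?_) h1
  rw [Int.isCoprime_iff_gcd_eq_one]
  have : Nat.Coprime p 2 := (Nat.coprime_primes hpr Nat.prime_two).2 hp
  exact_mod_cast this

/-- 2B(x, y) is a multiple of Q(x), and 2 is prime to p. -/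
theorem IsRoot.dv_of_norm (hp : p ≠ 2) (hK : IntLattice B K) (hx : IsRoot B K x) (h : Dv p j (B x
    x)) : ∀ y ∈ K, Dv p j (B x y) := by
  intro y hy
  obtain ⟨k, hk⟩ := hK.int x hx.mem y hy
  obtain ⟨c, hc⟩ := hK.int x hx.mem x hx.mem
  obtain ⟨m, hm⟩ := hx.2 y hy
  rw [hk, hc] at hm
  rw [hc, dv_intCast_iff (prime_ne_zero' p)] at h
  rw [hk, dv_intCast_iff (prime_ne_zero' p)]
  exact dv_of_dvd_two_mul hp (by exact_mod_cast hm) h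

/-- For v in the subspace the product of 2B(x, y)/Q(x) with Q(x) is divisible by p². If p² does not
divide Q(x), the first factor is divisible by p, so every point of the quadric lies on the mirror.
-/
theorem Frame.rootFun_of_not_dv (hK : IntLattice B K) (F : Frame p B K a u red) (hx : IsRoot B K x)
    (h : ¬ Dv p 2 (B x x)) (hv : InU a v) : rootFun p B K red x v = 0 := by
  obtain ⟨y, hy, rfl⟩ := F.surj v
  obtain ⟨m, hm⟩ := hx.2 y hy
  rw [F.rootFun_red hK.pd hx hy hm]
  have h1 := (F.modular y hy).2 hv x hx.mem
  rw [hK.pd.symm y x] at h1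
  obtain ⟨k, hk⟩ := hK.int x hx.mem y hy
  obtain ⟨c, hc⟩ := hK.int x hx.mem x hx.mem
  rw [hk, dv_intCast_iff (prime_ne_zero' p)] at h1
  rw [hc, dv_intCast_iff (prime_ne_zero' p)] at h
  rw [hk, hc] at hm
  have hm' : 2 * k = m * c := by exact_mod_cast hm
  have h2 : (p : ℤ) ^ 2 ∣ m * c := hm' ▸ h1.mul_left 2
  rw [ZMod.intCast_zmod_eq_zero_iff_dvd]
  have hpr : Prime (p : ℤ) := Nat.prime_iff_prime_int.1 Fact.out
  by_contra h3
  exact h (hpr.pow_dvd_of_dvd_mul_left 2 h3 h2)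

theorem Frame.rootFun_mul (hp : p ≠ 2) (hK : IntLattice B K) (F : Frame p B K a u red) (hx : IsRoot
    B K x) {c : ℤ} (hc : B x x = (p : ℚ) ^ 2 * c) : InU a (red x) ∧ formW a u (red x) (red x) = c ∧
    ∀ v, InU a v → rootFun p B K red x v * c = 2 * formW a u (red x) v := by
  have hU : InU a (red x) := (F.modular x hx.mem).1 (hx.dv_of_norm hp hK ⟨c, hc⟩)
  refine ⟨hU, (F.form x hx.mem x hx.mem hU hU c hc).symm, fun v hv => ?_⟩
  obtain ⟨y, hy, rfl⟩ := F.surj v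
  obtain ⟨k, hk⟩ := hx.dv_of_norm hp hK ⟨c, hc⟩ y hy
  obtain ⟨m, hm⟩ := hx.2 y hy
  rw [F.rootFun_red hK.pd hx hy hm]
  have h1 := F.form x hx.mem y hy hU hv k hk
  change _ = formW a u (red x) (red y) at h1
  rw [← h1]
  rw [hk, hc] at hm
  have hp0 : (p : ℚ) ^ 2 ≠ 0 := pow_ne_zero _ (by exact_mod_cast prime_ne_zero' p)
  have h2 : m * c = 2 * k := by
    have : (m : ℚ) * c = 2 * k := by grind
    exact_mod_cast this
  have := congrArg (fun t : ℤ => (t : ZMod p)) h2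
  grind

theorem Frame.red_rad (hp : p ≠ 2) (hK : IntLattice B K) (F : Frame p B K a u red) (hx : IsRoot B K x) (h : Dv p 3 (B x x)) : ∀ i, a i ≤ 2 → red x i = 0 :=
  F.rad x hx.mem (hx.dv_of_norm hp hK h)

theorem quadX_add_rad (hw : ∀ i, a i ≤ 2 → w i = 0) (t : ZMod p) : v + t • w ∈ quadX a u ↔ v ∈
    quadX a u := by
  rw [mem_quadX, mem_quadX]
  have h1 : InU a (v + t • w) ↔ InU a v := by
    refine forall_congr' fun i => forall_congr' fun hi => ?_
    simp_all
  have h2 : formW a u (v + t • w) (v + t • w) = formW a u v v := by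
    refine sum_congr rfl fun i _ => ?_
    by_cases hi : a i = 2
    · simp_all
    · simp [coefW, hi]
  rw [h1, h2]

/-- If p³ divides Q(x), the reduction of x is in the radical, and translations along it preserve the
quadric. They permute the p level sets of the functional, since its value at the reduction of x is
2; so all level sets have the same size. -/
theorem Frame.card_mirror_rad (hp : p ≠ 2) (hK : IntLattice B K) (F : Frame p B K a u red) (hx :
    IsRoot B K x) (h : Dv p 3 (B x x)) : p * ((quadX a u).filter (IsMirror p B K red x)).card =
    (quadX a u).card := by
  have h2 := two_ne_zero_zmod hp
  have hr := F.red_rad hp hK hx h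
  have h3 : ∀ r ∈ (univ : Finset (ZMod p)),
      ((quadX a u).filter fun v => rootFun p B K red x v = r).card =
        ((quadX a u).filter (IsMirror p B K red x)).card := by
    intro r _
    refine Finset.card_nbij' (fun v => v + (-(r / 2)) • red x) (fun v => v + (r / 2) • red x)
      ?_ ?_ ?_ ?_
    · intro v hv
      simp only [coe_filter, mem_ofPred_eq] at hv ⊢
      refine ⟨(quadX_add_rad hr _).2 hv.1, ?_⟩
      rw [IsMirror, map_add, map_smul, F.rootFun_self hK.pd hx, hv.2, smul_eq_mul]
      simp_all
    · intro v hv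
      simp only [coe_filter, mem_ofPred_eq] at hv ⊢
      refine ⟨(quadX_add_rad hr _).2 hv.1, ?_⟩
      rw [map_add, map_smul, F.rootFun_self hK.pd hx, hv.2, smul_eq_mul]
      simp_all
    · intro v _
      module
    · intro v _
      module
  have h4 := Finset.card_eq_sum_card_fiberwise (s := quadX a u) (t := univ)
    (f := fun v => rootFun p B K red x v) (fun _ _ => Finset.mem_coe.2 (mem_univ _))
  simp_all

theorem Frame.card_mirror_of_not_dv (hK : IntLattice B K) (F : Frame p B K a u red) (hx : IsRoot B
    K x) (h : ¬ Dv p 2 (B x x)) : ((quadX a u).filter (IsMirror p B K red x)).card = (quadX a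
    u).card := by
  congr 1
  refine Finset.filter_true_of_mem fun v hv => ?_
  exact F.rootFun_of_not_dv hK hx h (mem_quadX.1 hv).1

/-- Here Q(x)/p² is a unit c at p, and the mirror is the orthogonal complement of a vector of norm c
in the reduced form. -/
theorem Frame.card_mirror_mul (hp : p ≠ 2) (hK : IntLattice B K) (F : Frame p B K a u red) (hx :
    IsRoot B K x) {c : ℤ} (hc : B x x = (p : ℚ) ^ 2 * c) (h : (c : ZMod p) ≠ 0) : (quadS a u (c :
    ZMod p)).card * ((quadX a u).filter (IsMirror p B K red x)).card = ∑ w ∈ quadS a u (c : ZMod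
    p), ((quadX a u).filter fun v => formW a u w v = 0).card ∧ (quadS a u (c : ZMod p)).card ≠ 0 := by
  obtain ⟨h1, h2, h3⟩ := F.rootFun_mul hp hK hx hc
  have hm : red x ∈ quadS a u (c : ZMod p) := mem_quadS.2 ⟨h1, h2⟩
  refine ⟨?_, Finset.card_ne_zero_of_mem hm⟩
  rw [sum_card_orth hp h hm]
  congr 2
  refine Finset.filter_congr fun v hv => ?_
  have h4 := h3 v (mem_quadX.1 hv).1
  rw [IsMirror]
  constructor
  · intro h5
    rw [h5, zero_mul] at h4
    exact (mul_eq_zero.1 h4.symm).resolve_left (two_ne_zero_zmod hp)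
  · grind

/-- The point s • x is on the quadric exactly if Q(x)s² ≡ p²r mod p³. A line that meets the quadric
does so in two opposite points. -/
theorem Frame.card_axis (hp : p ≠ 2) (hK : IntLattice B K) (F : Frame p B K a u red) (hx : IsRoot B
    K x) {c r : ℕ} (hc : B x x = c) (hr : (r : ZMod p) = u 0) : ((quadX a u).filter (IsAxis red
    x)).card = if ∃ s < p, (c * s * s) % p ^ 3 = (p ^ 2 * r) % p ^ 3 then 2 else 0 := by
  have hB := hK.pd
  have hpp : p.Prime := Fact.out
  have hp2 : (p : ℤ) ^ 2 ≠ 0 := pow_ne_zero _ (by exact_mod_cast hpp.ne_zero)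
  have hmod : ∀ s : ℕ, (c * s * s) % p ^ 3 = (p ^ 2 * r) % p ^ 3 ↔
      ∃ k : ℤ, (c : ℤ) * s * s = p ^ 2 * k ∧ (k : ZMod p) = u 0 := by
    intro s
    change Nat.ModEq _ _ _ ↔ _
    rw [← hr]
    constructor
    · intro h
      have h1 := (Nat.modEq_iff_dvd.1 h.symm)
      obtain ⟨m, hm⟩ := h1
      push_cast at hm
      refine ⟨r + p * m, by linear_combination hm, by simp⟩
    · rintro ⟨k, hk, hkr⟩
      have h1 : ((k - r : ℤ) : ZMod p) = 0 := by push_cast; rw [hkr, sub_self]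
      rw [ZMod.intCast_zmod_eq_zero_iff_dvd] at h1
      obtain ⟨m, hm⟩ := h1
      refine (Nat.modEq_iff_dvd.2 ⟨m, ?_⟩).symm
      grind
  have hiff : (∃ s < p, (c * s * s) % p ^ 3 = (p ^ 2 * r) % p ^ 3) ↔
      ∃ v ∈ quadX a u, IsAxis red x v := by
    constructor
    · rintro ⟨s, -, h⟩
      obtain ⟨k, hk, hku⟩ := (hmod s).1 h
      -- If p divided s, then Q(x)s² would be divisible by p³, because p divides Q(x); but r is a
      -- unit.
      have hs : ¬ (p : ℤ) ∣ s := by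
        rintro ⟨t, ht⟩
        obtain ⟨d, hd⟩ := F.scale x hx.mem x hx.mem
        rw [hc, pow_one] at hd
        have hd' : (c : ℤ) = p * d := by exact_mod_cast hd
        have h3 : (k : ZMod p) = 0 := by
          rw [ZMod.intCast_zmod_eq_zero_iff_dvd]
          refine ⟨d * t * t, mul_left_cancel₀ hp2 ?_⟩
          grind
        exact F.unit 0 (hku.symm.trans h3)
      have hpr : Prime (p : ℤ) := Nat.prime_iff_prime_int.1 hpp
      have hc2 : (p : ℤ) ^ 2 ∣ c := by
        have h4 : (p : ℤ) ^ 2 ∣ (s * s) * c := ⟨k, by rw [← hk]; ring⟩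
        exact hpr.pow_dvd_of_dvd_mul_left 2 (fun h5 => hs ((hpr.dvd_or_dvd h5).elim id id)) h4
      have hdv : Dv p 2 (B x x) := by
        rw [hc]
        exact_mod_cast (dv_intCast_iff hpp.ne_zero).2 hc2
      have hadj : Adjoinable p B K (u 0) ((s : ℤ) • x) := by
        refine ⟨K.smul_mem _ hx.mem, fun y hy => ?_, k, ?_, hku⟩
        · rw [← cast_smul_eq_zsmul ℚ, map_smul, LinearMap.smul_apply, smul_eq_mul]
          exact (hx.dv_of_norm hp hK hdv y hy).int_mul s
        · rw [← cast_smul_eq_zsmul ℚ]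
          simp only [map_smul, LinearMap.smul_apply, smul_eq_mul, hc]
          have : (c : ℚ) * s * s = p ^ 2 * k := by exact_mod_cast hk
          push_cast
          linarith
      refine ⟨_, ((F.adjoinable_iff hK).1 hadj).2, (s : ZMod p), ?_⟩
      rw [F.red_zsmul _ hx.mem]
      simp
    · rintro ⟨v, hv, t, rfl⟩
      refine ⟨t.val, val_lt t, (hmod _).2 ?_⟩
      have h1 : red ((t.val : ℤ) • x) = t • red x := by
        rw [F.red_zsmul _ hx.mem]
        simp
      obtain ⟨k, hk, hku⟩ := ((F.adjoinable_iff hK).2 ⟨K.smul_mem _ hx.mem, h1 ▸ hv⟩).norm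
      refine ⟨k, ?_, hku⟩
      rw [← cast_smul_eq_zsmul ℚ] at hk
      simp only [map_smul, LinearMap.smul_apply, smul_eq_mul, hc] at hk
      have : ((c : ℤ) : ℚ) * t.val * t.val = p ^ 2 * k := by
        push_cast at hk ⊢
        linarith
      exact_mod_cast this
  split_ifs with h
  · obtain ⟨v, hv, hvx⟩ := hiff.1 h
    have hv0 := ne_zero_of_mem_quadX (F.unit 0) hv
    have hvv : v ≠ -v := by
      intro h1
      have h3 : (2 : ZMod p) • v = 0 := by
        rw [two_smul]
        grind
      exact hv0 ((smul_eq_zero.1 h3).resolve_left (two_ne_zero_zmod hp))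
    rw [← card_pair hvv]
    congr 1
    ext w
    simp
    obtain ⟨t, rfl⟩ := hvx
    have ht : t ≠ 0 := by rintro rfl; simp at hv0
    constructor
    · rintro ⟨hw, s, rfl⟩
      refine quadX_smul (F.unit 0) hv hw (t := s * t⁻¹) ?_
      rw [smul_smul, mul_assoc, inv_mul_cancel₀ ht, mul_one]
    · rintro (rfl | rfl)
      · exact ⟨hv, t, rfl⟩
      · refine ⟨?_, -t, by rw [neg_smul]⟩
        rw [mem_quadX] at hv ⊢
        have e : -(t • red x) = (-1 : ZMod p) • (t • red x) := by rw [neg_smul, one_smul]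
        rw [e, formW_smul]
        exact ⟨hv.1.smul _, by rw [hv.2]; ring⟩
  · simp_all

/-! ### Points common to several axes and mirrors -/

theorem IsRoot.angle_int (hB : IsPosDefSpace B) (hx : IsRoot B K x) (hy : IsRoot B K y) (hxy : y ≠
    x ∧ y ≠ -x) : ∃ n m : ℤ, 2 * B x y = n * B x x ∧ 2 * B y x = m * B y y ∧ 4 * B x y ^ 2 = ((n *
    m : ℤ) : ℚ) * (B x x * B y y) ∧ 0 ≤ n * m ∧ n * m ≤ 3 ∧ (B x y ≠ 0 → n ≠ 0 ∧ m ≠ 0) := by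
  obtain ⟨n, hn⟩ := hx.2 y hy.mem
  obtain ⟨m, hm⟩ := hy.2 x hx.mem
  obtain ⟨c, hc, hc4, hc'⟩ := hx.angle hB hy
  have hx0 := hB.ne_zero hx.ne_zero
  have hy0 := hB.ne_zero hy.ne_zero
  have h1 : 4 * B x y ^ 2 = ((n * m : ℤ) : ℚ) * (B x x * B y y) := by
    have hm' := hm
    rw [hB.symm y x] at hm'
    grind
  have h2 : n * m = c := by
    have : ((n * m : ℤ) : ℚ) = c := mul_right_cancel₀ (mul_ne_zero hx0 hy0) (h1.symm.trans hc)
    exact_mod_cast this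
  have h3 : c ≠ 4 := fun h => by simp_all
  refine ⟨n, m, hn, hm, h1, by omega, by omega, fun h0 => ⟨?_, ?_⟩⟩
  · rintro rfl
    simp_all
  · rintro rfl
    grind

theorem Frame.mirror_of_axis_orth (hB : IsPosDefSpace B) (F : Frame p B K a u red) (hx : IsRoot B K
    x) (hy : IsRoot B K y) (h : B y x = 0) (hv : IsAxis red x v) : IsMirror p B K red y v := by
  obtain ⟨t, rfl⟩ := hv
  rw [IsMirror, map_smul, F.rootFun_red hB hy hx.mem (m := 0) (by rw [h]; simp)]
  simp

theorem prime_dvd_small (hp : p ≠ 2) (h1 : 1 ≤ k) (h4 : k ≤ 4) (h : (k : ZMod p) = 0) : p = 3 ∧ k =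
    3 := by
  have hpp : p.Prime := Fact.out
  rw [ZMod.intCast_zmod_eq_zero_iff_dvd] at h
  have h5 := Int.le_of_dvd (by omega) h
  have h6 := hpp.two_le
  have h7 : p ≤ 4 := by omega
  have h8 : p ≠ 4 := by rintro rfl; norm_num at hpp
  have h9 : p = 3 := by omega
  subst h9
  omega

/-- The product of the two integers attached to x and y is 0, 1, 2 or 3 and divisible by p. If it is
not 0, then p = 3 and the roots are at 30 degrees. -/
theorem Frame.orth_of_axis_mirror (hp : p ≠ 2) (hB : IsPosDefSpace B) (F : Frame p B K a u red)
    (hreg : p = 3 → ¬ HasG2 B K) (hx : IsRoot B K x) (hy : IsRoot B K y) (hv : v ≠ 0) (h : IsAxis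
    red x v) (h' : IsMirror p B K red y v) : B y x = 0 := by
  by_contra h0
  have hne : x ≠ y ∧ x ≠ -y := by
    constructor
    · rintro rfl
      exact F.not_mirror_of_axis hp hB hx hv h h'
    · intro e
      rw [e] at h
      obtain ⟨t, ht⟩ := h
      refine F.not_mirror_of_axis hp hB hy hv ⟨-t, ?_⟩ h'
      rw [ht, F.red_neg hy.mem]
      module
  obtain ⟨n, m, hn, hm, h4, h5, h6, h7⟩ := hy.angle_int hB hx hne
  obtain ⟨t, rfl⟩ := h
  obtain ⟨hn0, hm0⟩ := h7 h0
  rw [IsMirror, map_smul, F.rootFun_red hB hy hx.mem hn, smul_eq_mul] at h'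
  have ht : t ≠ 0 := by rintro rfl; simp at hv
  have h8 := (mul_eq_zero.1 h').resolve_left ht
  have h9 : ((n * m : ℤ) : ZMod p) = 0 := by rw [cast_mul, h8, zero_mul]
  have h10 : 1 ≤ n * m := by
    have : n * m ≠ 0 := mul_ne_zero hn0 hm0
    omega
  obtain ⟨h11, h12⟩ := prime_dvd_small hp h10 (by omega) h9
  refine hreg h11 ⟨y, x, hy, hx, ?_⟩
  simp_all

/-- Proportional reductions make the product nm congruent to 4 modulo p. As 4 - nm is between 1 and
4 and p is odd, p = 3 and nm = 1. -/
theorem Frame.angle_of_proportional (hp : p ≠ 2) (hB : IsPosDefSpace B) (F : Frame p B K a u red)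
    (hx : IsRoot B K x) (hy : IsRoot B K y) (hne : y ≠ x ∧ y ≠ -x) {r : ZMod p} (h : red y = r •
    red x) : p = 3 ∧ 4 * B x y ^ 2 = B x x * B y y := by
  obtain ⟨n, m, hn, hm, h4, h5, h6, -⟩ := hx.angle_int hB hy hne
  have e1 := F.rootFun_red hB hx hy.mem hn
  have e2 := F.rootFun_self hB hy
  rw [h, map_smul, F.rootFun_self hB hx, smul_eq_mul] at e1
  rw [h, map_smul, F.rootFun_red hB hy hx.mem hm, smul_eq_mul] at e2
  have e3 : ((4 - n * m : ℤ) : ZMod p) = 0 := by grind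
  obtain ⟨h7, h8⟩ := prime_dvd_small hp (by omega) (by omega) e3
  refine ⟨h7, ?_⟩
  rw [h4, show n * m = 1 by omega]
  norm_num

theorem hasG2_of_vector (hK : IntLattice B K) (hx : IsRoot B K x) (hz : z ∈ K) (hz0 : z ≠ 0) (hint
    : ∀ k ∈ K, ∃ n : ℤ, 2 * B z k = n * B z z) (h : 4 * B x z ^ 2 = 3 * (B x x * B z z)) : HasG2 B
    K := by
  have hB := hK.pd
  obtain ⟨w, hw, r, hr, rfl⟩ := hK.exists_root_of_tau hz0 (tau_mem_of_int hB hz hz0 hint)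
  refine ⟨x, w, hx, hw, ?_⟩
  simp at h
  grind

/-- In the remaining case p = 3 at an angle of 60 or 120 degrees, the combination x + my with m = ±1
is divisible by 3 in K, and a third of it spans the axis of a symmetry at 30 degrees to x. -/
theorem Frame.parallel_of_proportional (hp : p ≠ 2) (hK : IntLattice B K) (F : Frame p B K a u red)
    (hreg : p = 3 → ¬ HasG2 B K) (hx : IsRoot B K x) (hy : IsRoot B K y) {r : ZMod p} (h : red y =
    r • red x) : y = x ∨ y = -x := by
  have hB := hK.pd
  by_contra hc
  push Not at hc
  obtain ⟨rfl, h4⟩ := F.angle_of_proportional hp hB hx hy hc h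
  apply hreg rfl
  have hx0 := hB.ne_zero hx.ne_zero
  have hy0 := hB.ne_zero hy.ne_zero
  obtain ⟨n, hn⟩ := hx.2 y hy.mem
  obtain ⟨m, hm⟩ := hy.2 x hx.mem
  rw [hB.symm y x] at hm
  have hnm : n * m = 1 := by
    have : ((n * m : ℤ) : ℚ) * (B x x * B y y) = 1 * (B x x * B y y) := by grind
    exact_mod_cast mul_right_cancel₀ (mul_ne_zero hx0 hy0) this
  have hn2 : n * n = 1 := by
    rcases Int.isUnit_iff.1 (IsUnit.of_mul_eq_one _ hnm) with rfl | rfl <;> rfl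
  have hmn : m = n := by linear_combination n * hnm - m * hn2
  subst hmn
  have hmm : (m : ℚ) * m = 1 := by exact_mod_cast hn2
  have hyy : B y y = B x x := by grind
  have hz : red (x + m • y) = 0 := by
    have e1 := F.rootFun_red hB hx hy.mem hn
    rw [h, map_smul, F.rootFun_self hB hx, smul_eq_mul] at e1
    rw [F.add _ hx.mem _ (K.smul_mem _ hy.mem), F.red_zsmul _ hy.mem, h, smul_smul, ← e1]
    have h3 : (3 : ZMod 3) = 0 := rfl
    have h6 : ((m * m : ℤ) : ZMod 3) = 1 := by rw [hn2]; rfl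
    have h7 : r * 2 * r = -1 := by
      push_cast at h6
      rw [← e1] at h6
      have : r * r = 1 := by linear_combination h6 - r * r * h3
      linear_combination 2 * this + h3
    simp_all
  obtain ⟨z, hzK, hz⟩ := F.ker _ (K.add_mem hx.mem (K.smul_mem _ hy.mem)) hz
  have hz' : x + (m : ℚ) • y = (3 : ℚ) • z := by
    rw [cast_smul_eq_zsmul, hz, ← cast_smul_eq_zsmul ℚ]
    norm_num
  have hBz : ∀ k, 3 * B z k = B x k + m * B y k := by
    intro k
    have := congrArg (fun t => B t k) hz'
    simpa using this.symm
  have hyx : B y x = B x y := hB.symm _ _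
  have hzx : 2 * B z x = B x x := by grind
  have hzy : 2 * B z y = m * B x x := by grind
  have hzz : 3 * B z z = B x x := by
    have := hBz z
    rw [hB.symm x z, hB.symm y z] at this
    grind
  refine hasG2_of_vector hK hx hzK ?_ ?_ ?_
  · grind
  · intro k hk
    obtain ⟨i, hi⟩ := hx.2 k hk
    obtain ⟨j, hj⟩ := hy.2 k hk
    refine ⟨i + m * j, ?_⟩
    grind
  · rw [hB.symm x z]
    grind

/-- For k in K the frame gives 2k = nx + my + lz with integers n, m, l. On both mirrors n and m
vanish modulo p, and 2 is invertible. -/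
theorem Frame.axis_of_orth_mirrors (hp : p ≠ 2) (hK : IntLattice B K) (F : Frame p B K a u red) (ht
    : OrthTriple B x y z) (hx : IsRoot B K x) (hy : IsRoot B K y) (hz : IsRoot B K z) (h1 :
    IsMirror p B K red x v) (h2 : IsMirror p B K red y v) : IsAxis red z v := by
  have hB := hK.pd
  obtain ⟨k, hk, rfl⟩ := F.surj v
  obtain ⟨n, hn⟩ := hx.2 k hk
  obtain ⟨m, hm⟩ := hy.2 k hk
  obtain ⟨l, hl⟩ := hz.2 k hk
  have e : (2 : ℤ) • k = n • x + m • y + l • z := by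
    simp only [← cast_smul_eq_zsmul ℚ]
    conv_lhs => rw [ht.expand hB hK.rank k]
    have hx0 := hB.ne_zero ht.hx
    have hy0 := hB.ne_zero ht.hy
    have hz0 := hB.ne_zero ht.hz
    have e1 : 2 * (B x k / B x x) = n := by rw [← mul_div_assoc, hn, mul_div_assoc, div_self hx0,
      mul_one]
    have e2 : 2 * (B y k / B y y) = m := by rw [← mul_div_assoc, hm, mul_div_assoc, div_self hy0,
      mul_one]
    have e3 : 2 * (B z k / B z z) = l := by rw [← mul_div_assoc, hl, mul_div_assoc, div_self hz0,
      mul_one]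
    rw [← e1, ← e2, ← e3]
    push_cast
    module
  have e' := congrArg red e
  rw [IsMirror, F.rootFun_red hB hx hk hn] at h1
  rw [IsMirror, F.rootFun_red hB hy hk hm] at h2
  rw [F.red_zsmul _ hk, F.add _ (K.add_mem (K.smul_mem _ hx.mem) (K.smul_mem _ hy.mem)) _
    (K.smul_mem _ hz.mem), F.add _ (K.smul_mem _ hx.mem) _ (K.smul_mem _ hy.mem),
    F.red_zsmul _ hx.mem, F.red_zsmul _ hy.mem, F.red_zsmul _ hz.mem, h1, h2] at e'
  simp at e'
  refine ⟨(2 : ZMod p)⁻¹ * l, ?_⟩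
  rw [mul_smul, ← e', smul_smul, inv_mul_cancel₀ (two_ne_zero_zmod hp), one_smul]

theorem IsA2Pair.root_facts (h : IsA2Pair B x y) : B x y = -(B x x / 2) := by
  linarith [h.inner]

theorem Frame.rootFun_a2 (hB : IsPosDefSpace B) (F : Frame p B K a u red) (hx : IsRoot B K x) (hy :
    IsRoot B K y) (h : IsA2Pair B x y) : rootFun p B K red x (red y) = -1 ∧ rootFun p B K red y
    (red x) = -1 := by
  constructor
  · rw [F.rootFun_red hB hx hy.mem (m := -1) (by rw [h.inner]; push_cast; ring)]
    simp
  · rw [F.rootFun_red hB hy hx.mem (m := -1) (by rw [hB.symm, h.inner, h.norm]; push_cast; ring)]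
    simp

/-- The third root w of the frame of z and x lies in the plane of x and y. For p ≠ 3 the mirrors of
x and y determine that of w, and x, w are orthogonal, so `Frame.axis_of_orth_mirrors` applies. -/
theorem Frame.axis_of_a2_mirrors (hp : p ≠ 2) (hp3 : p ≠ 3) (hK : IntLattice B K) (F : Frame p B K
    a u red) (h : IsA2Pair B x y) (hx : IsRoot B K x) (hy : IsRoot B K y) (hz : IsRoot B K z) (hzx
    : B z x = 0) (hzy : B z y = 0) (h1 : IsMirror p B K red x v) (h2 : IsMirror p B K red y v) :
    IsAxis red z v := by
  have hB := hK.pd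
  obtain ⟨w, hw, ht⟩ := hK.third_root hz hx hzx
  have hy0 := hB.ne_zero hy.ne_zero
  have hx0 := hB.ne_zero hx.ne_zero
  have hw0 := hB.ne_zero hw.ne_zero
  have hwx : B w x = 0 := by rw [hB.symm, ht.yz]
  obtain ⟨n, hn⟩ := hw.2 y hy.mem
  obtain ⟨m, hm⟩ := hy.2 w hw.mem
  have e1 : (2 : ℚ) • y = (-1 : ℚ) • x + (n : ℚ) • w := by
    conv_lhs => rw [ht.expand hB hK.rank y, hzy]
    have e2 : 2 * (B x y / B x x) = -1 := by
      rw [← mul_div_assoc, h.inner, neg_div, div_self hx0]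
    have e3 : 2 * (B w y / B w w) = n := by grind
    rw [← e2, ← e3]
    module
  have hnm : n * m = 3 := by
    have h3 := congrArg (fun t => B t y) e1
    simp only [map_smul, map_add, LinearMap.add_apply, LinearMap.smul_apply, smul_eq_mul] at h3
    rw [hB.symm y w] at hm
    have h4 : ((n * m : ℤ) : ℚ) * B y y = (3 : ℤ) * B y y := by
      push_cast
      rw [h.root_facts, ← h.norm] at h3
      grind
    exact_mod_cast mul_right_cancel₀ hy0 h4
  refine F.axis_of_orth_mirrors hp hK (ht.rotate hB) hx hw hz h1 ?_
  obtain ⟨k, hk, rfl⟩ := F.surj v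
  obtain ⟨i, hi⟩ := hx.2 k hk
  obtain ⟨j, hj⟩ := hy.2 k hk
  obtain ⟨l, hl⟩ := hw.2 k hk
  rw [IsMirror, F.rootFun_red hB hx hk hi] at h1
  rw [IsMirror, F.rootFun_red hB hy hk hj] at h2
  rw [IsMirror, F.rootFun_red hB hw hk hl]
  have h5 : m * l = 2 * j + i := by
    have h3 := congrArg (fun t => B t k) e1
    simp only [map_smul, map_add, LinearMap.add_apply, LinearMap.smul_apply, smul_eq_mul] at h3
    have h4 : (m : ℚ) * B y y = n * B w w := by rw [← hm, ← hn, hB.symm]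
    have h6 : ((m * l : ℤ) : ℚ) * B y y = ((2 * j + i : ℤ) : ℚ) * B y y := by
      push_cast
      rw [← h.norm] at hi
      grind
    exact_mod_cast mul_right_cancel₀ hy0 h6
  have h6 : ((m * l : ℤ) : ZMod p) = 0 := by simp_all
  have hm0 : (m : ZMod p) ≠ 0 := by
    intro h0
    have h7 : ((3 : ℤ) : ZMod p) = 0 := by rw [← hnm, cast_mul, h0, mul_zero]
    exact hp3 (prime_dvd_small hp (by norm_num) (by norm_num) h7).1
  grind

/-- The third root of the frame of z and x has 4cos² = 4 - 0 - 1 = 3 against y. -/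
theorem hasG2_of_a2_orth (hK : IntLattice B K) (h : IsA2Pair B x y) (hx : IsRoot B K x) (hy :
    IsRoot B K y) (hz : IsRoot B K z) (hzx : B z x = 0) (hzy : B z y = 0) : HasG2 B K := by
  have hB := hK.pd
  obtain ⟨w, hw, ht⟩ := hK.third_root hz hx hzx
  obtain ⟨c, hc, -⟩ := hw.angle hB hy
  have h1 := ht.angles hK hy.ne_zero (a := 0) (b := 1) (c := c) (by rw [hzy]; simp)
    (by rw [h.root_facts, h.norm]; push_cast; ring) hc
  refine ⟨w, y, hw, hy, ?_⟩
  rw [hc, show c = 3 by omega]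
  norm_num

theorem exists_kernel_line {l m : (Fin 3 → ZMod p) →ₗ[ZMod p] ZMod p} {z : Fin 3 → ZMod p} (h : l w
    * m z - l z * m w ≠ 0) : ∃ v, v ≠ 0 ∧ l v = 0 ∧ m v = 0 ∧ ∀ v', l v' = 0 → m v' = 0 → ∃ t :
    ZMod p, v' = t • v := by
  let T := l.prod m
  have hs : LinearMap.range T = ⊤ := by
    rw [LinearMap.range_eq_top]
    rintro ⟨r, s⟩
    refine ⟨((r * m z - s * l z) / (l w * m z - l z * m w)) • w +
      ((s * l w - r * m w) / (l w * m z - l z * m w)) • z, ?_⟩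
    ext
    · simp [T]
      grind
    · simp [T]
      grind
  have hk : finrank (ZMod p) (LinearMap.ker T) = 1 := by
    have := T.finrank_range_add_finrank_ker
    rw [hs, finrank_top] at this
    simp at this
    omega
  obtain ⟨⟨v, hv⟩, hv0, hvs⟩ := finrank_eq_one_iff'.1 hk
  have hmem : ∀ v', v' ∈ LinearMap.ker T ↔ l v' = 0 ∧ m v' = 0 := fun v' => by
    simp [T]
  refine ⟨v, fun h0 => hv0 (Subtype.ext h0), ((hmem v).1 hv).1, ((hmem v).1 hv).2, ?_⟩
  intro v' h1 h2
  obtain ⟨t, ht⟩ := hvs ⟨v', (hmem v').2 ⟨h1, h2⟩⟩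
  exact ⟨t, (congrArg Subtype.val ht).symm⟩

/-- A line through the origin that meets the quadric meets it in two opposite points. -/
theorem card_quadX_line (hp : p ≠ 2) (hu : u 0 ≠ 0) {P : (Fin 3 → ZMod p) → Prop} [DecidablePred P]
    (hP : ∀ w, ∀ t : ZMod p, P w → P (t • w)) (hl : ∀ w, P w → ∃ t : ZMod p, w = t • v) : ((quadX a
    u).filter P).card = if ∃ w ∈ quadX a u, P w then 2 else 0 := by
  split_ifs with h
  · obtain ⟨w, hw, hPw⟩ := h
    have hw0 := ne_zero_of_mem_quadX hu hw
    have hne : w ≠ -w := by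
      intro e
      have h2 : (2 : ZMod p) • w = 0 := by
        rw [two_smul]
        grind
      exact hw0 ((smul_eq_zero.1 h2).resolve_left (two_ne_zero_zmod hp))
    rw [← card_pair hne]
    congr 1
    ext w'
    simp
    constructor
    · rintro ⟨h1, h2⟩
      obtain ⟨t, rfl⟩ := hl w hPw
      obtain ⟨s, rfl⟩ := hl w' h2
      have ht : t ≠ 0 := by rintro rfl; simp at hw0
      have e1 := (mem_quadX.1 hw).2
      have e2 := (mem_quadX.1 h1).2
      rw [formW_smul] at e1 e2
      have e3 : s * s = t * t := by grind
      rcases mul_self_eq_mul_self_iff.1 e3 with rfl | rfl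
      · simp
      · simp
    · have hneg : -w = (-1 : ZMod p) • w := by simp
      rintro (rfl | rfl)
      · grind
      · rw [hneg]
        refine ⟨mem_quadX.2 ⟨(mem_quadX.1 hw).1.smul _, ?_⟩, hP _ _ hPw⟩
        rw [formW_smul, (mem_quadX.1 hw).2]
        ring
  · simp_all

theorem inU_single {i : Fin 3} (h : a i ≠ 1) : InU a (Pi.single i (1 : ZMod p)) := by
  intro j hj
  grind

theorem not_proportional {i j : Fin 3} (hij : i ≠ j) (h : ∀ z : Fin 3 → ZMod p, ∃ t : ZMod p, z i =
    t * v i ∧ z j = t * v j) : False := by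
  obtain ⟨t, h1, h2⟩ := h (Pi.single i 1)
  obtain ⟨s, h3, h4⟩ := h (Pi.single j 1)
  grind

/-- The Gram determinant of w₁, w₂, v, when v is orthogonal to the other two, equals the determinant
of the form times the square of the determinant of the coordinates. -/
theorem det_formW {w₁ w₂ : Fin 3 → ZMod p} (h1 : formW a u w₁ v = 0) (h2 : formW a u w₂ v = 0) :
    (formW a u w₁ w₁ * formW a u w₂ w₂ - formW a u w₁ w₂ ^ 2) * formW a u v v = coefW a u 0 * coefW
    a u 1 * coefW a u 2 * (w₁ 0 * (w₂ 1 * v 2 - w₂ 2 * v 1) - w₁ 1 * (w₂ 0 * v 2 - w₂ 2 * v 0) + w₁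
    2 * (w₂ 0 * v 1 - w₂ 1 * v 0)) ^ 2 := by
  have key : ∀ A C D E G H : ZMod p, E = 0 → G = 0 →
      (A * C - D ^ 2) * H = A * C * H + 2 * D * E * G - A * G ^ 2 - C * E ^ 2 - H * D ^ 2 := by
    grind
  rw [key _ _ _ _ _ _ h1 h2]
  simp [formW, sum_univ_three]
  ring

/-- For p ≠ 2, 3 the two mirrors meet in a line, spanned by v, and the reductions of x and y span a
complement. The question is whether v can be scaled onto the quadric. The answer does not involve x
and y, although the proof depends on the power of p in Q(x). -/
theorem Frame.exists_a2_mirrors_iff (hp : p ≠ 2) (hp3 : p ≠ 3) (hK : IntLattice B K) (F : Frame p B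
    K a u red) (ha : a 1 ≤ a 2) (h : IsA2Pair B x y) (hx : IsRoot B K x) (hy : IsRoot B K y) : (∃ v
    ∈ quadX a u, IsMirror p B K red x v ∧ IsMirror p B K red y v) ↔ a 1 = a 2 ∧ (a 1 ≠ 2 ∨ ∃ s :
    ZMod p, s * s = 3 * u 1 * u 2) := by
  have hB := hK.pd
  have h2 := two_ne_zero_zmod hp
  have h3 : (3 : ZMod p) ≠ 0 := fun h0 =>
    hp3 (prime_dvd_small hp (k := 3) (by norm_num) (by norm_num) (by exact_mod_cast h0)).1
  have h4 : (4 : ZMod p) ≠ 0 := by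
    have := mul_ne_zero h2 h2
    grind
  obtain ⟨e12, e21⟩ := F.rootFun_a2 hB hx hy h
  have e11 := F.rootFun_self hB hx
  have e22 := F.rootFun_self hB hy
  have hnat := hK.norm_nat hx.mem
  obtain ⟨c, hc⟩ := hnat
  have hyx : B y y = B x x := h.norm
  unfold IsMirror
  set l := rootFun p B K red x with hl
  set m := rootFun p B K red y with hm
  obtain ⟨v, hv0, hlv, hmv, hv⟩ := exists_kernel_line (l := l) (m := m) (w := red x) (z := red y)
    (by rw [e11, e22, e12, e21]; ring_nf; exact h3)
  have hdec : ∀ z, ∃ α β γ : ZMod p, z = α • red x + β • red y + γ • v := by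
    intro z
    obtain ⟨t, ht⟩ := hv (z - ((2 * l z + m z) / 3) • red x - ((l z + 2 * m z) / 3) • red y)
      (by simp only [map_sub, map_smul, smul_eq_mul, e11, e12]; field_simp; ring)
      (by simp only [map_sub, map_smul, smul_eq_mul, e21, e22]; field_simp; ring)
    refine ⟨(2 * l z + m z) / 3, (l z + 2 * m z) / 3, t, ?_⟩
    grind
  have hl1 : l (red x) ≠ 0 := by rw [e11]; exact h2
  have hcase : ¬ Dv p 2 (B x x) ∨ (∃ c' : ℤ, B x x = (p : ℚ) ^ 2 * c' ∧ (c' : ZMod p) ≠ 0) ∨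
      Dv p 3 (B x x) := by
    by_cases hd : Dv p 2 (B x x)
    · obtain ⟨c', hc'⟩ := hd
      by_cases h0 : (c' : ZMod p) = 0
      · rw [ZMod.intCast_zmod_eq_zero_iff_dvd] at h0
        obtain ⟨k, rfl⟩ := h0
        exact Or.inr (Or.inr ⟨k, by rw [hc']; push_cast; ring⟩)
      · grind
    · exact Or.inl hd
  have ha0 := F.zero
  have hpos := F.pos 1
  have hu0 := F.unit 0
  have hX : (∃ w ∈ quadX a u, l w = 0 ∧ m w = 0) ↔ InU a v ∧ ∃ t, t * t * formW a u v v = u 0 := by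
    constructor
    · rintro ⟨w, hw, hlw, hmw⟩
      obtain ⟨t, rfl⟩ := hv w hlw hmw
      obtain ⟨h5, h6⟩ := mem_quadX.1 hw
      rw [formW_smul] at h6
      have ht : t ≠ 0 := by rintro rfl; simp [hu0.symm] at h6
      have := h5.smul t⁻¹
      rw [smul_smul, inv_mul_cancel₀ ht, one_smul] at this
      grind
    · rintro ⟨h5, t, h6⟩
      exact ⟨t • v, mem_quadX.2 ⟨h5.smul t, by rw [formW_smul, h6]⟩, by simp [hlv], by simp [hmv]⟩
  have hall : a 1 ≠ 1 → ∀ z : Fin 3 → ZMod p, InU a z := fun h1 z i hi => by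
    fin_cases i <;> simp at hi <;> omega
  have hform : 3 ≤ a 1 → ∀ z z', formW a u z z' = u 0 * z 0 * z' 0 := fun h1 z z' => by
    simp only [formW, coefW, sum_univ_three, ha0, if_true]
    grind
  rcases hcase with hd | ⟨c', hc', hc0⟩ | hd
  -- If p² does not divide Q(x), both functionals vanish on the subspace where the quadric lives. It
  -- is therefore contained in the line of v, which forces a 1 = a 2 = 1, and the first unit vector
  -- is a point.
  · have hlU : ∀ z, InU a z → l z = 0 ∧ m z = 0 := fun z hz =>
      ⟨F.rootFun_of_not_dv hK hx hd hz, F.rootFun_of_not_dv hK hy (by rwa [hyx]) hz⟩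
    have hE : InU a (Pi.single 0 (1 : ZMod p)) := inU_single (by omega)
    have hone : ∀ i, i ≠ 0 → a i = 1 := by
      intro i hi
      by_contra hne
      have h5 := hlU _ (inU_single (p := p) hne)
      obtain ⟨s, hs⟩ := hv _ h5.1 h5.2
      obtain ⟨r, hr⟩ := hv _ (hlU _ hE).1 (hlU _ hE).2
      have f1 := congrFun hs i
      have f2 := congrFun hs 0
      have f4 := congrFun hr 0
      simp [Pi.single_eq_of_ne hi.symm] at f1 f2 f4
      grind
    have := hone 1 (by decide)
    have := hone 2 (by decide)
    exact iff_of_true ⟨_, mem_quadX.2 ⟨hE, by simp [formW, coefW, ha0, sum_univ_three]⟩, hlU _ hE⟩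
      ⟨by omega, Or.inl (by omega)⟩
  -- If Q(x) is p² times a unit c, the Gram determinant of x and y in the reduced form is 3c²/4, not
  -- zero. In the case of exponents 2, 2, 2, `det_formW` relates the norm of v to 3u₀u₁u₂ up to
  -- squares; otherwise v is isotropic.
  · have hU1 := (F.modular x hx.mem).1 (hx.dv_of_norm hp hK ⟨c', hc'⟩)
    have hU2 := (F.modular y hy.mem).1 (hy.dv_of_norm hp hK (by rw [hyx]; exact ⟨c', hc'⟩))
    obtain ⟨-, g1, i3⟩ := F.rootFun_mul hp hK hx hc'
    obtain ⟨j1, g2, j3⟩ := F.rootFun_mul hp hK hy (hyx.trans hc')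
    have g3 : formW a u (red x) (red y) = -(c' / 2) := by grind
    have g5 : ∀ z, InU a z → l z = 0 → m z = 0 →
        formW a u (red x) z = 0 ∧ formW a u (red y) z = 0 := fun z hz hlz hmz => by grind
    set D := (red x 0 * (red y 1 * v 2 - red y 2 * v 1) -
      red x 1 * (red y 0 * v 2 - red y 2 * v 0) + red x 2 * (red y 0 * v 1 - red y 1 * v 0)) with hD
    have hq : InU a v → (3 : ZMod p) * c' ^ 2 * formW a u v v =
        4 * (coefW a u 0 * coefW a u 1 * coefW a u 2 * D ^ 2) := fun hvU => by
      rw [hD, ← det_formW (g5 v hvU hlv hmv).1 (g5 v hvU hlv hmv).2, g1, g2, g3]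
      grind
    have h3c := mul_ne_zero h3 (pow_ne_zero 2 hc0)
    rw [hX]
    by_cases ha2 : a 1 = 2 ∧ a 2 = 2
    · have hvU := hall (by omega)
      have hc2 : ∀ i, coefW a u i = u i := fun i => by fin_cases i <;> simp [coefW, ha0, ha2]
      replace hq := hq (hvU v)
      simp [hc2] at hq
      have hq0 : formW a u v v ≠ 0 := by
        intro h0
        apply hv0
        funext i
        have h6 : formW a u v (Pi.single i 1) = 0 := by
          obtain ⟨α, β, γ, e⟩ := hdec (Pi.single i 1)
          obtain ⟨g6, g7⟩ := g5 v (hvU v) hlv hmv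
          rw [e, formW_comm, formW_add_left, formW_add_left, formW_smul_left, formW_smul_left,
            formW_smul_left, g6, g7, h0]
          ring
        rw [formW, Finset.sum_eq_single i (fun j _ hj => by rw [Pi.single_eq_of_ne hj, mul_zero])
          (by simp), hc2, Pi.single_eq_same, mul_one] at h6
        exact (mul_eq_zero.1 h6).resolve_left (F.unit i)
      have hD : D ≠ 0 := by grind
      constructor
      · rintro ⟨-, t, ht⟩
        refine ⟨by omega, Or.inr ⟨2 * u 1 * u 2 * D * t / c', ?_⟩⟩
        grind
      · rintro ⟨-, hs⟩
        obtain ⟨s, hs⟩ := hs.resolve_left (by simp [ha2])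
        have hs0 : s ≠ 0 := by grind
        refine ⟨hvU v, 3 * c' / (2 * s * D), ?_⟩
        field_simp
        grind
    · refine iff_of_false ?_ ?_
      · rintro ⟨hvU, t, ht⟩
        have h0 : coefW a u 1 * coefW a u 2 = 0 := by
          rcases not_and_or.1 ha2 with h | h <;> simp [coefW, h]
        grind
      · rintro ⟨h12, -⟩
        rcases (by omega : a 1 = 1 ∨ 3 ≤ a 1) with h1 | h1
        · refine not_proportional (i := 1) (j := 2) (by decide) (v := v) fun z => ?_
          obtain ⟨α, β, γ, rfl⟩ := hdec z
          exact ⟨γ, by simp [hU1 1 h1, hU2 1 h1], by simp [hU1 2 (by omega), hU2 2 (by omega)]⟩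
        · grind
  -- If p³ divides Q(x), the reductions of x and y are in the radical, so a 1 and a 2 are at least 3
  -- and the form is u₀ times the square of the coordinate 0, which does not vanish at v.
  · have hr : ∀ i, a i ≤ 2 → red x i = 0 ∧ red y i = 0 := fun i hi =>
      ⟨F.red_rad hp hK hx hd i hi, F.red_rad hp hK hy (by rwa [hyx]) i hi⟩
    have hbig : ∀ i, i ≠ 0 → 3 ≤ a i := by
      intro i hi
      by_contra hlt
      refine not_proportional hi (v := v) fun z => ?_
      obtain ⟨α, β, γ, rfl⟩ := hdec z
      exact ⟨γ, by simp [hr i (by omega)], by simp [hr 0 (by omega)]⟩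
    have h1 := hbig 1 (by decide)
    have hv00 : v 0 ≠ 0 := by
      intro h0
      obtain ⟨α, β, γ, e⟩ := hdec (Pi.single 0 1)
      have := congrFun e 0
      simp_all
    refine iff_of_true (hX.2 ⟨hall (by omega) v, (v 0)⁻¹, by rw [hform h1]; field_simp⟩)
      ⟨?_, Or.inl (by omega)⟩
    -- Let p^n be the exact power in Q(x). The Gram determinant of x and y is 3/4 of Q(x)², so it
    -- contains p exactly 2n times, while `deep` would give one factor more if a 1 < a 2.
    by_contra hne
    have hc0 : c ≠ 0 := by
      rintro rfl
      exact hB.ne_zero hx.ne_zero (by rw [hc]; simp)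
    have hpp := (Fact.out : p.Prime)
    obtain ⟨n, k, hk, hck⟩ := Nat.exists_eq_pow_mul_and_not_dvd hc0 p hpp.ne_one
    have hcn : B x x = p ^ n * k := by rw [hc, hck]; push_cast; ring
    have hn3 : 3 ≤ n := by
      by_contra hlt
      obtain ⟨r, hr⟩ := hd
      have h5 : p ^ 3 ∣ p ^ n * k := by
        have h6 : ((p ^ n * k : ℕ) : ℤ) = (p ^ 3 : ℕ) * r := by
          rw [hcn] at hr
          exact_mod_cast hr
        exact Int.natCast_dvd_natCast.1 ⟨r, h6⟩
      exact hk (Nat.dvd_of_mul_dvd_mul_left (pow_pos hpp.pos n)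
        (pow_succ p n ▸ (pow_dvd_pow p (by omega)).trans h5))
    have hdn : Dv p n (B x x) := ⟨k, by rw [hcn]; push_cast; ring⟩
    obtain ⟨r, hr⟩ := F.deep h1 (by omega) n hn3 x hx.mem y hy.mem (hx.dv_of_norm hp hK hdn)
      (hy.dv_of_norm hp hK (by rwa [hyx]))
    rw [h.norm, h.root_facts, hcn] at hr
    have h6 : (3 * k ^ 2 : ℤ) = p * (4 * r) := by
      have h5 : (3 * k ^ 2 : ℚ) = p * (4 * r) := by
        apply mul_left_cancel₀ (pow_ne_zero (2 * n) (show (p : ℚ) ≠ 0 from Nat.cast_ne_zero.2 hpp.ne_zero))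
        linear_combination 4 * hr
      exact_mod_cast h5
    have h7 := congrArg (Int.cast : ℤ → ZMod p) h6
    push_cast at h7
    rw [ZMod.natCast_self, zero_mul] at h7
    exact hk ((natCast_eq_zero_iff _ _).1 (pow_eq_zero_iff two_ne_zero |>.1 ((mul_eq_zero.1 h7).resolve_left h3)))

/-- For p = 3 the reduction of x - y lies on both mirrors, and without G₂ the two functionals are
independent, so it spans their intersection. But Q(x - y) = 3Q(x) makes it isotropic, so the line
contains no point of the quadric. -/
theorem Frame.no_a2_mirrors_three (hp3 : p = 3) (hK : IntLattice B K) (F : Frame p B K a u red) (hG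
    : ¬ HasG2 B K) (h : IsA2Pair B x y) (hx : IsRoot B K x) (hy : IsRoot B K y) (hw : w ∈ quadX a
    u) (h1 : IsMirror p B K red x w) (h2 : IsMirror p B K red y w) : False := by
  have hp : p ≠ 2 := by omega
  have hB := hK.pd
  have h3 : (3 : ZMod p) = 0 := by
    exact_mod_cast (natCast_eq_zero_iff 3 p).2 (by rw [hp3])
  obtain ⟨e12, e21⟩ := F.rootFun_a2 hB hx hy h
  have e11 := F.rootFun_self hB hx
  have e22 := F.rootFun_self hB hy
  have hnorm : B (x - y) (x - y) = 3 * B x x := by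
    simp [map_sub]
    rw [hB.symm y x, h.root_facts, h.norm]
    ring
  have hx0 := hB.ne_zero hx.ne_zero
  have hxy0 : x - y ≠ 0 := by grind
  -- If the functionals were equal, x - y would define a symmetry, at 30 degrees to x.
  have hfun : rootFun p B K red x ≠ rootFun p B K red y := by
    intro he
    refine hG (hasG2_of_vector hK hx (K.sub_mem hx.mem hy.mem) hxy0 (fun k hk => ?_) ?_)
    · obtain ⟨n, hn⟩ := hx.2 k hk
      obtain ⟨m, hm⟩ := hy.2 k hk
      have h4 : ((n - m : ℤ) : ZMod p) = 0 := by
        rw [Int.cast_sub, ← F.rootFun_red hB hx hk hn, ← F.rootFun_red hB hy hk hm, he, sub_self]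
      rw [ZMod.intCast_zmod_eq_zero_iff_dvd, hp3] at h4
      obtain ⟨r, hr⟩ := h4
      refine ⟨r, ?_⟩
      have hr' : (n : ℚ) - m = 3 * r := by exact_mod_cast hr
      rw [hnorm]
      rw [h.norm] at hm
      simp
      grind
    · rw [hnorm, map_sub, h.root_facts]
      ring
  obtain ⟨z, hz⟩ := DFunLike.exists_ne hfun
  obtain ⟨v, -, -, -, hv⟩ := exists_kernel_line (l := rootFun p B K red x)
    (m := rootFun p B K red y) (w := red x) (z := z) (by grind)
  have hdx : red (x - y) = red x - red y := F.red_sub hx.mem hy.mem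
  have hd0 : red (x - y) ≠ 0 := by
    intro h0
    rw [hdx, sub_eq_zero] at h0
    rcases F.parallel_of_proportional hp hK (fun _ => hG) hx hy (r := 1) (by rw [one_smul, h0]) with
      rfl | rfl
    · simp at hxy0
    · have := h.root_facts
      grind
  obtain ⟨r, hr⟩ := hv (red (x - y)) (by rw [hdx, map_sub, e11, e12]; linear_combination h3)
    (by rw [hdx, map_sub, e21, e22]; linear_combination -h3)
  obtain ⟨s, hs⟩ := hv w h1 h2
  have hr0 : r ≠ 0 := by
    rintro rfl
    simp_all
  have hw' : w = (s * r⁻¹) • red (x - y) := by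
    rw [hr, smul_smul, mul_assoc, inv_mul_cancel₀ hr0, mul_one, hs]
  have hwq := (mem_quadX.1 hw).2
  have hs0 : s * r⁻¹ ≠ 0 := by
    intro h0
    rw [h0, zero_smul] at hw'
    exact ne_zero_of_mem_quadX (F.unit 0) hw hw'
  have hU : InU a (red (x - y)) := by
    have := (mem_quadX.1 hw).1.smul (s * r⁻¹)⁻¹
    rwa [hw', smul_smul, inv_mul_cancel₀ hs0, one_smul] at this
  have hmem := K.sub_mem hx.mem hy.mem
  have hq : formW a u (red (x - y)) (red (x - y)) = 0 := by
    by_cases hd : Dv p 2 (B x x)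
    · obtain ⟨c, hc⟩ := hd
      have := F.form _ hmem _ hmem hU hU (3 * c) (by rw [hnorm, hc]; push_cast; ring)
      rw [cast_mul, Int.cast_ofNat, h3, zero_mul] at this
      exact this.symm
    · exfalso
      apply hfun
      apply LinearMap.ext
      intro z
      obtain ⟨k, hk, rfl⟩ := F.surj z
      obtain ⟨n, hn⟩ := hx.2 k hk
      obtain ⟨m, hm⟩ := hy.2 k hk
      rw [F.rootFun_red hB hx hk hn, F.rootFun_red hB hy hk hm, ← sub_eq_zero, ← Int.cast_sub]
      by_contra hne
      obtain ⟨q, hq⟩ := (F.modular _ hmem).2 hU k hk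
      obtain ⟨c, hc⟩ := hK.norm_nat hx.mem
      rw [h.norm, hc] at hm
      rw [hc] at hn hd
      have h5 : (n - m) * (c : ℤ) = p ^ 2 * (2 * q) := by
        have : ((n : ℚ) - m) * c = p ^ 2 * (2 * q) := by
          simp at hq
          linarith
        exact_mod_cast this
      rw [ZMod.intCast_zmod_eq_zero_iff_dvd] at hne
      have hpp : Prime (p : ℤ) := Nat.prime_iff_prime_int.1 Fact.out
      obtain ⟨t, ht⟩ := (IsCoprime.pow_left ((Irreducible.coprime_iff_not_dvd hpp.irreducible).2 hne) :
        IsCoprime ((p : ℤ) ^ 2) (n - m)).dvd_of_dvd_mul_left ⟨_, h5⟩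
      apply hd
      exact ⟨t, by exact_mod_cast ht⟩
  rw [hw', formW_smul, hq, mul_zero] at hwq
  exact F.unit 0 hwq.symm

theorem Frame.card_a2_mirrors (hp : p ≠ 2) (hK : IntLattice B K) (F : Frame p B K a u red) (ha : a
    1 ≤ a 2) (hreg : p = 3 → ¬ HasG2 B K) (h : IsA2Pair B x y) (hx : IsRoot B K x) (hy : IsRoot B K
    y) [Decidable (p ≠ 3 ∧ a 1 = a 2 ∧ (a 1 ≠ 2 ∨ ∃ s : ZMod p, s * s = 3 * u 1 * u 2))] : ((quadX
    a u).filter fun v => IsMirror p B K red x v ∧ IsMirror p B K red y v).card = if p ≠ 3 ∧ a 1 = a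
    2 ∧ (a 1 ≠ 2 ∨ ∃ s : ZMod p, s * s = 3 * u 1 * u 2) then 2 else 0 := by
  have hB := hK.pd
  by_cases hp3 : p = 3
  · rw [if_neg fun h => h.1 hp3, card_eq_zero, filter_eq_empty_iff]
    exact fun w hw hm => F.no_a2_mirrors_three hp3 hK (hreg hp3) h hx hy hw hm.1 hm.2
  · obtain ⟨e12, e21⟩ := F.rootFun_a2 hB hx hy h
    obtain ⟨v, -, -, -, hv⟩ := exists_kernel_line (l := rootFun p B K red x)
      (m := rootFun p B K red y) (w := red x) (z := red y) (by
        rw [F.rootFun_self hB hx, F.rootFun_self hB hy, e12, e21]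
        ring_nf
        intro h0
        exact hp3 (prime_dvd_small hp (k := 3) (by norm_num) (by norm_num) (by exact_mod_cast h0)).1)
    rw [card_quadX_line hp (F.unit 0) (v := v) (fun w t hw => ?_) fun w hw => hv w hw.1 hw.2]
    · refine if_congr ?_ rfl rfl
      rw [F.exists_a2_mirrors_iff hp hp3 hK ha h hx hy]
      simp_all
    · unfold IsMirror at hw ⊢
      simp_all

/-! ### The label at a point -/

/-- Vectors of equal norm at an angle of 60 or 120 degrees. -/
def IsHexPair (B : BilinForm ℚ V) (x y : V) : Prop :=
  B y y = B x x ∧ (2 * B x y = B x x ∨ 2 * B x y = -B x x)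

theorem IsA2Pair.hex_of_mem (hB : IsPosDefSpace B) {w : V} (h : IsA2Pair B x y) (hw : ∃ k ∈ [x, y,
    x + y], w = k ∨ w = -k) (hz : ∃ k ∈ [x, y, x + y], z = k ∨ z = -k) (hwz : z ≠ w ∧ z ≠ -w) : B w
    w = B x x ∧ IsHexPair B w z := by
  have h1 := h.root_facts
  have h2 := h.norm
  have h3 := hB.symm y x
  unfold IsHexPair
  obtain ⟨k, hk, hw⟩ := hw
  obtain ⟨k', hk', hz⟩ := hz
  simp at hk hk'
  rcases hk with rfl | rfl | rfl <;> rcases hk' with rfl | rfl | rfl <;>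
    rcases hw with rfl | rfl <;> rcases hz with rfl | rfl <;>
    first
    | (exfalso; simp at hwz; done)
    | (refine ⟨?_, ?_, ?_⟩ <;>
        (try simp only [map_add, map_neg, LinearMap.add_apply, LinearMap.neg_apply]) <;>
        first
        | linarith
        | (left; linarith)
        | (right; linarith))

theorem IsRootList.ne (h : IsRootList B K xs) (hx : x ∈ xs) (hy : y ∈ xs) (hxy : y ≠ x) : y ≠ x ∧ y
    ≠ -x :=
  have : Std.Symm fun x y : V => y ≠ x ∧ y ≠ -x :=
    ⟨fun _ _ h => ⟨h.1.symm, fun e => h.2 (by rw [e, neg_neg])⟩⟩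
  h.pairwise.forall hx hy hxy.symm

/-- All types but ∅, A₁ and A₂ contain an orthogonal pair of roots. -/
theorem IsRootList.of_no_orth (hK : IntLattice B K) (h : IsRootList B K ys) (ho : ∀ x ∈ ys, ∀ y ∈
    ys, B x y ≠ 0) : (ys = [] ∧ Nat.card (orthGroup B K) = 2) ∨ (∃ x, ys = [x] ∧ Nat.card
    (orthGroup B K) = 4) ∨ (ys.length = 3 ∧ Nat.card (orthGroup B K) = 12 ∧ ∃ c : ℚ, (∀ x ∈ ys, B x
    x = c) ∧ ∀ x ∈ ys, ∀ y ∈ ys, y ≠ x → IsHexPair B x y) := by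
  have hB := hK.pd
  have hlen : ∀ xs, IsRootList B K xs → ys.length = xs.length := fun xs hx => by
    simpa using (h.norms_perm hB hx).length_eq
  have hor : ∀ x y, IsRoot B K x → IsRoot B K y → B x y ≠ 0 := by
    intro x y hx hy
    obtain ⟨x', hx', e1⟩ := h.complete x hx
    obtain ⟨y', hy', e2⟩ := h.complete y hy
    have := ho x' hx' y' hy'
    rcases e1 with rfl | rfl <;> rcases e2 with rfl | rfl <;> simpa using this
  rcases hK.rootType with h1 | ⟨x, h1⟩ | ⟨x, y, z, ht, h1⟩ | ⟨x, y, hA, h1⟩ | ⟨z, x, y, ht, hn,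
    h1⟩ |
    ⟨z, x, y, hz, hzx, hzy, hA, h1⟩ | ⟨s, a, b, c, hs, ht, hab, hac, h1⟩
  · exact Or.inl ⟨List.length_eq_zero_iff.1 (hlen _ h1), card_orthGroup_none hK h1⟩
  · obtain ⟨y, rfl⟩ := List.length_eq_one_iff.1 (hlen _ h1)
    exact Or.inr (Or.inl ⟨y, rfl, card_orthGroup_one hK h1⟩)
  · exact absurd ht.xy (hor x y (h1.root _ (by simp)) (h1.root _ (by simp)))
  · refine Or.inr (Or.inr ⟨hlen _ h1, card_orthGroup_a2 hK hA h1, B x x, fun w hw => ?_, ?_⟩)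
    · obtain ⟨k, hk, e⟩ := h1.complete w (h.root w hw)
      have h2 := hA.root_facts
      have h3 := hA.norm
      have h4 := hB.symm y x
      simp at hk
      rcases hk with rfl | rfl | rfl <;> rcases e with rfl | rfl <;>
        simp only [map_add, map_neg, LinearMap.add_apply, LinearMap.neg_apply, h2, h3, h4] <;> ring
    · intro w hw z hz hne
      have hpw := h.ne hw hz hne
      exact (hA.hex_of_mem hB (h1.complete w (h.root w hw)) (h1.complete z (h.root z hz)) hpw).2
  · exact absurd ht.xy (hor z x (h1.root _ (by simp)) (h1.root _ (by simp)))
  · exact absurd hzx (hor z x (h1.root _ (by simp [listG2])) (h1.root _ (by simp [listG2])))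
  · exact absurd ht.xy (hor a b (h1.root _ (by simp [listCubic])) (h1.root _ (by simp [listCubic])))

/-- A lattice with a frame, such that the adjunction of a vector is inverse to `Λ_p`. -/
structure Gluing (p : ℕ) [Fact p.Prime] (B : BilinForm ℚ V) (K : Submodule ℤ V)
    (a : Fin 3 → ℕ) (u : Fin 3 → ZMod p) (red : V → Fin 3 → ZMod p) : Prop where
  ne_two : p ≠ 2
  int : IntLattice B K
  frame : Frame p B K a u red
  le : a 1 ≤ a 2
  glue : ∀ n, Adjoinable p B K (u 0) n → IntLattice B (overLat p K n) ∧
    watson B p (overLat p K n) = K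

/-- The label of the lattice obtained by the adjunction of a vector with the reduction `v`. -/
def LabelAt (p : ℕ) (B : BilinForm ℚ V) (K : Submodule ℤ V) (red : V → Fin 3 → ZMod p)
    (v : Fin 3 → ZMod p) (ℓ : Label) : Prop :=
  ∀ n ∈ K, red n = v → HasLabel B (overLat p K n) ℓ

theorem Gluing.labelAt (G : Gluing p B K a u red) (hv : v ∈ quadX a u) (h : ∀ n, red n = v →
    IntLattice B (overLat p K n) → watson B p (overLat p K n) = K → Adjoinable p B K (u 0) n →
    HasLabel B (overLat p K n) ℓ) : LabelAt p B K red v ℓ := by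
  intro n hn hr
  have had := (G.frame.adjoinable_iff G.int).2 ⟨hn, by rwa [hr]⟩
  obtain ⟨h1, h2⟩ := G.glue n had
  simp_all

/-- A point on the axis of x is on no other axis, and it is on the mirror of y exactly if y is
orthogonal to x. The list of surviving roots is x/p followed by the roots orthogonal to x; if it has
three members, it contains an orthogonal pair and is not A₂. -/
theorem Gluing.labelAt_axis (G : Gluing p B K a u red) (hreg : p = 3 → ¬ HasG2 B K) (hxs :
    IsRootList B K xs) (hf : ∀ x ∈ xs, B x x = f x) (hx : x ∈ xs) (hv : v ∈ quadX a u) (hxv :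
    IsAxis red x v) : LabelAt p B K red v (symmOrder (1 + (xs.filter fun y => B y x = 0).length),
    sortList (f x / p ^ 2 :: (xs.filter fun y => B y x = 0).map f)) := by
  have hp := G.ne_two
  have hK := G.int
  have hB := hK.pd
  have F := G.frame
  have hv0 := ne_zero_of_mem_quadX (F.unit 0) hv
  have hax : ∀ y ∈ xs, IsAxis red y v → y = x := by
    intro y hy hyv
    obtain ⟨t, ht⟩ := hxv
    obtain ⟨s, rfl⟩ := hyv
    have hs : s ≠ 0 := by rintro rfl; simp at hv0
    have hpar := F.parallel_of_proportional hp hK hreg (hxs.root x hx) (hxs.root y hy)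
      (r := s⁻¹ * t) (by rw [mul_smul, ← ht, smul_smul, inv_mul_cancel₀ hs, one_smul])
    by_contra hne
    have := hxs.ne hx hy hne
    tauto
  have hmir : ∀ y ∈ xs, IsMirror p B K red y v ↔ B y x = 0 := fun y hy =>
    ⟨F.orth_of_axis_mirror hp hB hreg (hxs.root x hx) (hxs.root y hy) hv0 hxv,
      fun h => F.mirror_of_axis_orth hB (hxs.root x hx) (hxs.root y hy) h hxv⟩
  have hxx : ¬ B x x = 0 := hB.ne_zero (hxs.root x hx).ne_zero
  have hnd : xs.Nodup := hxs.pairwise.imp fun h => h.1.symm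
  refine G.labelAt hv fun n hr hM hw had => ?_
  subst hr
  have hl := F.rootList_over hp hK hxs had hw
  set ys := xs.filter fun y => decide (B y x = 0) with hys
  have hperm : (xs.filter fun y => IsAxis red y (red n) ∨ IsMirror p B K red y (red n)).Perm
      (x :: ys) := by
    rw [List.perm_ext_iff_of_nodup (hnd.filter _)]
    · grind
    · grind
  have hconv : (x :: ys).map (convRoot p red (red n)) = (p : ℚ)⁻¹ • x :: ys := by
    rw [map_cons, convRoot, if_pos hxv]
    congr 1
    conv_rhs => rw [← List.map_id ys]
    refine map_congr_left fun y hy => ?_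
    obtain ⟨hy1, hy2⟩ := mem_filter.1 hy
    rw [convRoot, if_neg, id]
    grind
  have hl' : IsRootList B (overLat p K n) ((p : ℚ)⁻¹ • x :: ys) := by
    rw [← hconv]
    exact hl.perm (hperm.map _).symm
  have hp0 : (p : ℚ) ≠ 0 := by exact_mod_cast prime_ne_zero' p
  obtain ⟨m, hm⟩ := hM.norm_nat (hl'.root ((p : ℚ)⁻¹ • x) mem_cons_self).mem
  have hm' : f x / p ^ 2 = m := by
    have : (f x : ℚ) = p ^ 2 * m := by
      rw [← hf x hx, ← hm]
      simp
      field_simp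
    have : f x = p ^ 2 * m := by exact_mod_cast this
    simp_all
  rw [hl'.hasLabel_iff_eq hM (ns := f x / p ^ 2 :: ys.map f), card_orthGroup_of_list hM hl',
    List.length_cons, add_comm]
  · intro hlen
    have : ys ≠ [] := by rintro h; rw [h] at hlen; simp at hlen
    obtain ⟨y, hy⟩ := List.exists_mem_of_ne_nil _ this
    refine ⟨(p : ℚ)⁻¹ • x, by simp, y, mem_cons_of_mem _ hy, ?_⟩
    have h1 := (mem_filter.1 hy).2
    rw [map_smul, LinearMap.smul_apply, hB.symm, of_decide_eq_true h1, smul_zero]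
  · simp_all

/-- Off all axes no two surviving roots are orthogonal, as the point would be on the axis of the
third root of the frame. This leaves the types ∅, A₁ and A₂. -/
theorem Gluing.mirrors (G : Gluing p B K a u red) (hxs : IsRootList B K xs) (hf : ∀ x ∈ xs, B x x =
    f x) (hv : v ∈ quadX a u) (hax : ∀ x ∈ xs, ¬ IsAxis red x v) : (xs.filter (fun y => IsMirror p
    B K red y v) = [] ∧ LabelAt p B K red v (2, [])) ∨ (∃ x, xs.filter (fun y => IsMirror p B K red
    y v) = [x] ∧ LabelAt p B K red v (4, [f x])) ∨ ((xs.filter fun y => IsMirror p B K red y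
    v).length = 3 ∧ ∃ c : ℕ, LabelAt p B K red v (12, [c, c, c]) ∧ (∀ x ∈ xs, IsMirror p B K red x
    v → f x = c) ∧ ∀ x ∈ xs, IsMirror p B K red x v → ∀ y ∈ xs, IsMirror p B K red y v → y ≠ x →
    IsHexPair B x y) := by
  have hp := G.ne_two
  have hK := G.int
  have hB := hK.pd
  have F := G.frame
  obtain ⟨n, hn, rfl⟩ := F.surj v
  have had := (F.adjoinable_iff hK).2 ⟨hn, hv⟩
  have hlist : ∀ m, red m = red n → Adjoinable p B K (u 0) m → watson B p (overLat p K m) = K →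
      IsRootList B (overLat p K m) (xs.filter fun y => IsMirror p B K red y (red n)) := by
    intro m hm had hw
    have hl := F.rootList_over hp hK hxs had hw
    rw [hm] at hl
    have e1 : (xs.filter fun y => IsAxis red y (red n) ∨ IsMirror p B K red y (red n)) =
        xs.filter fun y => IsMirror p B K red y (red n) :=
      List.filter_congr fun y hy => by simp [hax y hy]
    rw [e1, map_congr_left (g := id), List.map_id] at hl
    · exact hl
    · intro y hy
      rw [convRoot, if_neg (hax y (mem_filter.1 hy).1), id]
  have hrange : ∀ m ∈ K, red m = red n → overLat p K m = overLat p K n := fun m hm hr =>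
    (F.over_eq_iff hK ((F.adjoinable_iff hK).2 ⟨hm, by rwa [hr]⟩) had).2 (Or.inl hr)
  obtain ⟨hM, hw⟩ := G.glue n had
  have hl := hlist n rfl had hw
  have hlab : ∀ ℓ, HasLabel B (overLat p K n) ℓ → LabelAt p B K red (red n) ℓ := fun ℓ h m hm hr => by
    simp_all
  have hno : ∀ x ∈ xs.filter (fun y => IsMirror p B K red y (red n)),
      ∀ y ∈ xs.filter (fun y => IsMirror p B K red y (red n)), B x y ≠ 0 := by
    intro x hx y hy h0
    obtain ⟨hx1, hx2⟩ := mem_filter.1 hx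
    obtain ⟨hy1, hy2⟩ := mem_filter.1 hy
    obtain ⟨z, hz, ht⟩ := hK.third_root (hxs.root x hx1) (hxs.root y hy1) h0
    have h4 := F.axis_of_orth_mirrors hp hK ht (hxs.root x hx1) (hxs.root y hy1) hz
      (of_decide_eq_true hx2) (of_decide_eq_true hy2)
    obtain ⟨w, hw1, rfl | rfl⟩ := hxs.complete z hz
    · simp_all
    · obtain ⟨t, ht⟩ := h4
      refine hax _ hw1 ⟨-t, ?_⟩
      rw [ht, F.red_neg (hxs.root w hw1).mem, smul_neg, neg_smul]
  rcases hl.of_no_orth hM hno with ⟨h1, h2⟩ | ⟨x, h1, h2⟩ | ⟨h1, h2, c, hc, h3⟩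
  · refine Or.inl ⟨h1, hlab _ ?_⟩
    rw [hl.hasLabel_iff_eq hM (ns := []) (by rw [h1]; rfl), h2]
    rfl
  · refine Or.inr (Or.inl ⟨x, h1, hlab _ ?_⟩)
    have hx : x ∈ xs := (mem_filter.1 (h1 ▸ List.mem_singleton_self x : x ∈ xs.filter _)).1
    rw [hl.hasLabel_iff_eq hM (ns := [f x]) (by rw [h1]; simp [hf x hx]), h2]
    rfl
  · have hmem : ∀ x ∈ xs, IsMirror p B K red x (red n) →
        x ∈ xs.filter fun y => IsMirror p B K red y (red n) := fun x hx h =>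
      mem_filter.2 ⟨hx, by simpa using h⟩
    obtain ⟨x₀, hx₀⟩ := List.exists_mem_of_length_pos (by rw [h1]; norm_num :
      0 < (xs.filter fun y => IsMirror p B K red y (red n)).length)
    have hx₀' := (mem_filter.1 hx₀).1
    have hfc : ∀ x ∈ xs.filter (fun y => IsMirror p B K red y (red n)), f x = f x₀ := by
      intro x hx
      have e1 := hc x hx
      rw [← hc x₀ hx₀, hf x (mem_filter.1 hx).1, hf x₀ hx₀'] at e1
      exact_mod_cast e1
    refine Or.inr (Or.inr ⟨h1, f x₀, hlab _ ?_, fun x hx h => hfc x (hmem x hx h),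
      fun x hx h y hy h' => h3 x (hmem x hx h) y (hmem y hy h')⟩)
    rw [hl.hasLabel_iff_eq hM (ns := [f x₀, f x₀, f x₀]), h2]
    · exact Prod.ext rfl (by simp [sortList])
    · rw [show ([f x₀, f x₀, f x₀].map fun n : ℕ => (n : ℚ)) = replicate 3 (f x₀ : ℚ) by rfl,
        List.eq_replicate_iff]
      simp_all

/-! ### The weighted count of labels -/

/-- The total weight of a label in a list of weighted labels. -/
def weight (E : List (ℕ × Label)) (lam : Label) : ℕ :=
  (E.map fun e => if e.2 = lam then e.1 else 0).sum

theorem weight_append (E E' : List (ℕ × Label)) (lam : Label) :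
    weight (E ++ E') lam = weight E lam + weight E' lam := by
  simp [weight]

theorem weight_flatMap {α : Type*} (es : List α) (g : α → List (ℕ × Label)) (lam : Label) :
    weight (es.flatMap g) lam = (es.map fun e => weight (g e) lam).sum := by
  induction es with
  | nil => rfl
  | cons e es ih => rw [flatMap_cons, weight_append, ih, map_cons, sum_cons]

/-- The number of points that lie on the mirror of a single root. An entry consists of the norm of
the root, the norms of the roots orthogonal to it, and the number of roots, up to sign, of the
same norm at an angle of 60 degrees. -/
def loneCount (adm mir : ℕ → ℕ) (d : ℕ) (e : ℕ × List ℕ × ℕ) : ℕ :=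
  mir e.1 - (e.2.1.map adm).sum - d * e.2.2

/-- The weighted labels that come from one root. -/
def rootCells (adm mir : ℕ → ℕ) (p d : ℕ) (e : ℕ × List ℕ × ℕ) : List (ℕ × Label) :=
  [(symmOrder (1 + e.2.1.length) * adm e.1,
      (symmOrder (1 + e.2.1.length), sortList (e.1 / p ^ 2 :: e.2.1))),
    (4 * loneCount adm mir d e, (4, [e.1])), (4 * (d * e.2.2), (12, [e.1, e.1, e.1]))]

/-- The weighted labels of the points of a quadric with `q` points. -/
def regularCells (q : ℕ) (adm mir : ℕ → ℕ) (p d : ℕ) (es : List (ℕ × List ℕ × ℕ)) :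
    List (ℕ × Label) :=
  es.flatMap (rootCells adm mir p d) ++
    [(2 * (q - (es.map fun e => adm e.1 + loneCount adm mir d e).sum -
      (es.map fun e => d * e.2.2).sum / 3), (2, []))]

theorem HasLabel.unique (hK : IntLattice B K) (h : HasLabel B K ℓ) (h' : HasLabel B K ℓ') : ℓ = ℓ' := by
  obtain ⟨xs, hx⟩ := hK.rootType.exists_list
  obtain ⟨ns, hn⟩ := hx.exists_norms hK
  rw [hx.hasLabel_iff_eq hK hn] at h h'
  rw [h, h']

theorem Gluing.labelAt_unique (G : Gluing p B K a u red) (hv : v ∈ quadX a u) (h : LabelAt p B K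
    red v ℓ) (h' : LabelAt p B K red v ℓ') : ℓ = ℓ' := by
  obtain ⟨n, hn, rfl⟩ := G.frame.surj v
  exact (h n hn rfl).unique (G.glue n ((G.frame.adjoinable_iff G.int).2 ⟨hn, hv⟩)).1 (h' n hn rfl)

theorem isHexPair_irrefl (hB : IsPosDefSpace B) (hx : x ≠ 0) : ¬ IsHexPair B x x := by
  have := hB.pos x hx
  rintro ⟨-, h | h⟩ <;> linarith

/-- Each point is charged to the roots that it involves. The sets α v and m v are the axes and the
mirrors of v; a point has one axis, or it has no axis and zero, one or three mirrors. Summing four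
pointwise identities over the quadric determines all the numbers from those of single axes, mirrors
and skew pairs of mirrors. -/
theorem Gluing.regular_weight (G : Gluing p B K a u red) (hreg : p = 3 → ¬ HasG2 B K) (hxs :
    IsRootList B K xs) {n : V → ℕ} (hf : ∀ x ∈ xs, B x x = f x) {adm mir : ℕ → ℕ} {d : ℕ} (hadm : ∀
    x ∈ xs, ((quadX a u).filter (IsAxis red x)).card = adm (f x)) (hmir : ∀ x ∈ xs, ((quadX a
    u).filter (IsMirror p B K red x)).card = mir (f x)) (hn : ∀ x ∈ xs, (xs.map fun y => open
    scoped Classical in if IsHexPair B x y then ((quadX a u).filter fun v => (∀ z ∈ xs, ¬ IsAxis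
    red z v) ∧ IsMirror p B K red x v ∧ IsMirror p B K red y v).card else 0).sum = 2 * (d * n x))
    {lab : (Fin 3 → ZMod p) → Label} (hlab : ∀ v ∈ quadX a u, LabelAt p B K red v (lab v)) (lam :
    Label) : weight (regularCells (quadX a u).card adm mir p d (xs.map fun x => (f x, (xs.filter
    fun y => B y x = 0).map f, n x))) lam = ∑ v ∈ quadX a u, if lab v = lam then lam.1 else 0 := by
  classical
  have hp := G.ne_two
  have hK := G.int
  have hB := hK.pd
  have F := G.frame
  set X := quadX a u with hX
  have hnd : xs.Nodup := hxs.pairwise.imp fun h => h.1.symm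
  set R := xs.toFinset with hR
  have hmR : ∀ {x}, x ∈ R ↔ x ∈ xs := List.mem_toFinset
  have hsum : ∀ w : V → ℕ, (xs.map w).sum = ∑ x ∈ R, w x := fun w => (List.sum_toFinset w hnd).symm
  set A : V → Label := fun x => (symmOrder (1 + (xs.filter fun y => B y x = 0).length),
    sortList (f x / p ^ 2 :: (xs.filter fun y => B y x = 0).map f)) with hA
  obtain ⟨α, hα⟩ : ∃ α : (Fin 3 → ZMod p) → Finset V, ∀ v, α v = R.filter (IsAxis red · v) :=
    ⟨_, fun _ => rfl⟩
  obtain ⟨m, hm⟩ : ∃ m : (Fin 3 → ZMod p) → Finset V, ∀ v, m v = R.filter (IsMirror p B K red · v) :=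
    ⟨_, fun _ => rfl⟩
  have hmα : ∀ {v x}, x ∈ R → (IsAxis red x v ↔ x ∈ α v) := fun hx => by simp [hα, hx]
  have hmm : ∀ {v x}, x ∈ R → (IsMirror p B K red x v ↔ x ∈ m v) := fun hx => by simp [hm, hx]
  have hcases : ∀ v ∈ X,
      (∃ x₀ ∈ R, α v = {x₀} ∧ (∀ x ∈ R, x ∈ m v ↔ B x x₀ = 0) ∧ lab v = A x₀) ∨
      α v = ∅ ∧ (m v = ∅ ∧ lab v = (2, []) ∨ (∃ x₀ ∈ R, m v = {x₀} ∧ lab v = (4, [f x₀])) ∨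
        (m v).card = 3 ∧ ∃ c, lab v = (12, [c, c, c]) ∧ (∀ x ∈ m v, f x = c) ∧
          ∀ x ∈ m v, ∀ y ∈ m v, y ≠ x → IsHexPair B x y) := by
    intro v hv
    have hv0 := ne_zero_of_mem_quadX (F.unit 0) hv
    have htf : (xs.filter fun y => IsMirror p B K red y v).toFinset = m v := by
      ext y
      simp [hR, hm]
    have hmem : ∀ {x}, x ∈ m v → x ∈ xs ∧ IsMirror p B K red x v := fun h => by simpa [hm,
      hR] using h
    rcases (α v).eq_empty_or_nonempty with h0 | ⟨x, h0⟩
    · refine Or.inr ⟨h0, ?_⟩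
      have hax : ∀ z ∈ xs, ¬ IsAxis red z v := fun z hz h => by
        simpa [h0] using (hmα (hmR.2 hz)).1 h
      rcases G.mirrors hxs hf hv hax with ⟨h1, h2⟩ | ⟨x, h1, h2⟩ | ⟨h1, c, h2, h3, h4⟩
      · exact Or.inl ⟨by rw [← htf, h1]; rfl, G.labelAt_unique hv (hlab v hv) h2⟩
      · have hx : m v = {x} := by rw [← htf, h1]; rfl
        exact Or.inr (Or.inl ⟨x, hmR.2 (hmem (hx ▸ Finset.mem_singleton_self x)).1, hx,
          G.labelAt_unique hv (hlab v hv) h2⟩)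
      · refine Or.inr (Or.inr ⟨?_, c, G.labelAt_unique hv (hlab v hv) h2,
          fun x hx => h3 x (hmem hx).1 (hmem hx).2, fun x hx y hy =>
          h4 x (hmem hx).1 (hmem hx).2 y (hmem hy).1 (hmem hy).2⟩)
        rw [← htf, List.toFinset_card_of_nodup (hnd.filter _), h1]
    · left
      obtain ⟨hx, hxv⟩ : x ∈ xs ∧ IsAxis red x v := by simpa [hα, hR] using h0
      refine ⟨x, hmR.2 hx, ?_, fun y hy => ?_,
        G.labelAt_unique hv (hlab v hv) (G.labelAt_axis hreg hxs hf hx hv hxv)⟩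
      · ext y
        simp only [hα, Finset.mem_filter, hmR, mem_singleton]
        refine ⟨fun ⟨hy, hyv⟩ => ?_, fun h => h ▸ ⟨hx, hxv⟩⟩
        by_contra hne
        obtain ⟨t, ht⟩ := hxv
        obtain ⟨s, rfl⟩ := hyv
        have hs : s ≠ 0 := by rintro rfl; simp at hv0
        have hpar := F.parallel_of_proportional hp hK hreg (hxs.root x hx) (hxs.root y hy)
          (r := s⁻¹ * t) (by rw [mul_smul, ← ht, smul_smul, inv_mul_cancel₀ hs, one_smul])
        have := hxs.ne hx hy hne
        tauto
      · rw [← hmm hy]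
        have hy := hxs.root y (hmR.1 hy)
        exact ⟨F.orth_of_axis_mirror hp hB hreg (hxs.root x hx) hy hv0 hxv,
          fun h => F.mirror_of_axis_orth hB (hxs.root x hx) hy h hxv⟩
  have hms : ∀ v, R ∩ m v = m v := fun v => by simp [hm, Finset.inter_eq_right]
  have h3m : ∀ {v}, (m v).card = 3 → m v ≠ ∅ ∧ ∀ x, m v ≠ {x} := fun h =>
    ⟨by rintro h'; simp [h'] at h, by rintro x h'; simp [h'] at h⟩
  set L : V → (Fin 3 → ZMod p) → Prop := fun x v => α v = ∅ ∧ m v = {x} with hL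
  set T : V → (Fin 3 → ZMod p) → Prop := fun x v => α v = ∅ ∧ (m v).card = 3 ∧ x ∈ m v with hT
  set S : (Fin 3 → ZMod p) → Prop := fun v => α v = ∅ ∧ m v = ∅ with hS
  -- The weight of a point with three mirrors is 12, and a third of it is charged to each of the
  -- three roots.
  have e2 : ∀ v ∈ X, (if lab v = lam then lam.1 else 0) =
      (∑ x ∈ R, if x ∈ α v then (if A x = lam then (A x).1 else 0) else 0) +
      (∑ x ∈ R, if L x v then (if (4, [f x]) = lam then 4 else 0) else 0) +
      (∑ x ∈ R, if T x v then (if (12, [f x, f x, f x]) = lam then 4 else 0) else 0) +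
      (if S v then (if (2, []) = lam then 2 else 0) else 0) := by
    intro v hv
    have : (if lab v = lam then lam.1 else 0) = if lab v = lam then (lab v).1 else 0 := by
      split_ifs with h <;> simp [h]
    rw [this]
    rcases hcases v hv with ⟨x₀, hx, h1, -, h3⟩ | ⟨h1, ⟨h2, h3⟩ | ⟨x₀, hx, h2, h3⟩ | ⟨h2, c, h3, h4,
      -⟩⟩
    · simp [hL, hT, hS, h1, h3, hx]
    · simp [hL, hT, hS, h1, h2, h3, (Finset.singleton_ne_empty _).symm]
    · simp [hL, hT, hS, h1, h2, h3, hx]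
    · simp only [hL, hT, hS, h1, h2, h3, h3m h2, true_and, if_false, Finset.sum_const_zero,
        add_zero,
        zero_add, Finset.sum_ite_mem, hms, Finset.inter_empty, Finset.sum_empty]
      rw [sum_congr rfl fun x hx => by rw [h4 x hx], sum_const, h2]
      split_ifs <;> rfl
  -- The partition of the quadric, multiplied by 3, so that a point with three mirrors counts once
  -- for each of them.
  have e3 : ∀ v ∈ X, 3 = (∑ x ∈ R, if x ∈ α v then 3 else 0) + (∑ x ∈ R, if L x v then 3 else 0) +
      (∑ x ∈ R, if T x v then 1 else 0) + (if S v then 3 else 0) := by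
    intro v hv
    rcases hcases v hv with ⟨x₀, hx, h1, -⟩ | ⟨h1, ⟨h2, -⟩ | ⟨x₀, hx, h2, -⟩ | ⟨h2, -⟩⟩
    · simp [hL, hT, hS, h1, hx]
    · simp [hL, hT, hS, h1, h2, (Finset.singleton_ne_empty _).symm]
    · simp [hL, hT, hS, h1, h2, hx]
    · simp [hL, hT, hS, h1, h2, h3m h2, hms]
  -- The mirror of x consists of the points on the axes orthogonal to x, the points with this mirror
  -- only, and the points off the axes with three mirrors.
  have e4 : ∀ v ∈ X, ∀ x ∈ R, (if x ∈ m v then 1 else 0) =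
      (∑ y ∈ R, if y ∈ α v then (if B y x = 0 then 1 else 0) else 0) + (if L x v then 1 else 0) +
        (if T x v then 1 else 0) := by
    intro v hv x hx
    rcases hcases v hv with ⟨x₀, hx₀, h1, h2, -⟩ | ⟨h1, ⟨h2, -⟩ | ⟨x₀, hx₀, h2, -⟩ | ⟨h2, -⟩⟩
    · simp [hL, hT, h1, h2 x hx, hB.symm x x₀, hx₀]
    · simp [hL, hT, h1, h2, (Finset.singleton_ne_empty _).symm]
    · simp [hL, hT, h1, h2, eq_comm]
    · simp [hL, hT, h1, h2, h3m h2]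
  -- A point with three mirrors, one of them that of x, is seen from two partners y of x. This is
  -- the factor 2 in the hypothesis `hn`.
  have e5 : ∀ v ∈ X, ∀ x ∈ R, (∑ y ∈ R, if IsHexPair B x y then
      (if α v = ∅ ∧ x ∈ m v ∧ y ∈ m v then 1 else 0) else 0) = 2 * (if T x v then 1 else 0) := by
    intro v hv x hx
    have hirr := isHexPair_irrefl hB (hxs.root x (hmR.1 hx)).ne_zero
    rcases hcases v hv with ⟨x₀, -, h1, -⟩ | ⟨h1, ⟨h2, -⟩ | ⟨x₀, -, h2, -⟩ | ⟨h2, c, -, -, h5⟩⟩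
    · simp [hT, h1]
    · simp [hT, h2]
    · simp only [hT, h2, mem_singleton, Finset.card_singleton]
      rw [Finset.sum_eq_zero]
      · simp
      · grind
    · by_cases hxv : x ∈ m v
      · have h6 : ∀ y ∈ R, (if IsHexPair B x y then (if y ∈ m v then 1 else 0) else 0) =
            if y ∈ (m v).erase x then 1 else 0 := by
          intro y hy
          have := h5 x hxv y
          grind
        simp only [hT, h1, h2, hxv, true_and, if_true]
        rw [sum_congr rfl h6, Finset.sum_ite_mem, Finset.inter_erase, hms, sum_const,
          Finset.card_erase_of_mem hxv, h2]
        rfl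
      · simp [hT, hxv]
  have hcard : ∀ (P : (Fin 3 → ZMod p) → Prop) [DecidablePred P], (X.filter P).card =
      ∑ v ∈ X, if P v then 1 else 0 := fun P _ => card_filter _ _
  have hc : ∀ (P : (Fin 3 → ZMod p) → Prop) [DecidablePred P] (w : ℕ),
      (∑ v ∈ X, if P v then w else 0) = w * (X.filter P).card := by
    intro P _ w
    rw [← sum_filter, sum_const, smul_eq_mul, mul_comm]
  have hswap : ∀ (P : V → (Fin 3 → ZMod p) → Prop) [∀ x, DecidablePred (P x)] (w : V → ℕ),
      ∑ v ∈ X, ∑ x ∈ R, (if P x v then w x else 0) = ∑ x ∈ R, w x * (X.filter (P x)).card := by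
    intro P _ w
    rw [Finset.sum_comm]
    exact sum_congr rfl fun x _ => hc _ _
  replace hadm : ∀ x ∈ R, (X.filter (x ∈ α ·)).card = adm (f x) := fun x hx => by
    simp only [← hadm x (hmR.1 hx), hmα hx]
  have hTc : ∀ x ∈ R, (X.filter (T x)).card = d * n x := by
    intro x hx
    have h1 := hn x (hmR.1 hx)
    have h2 := sum_congr rfl fun v hv => e5 v hv x hx
    rw [← mul_sum, ← hcard, Finset.sum_comm] at h2
    rw [hsum] at h1
    refine Nat.eq_of_mul_eq_mul_left two_pos (h2.symm.trans (Eq.trans ?_ h1))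
    refine sum_congr rfl fun y hy => ?_
    split_ifs
    · rw [← hcard]
      refine congrArg _ (Finset.filter_congr fun v _ => ?_)
      rw [hmm hx, hmm hy, hα, filter_eq_empty_iff]
      simp only [hmR]
    · simp
  set e : V → ℕ × List ℕ × ℕ := fun x => (f x, (xs.filter fun y => B y x = 0).map f, n x) with he
  have hLc : ∀ x ∈ R, (X.filter (L x)).card = loneCount adm mir d (e x) := by
    intro x hx
    have h1 := sum_congr rfl fun v hv => e4 v hv x hx
    have h3 : (((xs.filter fun y => B y x = 0).map f).map adm).sum =
        ∑ y ∈ R, (if B y x = 0 then 1 else 0) * (X.filter (y ∈ α ·)).card := by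
      rw [map_map, ← List.sum_toFinset _ (hnd.filter _), List.toFinset_filter]
      simp only [decide_eq_true_eq, sum_filter, ite_mul, one_mul, zero_mul]
      exact sum_congr rfl fun y hy => by rw [hadm y hy]; rfl
    rw [sum_add_distrib, sum_add_distrib, ← hcard, ← hcard, ← hcard, hswap, hTc x hx, ← h3] at h1
    have h4 := hmir x (hmR.1 hx)
    simp only [hmm hx, h1] at h4
    simp only [loneCount, he]
    omega
  have hSc : (X.filter S).card = X.card - (∑ x ∈ R, (adm (f x) + loneCount adm mir d (e x))) -
      (∑ x ∈ R, d * n x) / 3 := by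
    have h2 := sum_congr rfl e3
    rw [sum_const, smul_eq_mul, sum_add_distrib, sum_add_distrib, sum_add_distrib, hswap, hswap,
      hswap, hc, ← mul_sum, ← mul_sum, ← mul_sum, sum_congr rfl hadm, sum_congr rfl hLc,
      sum_congr rfl hTc] at h2
    rw [sum_add_distrib]
    omega
  rw [sum_congr rfl e2, sum_add_distrib, sum_add_distrib, sum_add_distrib, hswap, hswap, hswap, hc,
    hSc, regularCells, weight_append, weight_flatMap, map_map, map_map, map_map, hsum, hsum, hsum,
    ← sum_add_distrib, ← sum_add_distrib]
  congr 1
  · refine sum_congr rfl fun x hx => ?_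
    rw [hLc x hx, hTc x hx, hadm x hx]
    simp only [Function.comp, rootCells, weight, map_cons, List.map_nil, sum_cons, sum_nil, ite_mul,
      zero_mul, add_zero, he, hA, List.length_map, add_assoc]
  · simp only [weight, map_cons, List.map_nil, sum_cons, sum_nil, add_zero, ite_mul, zero_mul]
    rfl

/-! ### From weights of points to isometry classes -/

/-- Removal of duplicates. -/
def nub (l : List Label) : List Label := l.foldr (fun x acc => if x ∈ acc then acc else x :: acc) []

theorem mem_nub {l : List Label} {x : Label} : x ∈ nub l ↔ x ∈ l := by
  induction l with
  | nil => rfl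
  | cons y l ih =>
    rw [nub, List.foldr_cons, ← nub, mem_cons]
    grind

theorem nodup_nub (l : List Label) : (nub l).Nodup := by
  induction l with
  | nil => exact List.nodup_nil
  | cons y l ih =>
    rw [nub, List.foldr_cons, ← nub]
    grind

/-- The list of labels in which each label occurs as often as its weight tells, divided by `m`. -/
def assemble (m : ℕ) (E : List (ℕ × Label)) : List Label :=
  (nub (E.map Prod.snd)).flatMap fun lam => replicate (weight E lam / m) lam

theorem count_flatMap_replicate {α : Type*} [DecidableEq α] {l : List α} (h : l.Nodup) (w : α → ℕ)
    (x : α) : ((l.flatMap fun y => replicate (w y) y : List α) : Multiset α).count x =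
      if x ∈ l then w x else 0 := by
  induction l with
  | nil => rfl
  | cons y l ih =>
    rw [List.nodup_cons] at h
    rw [flatMap_cons, ← Multiset.coe_add, Multiset.count_add, ih h.2, Multiset.coe_replicate,
      Multiset.count_replicate]
    grind

theorem count_assemble (m : ℕ) (E : List (ℕ × Label)) (lam : Label) :
    (assemble m E : Multiset Label).count lam = weight E lam / m := by
  rw [assemble, count_flatMap_replicate (nodup_nub _)]
  split_ifs with h
  · rfl
  · have h2 : weight E lam = 0 := by
      rw [weight, List.sum_eq_zero]
      intro q hq
      obtain ⟨e, he, rfl⟩ := mem_map.1 hq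
      rw [if_neg]
      rintro rfl
      exact h (mem_nub.2 (mem_map.2 ⟨e, he, rfl⟩))
    simp_all

theorem image_eq_iff : σ '' (M : Set V) = (M' : Set V) ↔ ∀ x, x ∈ M ↔ σ x ∈ M' := by
  constructor
  · intro h x
    rw [← SetLike.mem_coe (p := M'), ← h]
    simp
  · intro h
    ext y
    obtain ⟨x, rfl⟩ := σ.surjective y
    simp_all

/-- An isometry between lattices with the same Λ_p preserves that common sublattice. -/
theorem mem_orthGroup_watson (hp : p ≠ 2) (hM : IntLattice B M) (hM' : IntLattice B M') (hw :
    watson B p M = K) (hw' : watson B p M' = K) (hσ : σ ∈ isometries B) (h : σ '' (M : Set V) = (M'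
    : Set V)) : σ ∈ orthGroup B K := by
  rw [image_eq_iff] at h
  refine mem_orthGroup.2 ⟨hσ, fun x => ?_⟩
  conv_rhs => rw [← hw, mem_watson_iff hp hM]
  conv_lhs => rw [← hw', mem_watson_iff hp hM', ← h]
  refine and_congr_right fun _ => ⟨fun h' y hy => ?_, fun h' y hy => ?_⟩
  · rw [← hσ]
    simp_all
  · obtain ⟨z, rfl⟩ := σ.surjective y
    rw [hσ]
    simp_all

theorem IsRoot.map (hσ : σ ∈ isometries B) (h : ∀ x, x ∈ M ↔ σ x ∈ M') (hx : IsRoot B M x) : IsRoot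
    B M' (σ x) := by
  refine ⟨⟨(h x).1 hx.mem, fun n y hy e => hx.1.2 n (σ.symm y) ((h _).2 (by simpa using hy)) ?_⟩,
    fun y hy => ?_⟩
  · rw [← map_zsmul, ← e, LinearEquiv.symm_apply_apply]
  · obtain ⟨n, hn⟩ := hx.2 (σ.symm y) ((h _).2 (by simpa using hy))
    refine ⟨n, ?_⟩
    rw [hσ, ← hn, ← hσ x (σ.symm y), apply_symm_apply]

theorem HasLabel.map (hM : IntLattice B M) (hM' : IntLattice B M') (hσ : σ ∈ isometries B) (h : σ
    '' (M : Set V) = (M' : Set V)) (hl : HasLabel B M ℓ) : HasLabel B M' ℓ := by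
  rw [image_eq_iff] at h
  have hs : σ.symm ∈ isometries B := fun x y => by
    rw [← hσ]
    simp
  have h' : ∀ x, x ∈ M' ↔ σ.symm x ∈ M := fun x => by rw [h]; simp
  obtain ⟨xs, hx⟩ := hM.rootType.exists_list
  obtain ⟨ns, hn⟩ := hx.exists_norms hM
  have hx' : IsRootList B M' (xs.map σ) := by
    refine ⟨fun y hy => ?_, ?_, fun w hw => ?_⟩
    · obtain ⟨x, hxx, rfl⟩ := mem_map.1 hy
      exact (hx.root x hxx).map hσ h
    · rw [List.pairwise_map]
      refine hx.pairwise.imp fun hxy => ⟨fun e => hxy.1 (σ.injective e), fun e => hxy.2 ?_⟩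
      apply σ.injective
      rw [e, map_neg]
    · obtain ⟨x, hxx, e⟩ := hx.complete _ (hw.map hs h')
      refine ⟨σ x, mem_map.2 ⟨x, hxx, rfl⟩, e.imp (fun e => ?_) fun e => ?_⟩
      · rw [← e, apply_symm_apply]
      · rw [← map_neg, ← e, apply_symm_apply]
  have hn' : ((xs.map σ).map fun x => B x x) = ns.map fun n : ℕ => (n : ℚ) := by
    rw [← hn, map_map]
    exact map_congr_left fun x _ => hσ x x
  have hc : Nat.card (orthGroup B M) = Nat.card (orthGroup B M') := by
    refine Nat.card_congr ⟨fun g => ⟨σ * g.1 * σ⁻¹, ?_⟩, fun g => ⟨σ⁻¹ * g.1 * σ, ?_⟩, fun g => ?_,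
      fun g => ?_⟩
    · obtain ⟨h1, h2⟩ := mem_orthGroup.1 g.2
      refine mem_orthGroup.2 ⟨fun x y => ?_, fun x => ?_⟩
      · change B (σ (g.1 (σ.symm x))) (σ (g.1 (σ.symm y))) = _
        rw [hσ, h1, hs]
      · simp_all
    · obtain ⟨h1, h2⟩ := mem_orthGroup.1 g.2
      refine mem_orthGroup.2 ⟨fun x y => ?_, fun x => ?_⟩
      · change B (σ.symm (g.1 (σ x))) (σ.symm (g.1 (σ y))) = _
        rw [hs, h1, hσ]
      · simp_all
    · exact Subtype.ext (by group)
    · exact Subtype.ext (by group)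
  rw [hx.hasLabel_iff_eq hM hn] at hl
  rw [hx'.hasLabel_iff_eq hM' hn', hl, hc]

open scoped Pointwise in
-- Orbit and stabilizer: the lattices of Γ isometric to M form its orbit under O(K), and the
-- stabilizer of M in O(K) is O(M), since O(M) ⊆ O(K).
theorem ncard_class_mul (hp : p ≠ 2) {Γ : Set (Submodule ℤ V)}
    (hΓ : ∀ M ∈ Γ, IntLattice B M ∧ watson B p M = K)
    (hmap : ∀ M ∈ Γ, ∀ σ ∈ orthGroup B K, ∃ M' ∈ Γ, σ '' (M : Set V) = (M' : Set V))
    (hM : M ∈ Γ) :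
    {M' | M' ∈ Γ ∧ ∃ σ ∈ isometries B, σ '' (M : Set V) = (M' : Set V)}.ncard *
      Nat.card (orthGroup B M) = Nat.card (orthGroup B K) := by
  have hact : ∀ g : orthGroup B K, g • (M : Set V) = g.1 '' (M : Set V) := fun g => rfl
  have h1 : orbit (orthGroup B K) (M : Set V) = (fun M' : Submodule ℤ V => (M' : Set V)) ''
      {M' | M' ∈ Γ ∧ ∃ σ ∈ isometries B, σ '' (M : Set V) = (M' : Set V)} := by
    ext S
    constructor
    · rintro ⟨g, rfl⟩
      obtain ⟨M', hM', e⟩ := hmap M hM g.1 g.2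
      exact ⟨M', ⟨hM', g.1, (mem_orthGroup.1 g.2).1, e⟩, e.symm⟩
    · rintro ⟨M', ⟨hM', σ, hσ, e⟩, rfl⟩
      exact ⟨⟨σ, mem_orthGroup_watson hp (hΓ M hM).1 (hΓ M' hM').1 (hΓ M hM).2 (hΓ M' hM').2 hσ e⟩,
        e⟩
  have h2 : Nat.card (MulAction.stabilizer (orthGroup B K) (M : Set V)) =
      Nat.card (orthGroup B M) := by
    refine Nat.card_congr ⟨fun g => ⟨g.1.1, (mem_orthGroup.1 g.1.2).1, g.2⟩,
      fun g => ⟨⟨g.1, ?_⟩, g.2.2⟩, fun _ => rfl, fun _ => rfl⟩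
    have := orthGroup_le_watson hp (hΓ M hM).1 g.2
    simp_all
  have h3 : (orbit (orthGroup B K) (M : Set V)).ncard =
      {M' | M' ∈ Γ ∧ ∃ σ ∈ isometries B, σ '' (M : Set V) = (M' : Set V)}.ncard := by
    rw [h1]
    exact Set.ncard_image_of_injective _ SetLike.coe_injective
  rw [← h3, ← h2, ← MulAction.index_stabilizer, mul_comm, Subgroup.card_mul_index]

/-- A class with label `lam` contains |O(K)|/`lam.1` lattices. The weight is twice the number of
lattices with this label times `lam.1`, so dividing it by 2|O(K)| gives the number of classes. -/
theorem hasLabelMultiset_of_weight (hp : p ≠ 2) (hK : IntLattice B K) {Γ : Set (Submodule ℤ V)}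
    (hfin : Γ.Finite) (hΓ : ∀ M ∈ Γ, IntLattice B M ∧ watson B p M = K)
    (hmap : ∀ M ∈ Γ, ∀ σ ∈ orthGroup B K, ∃ M' ∈ Γ, σ '' (M : Set V) = (M' : Set V))
    {lab : Submodule ℤ V → Label} (hlab : ∀ M ∈ Γ, HasLabel B M (lab M)) {E : List (ℕ × Label)}
    (hE : ∀ lam, weight E lam = 2 * ({M | M ∈ Γ ∧ lab M = lam}.ncard * lam.1)) :
    HasLabelMultiset B Γ (assemble (2 * Nat.card (orthGroup B K)) E) := by
  classical
  have : Finite Γ := hfin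
  have : Fintype Γ := Fintype.ofFinite Γ
  have hfc : Fintype (Classes B Γ) := Fintype.ofFinite _
  have hinv : ∀ M M' : Γ, (isometrySetoid B Γ).r M M' → lab M.1 = lab M'.1 := by
    rintro ⟨M, hM⟩ ⟨M', hM'⟩ ⟨σ, hσ, e⟩
    exact ((hlab M hM).map (hΓ M hM).1 (hΓ M' hM').1 hσ e).unique (hΓ M' hM').1 (hlab M' hM')
  let labC : Classes B Γ → Label := Quotient.lift (fun M : Γ => lab M.1) hinv
  refine ⟨hfc, labC, fun M => hlab M.1 M.2, ?_⟩
  have hg : 0 < Nat.card (orthGroup B K) := by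
    have := hK.finite_orthGroup
    have : Finite (orthGroup B K) := this
    simp
  ext lam
  rw [Multiset.count_map, count_assemble, hE]
  have h1 : {M | M ∈ Γ ∧ lab M = lam}.ncard * lam.1 =
      (Multiset.filter (fun a => lam = labC a) univ.val).card * Nat.card (orthGroup B K) := by
    have h2 : {M | M ∈ Γ ∧ lab M = lam}.ncard =
        ((univ : Finset Γ).filter fun M => lab M.1 = lam).card := by
      rw [← Set.ncard_coe_finset]
      refine Eq.trans ?_ (Set.ncard_image_of_injective _ Subtype.val_injective)
      congr 1
      ext M
      simp [and_comm]
    have h3 : ((univ : Finset Γ).filter fun M => lab M.1 = lam).card =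
        ∑ q ∈ (univ : Finset (Classes B Γ)).filter (fun q => lam = labC q),
          (((univ : Finset Γ).filter fun M => lab M.1 = lam).filter
            fun M => Quotient.mk (isometrySetoid B Γ) M = q).card := by
      refine Finset.card_eq_sum_card_fiberwise fun M hM => ?_
      simp at hM ⊢
      exact hM.symm
    rw [h2, h3, sum_mul, show (Multiset.filter (fun a => lam = labC a) univ.val).card =
      ((univ : Finset (Classes B Γ)).filter fun q => lam = labC q).card from rfl,
      Finset.card_eq_sum_ones, sum_mul]
    refine sum_congr rfl fun q hq => ?_
    have hq' := (Finset.mem_filter.1 hq).2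
    obtain ⟨⟨M, hM⟩, rfl⟩ := Quotient.exists_rep q
    rw [one_mul, ← ncard_class_mul hp hΓ hmap hM]
    have hlM : lab M = lam := hq'.symm
    have h4 : Nat.card (orthGroup B M) = lam.1 := by
      rw [← hlM]
      exact (hlab M hM).2.1
    rw [h4]
    congr 1
    rw [← Set.ncard_coe_finset]
    refine (Set.ncard_image_of_injective _ Subtype.val_injective).symm.trans ?_
    congr 1
    ext M'
    simp only [coe_filter, Finset.mem_filter, mem_univ, true_and, Set.mem_image,
      mem_ofPred_eq, Subtype.exists, exists_and_right, exists_eq_right]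
    constructor
    · rintro ⟨hM', h5, h6⟩
      obtain ⟨σ, hσ, e⟩ := (isometrySetoid B Γ).symm (Quotient.exact h6)
      grind
    · rintro ⟨hM', h6⟩
      have h7 : (isometrySetoid B Γ).r ⟨M, hM⟩ ⟨M', hM'⟩ := h6
      exact ⟨hM', (hinv _ _ h7).symm.trans hlM, Quotient.sound ((isometrySetoid B Γ).symm h7)⟩
  rw [h1, mul_left_comm, Nat.mul_div_cancel _ (by omega)]

/-- Each lattice comes from exactly two points v and -v, which accounts for the factor 2 in the
weights. -/
theorem Gluing.hasLabelMultiset (G : Gluing p B K a u red) {Γ : Set (Submodule ℤ V)}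
    (hΓ : ∀ M, M ∈ Γ ↔ ∃ n, Adjoinable p B K (u 0) n ∧ M = overLat p K n) {E : List (ℕ × Label)}
    (hE : ∀ lab : (Fin 3 → ZMod p) → Label, (∀ v ∈ quadX a u, LabelAt p B K red v (lab v)) →
      ∀ lam, weight E lam = ∑ v ∈ quadX a u, if lab v = lam then lam.1 else 0) :
    HasLabelMultiset B Γ (assemble (2 * Nat.card (orthGroup B K)) E) := by
  classical
  have hK := G.int
  have F := G.frame
  choose ν hν hνr using F.surj
  have had : ∀ v ∈ quadX a u, Adjoinable p B K (u 0) (ν v) := fun v hv =>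
    (F.adjoinable_iff hK).2 ⟨hν v, by rwa [hνr]⟩
  have hex : ∀ M ∈ Γ, IntLattice B M ∧ watson B p M = K := by
    intro M hM
    obtain ⟨n, hn, rfl⟩ := (hΓ M).1 hM
    exact G.glue n hn
  have hl : ∀ M : Submodule ℤ V, ∃ ℓ, M ∈ Γ → HasLabel B M ℓ := fun M => by
    by_cases hM : M ∈ Γ
    · obtain ⟨ℓ, hℓ⟩ := (hex M hM).1.exists_label
      grind
    · simp_all
  choose lab hlab using hl
  have himg : Γ = (fun v => overLat p K (ν v)) '' (quadX a u : Set (Fin 3 → ZMod p)) := by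
    ext M
    rw [hΓ]
    constructor
    · rintro ⟨n, hn, rfl⟩
      have h1 := (F.adjoinable_iff hK).1 hn
      exact ⟨red n, h1.2, (F.over_eq_iff hK (had _ h1.2) hn).2 (Or.inl (hνr _))⟩
    · grind
  have hmemΓ : ∀ v ∈ quadX a u, overLat p K (ν v) ∈ Γ := fun v hv => (hΓ _).2 ⟨_, had v hv, rfl⟩
  have hov : ∀ v ∈ quadX a u, ∀ w ∈ quadX a u,
      (overLat p K (ν v) = overLat p K (ν w) ↔ v = w ∨ v = -w) := fun v hv w hw => by
    rw [F.over_eq_iff hK (had v hv) (had w hw), hνr, hνr]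
  refine hasLabelMultiset_of_weight G.ne_two hK (himg ▸ (Finset.finite_toSet _).image _) hex ?_
    hlab fun lam => ?_
  · intro M hM σ hσ
    obtain ⟨n, hn, rfl⟩ := (hΓ M).1 hM
    exact ⟨overLat p K (σ n), (hΓ _).2 ⟨_, hn.map hσ, rfl⟩,
      image_eq_iff.2 fun x => (map_mem_over_iff hσ).symm⟩
  · rw [hE (fun v => lab (overLat p K (ν v))) ?_ lam]
    · rw [← sum_filter, sum_const, smul_eq_mul, ← mul_assoc]
      congr 1
      have h1 : {M | M ∈ Γ ∧ lab M = lam} = (((quadX a u).filter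
          fun v => lab (overLat p K (ν v)) = lam).image fun v => overLat p K (ν v) : Finset _) := by
        ext M
        grind
      rw [h1, Set.ncard_coe_finset, mul_comm]
      rw [Finset.card_eq_sum_card_image fun v => overLat p K (ν v), Finset.sum_const_nat (m := 2)]
      intro M hM
      obtain ⟨v, hv, rfl⟩ := Finset.mem_image.1 hM
      have hv' := (Finset.mem_filter.1 hv).1
      have hv0 := ne_zero_of_mem_quadX (F.unit 0) hv'
      have hneg : -v ∈ quadX a u := by
        rw [← neg_one_smul (ZMod p) v]
        refine mem_quadX.2 ⟨(mem_quadX.1 hv').1.smul _, ?_⟩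
        rw [formW_smul, (mem_quadX.1 hv').2]
        ring
      have hne : v ≠ -v := by
        intro e
        have h2 : (2 : ZMod p) • v = 0 := by
          rw [two_smul]
          grind
        exact hv0 ((smul_eq_zero.1 h2).resolve_left (two_ne_zero_zmod G.ne_two))
      rw [← card_pair hne]
      congr 1
      ext w
      simp
      grind
    · intro v hv m hm hr
      have h1 := (F.over_eq_iff hK ((F.adjoinable_iff hK).2 ⟨hm, by rwa [hr]⟩) (had v hv)).2
        (Or.inl (by rw [hr, hνr]))
      simp_all

/-! ### The counts as functions of the numerical data -/

/-- The triples of residues. -/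
def triples (p : ℕ) : List (ℕ × ℕ × ℕ) :=
  (List.range p).flatMap fun x => (List.range p).flatMap fun y => (List.range p).map fun z => (x, y, z)

/-- The coefficients of the form on the reduction. -/
def coefN (a u : ℕ) : ℕ := if a = 2 then u else 0

/-- The form on the reduction, for a prime and the data `((a₁, a₂), (u₀, u₁, u₂))`. -/
def dotN (P : ℕ × JordanData) (v w : ℕ × ℕ × ℕ) : ℕ :=
  P.2.2.1 * v.1 * w.1 + coefN P.2.1.1 P.2.2.2.1 * v.2.1 * w.2.1 +
    coefN P.2.1.2 P.2.2.2.2 * v.2.2 * w.2.2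

/-- The vectors of the reduction that lift to vectors of norm `p ^ 2 * r`. -/
def OnQuad (P : ℕ × JordanData) (r : ℕ) (v : ℕ × ℕ × ℕ) : Prop :=
  (P.2.1.1 ≠ 1 ∨ v.2.1 = 0) ∧ (P.2.1.2 ≠ 1 ∨ v.2.2 = 0) ∧ dotN P v v % P.1 = r % P.1

instance (P : ℕ × JordanData) (r : ℕ) (v : ℕ × ℕ × ℕ) : Decidable (OnQuad P r v) :=
  inferInstanceAs (Decidable (_ ∧ _ ∧ _))

/-- The number of vectors of norm `p ^ 2 * r`. -/
def quadCount (P : ℕ × JordanData) (r : ℕ) : ℕ :=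
  ((triples P.1).map fun v => if OnQuad P r v then 1 else 0).sum

/-- The number of the points orthogonal to `w`. -/
def orthCount (P : ℕ × JordanData) (w : ℕ × ℕ × ℕ) : ℕ :=
  ((triples P.1).map fun v => if OnQuad P P.2.2.1 v ∧ dotN P w v % P.1 = 0 then 1 else 0).sum

/-- The number of orthogonal pairs. -/
def pairCount (P : ℕ × JordanData) (r : ℕ) : ℕ :=
  ((triples P.1).map fun w => if OnQuad P r w then orthCount P w else 0).sum

/-- The number of points on the mirror of a root of norm `c`. -/
def mirCount (P : ℕ × JordanData) (c : ℕ) : ℕ :=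
  if c % P.1 ^ 2 = 0 then
    if c % P.1 ^ 3 = 0 then quadCount P P.2.2.1 / P.1
    else pairCount P (c / P.1 ^ 2) / quadCount P (c / P.1 ^ 2)
  else quadCount P P.2.2.1

/-- The number of points on the axis of a root of norm `c`. -/
def admCount (P : ℕ × JordanData) (c : ℕ) : ℕ :=
  if ∃ s < P.1, (c * s * s) % P.1 ^ 3 = (P.1 ^ 2 * P.2.2.1) % P.1 ^ 3 then 2 else 0

/-- The rotations of order three have twice this number of fixed points. -/
def hexCount (P : ℕ × JordanData) : ℕ :=
  if P.1 ≠ 3 ∧ P.2.1.1 = P.2.1.2 ∧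
    (P.2.1.1 ≠ 2 ∨ ∃ s < P.1, (s * s) % P.1 = (3 * P.2.2.2.1 * P.2.2.2.2) % P.1) then 1 else 0

theorem sum_zmod (f : ℕ → ℕ) : ((List.range p).map f).sum = ∑ x : ZMod p, f x.val := by
  have h : ((List.range p).map f).sum = ∑ i ∈ Finset.range p, f i := rfl
  rw [h]
  refine Finset.sum_nbij' (fun i : ℕ => (i : ZMod p)) ZMod.val (by simp) ?_ ?_ (by simp) ?_
  · grind
  · intro i hi
    exact ZMod.val_cast_of_lt (mem_range.1 hi)
  · intro i hi
    rw [ZMod.val_cast_of_lt (mem_range.1 hi)]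

/-- The residues of the coordinates of a vector. -/
def vals (v : Fin 3 → ZMod p) : ℕ × ℕ × ℕ := ((v 0).val, (v 1).val, (v 2).val)

theorem sum_triples (h : ℕ × ℕ × ℕ → ℕ) :
    ((triples p).map h).sum = ∑ v : Fin 3 → ZMod p, h (vals v) := by
  have hflat : ∀ {α : Type} (l : List ℕ) (f : ℕ → List α) (h : α → ℕ),
      ((l.flatMap f).map h).sum = (l.map fun x => ((f x).map h).sum).sum := by
    intro α l f h
    induction l with
    | nil => rfl
    | cons x l ih => rw [flatMap_cons, List.map_append, List.sum_append, ih]; rfl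
  let e : (Fin 3 → ZMod p) ≃ ZMod p × ZMod p × ZMod p :=
    ⟨fun v => (v 0, v 1, v 2), fun t => ![t.1, t.2.1, t.2.2], fun v => by
      funext i; fin_cases i <;> rfl, fun _ => rfl⟩
  rw [Fintype.sum_equiv e (fun v => h (vals v)) (fun t => h (t.1.val, t.2.1.val, t.2.2.val))
    fun _ => rfl, Fintype.sum_prod_type, triples, hflat, sum_zmod]
  refine sum_congr rfl fun x _ => ?_
  rw [Fintype.sum_prod_type, hflat, sum_zmod]
  refine sum_congr rfl fun y _ => ?_
  rw [map_map, sum_zmod]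
  rfl

/-- The data of a frame. -/
def params (p : ℕ) (a : Fin 3 → ℕ) (u : Fin 3 → ZMod p) : ℕ × JordanData :=
  (p, (a 1, a 2), ((u 0).val, (u 1).val, (u 2).val))

theorem natCast_dotN (ha : a 0 = 2) (v w : Fin 3 → ZMod p) :
    (dotN (params p a u) (vals v) (vals w) : ZMod p) = formW a u v w := by
  have h : ∀ i, ((coefN (a i) (u i).val : ℕ) : ZMod p) = coefW a u i := by
    intro i
    rw [coefN, coefW]
    simp
  simp only [dotN, params, vals, formW, sum_univ_three, ← h]
  push_cast [h]
  simp [coefW, ha]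

theorem onQuad_iff (ha : a 0 = 2) {r : ℕ} : OnQuad (params p a u) r (vals v) ↔ v ∈ quadS a u (r :
    ZMod p) := by
  rw [mem_quadS, ← natCast_dotN ha, ZMod.natCast_eq_natCast_iff', OnQuad, ← and_assoc]
  refine and_congr ?_ Iff.rfl
  simp only [InU, params, vals, Fin.forall_fin_succ, ha, ZMod.val_eq_zero, imp_iff_not_or]
  simp

theorem onQuad_iff' (ha : a 0 = 2) : OnQuad (params p a u) (u 0).val (vals v) ↔ v ∈ quadX a u := by
  rw [onQuad_iff ha, natCast_zmod_val]
  rfl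

theorem quadCount_eq (ha : a 0 = 2) (r : ℕ) :
    quadCount (params p a u) r = (quadS a u (r : ZMod p)).card := by
  rw [quadCount, show (params p a u).1 = p from rfl, sum_triples]
  simp only [onQuad_iff ha]
  simp

theorem quadCount_eq' (ha : a 0 = 2) :
    quadCount (params p a u) (u 0).val = (quadX a u).card := by
  rw [quadCount_eq ha, natCast_zmod_val]
  rfl

theorem orthCount_eq (ha : a 0 = 2) (w : Fin 3 → ZMod p) :
    orthCount (params p a u) (vals w) = ((quadX a u).filter fun v => formW a u w v = 0).card := by
  have h : ∀ v : Fin 3 → ZMod p, dotN (params p a u) (vals w) (vals v) % p = 0 ↔ formW a u w v = 0 := by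
    intro v
    rw [← natCast_dotN ha, natCast_eq_zero_iff, Nat.dvd_iff_mod_eq_zero]
  rw [orthCount, show (params p a u).1 = p from rfl, sum_triples]
  simp only [h, show (params p a u).2.2.1 = (u 0).val from rfl, onQuad_iff' ha]
  rw [card_filter]
  simp [ite_and]

theorem pairCount_eq (ha : a 0 = 2) (r : ℕ) : pairCount (params p a u) r =
    ∑ w ∈ quadS a u (r : ZMod p), ((quadX a u).filter fun v => formW a u w v = 0).card := by
  rw [pairCount, show (params p a u).1 = p from rfl, sum_triples]
  simp only [onQuad_iff ha, orthCount_eq ha]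
  simp

theorem dv_natCast_iff (j c : ℕ) : Dv p j (c : ℚ) ↔ c % p ^ j = 0 := by
  rw [← Nat.dvd_iff_mod_eq_zero, ← Int.natCast_dvd_natCast, Nat.cast_pow,
    ← dv_intCast_iff (prime_ne_zero' p), cast_natCast]

/-- The three branches of `mirCount` are the three cases of the power of p in Q(x): at least p³,
exactly p², and less. -/
theorem Frame.card_mirror (hp : p ≠ 2) (hK : IntLattice B K) (F : Frame p B K a u red) (hx : IsRoot
    B K x) {c : ℕ} (hc : B x x = c) : ((quadX a u).filter (IsMirror p B K red x)).card = mirCount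
    (params p a u) c := by
  have ha := F.zero
  rw [mirCount, show (params p a u).1 = p from rfl,
    show (params p a u).2.2.1 = (u 0).val from rfl]
  split_ifs with h2 h3
  · rw [quadCount_eq' ha, ← F.card_mirror_rad hp hK hx (by rwa [hc, dv_natCast_iff]),
      Nat.mul_div_cancel_left _ (Fact.out : p.Prime).pos]
  · obtain ⟨k, rfl⟩ := Nat.dvd_of_mod_eq_zero h2
    have hp0 := (Fact.out : p.Prime).pos
    obtain ⟨h4, h5⟩ := F.card_mirror_mul hp hK hx (c := k) (by rw [hc]; push_cast; ring) (by
      intro h0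
      rw [cast_natCast, natCast_eq_zero_iff] at h0
      obtain ⟨m, rfl⟩ := h0
      exact h3 (by rw [← mul_assoc, ← pow_succ, Nat.mul_mod_right]))
    rw [cast_natCast] at h4 h5
    rw [Nat.mul_div_cancel_left _ (pow_pos hp0 2), quadCount_eq ha, pairCount_eq ha, ← h4,
      Nat.mul_div_cancel_left _ (by omega)]
  · rw [quadCount_eq' ha, F.card_mirror_of_not_dv hK hx (by rwa [hc, dv_natCast_iff])]

theorem Frame.card_axis' (hp : p ≠ 2) (hK : IntLattice B K) (F : Frame p B K a u red) (hx : IsRoot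
    B K x) {c : ℕ} (hc : B x x = c) : ((quadX a u).filter (IsAxis red x)).card = admCount (params p
    a u) c :=
  F.card_axis hp hK hx hc (natCast_zmod_val _)

theorem Frame.card_a2_mirrors' (hp : p ≠ 2) (hK : IntLattice B K) (F : Frame p B K a u red) (ha : a
    1 ≤ a 2) (hreg : p = 3 → ¬ HasG2 B K) (h : IsA2Pair B x y) (hx : IsRoot B K x) (hy : IsRoot B K
    y) : ((quadX a u).filter fun v => IsMirror p B K red x v ∧ IsMirror p B K red y v).card = 2 *
    hexCount (params p a u) := by
  classical
  rw [F.card_a2_mirrors hp hK ha hreg h hx hy, hexCount, mul_ite, mul_one, mul_zero]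
  refine if_congr ?_ rfl rfl
  refine and_congr Iff.rfl (and_congr Iff.rfl (or_congr Iff.rfl ?_))
  simp only [params, ← ZMod.natCast_eq_natCast_iff']
  push_cast
  simp
  constructor
  · rintro ⟨s, hs⟩
    exact ⟨s.val, val_lt s, by rw [natCast_zmod_val, hs]⟩
  · grind

/-! ### The configuration of roots read off the label -/

/-- The element of a list that occurs `k` times modulo `m`. -/
def pick (m k : ℕ) (cs : List ℕ) : ℕ := (cs.filter fun c => cs.count c % m = k).headI

/-- The multiplicity is taken modulo m so that the distinguished norm is found even if it coincides
with one of the others, whose own multiplicities are multiples of m. -/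
theorem pick_sortList {k : ℕ} {ns : List ℕ} {z : ℕ} (hz : z ∈ ns) (h : ∀ c ∈ ns, ns.count c % m = k
    ↔ c = z) : pick m k (sortList ns) = z := by
  have hp := sortList_perm ns
  have hc : ∀ c, (sortList ns).count c = ns.count c := fun c => hp.count_eq c
  have h1 : ∀ c ∈ (sortList ns).filter (fun c => (sortList ns).count c % m = k), c = z := by grind
  have h2 : z ∈ (sortList ns).filter (fun c => (sortList ns).count c % m = k) :=
    mem_filter.2 ⟨hp.mem_iff.2 hz, by rw [hc]; exact decide_eq_true ((h z hz).2 rfl)⟩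
  rw [pick]
  cases hl : (sortList ns).filter (fun c => (sortList ns).count c % m = k) with
  | nil => rw [hl] at h2; simp at h2
  | cons b l => exact h1 b (by rw [hl]; exact mem_cons_self)

theorem sum_sortList (ns : List ℕ) : (sortList ns).sum = ns.sum := (sortList_perm ns).sum_eq

/-- The entries of the roots, for a label of a lattice. -/
def entries (ℓ : Label) : List (ℕ × List ℕ × ℕ) :=
  if ℓ.1 = 4 then [(ℓ.2.getD 0 0, [], 0)]
  else if ℓ.1 = 8 then
    [(ℓ.2.getD 0 0, [ℓ.2.getD 1 0, ℓ.2.getD 2 0], 0), (ℓ.2.getD 1 0, [ℓ.2.getD 0 0, ℓ.2.getD 2 0],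
      0),
      (ℓ.2.getD 2 0, [ℓ.2.getD 0 0, ℓ.2.getD 1 0], 0)]
  else if ℓ.1 = 12 then replicate 3 (ℓ.2.getD 0 0, [], 2)
  else if ℓ.1 = 16 then (fun z c => (z, [c, c, 2 * c, 2 * c], 0) ::
      (replicate 2 (c, [z, c], 0) ++ replicate 2 (2 * c, [z, 2 * c], 0)))
    (pick 2 1 ℓ.2) ((ℓ.2.sum - pick 2 1 ℓ.2) / 6)
  else if ℓ.1 = 24 then (fun z c => (z, [c, c, c, 3 * c, 3 * c, 3 * c], 0) ::
      (replicate 3 (c, [z, 3 * c], 0) ++ replicate 3 (3 * c, [z, c], 0)))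
    (pick 3 1 ℓ.2) ((ℓ.2.sum - pick 3 1 ℓ.2) / 12)
  else if ℓ.1 = 48 then (fun c e => replicate 3 (c, [c, c, e, e], 0) ++
      replicate 6 (e, [c, e], 4))
    (pick 6 3 ℓ.2) ((ℓ.2.sum - 3 * pick 6 3 ℓ.2) / 6)
  else []

/-- The number of points with several mirrors, in terms of the pairs at an angle of 60 degrees. -/
noncomputable def hexSum (p : ℕ) [Fact p.Prime] (B : BilinForm ℚ V) (K : Submodule ℤ V)
    (a : Fin 3 → ℕ) (u : Fin 3 → ZMod p) (red : V → Fin 3 → ZMod p) (xs : List V) (x : V) : ℕ :=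
  (xs.map fun y => open scoped Classical in if IsHexPair B x y then
    ((quadX a u).filter fun v => (∀ z ∈ xs, ¬ IsAxis red z v) ∧ IsMirror p B K red x v ∧
      IsMirror p B K red y v).card else 0).sum

theorem IsHexPair.exists_a2 (hB : IsPosDefSpace B) (hx : IsRoot B K x) (hy : IsRoot B K y) (h :
    IsHexPair B x y) : ∃ y', IsRoot B K y' ∧ IsA2Pair B x y' ∧ (y' = y ∨ y' = -y) := by
  have h0 := hB.pos x hx.ne_zero
  obtain ⟨h1, h2 | h2⟩ := h
  · exact ⟨-y, hy.neg, ⟨h0, by simpa using h1, by rw [map_neg, mul_neg, h2]⟩, Or.inr rfl⟩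
  · exact ⟨y, hy, ⟨h0, h1, h2⟩, Or.inl rfl⟩

theorem Frame.isMirror_of_eq (hB : IsPosDefSpace B) (F : Frame p B K a u red) {y' : V} (hy : IsRoot
    B K y) (h : y' = y ∨ y' = -y) (v : Fin 3 → ZMod p) : IsMirror p B K red y' v ↔ IsMirror p B K
    red y v := by
  rcases h with rfl | rfl
  · rfl
  · obtain ⟨k, hk, rfl⟩ := F.surj v
    obtain ⟨n, hn⟩ := hy.2 k hk
    rw [IsMirror, IsMirror, F.rootFun_red hB hy hk hn,
      F.rootFun_red hB hy.neg hk (m := -n) (by simp [hn])]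
    simp

/-- If all other roots are orthogonal to z, a point on the mirrors of a skew pair is on the axis of
z and does not count. For p = 3 such a pair would produce G₂, which is excluded. -/
theorem Gluing.hexSum_eq_zero (G : Gluing p B K a u red) (hreg : p = 3 → ¬ HasG2 B K) (hxs :
    IsRootList B K xs) (hz : z ∈ xs) (h : ∀ x ∈ xs, x = z ∨ B z x = 0) : ∀ x ∈ xs, hexSum p B K a u
    red xs x = 0 := by
  intro x hx
  have hB := G.int.pd
  have hz0 := hB.ne_zero (hxs.root z hz).ne_zero
  refine List.sum_eq_zero fun q hq => ?_
  obtain ⟨y, hy, rfl⟩ := mem_map.1 hq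
  split_ifs with hxy
  · rw [card_eq_zero, filter_eq_empty_iff]
    rintro v - ⟨h1, h2, h3⟩
    have hzx : B z x = 0 := by
      rcases h x hx with rfl | h4
      · exfalso
        rcases h y hy with rfl | h5
        · exact isHexPair_irrefl hB (hxs.root y hy).ne_zero hxy
        · rcases hxy.2 with h6 | h6 <;> rw [h5] at h6 <;> apply hz0 <;> linarith
      · exact h4
    have hzy : B z y = 0 := by
      rcases h y hy with rfl | h4
      · exfalso
        rcases hxy.2 with h6 | h6 <;> rw [hB.symm, hzx] at h6 <;>
          exact hB.ne_zero (hxs.root x hx).ne_zero (by linarith)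
      · exact h4
    obtain ⟨y', hy', hA, e⟩ := hxy.exists_a2 hB (hxs.root x hx) (hxs.root y hy)
    have hzy' : B z y' = 0 := by rcases e with rfl | rfl <;> simp [hzy]
    by_cases hp3 : p = 3
    · exact hreg hp3 (hasG2_of_a2_orth G.int hA (hxs.root x hx) hy' (hxs.root z hz) hzx hzy')
    · exact h1 z hz (G.frame.axis_of_a2_mirrors G.ne_two hp3 G.int hA (hxs.root x hx) hy'
        (hxs.root z hz) hzx hzy' h2 ((G.frame.isMirror_of_eq hB (hxs.root y hy) e v).2 h3))
  · rfl

/-- Without G₂ the condition on the axes holds by itself: the root of an axis through such a point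
would be orthogonal to both roots of an A₂, which yields G₂. So each partner contributes 2 ·
`hexCount` points. -/
theorem Gluing.hexSum_eq (G : Gluing p B K a u red) (hG : ¬ HasG2 B K) (hxs : IsRootList B K xs)
    (hx : x ∈ xs) : hexSum p B K a u red xs x = (xs.map fun y => open scoped Classical in if
    IsHexPair B x y then 1 else 0).sum * (2 * hexCount (params p a u)) := by
  classical
  have hB := G.int.pd
  have F := G.frame
  rw [hexSum, ← List.sum_map_mul_right]
  congr 1
  refine map_congr_left fun y hy => ?_
  rw [ite_mul, one_mul, zero_mul]
  split_ifs with hxy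
  · obtain ⟨y', hy', hA, e⟩ := hxy.exists_a2 hB (hxs.root x hx) (hxs.root y hy)
    rw [← F.card_a2_mirrors' G.ne_two G.int G.le (fun _ => hG) hA (hxs.root x hx) hy']
    congr 1
    refine Finset.filter_congr fun v hv => ?_
    rw [F.isMirror_of_eq hB (hxs.root y hy) e]
    refine ⟨fun h => h.2, fun h => ⟨fun z hz hzv => hG ?_, h⟩⟩
    have hv0 := ne_zero_of_mem_quadX (F.unit 0) hv
    have h1 := F.orth_of_axis_mirror G.ne_two hB (fun _ => hG) (hxs.root z hz) (hxs.root x hx) hv0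
      hzv h.1
    have h2 := F.orth_of_axis_mirror G.ne_two hB (fun _ => hG) (hxs.root z hz) (hxs.root y hy) hv0
      hzv h.2
    rw [hB.symm] at h1 h2
    exact hasG2_of_a2_orth G.int hA (hxs.root x hx) hy' (hxs.root z hz) h1
      (by rcases e with rfl | rfl <;> simp [h2])
  · rfl

/-- The entries describe the roots. -/
def Describes (p : ℕ) [Fact p.Prime] (B : BilinForm ℚ V) (K : Submodule ℤ V)
    (a : Fin 3 → ℕ) (u : Fin 3 → ZMod p) (red : V → Fin 3 → ZMod p)
    (es : List (ℕ × List ℕ × ℕ)) : Prop :=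
  ∃ (xs : List V) (f n : V → ℕ), IsRootList B K xs ∧ (∀ x ∈ xs, B x x = f x) ∧
    (∀ x ∈ xs, hexSum p B K a u red xs x = 2 * (hexCount (params p a u) * n x)) ∧
    xs.map (fun x => (f x, (xs.filter fun y => B y x = 0).map f, n x)) = es

theorem IntLattice.exists_normFun (hK : IntLattice B K) :
    ∃ f : V → ℕ, ∀ x ∈ K, B x x = f x := by
  have h1 : ∀ x, ∃ n : ℕ, x ∈ K → B x x = n := fun x => by
    by_cases hx : x ∈ K
    · exact (hK.norm_nat hx).imp fun _ h _ => h
    · simp_all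
  choose f hf using h1
  exact ⟨f, hf⟩

theorem Gluing.describes_isolated (G : Gluing p B K a u red) (hreg : p = 3 → ¬ HasG2 B K) (hxs :
    IsRootList B K xs) (hz : z ∈ xs) (h : ∀ x ∈ xs, x = z ∨ B z x = 0) (hf : ∀ x ∈ K, B x x = f x)
    : Describes p B K a u red (xs.map fun x => (f x, (xs.filter fun y => B y x = 0).map f, 0)) :=
  ⟨xs, f, fun _ => 0, hxs, fun x hx => hf x (hxs.root x hx).mem,
    fun x hx => by rw [G.hexSum_eq_zero hreg hxs hz h x hx, mul_zero, mul_zero], rfl⟩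

theorem Gluing.describes_three (G : Gluing p B K a u red) (hreg : p = 3 → ¬ HasG2 B K) (ht :
    OrthTriple B x y z) (h : IsRootList B K [x, y, z]) (hl : HasLabel B K ℓ) : Describes p B K a u
    red (entries ℓ) := by
  have hB := G.int.pd
  obtain ⟨f, hf⟩ := G.int.exists_normFun
  have hc := card_orthGroup_three G.int ht h
  obtain ⟨h1, h2, h3⟩ := (h.hasLabel_iff G.int).1 hl
  have h4 : (Relation.Comp (fun (l : List ℚ) (k : List V) => l = k.map fun x => B x x)
      (fun a b => Perm a b)) (ℓ.2.map fun n : ℕ => (n : ℚ)) [x, y, z] := by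
    rw [List.eq_map_comp_perm]
    exact h3
  -- The entries of the label are sorted, so the roots are put into the corresponding order first.
  obtain ⟨ys, hys, hp⟩ := h4
  have hy := h.perm hp
  have hor : ∀ v ∈ ys, ∀ w ∈ ys, v ≠ w → B v w = 0 := by
    intro v hv w hw hne
    have hv := hp.mem_iff.1 hv
    have hw := hp.mem_iff.1 hw
    simp at hv hw
    rcases hv with rfl | rfl | rfl <;> rcases hw with rfl | rfl | rfl <;>
      first | exact absurd rfl hne | exact ht.xy | exact ht.xz | exact ht.yz |
        (rw [hB.symm]; first | exact ht.xy | exact ht.xz | exact ht.yz)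
  obtain ⟨v, w, t, rfl⟩ := List.length_eq_three.1 hp.length_eq
  have hpw := hy.pairwise
  simp only [pairwise_cons, mem_cons, not_mem_nil, or_false, forall_eq_or_imp,
    forall_eq] at hpw
  have e : ℓ.2 = [f v, f w, f t] := by
    have : (ℓ.2.map fun n : ℕ => (n : ℚ)) = [f v, f w, f t].map fun n : ℕ => (n : ℚ) := by
      rw [hys]
      simp [hf _ (hy.root v (by simp)).mem, hf _ (hy.root w (by simp)).mem,
        hf _ (hy.root t (by simp)).mem]
    exact List.map_injective_iff.2 Nat.cast_injective this
  have o1 : B v w = 0 := hor v (by simp) w (by simp) hpw.1.1.1.symm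
  have o2 : B v t = 0 := hor v (by simp) t (by simp) hpw.1.2.1.symm
  have o3 : B w t = 0 := hor w (by simp) t (by simp) hpw.2.1.1.symm
  have := G.describes_isolated hreg hy (z := v) (by simp) (by simp [o1, o2]) hf
  convert this using 1
  have n1 := hB.ne_zero (hy.root v (by simp)).ne_zero
  have n2 := hB.ne_zero (hy.root w (by simp)).ne_zero
  have n3 := hB.ne_zero (hy.root t (by simp)).ne_zero
  rw [entries, h1, hc, e]
  simp [o1, o2, o3, hB.symm w v, hB.symm t v, hB.symm t w, n1, n2, n3]

theorem Gluing.describes_b2 (G : Gluing p B K a u red) (hreg : p = 3 → ¬ HasG2 B K) (ht :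
    OrthTriple B z x y) (hn : B y y = B x x) (h : IsRootList B K [z, x, y, x + y, x - y]) (hl :
    HasLabel B K ℓ) : Describes p B K a u red (entries ℓ) := by
  have hB := G.int.pd
  obtain ⟨f, hf⟩ := G.int.exists_normFun
  have o1 := ht.xy
  have o2 := ht.xz
  have o3 := ht.yz
  have o4 : B x z = 0 := by rw [hB.symm, o1]
  have o5 : B y z = 0 := by rw [hB.symm, o2]
  have o6 : B y x = 0 := by rw [hB.symm, o3]
  have hfz := hf z (h.root z (by simp)).mem
  have hfx := hf x (h.root x (by simp)).mem
  have n1 := hB.ne_zero ht.hx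
  have n2 := hB.ne_zero ht.hy
  have e1 : f y = f x := by
    have := hf y (h.root y (by simp)).mem
    simp_all
  have e2 : f (x + y) = 2 * f x := by
    have := hf _ (h.root (x + y) (by simp)).mem
    simp only [map_add, LinearMap.add_apply, o3, o6, hn, hfx] at this
    have h2 : ((2 * f x : ℕ) : ℚ) = f (x + y) := by rw [← this]; push_cast; ring
    exact_mod_cast h2.symm
  have e3 : f (x - y) = 2 * f x := by
    have := hf _ (h.root (x - y) (by simp)).mem
    simp only [map_sub, LinearMap.sub_apply, o3, o6, hn, hfx] at this
    have h2 : ((2 * f x : ℕ) : ℚ) = f (x - y) := by rw [← this]; push_cast; ring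
    exact_mod_cast h2.symm
  rw [h.hasLabel_iff_eq G.int (ns := [f z, f x, f x, 2 * f x, 2 * f x]) (by
    simp [o3, o6, hn, hfz, hfx]; ring), card_orthGroup_b2 G.int ht hn h] at hl
  -- Only the norm of z occurs an odd number of times, also if it equals `f x` or `2 * f x`. The
  -- other norms add up to `6 * f x`.
  have hpick : pick 2 1 (sortList [f z, f x, f x, 2 * f x, 2 * f x]) = f z := by
    refine pick_sortList (by simp) fun c hc => ?_
    grind
  have := G.describes_isolated hreg h (z := z) (by simp) (by simp [o1, o2]) hf
  convert this using 1
  have hs : (f x + (f x + (2 * f x + 2 * f x))) / 6 = f x := by omega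
  rw [hl, entries]
  simp [o1, o2, o3, o4, o5, o6, n1, n2, hn, e1, e2, e3, hpick, sum_sortList, hs]

theorem IntLattice.norms_g2 (hK : IntLattice B K) (o1 : B z x = 0) (o2 : B z y = 0) (hA : IsA2Pair
    B x y) (h : IsRootList B K (listG2 z x y)) (hl : HasLabel B K ℓ) (hf : ∀ x ∈ K, B x x = f x) :
    (f y = f x ∧ f (x + y) = f x ∧ f (x - y) = 3 * f x ∧ f ((2 : ℚ) • x + y) = 3 * f x ∧ f (x + (2
    : ℚ) • y) = 3 * f x) ∧ ℓ.1 = 24 ∧ pick 3 1 ℓ.2 = f z ∧ (ℓ.2.sum - pick 3 1 ℓ.2) / 12 = f x := by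
  have hB := hK.pd
  have o3 := hA.root_facts
  have o6 : B y x = -(B x x / 2) := by rw [hB.symm, o3]
  have hn := hA.norm
  have hfx := hf x (h.root x (by simp [listG2])).mem
  have key : ∀ v ∈ listG2 z x y, ∀ k : ℕ, B v v = k * B x x → f v = k * f x := by
    intro v hv k hk
    rw [hf v (h.root v hv).mem, hfx] at hk
    exact_mod_cast hk
  have e1 : f y = f x := by simpa using key y (by simp [listG2]) 1 (by simp [hn])
  have e2 : f (x + y) = f x := by
    simpa using key (x + y) (by simp [listG2]) 1 (by simp [o3, o6, hn]; ring)
  have e3 : f (x - y) = 3 * f x := key _ (by simp [listG2]) 3 (by simp [o3, o6, hn]; ring)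
  have e4 : f ((2 : ℚ) • x + y) = 3 * f x :=
    key _ (by simp [listG2]) 3 (by simp [o3, o6, hn]; ring)
  have e5 : f (x + (2 : ℚ) • y) = 3 * f x :=
    key _ (by simp [listG2]) 3 (by simp [o3, o6, hn]; ring)
  have hmap : ((listG2 z x y).map fun x => B x x) =
      [f z, f x, f x, f x, 3 * f x, 3 * f x, 3 * f x].map fun n : ℕ => (n : ℚ) := by
    rw [map_congr_left fun v hv => hf v (h.root v hv).mem]
    simp [listG2, e1, e2, e3, e4, e5]
  rw [h.hasLabel_iff_eq hK hmap, card_orthGroup_g2 hK o1 o2 hA h] at hl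
  have hpick : pick 3 1 ℓ.2 = f z := by
    rw [hl]
    refine pick_sortList (by simp) fun c hc => ?_
    grind
  refine ⟨⟨e1, e2, e3, e4, e5⟩, by rw [hl], hpick, ?_⟩
  rw [hpick, hl, sum_sortList]
  grind

theorem Gluing.describes_g2 (G : Gluing p B K a u red) (hreg : p = 3 → ¬ HasG2 B K) (hz : z ≠ 0)
    (o1 : B z x = 0) (o2 : B z y = 0) (hA : IsA2Pair B x y) (h : IsRootList B K (listG2 z x y)) (hl
    : HasLabel B K ℓ) : Describes p B K a u red (entries ℓ) := by
  have hB := G.int.pd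
  obtain ⟨f, hf⟩ := G.int.exists_normFun
  have o3 := hA.root_facts
  have o4 : B x z = 0 := by rw [hB.symm, o1]
  have o5 : B y z = 0 := by rw [hB.symm, o2]
  have o6 : B y x = -(B x x / 2) := by rw [hB.symm, o3]
  have hn := hA.norm
  have n1 := hB.ne_zero hz
  have n2 := hA.pos.ne'
  obtain ⟨⟨e1, e2, e3, e4, e5⟩, hl1, hp, hs⟩ := G.int.norms_g2 o1 o2 hA h hl hf
  have := G.describes_isolated hreg h (z := z) (by simp [listG2]) (by simp [listG2, o1, o2]) hf
  convert this using 1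
  generalize hq : B x x = q at *
  rw [entries, hl1, hs, hp]
  simp [listG2, filter_cons, o1, o2, o3, o4, o5, o6, n1, n2, hn, hq, e1, e2, e3, e4, e5]
  grind

/-- The three axes occur three times and the six diagonals six times, so the axes are recognized by
multiplicity 3 modulo 6. -/
theorem Gluing.describes_cubic (G : Gluing p B K a u red) (hG : ¬ HasG2 B K) (hs : s = 1 ∨ s = 1 /
    2) (ht : OrthTriple B x y z) (hy : B y y = B x x) (hz : B z z = B x x) (h : IsRootList B K
    (listCubic s x y z)) (hl : HasLabel B K ℓ) : Describes p B K a u red (entries ℓ) := by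
  classical
  have hB := G.int.pd
  obtain ⟨f, hf⟩ := G.int.exists_normFun
  have o1 := ht.xy
  have o2 := ht.xz
  have o3 := ht.yz
  have o4 : B y x = 0 := by rw [hB.symm, o1]
  have o5 : B z x = 0 := by rw [hB.symm, o2]
  have o6 : B z y = 0 := by rw [hB.symm, o3]
  have n1 := hB.ne_zero ht.hx
  have hfx := hf x (h.root x (by simp [listCubic])).mem
  have hs0 : s ≠ 0 := by rcases hs with rfl | rfl <;> norm_num
  have key : ∀ v ∈ listCubic s x y z, ∀ w ∈ listCubic s x y z, B v v = B w w → f v = f w := by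
    intro v hv w hw e
    rw [hf v (h.root v hv).mem, hf w (h.root w hw).mem] at e
    simp_all
  obtain ⟨e, he⟩ : ∃ e, e = f (s • (x + y)) := ⟨_, rfl⟩
  have hE : (e : ℚ) = 2 * s ^ 2 * B x x := by
    rw [he, ← hf _ (h.root (s • (x + y)) (by simp [listCubic])).mem]
    simp [o1, o4, hy]
    ring
  have e1 : f y = f x := key _ (by simp [listCubic]) _ (by simp [listCubic]) hy
  have e2 : f z = f x := key _ (by simp [listCubic]) _ (by simp [listCubic]) hz
  have e3 : ∀ v ∈ [s • (x + y), s • (x - y), s • (x + z), s • (x - z), s • (y + z), s • (y - z)],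
      f v = e := by
    intro v hv
    rw [he]
    refine key _ (by simp only [listCubic]; exact List.mem_of_mem_drop (i := 3) hv) _
      (by simp [listCubic]) ?_
    simp only [mem_cons, not_mem_nil, or_false] at hv
    rcases hv with rfl | rfl | rfl | rfl | rfl | rfl <;> simp [o1, o2, o3, o4, o5, o6, hy, hz,
      mul_add]
  simp only [List.forall_mem_cons, not_mem_nil, false_imp_iff, implies_true, and_true] at e3
  have f0 : f x ≠ 0 := fun h0 => n1 (by rw [hfx, h0, Nat.cast_zero])
  have hne : e ≠ f x ∧ e ≠ 0 := by
    have : (e : ℚ) ≠ f x ∧ (e : ℚ) ≠ 0 := by grind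
    exact_mod_cast this
  have hmap : ((listCubic s x y z).map fun x => B x x) =
      [f x, f x, f x, e, e, e, e, e, e].map fun n : ℕ => (n : ℚ) := by
    have : ((listCubic s x y z).map fun x => B x x) = (listCubic s x y z).map fun x => (f x : ℚ) :=
      map_congr_left fun v hv => hf v (h.root v hv).mem
    rw [this]
    simp [listCubic, e1, e2, e3, -smul_add]
  rw [h.hasLabel_iff_eq G.int hmap, card_orthGroup_cubic G.int hs ht hy hz h] at hl
  have hpick : pick 6 3 (sortList [f x, f x, f x, e, e, e, e, e, e]) = f x := by
    refine pick_sortList (by simp) fun c hc => ?_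
    simp only [mem_cons, not_mem_nil, or_false] at hc
    simp only [List.count_cons, List.count_nil, beq_iff_eq]
    grind
  have hsum : (f x + (f x + (f x + (e + (e + (e + (e + (e + e))))))) - 3 * f x) / 6 = e := by omega
  -- Axes are mutually orthogonal and have no partners at 60 degrees; each diagonal is orthogonal to
  -- the other diagonal of its square and at 60 degrees to the remaining four.
  have hS : ∀ v ∈ listCubic s x y z, ((listCubic s x y z).map fun w =>
      if IsHexPair B v w then 1 else 0).sum = if f v = f x then 0 else 4 := by
    intro v hv
    simp only [listCubic, mem_cons, not_mem_nil, or_false] at hv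
    generalize hq : B x x = q at *
    have m1 : q * 2 ≠ -q := fun h => n1 (by linarith)
    have m2 : q * 2 ≠ q := fun h => n1 (by linarith)
    have m3 : q * 4 ≠ -(q * 2) := fun h => n1 (by linarith)
    have m4 : q ≠ -(q * (1 / 2)) := fun h => n1 (by linarith)
    rcases hs with rfl | rfl <;> rcases hv with rfl | rfl | rfl | rfl | rfl | rfl | rfl | rfl | rfl <;>
      simp [listCubic, IsHexPair, o1, o2, o3, o4, o5, o6, hy, hz, hq, e1, e2, e3, hne.1,
        -smul_add, -smul_sub, -one_smul, -one_div] <;>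
      ring_nf <;> norm_num [n1, n1.symm, m1, m2, m3, m4]
  refine ⟨listCubic s x y z, f, fun v => if f v = f x then 0 else 4, h,
    fun v hv => hf v (h.root v hv).mem, fun v hv => ?_, ?_⟩
  · rw [G.hexSum_eq hG h hv, hS v hv]
    ring
  · rw [hl, entries]
    simp [listCubic, filter_cons, o1, o2, o3, o4, o5, o6, n1, hy, hz, e1, e2, e3, hne.1, hs0,
      hpick, sum_sortList, hsum, replicate, -smul_add, -smul_sub]

theorem Gluing.describes_a2 (G : Gluing p B K a u red) (hG : ¬ HasG2 B K) (hA : IsA2Pair B x y) (h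
    : IsRootList B K [x, y,
      x + y]) (hl : HasLabel B K ℓ) : Describes p B K a u red (entries ℓ) := by
  classical
  have hB := G.int.pd
  obtain ⟨f, hf⟩ := G.int.exists_normFun
  have o3 := hA.root_facts
  have o6 : B y x = -(B x x / 2) := by rw [hB.symm, o3]
  have hn := hA.norm
  have n2 := hA.pos.ne'
  have hfx := hf x (h.root x (by simp)).mem
  have e1 : f y = f x := by
    have := hf y (h.root y (by simp)).mem
    simp_all
  have e2 : f (x + y) = f x := by
    have := hf _ (h.root (x + y) (by simp)).mem
    simp [o3, o6, hn, hfx] at this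
    have h2 : ((f x : ℕ) : ℚ) = f (x + y) := by rw [← this]; ring
    simp_all
  rw [h.hasLabel_iff_eq G.int (ns := [f x, f x, f x]) (by simp [o3, o6, hn, hfx]; ring),
    card_orthGroup_a2 G.int hA h] at hl
  refine ⟨_, f, fun _ => 2, h, fun v hv => hf v (h.root v hv).mem, fun v hv => ?_, ?_⟩
  · have hS : ([x, y, x + y].map fun w => if IsHexPair B v w then 1 else 0).sum = 2 := by
      simp at hv
      have m1 : B x x * 2 ≠ -B x x := fun h => n2 (by linarith)
      rcases hv with rfl | rfl | rfl <;> simp [IsHexPair, o3, o6, hn] <;> ring_nf <;> simp [n2, m1]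
    rw [G.hexSum_eq hG h hv, hS]
    ring
  · rw [hl, entries]
    generalize hq : B x x = q at *
    simp [hq, sortList, filter_cons, o3, o6, n2, hn, e1, e2]
    grind

/-- For a fixed label the order of the group singles out the type of the root system, and the norms
fix the rest. The hypothesis excludes exactly G₂ × A₁ for p = 3. -/
theorem Gluing.describes (G : Gluing p B K a u red) (hl : HasLabel B K ℓ) (hreg : p = 3 → ℓ.1 ≠ 24)
    : Describes p B K a u red (entries ℓ) := by
  have hK := G.int
  obtain ⟨f, hf⟩ := hK.exists_normFun
  by_cases hG : HasG2 B K
  · obtain ⟨z, x, y, hz, o1, o2, hA, h⟩ := exists_g2 hK hG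
    refine G.describes_g2 (fun h3 => ?_) hz o1 o2 hA h hl
    exact absurd (((h.hasLabel_iff hK).1 hl).1.trans (card_orthGroup_g2 hK o1 o2 hA h)) (hreg h3)
  have hr : p = 3 → ¬ HasG2 B K := fun _ => hG
  rcases hK.rootType with h | ⟨x, h⟩ | ⟨x, y, z, ht, h⟩ | ⟨x, y, hA, h⟩ | ⟨z, x, y, ht, hn, h⟩ |
    ⟨z, x, y, hz, hzx, hzy, hA, h⟩ | ⟨s, x, y, z, hs, ht, hy, hz, h⟩
  · rw [h.hasLabel_iff_eq hK (ns := []) rfl, card_orthGroup_none hK h] at hl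
    exact ⟨[], f, f, h, by simp, by simp, by simp [hl, entries]⟩
  · have hfx := hf x (h.root x (by simp)).mem
    rw [h.hasLabel_iff_eq hK (ns := [f x]) (by simp [hfx]), card_orthGroup_one hK h] at hl
    convert G.describes_isolated hr h (z := x) (by simp) (by simp) hf using 1
    simp [hl, entries, sortList, hK.pd.ne_zero (h.root x (by simp)).ne_zero]
  · exact G.describes_three hr ht h hl
  · exact G.describes_a2 hG hA h hl
  · exact G.describes_b2 hr ht hn h hl
  · exact absurd ⟨x, (2 : ℚ) • x + y, h.root x (by simp [listG2]), h.root _ (by simp [listG2]), by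
      simp [hA.root_facts, hK.pd.symm y x, hA.norm]
      ring⟩ hG
  · exact G.describes_cubic hG hs ht hy hz h hl

/-! ### The prime 3 and roots of type G₂ × A₁ -/

/-- The norm of a root after the adjunction of a vector on its axis, if `e = 0`, or on its mirror,
if `m = 0`. -/
def conv (e m n : ℕ) : List ℕ := if e = 0 then [n / 9] else if m = 0 then [n] else []

theorem length_conv (e m n : ℕ) : (conv e m n).length = if e = 0 then 1 else if m = 0 then 1 else 0 := by
  rw [conv]
  grind

/-- The norms of the roots after the adjunction of a vector to a lattice with roots of type
`G₂ × A₁`, for the prime `3`. -/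
def g2Norms (z c : ℕ) (t : ℕ × ℕ × ℕ) : List ℕ :=
  conv (t.1 + t.2.1) t.2.2 z ++ (conv (t.2.1 + t.2.2) ((t.1 + t.2.1) % 3) c ++
    (conv (t.1 + t.2.2) ((t.1 + t.2.1) % 3) c ++
    (conv ((t.1 + 2 * t.2.1) % 3 + t.2.2) ((t.1 + t.2.1) % 3) c ++
    (conv ((t.1 + t.2.1) % 3 + t.2.2) ((t.1 + 2 * t.2.1) % 3) (3 * c) ++
    (conv ((t.1 + t.2.1) % 3 + t.2.2) t.1 (3 * c) ++
    conv ((t.1 + t.2.1) % 3 + t.2.2) t.2.1 (3 * c))))))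

/-- The vector with these coordinates may be adjoined. -/
def OnG2 (r z c : ℕ) (t : ℕ × ℕ × ℕ) : Prop :=
  (2 * (c * t.1) + 8 * (c * t.2.1)) % 9 = 0 ∧ (2 * (c * t.2.1) + 8 * (c * t.1)) % 9 = 0 ∧
    (z * t.2.2) % 9 = 0 ∧ (c * (t.1 * t.1) + 26 * (c * (t.1 * t.2.1)) + c * (t.2.1 * t.2.1) +
      z * (t.2.2 * t.2.2)) % 27 = (9 * r) % 27

instance (r z c : ℕ) (t : ℕ × ℕ × ℕ) : Decidable (OnG2 r z c t) :=
  inferInstanceAs (Decidable (_ ∧ _ ∧ _ ∧ _))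

/-- The order of the orthogonal group, in terms of the norms of the roots. -/
def g2Order (ns : List ℕ) (g : ℕ) : ℕ := if ns.length = 3 ∧ g ≠ 0 then 12 else symmOrder ns.length

/-- The weighted labels for the prime `3` and a lattice with roots of type `G₂ × A₁`. -/
def g2Cells (r z c : ℕ) : List (ℕ × Label) :=
  (triples 3).flatMap fun t => if OnG2 r z c t then
    [(g2Order (g2Norms z c t) t.2.2, (g2Order (g2Norms z c t) t.2.2,
      sortList (g2Norms z c t)))] else []

/-- A description of the axis and the mirror of a root in terms of residues. -/
def G2Row (i j k i' j' k' : ℤ) (e m : ℕ → ℕ → ℕ → ℕ) : Prop :=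
  ∀ α β γ : ZMod 3, ((∃ s : ZMod 3, α = s * i ∧ β = s * j ∧ γ = s * k) ↔
    e α.val β.val γ.val = 0) ∧ (α * i' + β * j' + γ * k' = 0 ↔ m α.val β.val γ.val = 0)

instance (i j k i' j' k' : ℤ) (e m : ℕ → ℕ → ℕ → ℕ) : Decidable (G2Row i j k i' j' k' e m) :=
  inferInstanceAs (Decidable (∀ _, _))

/-- If three roots survive and z is not among those with a mirror through the point, they are the
short A₂; this is the only case in which three symmetries give a group of order 12. -/
theorem g2_length (z c : ℕ) : ∀ α β γ : ZMod 3, (g2Norms z c (α.val, β.val, γ.val)).length = 3 →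
    γ.val ≠ 0 → α.val = 1 ∧ β.val = 2 ∨ α.val = 2 ∧ β.val = 1 := by
  simp only [g2Norms, List.length_append, length_conv]
  decide

/-- The norms of the surviving roots are known in general; only the order of the group is left as a
hypothesis, because here it is not always determined by the number of roots. -/
theorem Gluing.labelAt_of_card (G : Gluing p B K a u red) (hxs : IsRootList B K xs) (hf : ∀ x ∈ xs,
    B x x = f x) (hv : v ∈ quadX a u) {g : ℕ} (hg : ∀ M, IntLattice B M → IsRootList B M
    ((xs.filter fun x => IsAxis red x v ∨ IsMirror p B K red x v).map (convRoot p red v)) →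
    ((xs.filter fun x => IsAxis red x v ∨ IsMirror p B K red x v).map (convRoot p red v)).length =
    (xs.flatMap fun x => open scoped Classical in if IsAxis red x v then [f x / p ^ 2] else if
    IsMirror p B K red x v then [f x] else []).length → Nat.card (orthGroup B M) = g) : LabelAt p B
    K red v (g, sortList (xs.flatMap fun x => open scoped Classical in if IsAxis red x v then [f x
    / p ^ 2] else if IsMirror p B K red x v then [f x] else [])) := by
  refine G.labelAt hv fun n hr hM hw had => ?_
  subst hr
  have hl := G.frame.rootList_over G.ne_two G.int hxs had hw
  have hr := hl.root
  suffices hns : _ = List.map (fun n : ℕ => (n : ℚ)) (xs.flatMap fun x => open scoped Classical in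
      if IsAxis red x (red n) then [f x / p ^ 2] else if IsMirror p B K red x (red n) then [f x]
      else []) by
    rw [hl.hasLabel_iff_eq hM hns, hg _ hM hl (by simpa using congrArg List.length hns)]
  clear hl hg hxs
  induction xs with
  | nil => rfl
  | cons x xs ih =>
    have hp0 : (p : ℚ) ≠ 0 := by exact_mod_cast prime_ne_zero' p
    have hx := hf x mem_cons_self
    have hf' := fun y hy => hf y (mem_cons_of_mem x hy)
    rw [flatMap_cons, List.map_append]
    by_cases h1 : IsAxis red x (red n)
    · rw [List.filter_cons_of_pos (by simp [h1])] at hr ⊢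
      rw [map_cons, map_cons, ih hf' fun y hy => hr y (mem_cons_of_mem _ hy),
        if_pos h1, convRoot, if_pos h1]
      obtain ⟨m, hm⟩ := hM.norm_nat (hr _ mem_cons_self).mem
      rw [convRoot, if_pos h1] at hm
      have hfm : f x = p ^ 2 * m := by
        have : (f x : ℚ) = p ^ 2 * m := by
          rw [← hx, ← hm]
          simp
          field_simp
        exact_mod_cast this
      simp_all
    · by_cases h2 : IsMirror p B K red x (red n)
      · rw [List.filter_cons_of_pos (by simp [h2])] at hr ⊢
        rw [map_cons, map_cons, ih hf' fun y hy => hr y (mem_cons_of_mem _ hy),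
          if_neg h1, if_pos h2, convRoot, if_neg h1, hx]
        rfl
      · simp_all

/-- The long root x - y has norm 3Q(x), so the integers 2B(x, k)/Q(x) and 2B(y, k)/Q(y) differ by a
multiple of 3. This removes the denominator 3 that projection to the A₂ would otherwise have. -/
theorem exists_coeff_g2 (hK : IntLattice B K) (hz : z ≠ 0) (o1 : B z x = 0) (o2 : B z y = 0) (hA :
    IsA2Pair B x y) (h : IsRootList B K (listG2 z x y)) {k : V} (hk : k ∈ K) : ∃ α β l : ℤ, (2 : ℤ)
    • k = (2 * α) • x + (2 * β) • y + l • z := by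
  have hB := hK.pd
  have o3 := hA.root_facts
  have o6 : B y x = -(B x x / 2) := by rw [hB.symm, o3]
  have hn := hA.norm
  have h0 := hA.pos
  obtain ⟨i, hi⟩ := (h.root x (by simp [listG2])).2 k hk
  obtain ⟨j, hj⟩ := (h.root y (by simp [listG2])).2 k hk
  obtain ⟨l, hl⟩ := (h.root z (by simp [listG2])).2 k hk
  obtain ⟨m, hm⟩ := (h.root (x - y) (by simp [listG2])).2 k hk
  have hij : i - j = 3 * m := by
    have : (i : ℚ) - j = 3 * m := by
      refine mul_right_cancel₀ h0.ne' ?_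
      simp only [map_sub, LinearMap.sub_apply, o3, o6, hn] at hm
      grind
    exact_mod_cast this
  have hi' : (i : ℚ) = j + 3 * m := by exact_mod_cast (by omega : i = j + 3 * m)
  refine ⟨j + 2 * m, j + m, l, ?_⟩
  have hy' : B (x + (2 : ℚ) • y) (x + (2 : ℚ) • y) ≠ 0 := by
    simp [o3, o6, hn]
    linarith
  have ht : OrthTriple B z x (x + (2 : ℚ) • y) :=
    ⟨hz, fun e => by simp [e] at h0, fun e => hy' (by rw [e]; simp), o1, by simp [o1, o2],
      by simp [o3]; ring⟩
  rw [ht.expand hB hK.rank k]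
  have e1 : B z k / B z z = l / 2 := by
    rw [div_eq_div_iff (hB.ne_zero hz) two_ne_zero]
    linarith
  have e2 : B x k / B x x = (j + 3 * m) / 2 := by grind
  have e3 : B (x + (2 : ℚ) • y) k / B (x + (2 : ℚ) • y) (x + (2 : ℚ) • y) = (j + m) / 2 := by
    rw [div_eq_div_iff hy' two_ne_zero]
    simp [o3, o6, hn]
    grind
  rw [e1, e2, e3]
  simp only [← cast_smul_eq_zsmul ℚ]
  push_cast
  module

/-- By `exists_coeff_g2` every 2k is an integral combination of x, y, z, and 2 is invertible modulo
3. So the reductions of x, y, z span, and by counting they form a basis. -/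
theorem Frame.exists_basis_g2 [Fact (Nat.Prime 3)] {u : Fin 3 → ZMod 3} {red : V → Fin 3 → ZMod 3}
    (F : Frame 3 B K a u red) (hK : IntLattice B K) (hz : z ≠ 0) (o1 : B z x = 0) (o2 : B z y = 0)
    (hA : IsA2Pair B x y) (h : IsRootList B K (listG2 z x y)) : Bijective fun t : Fin 3 →
    ZMod 3 => t 0 • red x + t 1 • red y + t 2 • red z := by
  have hxK := (h.root x (by simp [listG2])).mem
  have hyK := (h.root y (by simp [listG2])).mem
  have hzK := (h.root z (by simp [listG2])).mem
  refine Surjective.bijective_of_finite fun v => ?_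
  obtain ⟨k, hk, rfl⟩ := F.surj v
  obtain ⟨α, β, l, e⟩ := exists_coeff_g2 hK hz o1 o2 hA h hk
  have e' := congrArg red e
  rw [F.red_zsmul _ hk,
    F.add _ (K.add_mem (K.smul_mem _ hxK) (K.smul_mem _ hyK)) _ (K.smul_mem _ hzK),
    F.add _ (K.smul_mem _ hxK) _ (K.smul_mem _ hyK), F.red_zsmul _ hxK, F.red_zsmul _ hyK,
    F.red_zsmul _ hzK] at e'
  refine ⟨![α, β, 2 * l], ?_⟩
  have h4 : (2 : ZMod 3) * ((2 : ℤ) : ZMod 3) = 1 := rfl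
  rw [← one_smul (ZMod 3) (red k), ← h4, mul_smul, e', smul_add, smul_add, smul_smul, smul_smul,
    smul_smul, cast_mul, cast_mul, ← mul_assoc, ← mul_assoc, h4, one_mul, one_mul]
  rfl

/-- The conditions on αx + βy + γz are tested against x, y and z, which suffices by
`exists_coeff_g2`. To stay in ℕ, the coefficient -1 is written as 8 modulo 9 and as 26 modulo 27. -/
theorem Frame.mem_quadX_g2 [Fact (Nat.Prime 3)] {u : Fin 3 → ZMod 3} {red : V → Fin 3 → ZMod 3} (F
    : Frame 3 B K a u red) (hK : IntLattice B K) (hz : z ≠ 0) (o1 : B z x = 0) (o2 : B z y = 0) (hA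
    : IsA2Pair B x y) (h : IsRootList B K (listG2 z x y)) {c d : ℕ} (hc : B x x = c) (hd : B z z =
    d) (t : Fin 3 → ZMod 3) : t 0 • red x + t 1 • red y + t 2 • red z ∈ quadX a u ↔ OnG2 (u 0).val
    d c (vals t) := by
  have hxK := (h.root x (by simp [listG2])).mem
  have hyK := (h.root y (by simp [listG2])).mem
  have hzK := (h.root z (by simp [listG2])).mem
  have hB := hK.pd
  have o3 := hA.root_facts
  have o4 : B x z = 0 := by rw [hB.symm, o1]
  have o5 : B y z = 0 := by rw [hB.symm, o2]
  have o6 : B y x = -(B x x / 2) := by rw [hB.symm, o3]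
  have hn := hA.norm
  obtain ⟨α, hα⟩ : ∃ α, (t 0).val = α := ⟨_, rfl⟩
  obtain ⟨β, hβ⟩ : ∃ β, (t 1).val = β := ⟨_, rfl⟩
  obtain ⟨γ, hγ⟩ : ∃ γ, (t 2).val = γ := ⟨_, rfl⟩
  obtain ⟨r, hr⟩ : ∃ r, (u 0).val = r := ⟨_, rfl⟩
  have hnK : (α : ℤ) • x + (β : ℤ) • y + (γ : ℤ) • z ∈ K :=
    K.add_mem (K.add_mem (K.smul_mem _ hxK) (K.smul_mem _ hyK)) (K.smul_mem _ hzK)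
  have hred : red ((α : ℤ) • x + (β : ℤ) • y + (γ : ℤ) • z) =
      t 0 • red x + t 1 • red y + t 2 • red z := by
    rw [F.add _ (K.add_mem (K.smul_mem _ hxK) (K.smul_mem _ hyK)) _ (K.smul_mem _ hzK),
      F.add _ (K.smul_mem _ hxK) _ (K.smul_mem _ hyK), F.red_zsmul _ hxK, F.red_zsmul _ hyK,
      F.red_zsmul _ hzK, ← hα, ← hβ, ← hγ]
    simp
  have hiff := F.adjoinable_iff hK (n := (α : ℤ) • x + (β : ℤ) • y + (γ : ℤ) • z)
  rw [hred, and_iff_right hnK] at hiff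
  rw [← hiff, OnG2, hr]
  simp only [vals, hα, hβ, hγ]
  set n := (α : ℤ) • x + (β : ℤ) • y + (γ : ℤ) • z with hndef
  have hnx : 2 * B n x = ((2 * (c * α) - c * β : ℤ) : ℚ) := by
    simp [hndef, o1, o6, hc]
    ring
  have hny : 2 * B n y = ((2 * (c * β) - c * α : ℤ) : ℚ) := by
    simp [hndef, o2, o3, hn, hc]
    ring
  have hnz : B n z = ((d * γ : ℤ) : ℚ) := by
    simp [hndef, o4, o5, hd]
    ring
  have hnn : B n n = ((c * (α * α) - c * (α * β) + c * (β * β) + d * (γ * γ) : ℤ) : ℚ) := by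
    simp [hndef, o1, o2, o3, o4, o5, o6, hn, hc, hd]
    ring
  -- The factor 2 is harmless modulo 9, and the expansion in x, y, z is available for 2k only.
  have hdv : ∀ k ∈ K, Dv 3 2 (B n k) ↔ Dv 3 2 (2 * B n k) := fun k hk => by
    obtain ⟨j, hj⟩ := hK.int n hnK k hk
    rw [hj, show (2 * j : ℚ) = ((2 * j : ℤ) : ℚ) by push_cast; rfl, dv_intCast_iff three_ne_zero,
      dv_intCast_iff three_ne_zero]
    omega
  have hur : u 0 = ((r : ℤ) : ZMod 3) := by rw [← hr]; simp
  have hnorm : (∃ k : ℤ, B n n = ((3 : ℕ) : ℚ) ^ 2 * k ∧ (k : ZMod 3) = u 0) ↔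
      (c * (α * α) + 26 * (c * (α * β)) + c * (β * β) + d * (γ * γ)) % 27 = (9 * r) % 27 := by
    rw [hnn, hur]
    simp only [ZMod.intCast_eq_intCast_iff_dvd_sub]
    have : (∃ k : ℤ, ((c * (α * α) - c * (α * β) + c * (β * β) + d * (γ * γ) : ℤ) : ℚ) =
        ((3 : ℕ) : ℚ) ^ 2 * k ∧ ((3 : ℕ) : ℤ) ∣ (r : ℤ) - k) ↔
        ∃ k : ℤ, ((c * (α * α) : ℕ) - (c * (α * β) : ℕ) + (c * (β * β) : ℕ) + (d * (γ * γ) : ℕ) : ℤ) =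
        9 * k ∧ (3 : ℤ) ∣ (r : ℤ) - k := by
      refine exists_congr fun k => and_congr ?_ Iff.rfl
      rw [show ((3 : ℕ) : ℚ) ^ 2 * k = ((9 * k : ℤ) : ℚ) by push_cast; norm_num, Int.cast_inj]
      simp
    rw [this]
    constructor
    · omega
    · intro h1
      refine ⟨((c * (α * α) : ℕ) - (c * (α * β) : ℕ) + (c * (β * β) : ℕ) + (d * (γ * γ) : ℕ) : ℤ) / 9,
        ?_, ?_⟩ <;> omega
  have e9 : ∀ j : ℤ, Dv 3 2 j ↔ (9 : ℤ) ∣ j := fun j => by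
    rw [dv_intCast_iff three_ne_zero]
    norm_num
  constructor
  · rintro ⟨-, h2, h3⟩
    have h4 := (hdv x hxK).1 (h2 x hxK)
    have h5 := (hdv y hyK).1 (h2 y hyK)
    have h6 := h2 z hzK
    rw [hnx, e9] at h4
    rw [hny, e9] at h5
    rw [hnz, e9] at h6
    refine ⟨?_, ?_, ?_, hnorm.1 h3⟩ <;> zify <;> omega
  · rintro ⟨h1, h2, h3, h4⟩
    refine ⟨hnK, fun k hk => ?_, hnorm.2 h4⟩
    obtain ⟨α', β', l, e⟩ := exists_coeff_g2 hK hz o1 o2 hA h hk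
    have e' := congrArg (B n) e
    rw [hdv k hk]
    have : 2 * B n k = ((α' * (2 * (c * α) - c * β) + β' * (2 * (c * β) - c * α) + l * (d * γ) : ℤ) : ℚ) := by
      simp only [map_add, map_zsmul, zsmul_eq_mul, hnz] at e'
      grind
    rw [this, e9]
    zify at h1 h2 h3
    exact dvd_add (dvd_add (Dvd.dvd.mul_left (by omega) _) (Dvd.dvd.mul_left (by omega) _))
      (Dvd.dvd.mul_left (by omega) _)

/-- All 27 vectors are written in the basis x, y, z. For each of the seven roots the axis and the
mirror become explicit conditions on the coordinates, and the label at the point follows. -/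
theorem Gluing.g2_weight [Fact (Nat.Prime 3)] {u : Fin 3 → ZMod 3} {red : V → Fin 3 → ZMod 3} (G :
    Gluing 3 B K a u red) (hz : z ≠ 0) (o1 : B z x = 0) (o2 : B z y = 0) (hA : IsA2Pair B x y) (h :
    IsRootList B K (listG2 z x y)) (hf : ∀ v ∈ listG2 z x y, B v v = f v) (e1 : f y = f x) (e2 : f
    (x + y) = f x) (e3 : f (x - y) = 3 * f x) (e4 : f ((2 : ℚ) • x + y) = 3 * f x) (e5 : f (x + (2
    : ℚ) • y) = 3 * f x) {lab : (Fin 3 → ZMod 3) → Label} (hlab : ∀ v ∈ quadX a u, LabelAt 3 B K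
    red v (lab v)) (lam : Label) : weight (g2Cells (u 0).val (f z) (f x)) lam = ∑ v ∈ quadX a u, if
    lab v = lam then lam.1 else 0 := by
  classical
  have hK := G.int
  have hB := hK.pd
  have F := G.frame
  have hm : ∀ v ∈ [z, x, y, x + y, x - y, (2 : ℚ) • x + y, x + (2 : ℚ) • y], IsRoot B K v :=
    fun v hv => h.root v hv
  simp at hm
  obtain ⟨hrz, hrx, hry, hrs, hrd, hrl, hrl'⟩ := hm
  have hbij := F.exists_basis_g2 hK hz o1 o2 hA h
  set ψ : (Fin 3 → ZMod 3) → Fin 3 → ZMod 3 := fun t => t 0 • red x + t 1 • red y + t 2 • red z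
    with hψ
  have o3 := hA.root_facts
  have o4 : B x z = 0 := by rw [hB.symm, o1]
  have o5 : B y z = 0 := by rw [hB.symm, o2]
  have o6 : B y x = -(B x x / 2) := by rw [hB.symm, o3]
  have hn := hA.norm
  have hax : ∀ {r : V} {i j k : ℤ}, r = i • x + j • y + k • z → ∀ t, IsAxis red r (ψ t) ↔
      ∃ s : ZMod 3, t 0 = s * i ∧ t 1 = s * j ∧ t 2 = s * k := by
    intro r i j k hr t
    have hred : red r = ψ ![(i : ZMod 3), j, k] := by
      rw [hr, F.add _ (K.add_mem (K.smul_mem _ hrx.mem) (K.smul_mem _ hry.mem)) _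
        (K.smul_mem _ hrz.mem), F.add _ (K.smul_mem _ hrx.mem) _ (K.smul_mem _ hry.mem),
        F.red_zsmul _ hrx.mem, F.red_zsmul _ hry.mem, F.red_zsmul _ hrz.mem]
      simp [hψ]
    refine exists_congr fun s => ?_
    have : s • red r = ψ (s • ![(i : ZMod 3), j, k]) := by
      rw [hred]
      simp [hψ, smul_smul]
    rw [this, hbij.injective.eq_iff, funext_iff, Fin.forall_fin_succ, Fin.forall_fin_succ]
    simp
  have hmi : ∀ {r : V} {i j k : ℤ}, IsRoot B K r → 2 * B r x = i * B r r → 2 * B r y = j * B r r →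
      2 * B r z = k * B r r → ∀ t, IsMirror 3 B K red r (ψ t) ↔
        t 0 * i + t 1 * j + t 2 * k = 0 := by
    intro r i j k hr hi hj hk t
    rw [IsMirror, map_add, map_add, map_smul, map_smul, map_smul, F.rootFun_red hB hr hrx.mem hi,
      F.rootFun_red hB hr hry.mem hj, F.rootFun_red hB hr hrz.mem hk]
    rfl
  have key : ∀ {r : V} {i j k i' j' k' : ℤ} (e m : ℕ → ℕ → ℕ → ℕ), G2Row i j k i' j' k' e m →
      IsRoot B K r → r = i • x + j • y + k • z → 2 * B r x = i' * B r r → 2 * B r y = j' * B r r →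
      2 * B r z = k' * B r r → ∀ t : Fin 3 → ZMod 3,
      (IsAxis red r (ψ t) ↔ e (t 0).val (t 1).val (t 2).val = 0) ∧
      (IsMirror 3 B K red r (ψ t) ↔ m (t 0).val (t 1).val (t 2).val = 0) :=
    fun _ _ hR hr h1 h2 h3 h4 t => ⟨(hax h1 _).trans (hR _ _ _).1,
      (hmi hr h2 h3 h4 _).trans (hR _ _ _).2⟩
  have hs2 : ∀ v : V, (2 : ℤ) • v = (2 : ℚ) • v := fun v => by
    rw [← cast_smul_eq_zsmul ℚ]
    rfl
  -- Each root is given by its coordinates and by its values 2B(r, ·)/Q(r) on x, y, z. The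
  -- equivalence with the arithmetic conditions in `g2Norms` is a check over the 27 triples.
  have tz := key (fun α β _ => α + β) (fun _ _ γ => γ) (by decide : G2Row 0 0 1 0 0 2 _ _) hrz (by simp)
    (by simp [o1]) (by simp [o2]) (by simp)
  have tx := key (fun _ β γ => β + γ) (fun α β _ => (α + β) % 3) (by decide : G2Row 1 0 0 2 (-1) 0 _ _)
    hrx (by simp) (by simp) (by simp [o3]; ring) (by simp [o4])
  have ty := key (fun α _ γ => α + γ) (fun α β _ => (α + β) % 3) (by decide : G2Row 0 1 0 (-1) 2 0 _ _)
    hry (by simp) (by simp [o6, hn]; ring) (by simp) (by simp [o5])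
  have ts := key (fun α β γ => (α + 2 * β) % 3 + γ) (fun α β _ => (α + β) % 3)
    (by decide : G2Row 1 1 0 1 1 0 _ _) hrs (by simp)
    (by simp [o3, o6, hn]; ring) (by simp [o3, o6, hn]; ring) (by simp [o4, o5])
  have td := key (fun α β γ => (α + β) % 3 + γ) (fun α β _ => (α + 2 * β) % 3)
    (by decide : G2Row 1 (-1) 0 1 (-1) 0 _ _) hrd
    (by simp [sub_eq_add_neg]) (by simp [o3, o6, hn]; ring) (by simp [o3, o6, hn]; ring)
    (by simp [o4, o5])
  have tl := key (fun α β γ => (α + β) % 3 + γ) (fun α _ _ => α)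
    (by decide : G2Row 2 1 0 1 0 0 _ _) hrl
    (by simp [hs2]) (by simp [o3, o6, hn]; ring) (by simp [o3, hn]; ring)
    (by simp [o4, o5])
  have tl' := key (fun α β γ => (α + β) % 3 + γ) (fun _ β _ => β)
    (by decide : G2Row 1 2 0 0 1 0 _ _) hrl'
    (by simp [hs2]) (by simp [o6]; ring) (by simp [o3, o6]; ring)
    (by simp [o4, o5])
  have hlist : ∀ t, ((listG2 z x y).flatMap fun r => if IsAxis red r (ψ t) then [f r / 3 ^ 2]
      else if IsMirror 3 B K red r (ψ t) then [f r] else []) = g2Norms (f z) (f x) (vals t) := by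
    intro t
    simp only [listG2, flatMap_cons, List.flatMap_nil, List.append_nil, g2Norms, e1, e2, e3, e4,
      e5, tz, tx, ty, ts, td, tl, tl']
    rfl
  have hlabt : ∀ t, ψ t ∈ quadX a u → lab (ψ t) = (g2Order (g2Norms (f z) (f x) (vals t)) (vals t).2.2,
      sortList (g2Norms (f z) (f x) (vals t))) := by
    intro t ht
    refine G.labelAt_unique ht (hlab _ ht) ?_
    have := G.labelAt_of_card h hf ht (g := g2Order (g2Norms (f z) (f x) (vals t)) (vals t).2.2)
      fun M hM hl hlen => ?_
    · rwa [hlist] at this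
    rw [hlist] at hlen
    rw [g2Order]
    split_ifs with hc
    · have hd := g2_length _ _ _ _ _ hc.1 hc.2
      have hγ : (t 2).val ≠ 0 := hc.2
      refine card_orthGroup_a2 hM hA ?_
      convert hl using 1
      rcases hd with ⟨hα, hβ⟩ | ⟨hα, hβ⟩ <;>
        simp [listG2, convRoot, tz, tx, ty, ts, td, tl, tl', hα, hβ, hγ]
    · rw [← hlen] at hc ⊢
      refine card_orthGroup_of_list hM hl fun h3 => ?_
      -- Three surviving roots that are not to give order 12 require γ = 0. Then z survives, and it
      -- is orthogonal to the other survivors.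
      have hγ : (t 2).val = 0 := by
        by_contra h
        exact hc ⟨h3, h⟩
      rw [listG2, List.filter_cons_of_pos (by simp [tz, hγ]), map_cons, List.length_cons,
        Nat.add_right_cancel_iff] at h3
      rw [listG2, List.filter_cons_of_pos (by simp [tz, hγ]), map_cons]
      obtain ⟨w, hw⟩ := List.exists_mem_of_length_pos (by rw [h3]; exact two_pos)
      refine ⟨_, mem_cons_self, w, mem_cons_of_mem _ hw, ?_⟩
      obtain ⟨r, hr, rfl⟩ := mem_map.1 hw
      have hr := (mem_filter.1 hr).1
      obtain ⟨s, -, hs⟩ := convRoot_smul (p := 3) (red := red) (ψ t) r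
      obtain ⟨s', -, hs'⟩ := convRoot_smul (p := 3) (red := red) (ψ t) z
      rw [hs, hs']
      simp at hr
      rcases hr with rfl | rfl | rfl | rfl | rfl | rfl <;> simp [o1, o2]
  have hX := F.mem_quadX_g2 hK hz o1 o2 hA h (hf x (by simp [listG2])) (hf z (by simp [listG2]))
  rw [g2Cells, weight_flatMap, sum_triples (p := 3), ← Finset.univ_inter (quadX a u),
    ← Finset.sum_ite_mem, ← hbij.sum_comp fun v => if v ∈ quadX a u then _ else _]
  refine sum_congr rfl fun t _ => ?_
  by_cases ht : ψ t ∈ quadX a u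
  · rw [if_pos ht, if_pos ((hX t).1 ht), hlabt t ht, weight]
    simp
    split_ifs with hl
    · rw [← hl]
    · rfl
  · rw [if_neg ht, if_neg fun h => ht ((hX t).2 h)]
    rfl

/-! ### Scaled lattices and partial duals -/

section Scaling

variable {f g : Fin 3 → ℤ}

theorem pow_smul_mem (n : ℕ) (hy : y ∈ K) : (p : ℚ) ^ n • y ∈ K := by
  have := K.smul_mem ((p : ℤ) ^ n) hy
  rw [← cast_smul_eq_zsmul ℚ] at this
  simpa using this

theorem coord_smul (c : V →ₗ[ℚ] (Fin 3 → ℚ_[p])) (k : ℤ) (y : V) (i : Fin 3) :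
    c ((p : ℚ) ^ k • y) i = (p : ℚ_[p]) ^ k * c y i := by
  rw [map_smul, Pi.smul_apply, smul_def]
  simp

theorem padic_ne_zero : (p : ℚ_[p]) ≠ 0 := by exact_mod_cast prime_ne_zero' p

theorem Coord.sat_pow (h : Coord p B K D c) {n : ℕ} (hy : (p : ℚ) ^ n • y ∈ K) (hi : ∀ i, ∃ z :
    ℤ_[p], c y i = z) : y ∈ K := by
  induction n with
  | zero => simpa using hy
  | succ n ih =>
    refine ih (h.sat _ ?_ fun i => ?_)
    · rw [← cast_smul_eq_zsmul ℚ, smul_smul, cast_natCast, ← pow_succ']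
      exact hy
    · obtain ⟨z, hz⟩ := hi i
      refine ⟨p ^ n * z, ?_⟩
      rw [← zpow_natCast, coord_smul, hz]
      push_cast
      rw [zpow_natCast]

theorem Coord.dense_pow (h : Coord p B K D c) (n : ℕ) (u : Fin 3 → ℤ_[p]) :
    ∃ x ∈ K, ∀ i, ∃ z : ℤ_[p], c x i = u i + p ^ n * z := by
  induction n with
  | zero =>
    refine ⟨0, K.zero_mem, fun i => ⟨-u i, ?_⟩⟩
    simp
  | succ n ih =>
    obtain ⟨x, hx, hxi⟩ := ih
    choose z hz using hxi
    obtain ⟨y, hy, hyi⟩ := h.dense fun i => -z i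
    choose w hw using hyi
    refine ⟨x + (p : ℚ) ^ (n : ℤ) • y, K.add_mem hx (by rw [zpow_natCast]; exact pow_smul_mem n hy),
      fun i => ⟨w i, ?_⟩⟩
    rw [map_add, Pi.add_apply, coord_smul, hz, hw]
    push_cast
    rw [zpow_natCast]
    ring

/-- `K'` consists of the vectors whose coordinates at `p` are divisible by `p ^ f i`, and that are
in `K` away from `p`. -/
def Scaled (p : ℕ) [Fact p.Prime] (K : Submodule ℤ V) (c : V →ₗ[ℚ] (Fin 3 → ℚ_[p])) (f : Fin 3 → ℤ)
    (K' : Submodule ℤ V) : Prop :=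
  ∀ y, y ∈ K' ↔ (∃ n : ℕ, (p : ℚ) ^ n • y ∈ K) ∧ ∀ i, ∃ z : ℤ_[p], c y i = (p : ℚ_[p]) ^ f i * z

/-- A lattice is determined by its coordinates at p and by K away from p. Identities between
iterated duals are proved by comparing exponents. -/
theorem Scaled.unique (h : Scaled p K c f K') (h' : Scaled p K c f K'') : K' = K'' := by
  ext y
  rw [h, h']

theorem Coord.scaled_self (h : Coord p B K D c) : Scaled p K c 0 K := fun y => by
  refine ⟨fun hy => ⟨⟨0, by simpa using hy⟩, fun i => ?_⟩, fun ⟨⟨n, hn⟩,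
    hi⟩ => h.sat_pow hn fun i => ?_⟩
  · simpa using h.int y hy i
  · simpa using hi i

/-- The coordinates divided by `p ^ f i`. -/
noncomputable def divCoord (p : ℕ) [Fact p.Prime] (f : Fin 3 → ℤ) (c : V →ₗ[ℚ] (Fin 3 → ℚ_[p])) :
    V →ₗ[ℚ] (Fin 3 → ℚ_[p]) where
  toFun y i := (p : ℚ_[p]) ^ (-f i) * c y i
  map_add' x y := by
    funext i
    simp [mul_add]
  map_smul' q x := by
    funext i
    simp

theorem divCoord_eq_iff {i : Fin 3} {z : ℚ_[p]} : divCoord p f c y i = (p : ℚ_[p]) ^ k * z ↔ c y i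
    = (p : ℚ_[p]) ^ (f i + k) * z := by
  have hp := zpow_ne_zero (f i) (padic_ne_zero (p := p))
  rw [divCoord, LinearMap.coe_mk, AddHom.coe_mk, zpow_neg, inv_mul_eq_iff_eq_mul₀ hp,
    zpow_add₀ padic_ne_zero, mul_assoc]

theorem divCoord_eq_iff' {i : Fin 3} {z : ℚ_[p]} : divCoord p f c y i = z ↔ c y i = (p : ℚ_[p]) ^ f
    i * z := by
  simpa using divCoord_eq_iff (k := 0) (f := f) (c := c) (y := y) (i := i) (z := z)

theorem exists_pow_natAbs (f : ℤ) {n : ℕ} (hn : f.natAbs ≤ n) (z : ℤ_[p]) :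
    ∃ w : ℤ_[p], (p : ℚ_[p]) ^ n * z = (p : ℚ_[p]) ^ f * w := by
  obtain ⟨m, hm⟩ := Int.eq_ofNat_of_zero_le (show (0 : ℤ) ≤ n - f by omega)
  refine ⟨p ^ m * z, ?_⟩
  push_cast
  rw [← mul_assoc, ← zpow_natCast, ← zpow_natCast, ← hm, ← zpow_add₀ padic_ne_zero]
  congr 2
  ring

theorem Scaled.exists_pow (h : Scaled p K c f K') (hc : Coord p B K D c) :
    ∃ n : ℕ, (∀ x ∈ K, (p : ℚ) ^ n • x ∈ K') ∧ ∀ y ∈ K', (p : ℚ) ^ n • y ∈ K := by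
  refine ⟨∑ i, (f i).natAbs, fun x hx => (h _).2 ⟨⟨0, ?_⟩, fun i => ?_⟩, fun y hy => ?_⟩
  · rw [pow_zero, one_smul]
    exact pow_smul_mem _ hx
  · obtain ⟨z, hz⟩ := hc.int x hx i
    rw [← zpow_natCast, coord_smul, hz, zpow_natCast]
    exact exists_pow_natAbs _ (Finset.single_le_sum (fun i _ => Nat.zero_le (f i).natAbs) (mem_univ i)) z
  · obtain ⟨⟨n, hn⟩, hi⟩ := (h y).1 hy
    refine hc.sat_pow (n := n) ?_ fun i => ?_
    · rw [smul_comm]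
      exact pow_smul_mem _ hn
    · obtain ⟨z, hz⟩ := hi i
      obtain ⟨w, hw⟩ := exists_pow_natAbs (-f i) (n := ∑ i, (f i).natAbs) (by
        rw [Int.natAbs_neg]
        exact Finset.single_le_sum (fun i _ => Nat.zero_le (f i).natAbs) (mem_univ i)) z
      refine ⟨w, ?_⟩
      rw [← zpow_natCast, coord_smul, hz, mul_left_comm, zpow_natCast, hw, ← mul_assoc,
        ← zpow_add₀ padic_ne_zero, add_neg_cancel, zpow_zero, one_mul]

theorem Scaled.trans (h : Scaled p K c f K') (hc : Coord p B K D c)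
    (h' : Scaled p K' (divCoord p f c) g K'') : Scaled p K c (f + g) K'' := by
  obtain ⟨n, h1, h2⟩ := h.exists_pow hc
  intro y
  rw [h']
  simp only [divCoord_eq_iff, Pi.add_apply]
  refine and_congr_left fun _ => ⟨fun ⟨m, hm⟩ => ⟨n + m, ?_⟩, fun ⟨m, hm⟩ => ⟨n + m, ?_⟩⟩
  · rw [pow_add, mul_smul]
    exact h2 _ hm
  · rw [pow_add, mul_smul]
    exact h1 _ hm

/-- The statement allows the form to be scaled by s at the same time, as dual lattices are to be
integral with prescribed exponents. -/
theorem Scaled.coord (h : Scaled p K c f K') (hc : Coord p B K D c) (hD : ∀ i, (D' i : ℚ_[p]) = s *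
    ((p : ℚ_[p]) ^ (2 * f i) * D i)) : Coord p (s • B) K' D' (divCoord p f c) := by
  refine ⟨fun x y => ?_, fun y hy i => ?_, fun u => ?_, fun y hy hi => ?_⟩
  · rw [LinearMap.smul_apply, LinearMap.smul_apply, smul_eq_mul, Rat.cast_mul, hc.gram x y, mul_sum]
    refine sum_congr rfl fun i _ => ?_
    have hp := zpow_ne_zero (f i) (padic_ne_zero (p := p))
    have e : ∀ v, divCoord p f c v i = (p : ℚ_[p]) ^ (-f i) * c v i := fun _ => rfl
    rw [hD, e, e, zpow_neg, two_mul, zpow_add₀ padic_ne_zero]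
    field_simp
  · obtain ⟨z, hz⟩ := ((h y).1 hy).2 i
    exact ⟨z, divCoord_eq_iff'.2 hz⟩
  · set F := ∑ i, (f i).natAbs with hF
    have hFi : ∀ i, (f i).natAbs ≤ F := fun i =>
      Finset.single_le_sum (fun i _ => Nat.zero_le (f i).natAbs) (mem_univ i)
    have h1 : ∀ i, ∃ w : ℤ_[p], (p : ℚ_[p]) ^ ((F : ℤ) + f i) * u i = w := fun i => by
      obtain ⟨w, hw⟩ := exists_pow_natAbs (-f i) (n := F) (by rw [Int.natAbs_neg]; exact hFi i) (u i)
      refine ⟨w, ?_⟩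
      rw [add_comm, zpow_add₀ padic_ne_zero, mul_assoc, zpow_natCast, hw, ← mul_assoc,
        ← zpow_add₀ padic_ne_zero, add_neg_cancel, zpow_zero, one_mul]
    choose w hw using h1
    obtain ⟨x, hx, hxi⟩ := hc.dense_pow (2 * F + 1) w
    choose z hz using hxi
    have h2 : ∀ i, c ((p : ℚ) ^ (-(F : ℤ)) • x) i = (p : ℚ_[p]) ^ f i *
        (u i + (p : ℚ_[p]) * ((p : ℚ_[p]) ^ (F - f i) * z i)) := fun i => by
      rw [coord_smul, hz, ← hw i, mul_add, ← mul_assoc, ← zpow_add₀ padic_ne_zero,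
        neg_add_cancel_left,
        mul_add]
      congr 1
      rw [← zpow_natCast, ← mul_assoc, ← mul_assoc, ← mul_assoc, ← zpow_add₀ padic_ne_zero,
        ← zpow_add_one₀ padic_ne_zero, ← zpow_add₀ padic_ne_zero]
      congr 2
      push_cast
      ring
    have h3 : ∀ i, ∃ v : ℤ_[p], (p : ℚ_[p]) ^ (F - f i) * z i = v := fun i => by
      obtain ⟨m, hm⟩ := Int.eq_ofNat_of_zero_le (show (0 : ℤ) ≤ F - f i by have := hFi i; omega)
      exact ⟨p ^ m * z i, by rw [hm, zpow_natCast]; push_cast; rfl⟩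
    choose v hv using h3
    refine ⟨(p : ℚ) ^ (-(F : ℤ)) • x, (h _).2 ⟨⟨F, ?_⟩, fun i => ⟨u i + p * v i, ?_⟩⟩,
      fun i => ⟨v i, ?_⟩⟩
    · rw [smul_smul, zpow_neg, zpow_natCast, mul_inv_cancel₀ (pow_ne_zero _ (by
        exact_mod_cast prime_ne_zero' p)), one_smul]
      exact hx
    · rw [h2, hv]
      push_cast
      rfl
    · rw [divCoord_eq_iff', h2, hv]
  · rw [h] at hy ⊢
    obtain ⟨⟨n, hn⟩, -⟩ := hy
    refine ⟨⟨n + 1, ?_⟩, fun i => ?_⟩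
    · rw [← cast_smul_eq_zsmul ℚ, smul_smul, cast_natCast, ← pow_succ] at hn
      exact hn
    · obtain ⟨z, hz⟩ := hi i
      exact ⟨z, divCoord_eq_iff'.1 hz⟩

theorem Scaled.isLattice (h : Scaled p K c f K') (hc : Coord p B K D c)
    (hK : IsLattice ℚ K) : IsLattice ℚ K' := by
  obtain ⟨n, h1, h2⟩ := h.exists_pow hc
  have hp0 : (p : ℚ) ^ n ≠ 0 := pow_ne_zero _ (by exact_mod_cast prime_ne_zero' p)
  refine ⟨?_, ?_⟩
  · have hn : IsNoetherian ℤ K := isNoetherian_of_isNoetherianRing_of_finite ℤ K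
    let φ : V →ₗ[ℤ] V := ((p : ℚ) ^ n • LinearMap.id : V →ₗ[ℚ] V).restrictScalars ℤ
    have hinj : Injective φ := fun x y hxy => smul_right_injective V hp0 hxy
    refine Submodule.fg_of_fg_map_injective φ hinj (isNoetherian_submodule.1 hn _ ?_)
    rintro _ ⟨y, hy, rfl⟩
    exact h2 y hy
  · rw [eq_top_iff, ← hK.span_eq_top]
    refine span_le.2 fun x hx => ?_
    exact (Submodule.smul_mem_iff _ hp0).1 (subset_span (R := ℚ) (h1 x hx))

end Scaling

/-- The change of a label under duality: the norms divisible by `P` are divided by `d`, the other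
norms are multiplied by `d`. -/
def dualLabel (P d : ℕ) (ℓ : Label) : Label :=
  (ℓ.1, sortList (ℓ.2.map fun c => if c % P = 0 then c / d else c * d))

/-- The lattice of the vectors `p ^ e x`, for `x` in `K` with `B(x, K)` in `p ^ b ℤ`. -/
def dualLat (p b : ℕ) (e : ℤ) (B : BilinForm ℚ V) (K : Submodule ℤ V) : Submodule ℤ V where
  carrier := {y | (p : ℚ) ^ (-e) • y ∈ K ∧ ∀ z ∈ K, Dv p b (B ((p : ℚ) ^ (-e) • y) z)}
  zero_mem' := by
    refine ⟨by rw [smul_zero]; exact K.zero_mem, fun z _ => ⟨0, by simp⟩⟩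
  add_mem' := by
    rintro x y ⟨hx, hx'⟩ ⟨hy, hy'⟩
    refine ⟨by rw [smul_add]; exact K.add_mem hx hy, fun z hz => ?_⟩
    rw [smul_add, map_add]
    exact (hx' z hz).add (hy' z hz)
  smul_mem' := by
    rintro n x ⟨hx, hx'⟩
    refine ⟨by rw [smul_comm]; exact K.smul_mem n hx, fun z hz => ?_⟩
    rw [smul_comm, map_zsmul, LinearMap.smul_apply, zsmul_eq_mul]
    exact (hx' z hz).int_mul n

theorem mem_dualLat : y ∈ dualLat p b e B K ↔ (p : ℚ) ^ (-e) • y ∈ K ∧ ∀ z ∈ K, Dv p b (B ((p : ℚ)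
    ^ (-e) • y) z) := Iff.rfl

theorem rat_ne_zero : (p : ℚ) ≠ 0 := by exact_mod_cast prime_ne_zero' p

theorem smul_mem_dualLat : (p : ℚ) ^ e • x ∈ dualLat p b e B K ↔ x ∈ K ∧ ∀ z ∈ K, Dv p b (B x z) := by
  rw [mem_dualLat, smul_smul, ← zpow_add₀ rat_ne_zero, neg_add_cancel, zpow_zero, one_smul]

theorem exists_of_mem_dualLat (hy : y ∈ dualLat p b e B K) : ∃ x ∈ K, (∀ z ∈ K, Dv p b (B x z)) ∧ y
    = (p : ℚ) ^ e • x :=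
  ⟨_, hy.1, hy.2, by rw [smul_smul, ← zpow_add₀ rat_ne_zero, add_neg_cancel, zpow_zero, one_smul]⟩

theorem watson_eq_dualLat (hp : p ≠ 2) (hK : IntLattice B K) : watson B p K = dualLat p 1 0 B K := by
  ext y
  rw [mem_watson_iff hp hK, mem_dualLat, neg_zero, zpow_zero, one_smul]

theorem dualLat_map (hσ : σ ∈ isometries B) (h : ∀ x, x ∈ K ↔ σ x ∈ K') (y : V) : y ∈ dualLat p b e
    B K ↔ σ y ∈ dualLat p b e B K' := by
  rw [mem_dualLat, mem_dualLat, ← map_smul, ← h]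
  refine and_congr_right fun _ => ⟨fun h' z hz => ?_, fun h' z hz => ?_⟩
  · obtain ⟨w, rfl⟩ := σ.surjective z
    rw [hσ]
    simp_all
  · rw [← hσ]
    simp_all

theorem isometries_smul (hs : s ≠ 0) : isometries (s • B) = isometries B := by
  ext σ
  simp [isometries, hs]

theorem IsPosDefSpace.smul (hB : IsPosDefSpace B) (hs : 0 < s) : IsPosDefSpace (s • B) :=
  ⟨fun x y => by simp [hB.symm x y], fun x hx => by simpa using mul_pos hs (hB.pos x hx)⟩

theorem tau_smul_form (hs : s ≠ 0) (hB : IsPosDefSpace B) (hx : x ≠ 0) : tau (s • B) x = tau B x := by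
  have h := hB.ne_zero hx
  ext y
  rw [tau_apply h, tau_apply (by simpa using ⟨hs, h⟩)]
  simp only [LinearMap.smul_apply, smul_eq_mul]
  grind

/-- B(x, K) ⊆ p^b ℤ means that the coordinate of exponent a is divisible by p^(b - a), with
truncated subtraction; the factor p^e shifts all exponents. -/
theorem Coord.scaled_dual (h : Coord p B K (diagForm p a ε) c) (hK : IntLattice B K) :
    Scaled p K c (fun i => ((b - a i : ℕ) : ℤ) + e) (dualLat p b e B K) := by
  intro y
  constructor
  · intro hy
    obtain ⟨x, hx, hd, rfl⟩ := exists_of_mem_dualLat hy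
    obtain ⟨z, hz⟩ := h.exists_int hx
    have h1 := (h.dvd_iff hK hx hz b).1 hd
    refine ⟨⟨e.natAbs, ?_⟩, fun i => ?_⟩
    · obtain ⟨n, hn⟩ := Int.eq_ofNat_of_zero_le (show 0 ≤ (e.natAbs : ℤ) + e by omega)
      rw [smul_smul, ← zpow_natCast, ← zpow_add₀ rat_ne_zero, hn, zpow_natCast]
      exact pow_smul_mem n hx
    · obtain ⟨w, hw⟩ := pow_dvd_diag.1 (h1 i)
      refine ⟨w, ?_⟩
      dsimp only
      rw [coord_smul, hz, hw, add_comm, zpow_add₀ padic_ne_zero, zpow_natCast]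
      push_cast
      ring
  · rintro ⟨⟨n, hn⟩, hi⟩
    choose w hw using hi
    have hz : ∀ i, c ((p : ℚ) ^ (-e) • y) i = ((p ^ (b - a i) * w i : ℤ_[p]) : ℚ_[p]) := fun i => by
      rw [coord_smul, hw, ← mul_assoc, ← zpow_add₀ padic_ne_zero, neg_add_cancel_comm_assoc,
        zpow_natCast]
      simp
    have hx : (p : ℚ) ^ (-e) • y ∈ K := by
      obtain ⟨k, hk⟩ := Int.eq_ofNat_of_zero_le (show 0 ≤ (e.natAbs : ℤ) - e by omega)
      refine h.sat_pow (n := e.natAbs + n) ?_ fun i => ⟨_, hz i⟩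
      rw [pow_add, mul_smul, smul_comm ((p : ℚ) ^ n), smul_smul, ← zpow_natCast,
        ← zpow_add₀ rat_ne_zero, ← sub_eq_add_neg, hk, zpow_natCast]
      exact pow_smul_mem k hn
    exact ⟨hx, (h.dvd_iff hK hx hz b).2 fun i => pow_dvd_diag.2 (Dvd.intro _ rfl)⟩

/-- For exponents at most b the exponent a becomes a + 2(b - a + e) + (m - b - 2e) = m + b - a. So
the dual reverses the interval from m to b, and e only changes the embedding in V. -/
theorem Coord.dual_coord (h : Coord p B K (diagForm p a ε) c) (hK : IntLattice B K)
    (ha : ∀ i, a i ≤ b) (hm : ∀ i, a i ≤ m + b) :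
    Coord p ((p : ℚ) ^ ((m : ℤ) - b - 2 * e) • B) (dualLat p b e B K)
      (diagForm p (fun i => m + b - a i) ε) (divCoord p (fun i => ((b - a i : ℕ) : ℤ) + e) c) := by
  refine (h.scaled_dual hK).coord h fun i => ?_
  rw [diagForm, diagForm]
  push_cast
  rw [← zpow_natCast, ← zpow_natCast, ← mul_assoc, ← mul_assoc, ← zpow_add₀ padic_ne_zero,
    ← zpow_add₀ padic_ne_zero]
  grind

theorem Coord.dual_int (h : Coord p B K (diagForm p a ε) c) (hK : IntLattice B K) :
    IntLattice ((p : ℚ) ^ ((m : ℤ) - b - 2 * e) • B) (dualLat p b e B K) := by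
  refine ⟨hK.pd.smul (zpow_pos (by exact_mod_cast (Fact.out : p.Prime).pos) _), hK.rank,
    (h.scaled_dual hK).isLattice h hK.lat, fun x hx y hy => ?_⟩
  obtain ⟨x, -, hd, rfl⟩ := exists_of_mem_dualLat hx
  obtain ⟨y, hy', -, rfl⟩ := exists_of_mem_dualLat hy
  obtain ⟨k, hk⟩ := hd y hy'
  refine ⟨p ^ m * k, ?_⟩
  have h1 : (p : ℚ) ^ ((m : ℤ) - b - 2 * e) * ((p : ℚ) ^ e * ((p : ℚ) ^ e * (p : ℚ) ^ b)) = p ^ m := by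
    rw [← zpow_natCast, ← zpow_natCast, ← zpow_add₀ rat_ne_zero, ← zpow_add₀ rat_ne_zero,
      ← zpow_add₀ rat_ne_zero]
    grind
  simp only [LinearMap.smul_apply, map_smul, smul_eq_mul, hk]
  push_cast
  grind

/-- Reversing the exponents twice is the identity, and the second shift m - b - e is chosen to
cancel the first. -/
theorem Coord.dual_dual (h : Coord p B K (diagForm p a ε) c) (hK : IntLattice B K)
    (ha : ∀ i, a i ≤ b) (hm : ∀ i, m ≤ a i) :
    dualLat p b (m - b - e) ((p : ℚ) ^ ((m : ℤ) - b - 2 * e) • B) (dualLat p b e B K) = K := by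
  have h1 := h.dual_coord (m := m) (e := e) hK ha fun i => (ha i).trans (Nat.le_add_left _ _)
  have h2 := (h.scaled_dual (e := e) hK).trans h (h1.scaled_dual (b := b) (e := m - b - e) (h.dual_int hK))
  refine h2.unique ?_
  convert h.scaled_self using 1
  funext i
  have := ha i
  have := hm i
  simp
  omega

/-- If p^j divides Q(x), it divides B(x, K), since x is a root and p is odd. On the coordinates of
exponent m this gives z_i divisible by p^(j-m), so their part of Q(x) gains a factor p if j > m; the
others contribute multiples of p^b. Hence there is no power strictly between p^m and p^b. -/
theorem Coord.dv_of_root (h : Coord p B K (diagForm p a ε) c) (hp : p ≠ 2) (hK : IntLattice B K)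
    (ha : ∀ i, a i = m ∨ a i = b) (hx : IsRoot B K x) (hk : B x x = k) (hd : (p : ℤ) ^ (m + 1) ∣ k)
    : (p : ℤ) ^ b ∣ k := by
  by_cases hmb : b ≤ m + 1
  · exact (pow_dvd_pow _ hmb).trans hd
  suffices key : ∀ j, m + 1 ≤ j → j ≤ b → (p : ℤ) ^ j ∣ k from key b (by omega) le_rfl
  obtain ⟨z, hz⟩ := h.exists_int hx.mem
  intro j hj
  induction j, hj using Nat.le_induction with
  | base => exact fun _ => hd
  | succ j hj ih =>
    intro hjb
    have h1 := ih (by omega)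
    rw [← dv_intCast_iff (prime_ne_zero' p), ← hk] at h1
    have h2 := (h.dvd_iff hK hx.mem hz j).1 (hx.dv_of_norm hp hK h1)
    rw [← pow_p_dvd_int_iff, h.gram_int hz hz hk]
    refine dvd_sum fun i _ => ?_
    rcases ha i with hi | hi
    · obtain ⟨w, hw⟩ := h2 i
      obtain ⟨v, hv⟩ := pow_dvd_diag.1 (h2 i)
      rw [hw, hv, mul_mul_mul_comm, ← pow_add]
      exact (pow_dvd_pow _ (by omega)).mul_right _
    · rw [diagForm, hi, mul_assoc, mul_assoc]
      exact (pow_dvd_pow _ hjb).mul_right _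

/-- By `Coord.dv_of_root` such a norm is p^m times a number prime to p. -/
theorem Coord.dvd_of_root (h : Coord p B K (diagForm p a ε) c) (hp : p ≠ 2) (hK : IntLattice B K)
    (ha : ∀ i, a i = m ∨ a i = b) (hmb : m ≤ b) (hx : IsRoot B K x) (hk : B x x = k) (hd : ¬ (p :
    ℤ) ^ b ∣ k) {n : ℤ} (hn : (p : ℤ) ^ b ∣ n * k) : (p : ℤ) ^ (b - m) ∣ n := by
  obtain ⟨z, hz⟩ := h.exists_int hx.mem
  have h1 : (p : ℤ) ^ m ∣ k := by
    rw [← pow_p_dvd_int_iff, h.gram_int hz hz hk]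
    refine dvd_sum fun i _ => ?_
    rw [diagForm, mul_assoc, mul_assoc]
    exact (pow_dvd_pow _ (by rcases ha i with hi | hi <;> omega)).mul_right _
  have hp0 : (p : ℤ) ^ m ≠ 0 := pow_ne_zero _ (by exact_mod_cast prime_ne_zero' p)
  obtain ⟨l, rfl⟩ := h1
  have h2 : ¬ (p : ℤ) ∣ l := fun ⟨q, hq⟩ => hd (h.dv_of_root hp hK ha hx hk ⟨q, by rw [hq]; ring⟩)
  refine (Nat.prime_iff_prime_int.1 Fact.out).pow_dvd_of_dvd_mul_right _ h2 ?_
  obtain ⟨q, hq⟩ := hn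
  refine ⟨q, mul_left_cancel₀ hp0 ?_⟩
  have h3 : (p : ℤ) ^ m * p ^ (b - m) = p ^ b := by rw [← pow_add, Nat.add_sub_cancel' hmb]
  grind

/-- Duality commutes with isometries, so the group is the same and the symmetries have the same
lines. Only the primitive vector on each line has to be found anew. -/
theorem Coord.hasLabel_dual (h : Coord p B K (diagForm p a ε) c) (hp : p ≠ 2) (hK : IntLattice B K)
    (ha : ∀ i, a i = m ∨ a i = b) (hmb : m ≤ b) (hl : HasLabel B K ℓ) : HasLabel ((p : ℚ) ^ ((m :
    ℤ) - b - 2 * e) • B) (dualLat p b e B K) (dualLabel (p ^ b) (p ^ (b - m)) ℓ) := by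
  classical
  have hB := hK.pd
  have hpr : Nat.Prime p := Fact.out
  have hK' := h.dual_int (m := m) (b := b) (e := e) hK
  have hdd := h.dual_dual (m := m) (b := b) (e := e) hK (fun i => by rcases ha i with hi | hi <;> omega)
    fun i => by rcases ha i with hi | hi <;> omega
  set s : ℚ := (p : ℚ) ^ ((m : ℤ) - b - 2 * e) with hs
  have hs0 : s ≠ 0 := zpow_ne_zero _ rat_ne_zero
  set K' := dualLat p b e B K
  have horth : orthGroup (s • B) K' = orthGroup B K := by
    ext g
    rw [mem_orthGroup, mem_orthGroup]
    have h0 : (∀ x y, (s • B) (g x) (g y) = (s • B) x y) ↔ ∀ x y, B (g x) (g y) = B x y := by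
      simp_all
    rw [h0]
    refine and_congr_right fun hg => ⟨fun h1 x => ?_,
      fun h1 y => (dualLat_map hg (fun x => (h1 x).symm) y).symm⟩
    rw [← hdd]
    exact (dualLat_map (by rwa [isometries_smul hs0]) (fun y => (h1 y).symm) x).symm
  obtain ⟨f, hf⟩ := hK.exists_normFun
  obtain ⟨xs, hx⟩ := hK.rootType.exists_list
  rw [hx.hasLabel_iff_eq hK (ns := xs.map f)
    (by rw [map_map]; exact map_congr_left fun x hxx => hf x (hx.root x hxx).mem)] at hl
  -- The vector x is in the dual up to the factor p^e if p^b divides Q(x); otherwise it needs the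
  -- additional factor p^(b - m). With the scaling of the form, the norm is divided by p^(b - m) in
  -- the first case and multiplied by it in the second.
  let j : V → ℕ := fun x => if f x % p ^ b = 0 then 0 else b - m
  have hcast : ∀ k x, f x % p ^ k = 0 ↔ (p : ℤ) ^ k ∣ (f x : ℤ) := fun k x => by
    rw [← Nat.dvd_iff_mod_eq_zero]
    exact_mod_cast Iff.rfl
  have hroot : ∀ x ∈ xs, IsRoot (s • B) K' ((p : ℚ) ^ (e + j x) • x) := by
    intro x hxx
    have hr := hx.root x hxx
    have hfx : B x x = (f x : ℤ) := hf x hr.mem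
    refine isRoot_of_tau_mem hK'.pd ⟨?_, fun n y hy hxy => ?_⟩ ?_
    · rw [zpow_add₀ rat_ne_zero, mul_smul, smul_mem_dualLat, zpow_natCast]
      refine ⟨pow_smul_mem _ hr.mem, fun z hz => ?_⟩
      simp only [j]
      split_ifs with h0
      · rw [pow_zero, one_smul]
        refine hr.dv_of_norm hp hK ?_ z hz
        rw [hfx, dv_intCast_iff (prime_ne_zero' p)]
        simp_all
      · obtain ⟨w, hw⟩ := h.exists_int hr.mem
        obtain ⟨k, hk⟩ := (h.dvd_iff hK hr.mem hw m).2 (fun i => by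
          rw [diagForm, mul_assoc]
          exact (pow_dvd_pow _ (by rcases ha i with hi | hi <;> omega)).mul_right _) z hz
        refine ⟨k, ?_⟩
        rw [map_smul, LinearMap.smul_apply, smul_eq_mul, hk, ← mul_assoc, ← pow_add,
          Nat.sub_add_cancel hmb]
    · obtain ⟨w, hw, hd, rfl⟩ := exists_of_mem_dualLat hy
      rw [zpow_add₀ rat_ne_zero, mul_smul, smul_comm n, zpow_natCast] at hxy
      have hxw : (p : ℚ) ^ j x • x = n • w := smul_right_injective V (zpow_ne_zero e rat_ne_zero) hxy
      simp only [j] at hxw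
      split_ifs at hxw with h0
      · rw [pow_zero, one_smul] at hxw
        exact hr.1.2 n w hw hxw
      · have hn : (n : ℚ) ≠ 0 := fun hn => by
          rw [← cast_smul_eq_zsmul ℚ, hn, zero_smul] at hxw
          exact (smul_ne_zero (pow_ne_zero _ rat_ne_zero) hr.ne_zero) hxw
        have hwx : w = ((n : ℚ)⁻¹ * p ^ (b - m)) • x := by
          rw [mul_smul, hxw, ← cast_smul_eq_zsmul ℚ, smul_smul, inv_mul_cancel₀ hn, one_smul]
        obtain ⟨k, hk⟩ := hr.1.int_of_smul (hwx ▸ hw)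
        have hkn : n * k = (p : ℤ) ^ (b - m) := by
          have : (n : ℚ) * k = p ^ (b - m) := by rw [← hk, ← mul_assoc, mul_inv_cancel₀ hn, one_mul]
          exact_mod_cast this
        have h1 := hd x hr.mem
        rw [hwx, hk, map_smul, LinearMap.smul_apply, smul_eq_mul, hfx, ← cast_mul,
          dv_intCast_iff (prime_ne_zero' p)] at h1
        obtain ⟨l, rfl⟩ := h.dvd_of_root hp hK ha hmb hr hfx (fun h2 => h0 ((hcast _ _).2 h2)) h1
        refine IsUnit.of_mul_eq_one l (mul_left_cancel₀ (pow_ne_zero (b - m) (by exact_mod_cast prime_ne_zero' p : (p : ℤ) ≠ 0)) ?_)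
        linarith
    · rw [tau_smul (zpow_ne_zero _ rat_ne_zero), tau_smul_form hs0 hB hr.ne_zero, horth]
      exact hr.tau_mem hB
  have htau : ∀ x ∈ xs, tau (s • B) ((p : ℚ) ^ (e + j x) • x) = tau B x := fun x hxx => by
    rw [tau_smul (zpow_ne_zero _ rat_ne_zero), tau_smul_form hs0 hB (hx.root x hxx).ne_zero]
  have hx' : IsRootList (s • B) K' (xs.map fun x => (p : ℚ) ^ (e + j x) • x) := by
    refine ⟨fun y hy => ?_, ?_, fun y hy => ?_⟩
    · obtain ⟨x, hxx, rfl⟩ := mem_map.1 hy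
      simp_all
    · rw [List.pairwise_map]
      refine hx.pairwise.imp_of_mem fun {x y} hxx hyy hxy => ?_
      by_contra hne
      have h1 := (IsRoot.tau_eq_iff hK'.pd (hroot x hxx) (hroot y hyy)).2 (by tauto)
      rw [htau x hxx, htau y hyy, (hx.root x hxx).tau_eq_iff hB (hx.root y hyy)] at h1
      tauto
    · have h1 := hy.tau_mem hK'.pd
      rw [tau_smul_form hs0 hB hy.ne_zero, horth] at h1
      obtain ⟨w, hw, r, hr, e1⟩ := hK.exists_root_of_tau hy.ne_zero h1
      obtain ⟨x, hxx, e2⟩ := hx.complete w hw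
      refine ⟨_, mem_map.2 ⟨x, hxx, rfl⟩, ?_⟩
      rw [← IsRoot.tau_eq_iff hK'.pd (hroot x hxx) hy, htau x hxx, tau_smul_form hs0 hB hy.ne_zero,
        e1,
        tau_smul hr]
      exact ((hx.root x hxx).tau_eq_iff hB hw).2 e2
  rw [hx'.hasLabel_iff_eq hK' (ns := xs.map fun x => if f x % p ^ b = 0 then f x / p ^ (b - m)
    else f x * p ^ (b - m)), hl, dualLabel, horth]
  · refine Prod.ext rfl (sortList_eq_of_perm ?_)
    have := (sortList_perm (xs.map f)).map fun c => if c % p ^ b = 0 then c / p ^ (b - m) else c * p ^ (b - m)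
    rwa [map_map] at this
  · rw [map_map, map_map]
    refine map_congr_left fun x hxx => ?_
    have h1 : ∀ k : ℕ, (p : ℚ) ^ ((m : ℤ) - b - 2 * e) * (p ^ (e + k) * (p ^ (e + k) * p ^ (b - m))) =
        p ^ (2 * k) := fun k => by
      rw [← zpow_natCast, ← zpow_natCast, ← zpow_add₀ rat_ne_zero, ← zpow_add₀ rat_ne_zero,
        ← zpow_add₀ rat_ne_zero]
      grind
    have hp0 : (p : ℚ) ^ (b - m) ≠ 0 := pow_ne_zero _ rat_ne_zero
    simp only [Function.comp_apply, LinearMap.smul_apply, map_smul, smul_eq_mul,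
      hf x (hx.root x hxx).mem, j, hs]
    refine mul_right_cancel₀ hp0 ?_
    split_ifs with h0
    · rw [← Nat.cast_pow, ← Nat.cast_mul, Nat.div_mul_cancel, Nat.cast_pow]
      · linear_combination (f x : ℚ) * h1 0
      · exact (pow_dvd_pow _ (Nat.sub_le _ _)).trans (Nat.dvd_of_mod_eq_zero h0)
    · push_cast
      linear_combination (f x : ℚ) * h1 (b - m)

/-! ### The label of the fiber when only one exponent is zero -/

/-- The weighted labels for the parameters `P` of the reduction and the label `ℓ`. -/
def cells (P : ℕ × JordanData) (ℓ : Label) : List (ℕ × Label) :=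
  if P.1 = 3 ∧ ℓ.1 = 24 then g2Cells P.2.2.1 (pick 3 1 ℓ.2) ((ℓ.2.sum - pick 3 1 ℓ.2) / 12)
  else regularCells (quadCount P P.2.2.1) (admCount P) (mirCount P) P.1 (hexCount P) (entries ℓ)

/-- The labels of the classes of the lattices obtained by adjunction. -/
def overLabels (P : ℕ × JordanData) (ℓ : Label) : List Label := assemble (2 * ℓ.1) (cells P ℓ)

/-- For p = 3 the order 24 characterizes G₂ × A₁, where the enumeration of 27 vectors is used; in
all other cases the regular count applies. -/
theorem Gluing.weight_cells (G : Gluing p B K a u red) (hl : HasLabel B K ℓ) {lab : (Fin 3 → ZMod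
    p) → Label} (hlab : ∀ v ∈ quadX a u, LabelAt p B K red v (lab v)) (lam : Label) : weight (cells
    (params p a u) ℓ) lam = ∑ v ∈ quadX a u, if lab v = lam then lam.1 else 0 := by
  have hK := G.int
  have F := G.frame
  rw [cells, show (params p a u).1 = p from rfl, show (params p a u).2.2.1 = (u 0).val from rfl]
  split_ifs with h
  · obtain ⟨rfl, h24⟩ := h
    obtain ⟨f, hf⟩ := hK.exists_normFun
    have hc := ((hK.rootType.exists_list.choose_spec.hasLabel_iff hK).1 hl).1
    rw [h24] at hc
    rcases hK.rootType with h | ⟨x, h⟩ | ⟨x, y, z, ht, h⟩ | ⟨x, y, hA, h⟩ | ⟨z, x, y, ht, hn, h⟩ |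
      ⟨z, x, y, hz, o1, o2, hA, h⟩ | ⟨s, x, y, z, hs, ht, hy, hz, h⟩
    · rw [card_orthGroup_none hK h] at hc; omega
    · rw [card_orthGroup_one hK h] at hc; omega
    · rw [card_orthGroup_three hK ht h] at hc; omega
    · rw [card_orthGroup_a2 hK hA h] at hc; omega
    · rw [card_orthGroup_b2 hK ht hn h] at hc; omega
    · obtain ⟨⟨e1, e2, e3, e4, e5⟩, -, hp, hs⟩ := hK.norms_g2 o1 o2 hA h hl hf
      rw [hs, hp]
      exact G.g2_weight hz o1 o2 hA h (fun v hv => hf v (h.root v hv).mem) e1 e2 e3 e4 e5 hlab lam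
    · rw [card_orthGroup_cubic hK hs ht hy hz h] at hc; omega
  · obtain ⟨xs, f, n, hx, hf, hs, he⟩ := G.describes hl fun h3 h24 => h ⟨h3, h24⟩
    have hreg : p = 3 → ¬ HasG2 B K := fun h3 hG => by
      obtain ⟨z, x, y, hz, o1, o2, hA, h'⟩ := exists_g2 hK hG
      exact h ⟨h3, ((h'.hasLabel_iff hK).1 hl).1.trans (card_orthGroup_g2 hK o1 o2 hA h')⟩
    rw [quadCount_eq' F.zero, ← he]
    exact G.regular_weight hreg hx hf
      (fun x hxx => F.card_axis' G.ne_two hK (hx.root x hxx) (hf x hxx))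
      (fun x hxx => F.card_mirror G.ne_two hK (hx.root x hxx) (hf x hxx)) hs hlab lam

theorem hasLabelMultiset_fiber (hp : p ≠ 2) (hN : IntLattice B N) (ha : a 0 = 2) (ha' : a' 0 = 0)
    (h1 : a' 1 = a 1) (h2 : a' 2 = a 2) (hpos : ∀ i, 1 ≤ a i) (hle : a 1 ≤ a 2) (h : Coord p B N
    (diagForm p a ε) c) (hl : HasLabel B N ℓ) : HasLabelMultiset B (fiber p B N (diagForm p a' ε))
    (overLabels (params p a fun i => toZMod (ε i : ℤ_[p])) ℓ) := by
  have G : Gluing p B N a (fun i => toZMod (ε i : ℤ_[p])) (redCoord c) :=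
    ⟨hp, hN, h.frame hN ha hpos, hle, fun n hn =>
      ⟨over_int hN hn, watson_over hp hN ha ha' h1 h2 hpos h hn⟩⟩
  have hc := ((hN.rootType.exists_list.choose_spec.hasLabel_iff hN).1 hl).1
  rw [overLabels, hc]
  exact G.hasLabelMultiset (fun M => mem_fiber_iff hp hN ha ha' h1 h2 hpos h)
    fun lab hlab lam => G.weight_cells hl hlab lam

/-! ### Two zero exponents: reduction by duality -/

theorem HasLabelMultiset.transport {X Y : Set (Submodule ℤ V)} (Φ : X ≃ Y) {g : Label → Label}
    (hΦ : ∀ M M' : X, (isometrySetoid B X) M M' ↔ (isometrySetoid B' Y) (Φ M) (Φ M'))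
    (hlab : ∀ (M : X) ℓ, HasLabel B' (Φ M).1 ℓ → HasLabel B M.1 (g ℓ)) {s : Multiset Label}
    (h : HasLabelMultiset B' Y s) : HasLabelMultiset B X (s.map g) := by
  obtain ⟨hfin, lab, h1, rfl⟩ := h
  let q : Classes B X ≃ Classes B' Y := Quotient.congr Φ hΦ
  let hfin' : Fintype (Classes B X) := Fintype.ofEquiv _ q.symm
  refine ⟨hfin', fun x => g (lab (q x)), fun M => hlab M _ (h1 (Φ M)), ?_⟩
  rw [Multiset.map_map, ← Multiset.map_univ_val_equiv q, Multiset.map_map]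
  rfl

theorem Coord.reindex (h : Coord p B K D c) (π : Equiv.Perm (Fin 3)) :
    Coord p B K (D ∘ π) (LinearMap.funLeft ℚ ℚ_[p] π ∘ₗ c) where
  gram x y := by
    rw [h.gram, ← Equiv.sum_comp π]
    rfl
  int x hx i := h.int x hx (π i)
  dense u := by
    obtain ⟨x, hx, h1⟩ := h.dense (u ∘ π.symm)
    exact ⟨x, hx, fun i => by simpa using h1 (π i)⟩
  sat y hy hi := h.sat y hy fun i => by simpa using hi (π.symm i)

theorem fiber_reindex (π : Equiv.Perm (Fin 3)) : fiber p B N (D ∘ π) = fiber p B N D := by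
  ext M
  refine and_congr_right fun _ => and_congr_right fun _ => ⟨fun ⟨c, hc⟩ => ?_, fun ⟨c, hc⟩ => ⟨_,
    hc.reindex π⟩⟩
  have := hc.reindex π.symm
  rw [Function.comp_assoc, Equiv.self_comp_symm] at this
  exact ⟨_, this⟩

/-- Λ_p multiplies the coordinates of exponent 0 by p; with truncated subtraction, a + 2(1 - a) is 2
for a = 0 and a otherwise. -/
theorem Coord.watson (h : Coord p B K (diagForm p a ε) c) (hp : p ≠ 2) (hK : IntLattice B K) :
    Coord p B (watson B p K) (diagForm p (fun i => a i + 2 * (1 - a i)) ε)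
      (divCoord p (fun i => ((1 - a i : ℕ) : ℤ) + 0) c) := by
  rw [watson_eq_dualLat hp hK]
  have := (h.scaled_dual (b := 1) (e := 0) hK).coord h (s := 1)
    (D' := diagForm p (fun i => a i + 2 * (1 - a i)) ε) fun i => by
      have e1 : 2 * (((1 - a i : ℕ) : ℤ) + 0) = ((2 * (1 - a i) : ℕ) : ℤ) := by
        rw [add_zero, Nat.cast_mul]; rfl
      rw [diagForm, diagForm, Rat.cast_one, one_mul, e1, zpow_natCast, add_comm, pow_add, mul_assoc]
      push_cast
      rfl
  rwa [one_smul] at this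

/-- Both sides scale each coordinate by the same power of p. On the left the exponents 0 and b have
been interchanged, so Λ_p acts on the other coordinates; the shift e + 1 on the right makes up for
this. -/
theorem Coord.watson_dual (h : Coord p B M (diagForm p a ε) c) (hp : p ≠ 2) (hM : IntLattice B M)
    (ha : ∀ i, a i = 0 ∨ a i = b) (hb : 2 ≤ b) :
    TernaryLattice.watson ((p : ℚ) ^ (((0 : ℕ) : ℤ) - b - 2 * e) • B) p (dualLat p b e B M) =
      dualLat p b (e + 1) B (TernaryLattice.watson B p M) := by
  have hi := h.dual_int (m := 0) (b := b) (e := e) hM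
  have hd := h.dual_coord (m := 0) (e := e) hM (b := b) (fun i => by rcases ha i with hi | hi <;> omega)
    fun i => by rcases ha i with hi | hi <;> omega
  have h1 := (h.scaled_dual (b := b) (e := e) hM).trans h (hd.scaled_dual (b := 1) (e := 0) hi)
  rw [← watson_eq_dualLat hp hi] at h1
  have h2 := h.scaled_dual (b := 1) (e := 0) hM
  rw [← watson_eq_dualLat hp hM] at h2
  refine h1.unique ?_
  convert h2.trans h ((h.watson hp hM).scaled_dual (b := b) (e := e + 1) (watson_int hM)) using 1
  funext i
  simp only [Pi.add_apply]
  rcases ha i with hi | hi <;> rw [hi] <;> omega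

theorem dualLat_mem_fiber (hp : p ≠ 2) (hM : M ∈ fiber p B N (diagForm p a ε))
    (ha : ∀ i, a i = 0 ∨ a i = b) (hb : 2 ≤ b) :
    dualLat p b e B M ∈ fiber p ((p : ℚ) ^ (((0 : ℕ) : ℤ) - b - 2 * e) • B) (dualLat p b (e + 1) B N)
      (diagForm p (fun i => 0 + b - a i) ε) := by
  obtain ⟨hi, rfl, c, hc⟩ := hM
  exact ⟨hc.dual_int hi, hc.watson_dual hp hi ha hb, _, hc.dual_coord hi
    (fun i => by rcases ha i with hi | hi <;> omega) fun i => by rcases ha i with hi | hi <;> omega⟩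

/-- The dual has exponents b, b, 0, hence a single unit on the diagonal, and falls under
`hasLabelMultiset_fiber`. The label of N is transformed by the dual for the interval from 2 to b,
and the labels obtained are transformed back by the dual for the interval from 0 to b. -/
theorem hasLabelMultiset_fiber_dual (hp : p ≠ 2) (hN : IntLattice B N) (hb : 2 ≤ b) (hL : L ∈ fiber
    p B N (diagForm p ![0, 0, b] ε)) (hl : HasLabel B N ℓ) : HasLabelMultiset B (fiber p B N
    (diagForm p ![0, 0, b] ε)) (((overLabels (params p ![2, b, b] (fun i => toZMod ((![ε
    2, ε 0, ε 1] i : ℤ_[p]ˣ) : ℤ_[p]))) (dualLabel (p ^ b) (p ^ (b - 2)) ℓ)).map (dualLabel (p ^ b)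
    (p ^ b)) : List Label) : Multiset Label) := by
  have hcN : ∃ c, Coord p B N (diagForm p ![2, 2, b] ε) c := by
    obtain ⟨hi, rfl, c, hc⟩ := hL
    refine ⟨_, (show (fun i => (![0, 0, b] : Fin 3 → ℕ) i + 2 * (1 - (![0, 0,
      b] : Fin 3 → ℕ) i)) = ![2, 2, b] from ?_) ▸
      hc.watson hp hi⟩
    funext i
    fin_cases i <;> simp
    omega
  obtain ⟨c, hc⟩ := hcN
  have hp0 : (p : ℚ) ≠ 0 := rat_ne_zero
  set a : Fin 3 → ℕ := ![0, 0, b] with hadef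
  set s : ℚ := (p : ℚ) ^ (((0 : ℕ) : ℤ) - b - 2 * 0) with hs
  have hs0 : s ≠ 0 := zpow_ne_zero _ hp0
  have ha : ∀ i, a i = 0 ∨ a i = b := fun i => by fin_cases i <;> simp [a]
  have ha' : ∀ i, 0 + b - a i = 0 ∨ 0 + b - a i = b := fun i => by rcases ha i with h | h <;> omega
  have h2b : ∀ i, (![2, 2, b] : Fin 3 → ℕ) i = 2 ∨ (![2, 2, b] : Fin 3 → ℕ) i = b := fun i => by
    fin_cases i <;> simp
  -- The duals of N and of the lattices above it are taken with different m and e, chosen so that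
  -- both live on the same scaled form.
  have es : (p : ℚ) ^ (((2 : ℕ) : ℤ) - b - 2 * 1) = s := by
    rw [hs]; congr 1; push_cast; ring
  -- The shift -b makes the second dual return to the original form.
  have eB : (p : ℚ) ^ (((0 : ℕ) : ℤ) - b - 2 * (-b)) • s • B = B := by
    rw [smul_smul, hs, ← zpow_add₀ hp0]
    convert one_smul ℚ B
    rw [← zpow_zero (p : ℚ)]; congr 1; push_cast; ring
  have hK := hc.dual_int (m := 2) (b := b) (e := 1) hN
  have hKN := hc.dual_dual (m := 2) (b := b) (e := 1) hN
    (fun i => by rcases h2b i with h | h <;> omega) fun i => by rcases h2b i with h | h <;> omega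
  have hlK := hc.hasLabel_dual (m := 2) (b := b) (e := 1) hp hN h2b hb hl
  have hcK := (hc.dual_coord (m := 2) (b := b) (e := 1) hN
    (fun i => by rcases h2b i with h | h <;> omega) fun i => by rcases h2b i with h | h <;> omega).reindex (finRotate 3).symm
  rw [es] at hK hKN hlK hcK
  have r0 : (finRotate 3).symm 0 = 2 := by decide
  have r1 : (finRotate 3).symm 1 = 0 := by decide
  have r2 : (finRotate 3).symm 2 = 1 := by decide
  have e1 : diagForm p (fun i => 2 + b - (![2, 2, b] : Fin 3 → ℕ) i) ε ∘ (finRotate 3).symm =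
      diagForm p ![2, b, b] ![ε 2, ε 0, ε 1] := by
    funext i
    fin_cases i <;> simp [diagForm, r0, r1, r2, a]
  have e2 : diagForm p (fun i => 0 + b - a i) ε ∘ (finRotate 3).symm =
      diagForm p ![0, b, b] ![ε 2, ε 0, ε 1] := by
    funext i
    fin_cases i <;> simp [diagForm, r0, r1, r2, a]
  rw [e1] at hcK
  have key := hasLabelMultiset_fiber (a := ![2, b, b]) (a' := ![0, b, b]) hp hK rfl rfl rfl rfl
    (fun i => by fin_cases i <;> simp <;> omega) le_rfl hcK hlK
  rw [← e2, fiber_reindex] at key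
  have hΦ : ∀ M ∈ fiber p B N (diagForm p a ε), dualLat p b 0 B M ∈
      fiber p (s • B) (dualLat p b 1 B N) (diagForm p (fun i => 0 + b - a i) ε) := fun M hM =>
    dualLat_mem_fiber (e := 0) hp hM ha hb
  have hΨ : ∀ M ∈ fiber p (s • B) (dualLat p b 1 B N) (diagForm p (fun i => 0 + b - a i) ε),
      dualLat p b (-b) (s • B) M ∈ fiber p B N (diagForm p a ε) := fun M hM => by
    have := dualLat_mem_fiber (e := -b) hp hM ha' hb
    have e3 : -(b : ℤ) + 1 = ((2 : ℕ) : ℤ) - b - 1 := by push_cast; ring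
    have e4 : (fun i => 0 + b - (0 + b - a i)) = a := by
      funext i
      rcases ha i with h | h <;> omega
    rwa [eB, e3, hKN, e4] at this
  have hΨΦ : ∀ M ∈ fiber p B N (diagForm p a ε),
      dualLat p b (-b) (s • B) (dualLat p b 0 B M) = M := fun M hM => by
    obtain ⟨hi, -, c, hc⟩ := hM
    have := hc.dual_dual (m := 0) (b := b) (e := 0) hi (fun i => by rcases ha i with h | h <;> omega)
      fun i => Nat.zero_le _
    rw [← hs] at this
    convert this using 2
    push_cast; ring
  have hΦΨ : ∀ M ∈ fiber p (s • B) (dualLat p b 1 B N) (diagForm p (fun i => 0 + b - a i) ε),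
      dualLat p b 0 B (dualLat p b (-b) (s • B) M) = M := fun M hM => by
    obtain ⟨hi, -, c, hc⟩ := hM
    have := hc.dual_dual (m := 0) (b := b) (e := -b) hi (fun i => by rcases ha i with h | h <;> omega)
      fun i => Nat.zero_le _
    rw [eB] at this
    convert this using 2
    push_cast; ring
  refine HasLabelMultiset.transport (X := fiber p B N (diagForm p a ε)) (s := (_ : List Label)) ⟨fun M => ⟨_, hΦ M.1 M.2⟩, fun M => ⟨_, hΨ M.1 M.2⟩,
    fun M => Subtype.ext (hΨΦ M.1 M.2), fun M => Subtype.ext (hΦΨ M.1 M.2)⟩ (fun M M' => ?_)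
    (fun M ℓ' h => ?_) key
  · constructor
    · rintro ⟨σ, hσ, h⟩
      exact ⟨σ, by rwa [isometries_smul hs0],
        image_eq_iff.2 fun x => dualLat_map hσ (image_eq_iff.1 h) x⟩
    · rintro ⟨σ, hσ, h⟩
      refine ⟨σ, by rwa [isometries_smul hs0] at hσ, image_eq_iff.2 fun x => ?_⟩
      have : x ∈ dualLat p b (-b) (s • B) (dualLat p b 0 B M.1) ↔
          σ x ∈ dualLat p b (-b) (s • B) (dualLat p b 0 B M'.1) := dualLat_map hσ (image_eq_iff.1 h) x
      rwa [hΨΦ M.1 M.2, hΨΦ M'.1 M'.2] at this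
  · obtain ⟨hi, -, c, hc⟩ := hΦ M.1 M.2
    have := hc.hasLabel_dual (m := 0) (b := b) (e := -b) hp hi ha' (Nat.zero_le _) h
    rw [eB, hΨΦ M.1 M.2] at this
    exact this

-- Primitive recursiveness

attribute [fun_prop] Primrec PrimrecPred

section Recursion

variable {α β γ σ : Type*} [Primcodable α] [Primcodable β] [Primcodable γ] [Primcodable σ]
  {f g h : α → ℕ} {P : α → ℕ × JordanData}

@[fun_prop]
theorem primrec_id : Primrec fun x : α => x := Primrec.id

@[fun_prop]
theorem primrec_const (y : σ) : Primrec fun _ : α => y := Primrec.const y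

@[fun_prop]
theorem primrec_comp {f : β → σ} {g : α → β} (hf : Primrec f) (hg : Primrec g) :
    Primrec fun x => f (g x) := hf.comp hg

@[fun_prop]
theorem primrec_pair {f : α → β} {g : α → γ} (hf : Primrec f) (hg : Primrec g) :
    Primrec fun x => (f x, g x) := hf.pair hg

@[fun_prop]
theorem primrec_fst {f : α → β × γ} (hf : Primrec f) : Primrec fun x => (f x).1 :=
  Primrec.fst.comp hf

@[fun_prop]
theorem primrec_snd {f : α → β × γ} (hf : Primrec f) : Primrec fun x => (f x).2 :=
  Primrec.snd.comp hf

@[fun_prop]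
theorem primrec_add (hf : Primrec f) (hg : Primrec g) : Primrec fun x => f x + g x :=
  Primrec.nat_add.comp hf hg

@[fun_prop]
theorem primrec_sub (hf : Primrec f) (hg : Primrec g) : Primrec fun x => f x - g x :=
  Primrec.nat_sub.comp hf hg

@[fun_prop]
theorem primrec_mul (hf : Primrec f) (hg : Primrec g) : Primrec fun x => f x * g x :=
  Primrec.nat_mul.comp hf hg

@[fun_prop]
theorem primrec_div (hf : Primrec f) (hg : Primrec g) : Primrec fun x => f x / g x :=
  Primrec.nat_div.comp hf hg

@[fun_prop]
theorem primrec_mod (hf : Primrec f) (hg : Primrec g) : Primrec fun x => f x % g x :=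
  Primrec.nat_mod.comp hf hg

@[fun_prop]
theorem primrec_pow (hf : Primrec f) (hg : Primrec g) : Primrec fun x => f x ^ g x :=
  (Primrec₂.unpaired'.1 Nat.Primrec.pow).comp hf hg

@[fun_prop]
theorem primrec_cons {f : α → β} {l : α → List β} (hf : Primrec f) (hl : Primrec l) :
    Primrec fun x => f x :: l x := Primrec.list_cons.comp hf hl

@[fun_prop]
theorem primrec_append {l m : α → List β} (hl : Primrec l) (hm : Primrec m) :
    Primrec fun x => l x ++ m x := Primrec.list_append.comp hl hm

@[fun_prop]
theorem primrec_range (hf : Primrec f) : Primrec fun x => List.range (f x) :=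
  Primrec.list_range.comp hf

@[fun_prop]
theorem primrec_length {l : α → List β} (hl : Primrec l) : Primrec fun x => (l x).length :=
  Primrec.list_length.comp hl

@[fun_prop]
theorem primrec_headI {l : α → List ℕ} (hl : Primrec l) : Primrec fun x => (l x).headI :=
  Primrec.list_headI.comp hl

@[fun_prop]
theorem primrec_getD {l : α → List ℕ} (hl : Primrec l) (hf : Primrec f) (d : ℕ) :
    Primrec fun x => (l x).getD (f x) d := (Primrec.list_getD d).comp hl hf

@[fun_prop]
theorem primrec_map {l : α → List β} {g : α → β → γ} (hl : Primrec l)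
    (hg : Primrec fun x : α × β => g x.1 x.2) : Primrec fun x => (l x).map (g x) :=
  Primrec.list_map hl hg

@[fun_prop]
theorem primrec_flatMap {l : α → List β} {g : α → β → List γ} (hl : Primrec l)
    (hg : Primrec fun x : α × β => g x.1 x.2) : Primrec fun x => (l x).flatMap (g x) :=
  Primrec.list_flatMap hl hg

@[fun_prop]
theorem primrec_sum {l : α → List ℕ} (hl : Primrec l) : Primrec fun x => (l x).sum :=
  Primrec.list_foldr hl (Primrec.const 0)
    (Primrec.nat_add.comp (Primrec.fst.comp Primrec.snd) (Primrec.snd.comp Primrec.snd)).to₂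

@[fun_prop]
theorem primrec_replicate {y : α → β} (hf : Primrec f) (hy : Primrec y) :
    Primrec fun x => replicate (f x) (y x) :=
  (show Primrec fun x => (List.range (f x)).map fun _ => y x by fun_prop).of_eq fun x => by simp

@[fun_prop]
theorem primrecPred_eq {f g : α → β} (hf : Primrec f) (hg : Primrec g) :
    PrimrecPred fun x => f x = g x := Primrec.eq.comp hf hg

@[fun_prop]
theorem primrecPred_ne {f g : α → β} (hf : Primrec f) (hg : Primrec g) :
    PrimrecPred fun x => f x ≠ g x := (Primrec.eq.comp hf hg).not

@[fun_prop]
theorem primrecPred_and {c d : α → Prop} (hc : PrimrecPred c) (hd : PrimrecPred d) :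
    PrimrecPred fun x => c x ∧ d x := hc.and hd

@[fun_prop]
theorem primrecPred_or {c d : α → Prop} (hc : PrimrecPred c) (hd : PrimrecPred d) :
    PrimrecPred fun x => c x ∨ d x := hc.or hd

@[fun_prop]
theorem primrecPred_exists {c : α → ℕ → Prop} (hf : Primrec f)
    (hc : PrimrecPred fun x : α × ℕ => c x.1 x.2) : PrimrecPred fun x => ∃ n < f x, c x n := by
  -- The bounded quantifier is a search through the list of the numbers below the bound.
  have hr : PrimrecRel fun (n : ℕ) (x : α) => c x n := hc.comp (Primrec.snd.pair Primrec.fst)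
  exact (hr.exists_mem_list.comp (Primrec.list_range.comp hf) primrec_id).of_eq fun x => by simp

@[fun_prop]
theorem primrec_ite {c : α → Prop} [DecidablePred c] {f g : α → σ} (hc : PrimrecPred c)
    (hf : Primrec f) (hg : Primrec g) : Primrec fun x => if c x then f x else g x :=
  Primrec.ite hc hf hg

@[fun_prop]
theorem primrec_filter {l : α → List β} {c : α → β → Prop} [∀ x, DecidablePred (c x)]
    (hl : Primrec l) (hc : PrimrecPred fun x : α × β => c x.1 x.2) :
    Primrec fun x => (l x).filter fun y => c x y :=
  (show Primrec fun x => (l x).flatMap fun y => if c x y then [y] else [] by fun_prop).of_eq fun x => by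
    induction l x with
    | nil => rfl
    | cons y l ih => by_cases h : c x y <;> simp [h, ih]

@[fun_prop]
theorem primrec_count {l : α → List ℕ} (hl : Primrec l) (hf : Primrec f) :
    Primrec fun x => (l x).count (f x) :=
  (show Primrec fun x => ((l x).filter fun y => y = f x).length by fun_prop).of_eq fun x => by
    rw [List.count, List.countP_eq_length_filter]
    rfl

@[fun_prop]
theorem primrec_sortList {l : α → List ℕ} (hl : Primrec l) : Primrec fun x => sortList (l x) := by
  have h : Primrec₂ fun (a : ℕ) (l : List ℕ) => l.orderedInsert (· ≤ ·) a := by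
    refine (Primrec.list_rec (f := fun x : ℕ × List ℕ => x.2) (g := fun x => [x.1])
      (h := fun x y => if x.1 ≤ y.1 then x.1 :: y.1 :: y.2.1 else y.1 :: y.2.2) Primrec.snd
      (by fun_prop) ?_).of_eq ?_
    · exact Primrec.ite (Primrec.nat_le.comp (by fun_prop) (by fun_prop)) (by fun_prop) (by fun_prop)
    · rintro ⟨a, l⟩
      induction l with
      | nil => rfl
      | cons b l ih =>
        dsimp only at ih ⊢
        rw [ih, List.orderedInsert]
  exact Primrec.list_foldr hl (Primrec.const [])
    (h.comp (Primrec.fst.comp Primrec.snd) (Primrec.snd.comp Primrec.snd)).to₂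

@[fun_prop]
theorem primrec_nub {l : α → List Label} (hl : Primrec l) : Primrec fun x => nub (l x) := by
  have hm : PrimrecPred fun x : Label × List Label => x.1 ∈ x.2 :=
    ((PrimrecRel.exists_mem_list (R := fun a b : Label => a = b) Primrec.eq).comp Primrec.snd
      Primrec.fst).of_eq fun x => by simp
  exact Primrec.list_foldr hl (Primrec.const []) (Primrec.ite (hm.comp Primrec.snd) (Primrec.snd.comp Primrec.snd)
    (Primrec.list_cons.comp (Primrec.fst.comp Primrec.snd) (Primrec.snd.comp Primrec.snd))).to₂

@[fun_prop]
theorem primrec_quadCount (hP : Primrec P) (hf : Primrec f) :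
    Primrec fun x => quadCount (P x) (f x) := by
  unfold quadCount triples OnQuad dotN coefN
  fun_prop

/-- The labels of the classes of the lattices in `Γ_p^L(N)`, from the prime, the label of `N` and the
data of a Jordan decomposition of `L_p`. -/
def gamLabels (q : ℕ × Label × JordanData) : List Label :=
  if q.2.2.1.1 = 0 then
    (overLabels (q.1, (q.2.2.1.2, q.2.2.1.2), (q.2.2.2.2.2, q.2.2.2.1, q.2.2.2.2.1))
      (dualLabel (q.1 ^ q.2.2.1.2) (q.1 ^ (q.2.2.1.2 - 2)) q.2.1)).map
        (dualLabel (q.1 ^ q.2.2.1.2) (q.1 ^ q.2.2.1.2))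
  else overLabels (q.1, q.2.2) q.2.1

/-- All searches and sums run over explicit finite lists, so once the functions are unfolded,
closure properties suffice. -/
theorem primrec_gamLabels : Primrec gamLabels := by
  have h1 : Primrec fun x : (ℕ × JordanData) × ℕ => mirCount x.1 x.2 := by
    unfold mirCount pairCount orthCount triples OnQuad dotN coefN
    fun_prop
  have h2 : Primrec fun x : Label => entries x := by
    unfold entries pick
    fun_prop
  have h3 : Primrec fun x : ℕ × ℕ × ℕ => g2Cells x.1 x.2.1 x.2.2 := by
    unfold g2Cells OnG2 g2Order g2Norms conv symmOrder triples
    fun_prop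
  unfold gamLabels overLabels cells dualLabel assemble weight regularCells rootCells loneCount symmOrder pick
    admCount hexCount
  fun_prop

end Recursion

end TernaryLattice


/-! ### The theorem -/

theorem theorem7p6 :
    ∃ F : ℕ × TernaryLattice.Label × TernaryLattice.JordanData → List TernaryLattice.Label,
      Computable F ∧
      ∀ (V : Type*) [AddCommGroup V] [Module ℚ V] (B : LinearMap.BilinForm ℚ V),
        Module.finrank ℚ V = 3 → TernaryLattice.IsPosDefSpace B →
      ∀ (p : ℕ) [Fact p.Prime], p ≠ 2 →
      ∀ (L N : Submodule ℤ V), Submodule.IsLattice ℚ L → TernaryLattice.IsPrimitive B L →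
        TernaryLattice.watson B p L = N →
        (∃ ℓ : TernaryLattice.Label, TernaryLattice.HasLabel B N ℓ) ∧
        ∀ ℓ : TernaryLattice.Label, TernaryLattice.HasLabel B N ℓ →
        ∀ (α β : ℕ) (ε₁ ε₂ ε₃ : ℤ_[p]ˣ), TernaryLattice.HasJordan B p L α β ε₁ ε₂ ε₃ →
          2 ≤ α + β →
          TernaryLattice.HasLabelMultiset B (TernaryLattice.Gam B p L N)
            (F (p, ℓ, TernaryLattice.jordanData p α β ε₁ ε₂ ε₃) : Multiset TernaryLattice.Label) := by
  open TernaryLattice in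
  refine ⟨gamLabels, primrec_gamLabels.to_comp, ?_⟩
  intro V _ _ B hV hB p _ hp L N hlat hprim hw
  have hL : IntLattice B L := by
    refine ⟨hB, hV, hlat, fun x hx y hy => ?_⟩
    have h1 : B x y ∈ scale B L := Submodule.subset_span ⟨x, hx, y, hy, rfl⟩
    rw [hprim, Submodule.mem_one] at h1
    obtain ⟨n, hn⟩ := h1
    exact ⟨n, hn.symm⟩
  have hN : IntLattice B N := hw ▸ watson_int hL
  refine ⟨hN.exists_label, fun ℓ hl α β ε₁ ε₂ ε₃ hJ hab => ?_⟩
  obtain ⟨c, hc⟩ := hJ.exists_coord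
  have hLf : L ∈ fiber p B N (diagForm p ![0, α, β] ![ε₁, ε₂, ε₃]) := ⟨hL, hw, c, hc⟩
  rw [gam_eq_fiber hL hw hJ]
  -- For α = 0 the hypothesis on α + β gives β ≥ 2, as the dual construction requires. For α ≥ 1 the
  -- exponents of N are 2, α, β and adjunction applies directly.
  by_cases h0 : α = 0
  · subst h0
    exact hasLabelMultiset_fiber_dual hp hN (by omega) hLf hl
  · have e : (fun i => (![0, α, β] : Fin 3 → ℕ) i + 2 * (1 - (![0, α, β] : Fin 3 → ℕ) i)) = ![2, α,
      β] := by
      have := hJ.1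
      funext i
      fin_cases i <;> simp <;> omega
    have hcN := hc.watson hp hL
    rw [e, hw] at hcN
    have := hasLabelMultiset_fiber (a := ![2, α, β]) (a' := ![0, α, β]) hp hN rfl rfl rfl rfl
      (fun i => by have := hJ.1; fin_cases i <;> simp <;> omega) hJ.1 hcN hl
    rw [gamLabels, if_neg]
    exacts [this, h0]
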